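/- **Setting.** Let $T>0$, let $m\ge 4$ be an integer, and let $\nu$ be a Lévy measure on $\mathbb R$, i.e. a Borel measure with $\nu(\{0\})=0$ and $\int_{\mathbb R} (1\wedge z^2)\,\nu(dz)<\infty$. Put $\mu_0=\nu(\mathbb R\setminus[-1,1])$ and $\mu_2=\int_{|z|\le 1}z^2\,\nu(dz)$. For an integer $k\ge0$ let $H^k=H^k(\mathbb R)$ be the $L_2$-based Sobolev space with $\|g\|_{H^k}^2=\sum_{j\le k}\|\partial_x^j g\|_{L_2}^2$; for $k\ge1$ its elements are identified with their continuous representatives. Consider $$du_t=\big[(L_t+J)u_t+f_t\big]\,dt\ \text{ on }[0,T]\times\mathbb R,\qquad u_0=\psi,$$ $$L_t\phi=a_t\,\partial_x^2\phi+b_t\,\partial_x\phi+c_t\,\phi,\qquad J\phi(x)=\int_{\mathbb R}\big(\phi(x+z)-\phi(x)-I_{|z|\le1}\,z\,\partial_x\phi(x)\big)\,\nu(dz).$$ A solution is a weakly continuous function $u:[0,T]\to H^1$ such that for all $\phi\in C_c^\infty(\mathbb R)$ and $t\in[0,T]$ $$(u_t,\phi)=(\psi,\phi)+\int_0^t\big[(\partial_xu_s,-\phi\,\partial_xa_s-a_s\partial_x\phi+b_s\phi)+(c_su_s,\phi)+(f_s,\phi)\big]ds$$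 $$-\int_0^t\!\int_{|z|\le1}\!\int_0^1(1-\theta)z^2\big(\partial_xu_s(\cdot+\theta z),\partial_x\phi\big)\,d\theta\,\nu(dz)\,ds+\int_0^t\!\int_{|z|>1}\big(u_s(\cdot+z)-u_s,\phi\big)\,\nu(dz)\,ds,$$ where $(\cdot,\cdot)$ is the inner product of $L_2(\mathbb R)$. **Assumptions.** 1. $a,b,c:[0,T]\times\mathbb R\to\mathbb R$ are measurable; $b,c$ with their $x$-derivatives up to order $m$, and $a$ with its $x$-derivatives up to order $\max(m,2)$, are continuous in $x$ and bounded in magnitude by a constant $K$, uniformly in $t$. 2. $\psi\in H^m$, $f:[0,T]\to H^m$ is measurable and $\mathcal K_m^2:=\|\psi\|_{H^m}^2+\int_0^T\|f_t\|_{H^m}^2\,dt<\infty$. 3. $a\ge0$. 4. There are an integer $l\ge1$ and constants $C$ and $\gamma>0$ such that for all $x\in\mathbb R$, $t,s\in[0,T]$, $0\le j\le l$, $$|\partial_x^ja_t(x)-\partial_x^ja_s(x)|^2+|\partial_x^jb_t(x)-\partial_x^jb_s(x)|^2+|\partial_x^jc_t(x)-\partial_x^jc_s(x)|^2\le C|t-s|^\gamma,\qquad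 \|f_t-f_s\|_{H^l}^2\le C|t-s|^\gamma .$$ 5. There is a constant $K'$ with $\|f_t\|_{H^{m-2}}^2\le K'$ for all $t\in[0,T]$. **Scheme.** Let $h\in\mathfrak N:=\{1/p:p\in\mathbb N,\ p\ge1\}$, $\mathbb G_h=h\mathbb Z$, $\|\phi\|_{l_2(\mathbb G_h)}^2=h\sum_{x\in\mathbb G_h}|\phi(x)|^2$. For $\lambda\ne0$ let $\delta_\lambda\phi(x)=(\phi(x+\lambda)-\phi(x))/\lambda$ and $\delta^h=\frac12(\delta_h+\delta_{-h})$. For integers $k\ge1$ let $B^h_k=((k-1)h,kh]$, and for $k\le-1$ let $B^h_k=[kh,(k+1)h)$. Put $$L^h_t\phi=a_t\,\delta^h\delta^h\phi+b_t\,\delta^h\phi+c_t\,\phi,$$ $$J^h\phi(x)=\sum_{0<|k|\le1/h}\zeta^h_k\sum_{r=0}^{|k|-1}\theta_k^r\,\delta_{-h}\delta_h\phi\Big(x+\tfrac{k}{|k|}rh\Big)+\sum_{|k|>1/h}\big(\phi(x+hk)-\phi(x)\big)\nu(B^h_k),$$ $$\zeta^h_k=\int_{B^h_k}z^2\,\nu(dz),\qquad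 \theta^r_k=\int_{r/|k|}^{(r+1)/|k|}(1-\theta)\,d\theta .$$ For an integer $n\ge1$ let $\tau=T/n$ and consider in $l_2(\mathbb G_h)$ the implicit scheme $$v_i=v_{i-1}+\tau\big[(L^h_{i\tau}+J^h)v_i+f_{i\tau}\big],\quad i=1,\dots,n,\qquad v_0=\psi .$$ **Theorem.** There are constants $N_0'$ and $N$, depending only on $K,C,T,m,\mu_0$ and $\mu_2$, such that under the above assumptions, for all $h\in\mathfrak N$ and all $n>N_0'$, the scheme has a unique solution $(v^{h,\tau}_i)_{i=0}^n$ in $l_2(\mathbb G_h)$, and, $u$ being the solution of the equation and $\mathcal N_m^2:=K'+\mathcal K_m^2$, (i) $$\max_{i\le n}\sup_{x\in\mathbb G_h}|u_{i\tau}(x)-v^{h,\tau}_i(x)|^2+\max_{i\le n}\|u_{i\tau}-v^{h,\tau}_i\|^2_{l_2(\mathbb G_h)}\le N\Big[(h^2+\tau^{1\wedge\gamma})\,\mathcal N_m^2+C\,\tau^{\gamma}\Big];$$ (ii) if moreover $m\ge5$, then $$\max_{i\le n}\sup_{x\in\mathbb G_h}|u_{i\tau}(x)-v^{h,\tau}_i(x)|^2+\max_{i\le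 n}\|u_{i\tau}-v^{h,\tau}_i\|^2_{l_2(\mathbb G_h)}\le N\Big[(h^2+\tau^{2\wedge\gamma})\,\mathcal N_m^2+C\,\tau^{\gamma}\Big].$$ -/

import Mathlib

open MeasureTheory Set
open scoped ContDiff ENNReal

noncomputable section

/-- The space `L₂(ℝ)`. -/
abbrev L2R : Type := Lp ℝ 2 (volume : Measure ℝ)

/-- `φ ∈ C_c^∞(ℝ)`. -/
def IsTestFn (φ : ℝ → ℝ) : Prop := ContDiff ℝ ∞ φ ∧ HasCompactSupport φ

/-- `g'` is the `j`-th distributional derivative of `g`. -/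
def IsWeakDeriv (j : ℕ) (g g' : L2R) : Prop :=
  ∀ φ : ℝ → ℝ, IsTestFn φ →
    ∫ x, g x * iteratedDeriv j φ x = (-1 : ℝ) ^ j * ∫ x, g' x * φ x

theorem IsTestFn.memLp_iteratedDeriv {φ : ℝ → ℝ} (hφ : IsTestFn φ) (j : ℕ) :
    MemLp (iteratedDeriv j φ) 2 (volume : Measure ℝ) := by
  have h1 : Continuous (iteratedDeriv j φ) :=
    hφ.1.continuous_iteratedDeriv j (by exact_mod_cast le_top)
  have h2 : HasCompactSupport (iteratedDeriv j φ) := by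
    have := hφ.2.iteratedFDeriv (𝕜 := ℝ) j
    rw [iteratedDeriv_eq_equiv_comp]
    exact this.comp_left (map_zero _)
  exact h1.memLp_of_hasCompactSupport h2

theorem IsTestFn.integrable_mul {φ : ℝ → ℝ} (hφ : IsTestFn φ) (j : ℕ) (g : L2R) :
    Integrable (fun x => g x * iteratedDeriv j φ x) (volume : Measure ℝ) :=
  (Lp.memLp g).integrable_mul (hφ.memLp_iteratedDeriv j)

theorem IsWeakDeriv.add {j : ℕ} {g g' w w' : L2R} (hg : IsWeakDeriv j g g')
    (hw : IsWeakDeriv j w w') : IsWeakDeriv j (g + w) (g' + w') := by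
  intro φ hφ
  have e1 : ∫ x, (g + w) x * iteratedDeriv j φ x
      = (∫ x, g x * iteratedDeriv j φ x) + ∫ x, w x * iteratedDeriv j φ x := by
    rw [← integral_add (hφ.integrable_mul j g) (hφ.integrable_mul j w)]
    refine integral_congr_ae ?_
    filter_upwards [Lp.coeFn_add g w] with x hx
    rw [hx, Pi.add_apply, add_mul]
  have e2 : ∫ x, (g' + w') x * φ x = (∫ x, g' x * φ x) + ∫ x, w' x * φ x := by
    have i1 := hφ.integrable_mul 0 g'
    have i2 := hφ.integrable_mul 0 w'
    simp only [iteratedDeriv_zero] at i1 i2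
    rw [← integral_add i1 i2]
    refine integral_congr_ae ?_
    filter_upwards [Lp.coeFn_add g' w'] with x hx
    rw [hx, Pi.add_apply, add_mul]
  rw [e1, e2, hg φ hφ, hw φ hφ, mul_add]

theorem IsWeakDeriv.smul {j : ℕ} {g g' : L2R} (r : ℝ) (hg : IsWeakDeriv j g g') :
    IsWeakDeriv j (r • g) (r • g') := by
  intro φ hφ
  have e (w : L2R) (χ : ℝ → ℝ) : ∫ x, (r • w) x * χ x = r * ∫ x, w x * χ x := by
    rw [← integral_const_mul]
    refine integral_congr_ae ?_
    filter_upwards [Lp.coeFn_smul r w] with x hx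
    rw [hx, Pi.smul_apply, smul_eq_mul, mul_assoc]
  rw [e, e, hg φ hφ]
  ring

theorem IsWeakDeriv.zero (j : ℕ) : IsWeakDeriv j 0 0 := by
  simpa using IsWeakDeriv.smul (0 : ℝ) (j := j) (g := 0) (g' := 0) (by
    intro φ _
    have h : ∀ χ : ℝ → ℝ, ∫ x, (0 : L2R) x * χ x = 0 := by
      intro χ
      rw [← integral_zero ℝ ℝ]
      refine integral_congr_ae ?_
      filter_upwards [Lp.coeFn_zero ℝ 2 (volume : Measure ℝ)] with x hx
      rw [hx, Pi.zero_apply, zero_mul]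
    rw [h, h, mul_zero])

/-- `H^k` as the space of tuples `(g, Dg, …, D^k g)` of square integrable functions,
with the norm `‖g‖² = ∑_{j ≤ k} ‖D^j g‖²`. -/
def sobolevSubmodule (k : ℕ) : Submodule ℝ (PiLp 2 (fun _ : Fin (k + 1) => L2R)) where
  carrier := {g | ∀ j : Fin (k + 1), IsWeakDeriv j (g 0) (g j)}
  add_mem' hg hw := fun j => (hg j).add (hw j)
  zero_mem' := fun j => IsWeakDeriv.zero j
  smul_mem' r _ hg := fun j => (hg j).smul r

/-- The Hilbert space `H^k = H^k(ℝ)`. -/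
abbrev HSob (k : ℕ) : Type := sobolevSubmodule k

/-- The underlying element of `L₂(ℝ)`. -/
def HSob.toL2 {k : ℕ} (g : HSob k) : L2R := g.1 0

/-- The first derivative of an element of `H^1`. -/
def HSob.dx (g : HSob 1) : L2R := g.1 1

/-- `w` belongs to `H^l` and `‖w‖²_{H^l} ≤ R`. -/
def SobolevSqLE (l : ℕ) (w : L2R) (R : ℝ) : Prop :=
  ∃ g : HSob l, g.toL2 = w ∧ ‖g‖ ^ 2 ≤ R

open Classical in
/-- The continuous representative of an element of `L₂(ℝ)` (zero if there is none). -/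
def contRep (g : L2R) : ℝ → ℝ :=
  if h : ∃ w : ℝ → ℝ, Continuous w ∧ g =ᵐ[volume] w then h.choose else 0

/-- The value of `g ∈ H^k`, `k ≥ 1`, at a point. -/
def HSob.val {k : ℕ} (g : HSob k) (x : ℝ) : ℝ := contRep g.toL2 x

/-- Lévy measures on `ℝ`. -/
structure IsLevyMeasure (ν : Measure ℝ) : Prop where
  zero : ν {0} = 0
  finite : ∫⁻ z, ENNReal.ofReal (min 1 (z ^ 2)) ∂ν < ⊤

/-- `μ₀ = ν(ℝ ∖ [-1,1])`. -/
def levyMu0 (ν : Measure ℝ) : ℝ := ν.real (Icc (-1) 1)ᶜ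

/-- `μ₂ = ∫_{|z| ≤ 1} z² ν(dz)`. -/
def levyMu2 (ν : Measure ℝ) : ℝ := ∫ z in {z : ℝ | |z| ≤ 1}, z ^ 2 ∂ν

/-- `g : [0,T] × ℝ → ℝ` is measurable, and `g_t` and its derivatives up to order `r` are
continuous in `x` and bounded by `K`. -/
structure CoeffBound (T K : ℝ) (r : ℕ) (g : ℝ → ℝ → ℝ) : Prop where
  meas : Measurable (fun q : Icc (0 : ℝ) T × ℝ => g q.1 q.2)
  smooth : ∀ t ∈ Icc (0 : ℝ) T, ContDiff ℝ r (g t)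
  bound : ∀ t ∈ Icc (0 : ℝ) T, ∀ j ≤ r, ∀ x, |iteratedDeriv j (g t) x| ≤ K

/-- `f : [0,T] → H^m` is measurable and `∫_0^T ‖f_t‖² dt < ∞`. -/
structure ForcingL2 (T : ℝ) {m : ℕ} (f : ℝ → HSob m) : Prop where
  meas : StronglyMeasurable (fun t : Icc (0 : ℝ) T => f t)
  sq_int : IntegrableOn (fun t => ‖f t‖ ^ 2) (Icc 0 T)

/-- `𝒦_m² = ‖ψ‖²_{H^m} + ∫_0^T ‖f_t‖²_{H^m} dt`. -/
def dataSq (T : ℝ) {m : ℕ} (ψ : HSob m) (f : ℝ → HSob m) : ℝ :=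
  ‖ψ‖ ^ 2 + ∫ t in (0 : ℝ)..T, ‖f t‖ ^ 2

/-- Hölder continuity in time of the coefficients and of the free term. -/
structure TimeHolder (T C γ : ℝ) (l : ℕ) (a b c : ℝ → ℝ → ℝ) {m : ℕ} (f : ℝ → HSob m) :
    Prop where
  coeff : ∀ t ∈ Icc (0 : ℝ) T, ∀ s ∈ Icc (0 : ℝ) T, ∀ j ≤ l, ∀ x,
    |iteratedDeriv j (a t) x - iteratedDeriv j (a s) x| ^ 2
      + |iteratedDeriv j (b t) x - iteratedDeriv j (b s) x| ^ 2
      + |iteratedDeriv j (c t) x - iteratedDeriv j (c s) x| ^ 2 ≤ C * |t - s| ^ γ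
  forcing : ∀ t ∈ Icc (0 : ℝ) T, ∀ s ∈ Icc (0 : ℝ) T,
    SobolevSqLE l ((f t).toL2 - (f s).toL2) (C * |t - s| ^ γ)

/-- `u : [0,T] → H^1` is a (weakly continuous) solution of
`du_t = ((L_t + J) u_t + f_t) dt`, `u_0 = ψ`. -/
structure IsPIDESolution (T : ℝ) (ν : Measure ℝ) (a b c : ℝ → ℝ → ℝ) {m : ℕ}
    (ψ : HSob m) (f : ℝ → HSob m) (u : ℝ → HSob 1) : Prop where
  weak_cont : ∀ F : HSob 1 →L[ℝ] ℝ, ContinuousOn (fun t => F (u t)) (Icc 0 T)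
  eqn : ∀ φ : ℝ → ℝ, IsTestFn φ → ∀ t ∈ Icc (0 : ℝ) T,
    ∫ x, (u t).toL2 x * φ x =
      (∫ x, ψ.toL2 x * φ x)
      + (∫ s in (0 : ℝ)..t,
          ((∫ x, (u s).dx x * (-(φ x * deriv (a s) x) - a s x * deriv φ x + b s x * φ x))
            + ∫ x, c s x * (u s).toL2 x * φ x))
      - (∫ s in (0 : ℝ)..t, ∫ z in {z : ℝ | |z| ≤ 1}, (∫ θ in (0 : ℝ)..1,
          (1 - θ) * z ^ 2 * ∫ x, (u s).dx (x + θ * z) * deriv φ x) ∂ν)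
      + (∫ s in (0 : ℝ)..t, ∫ z in {z : ℝ | 1 < |z|},
          (∫ x, ((u s).toL2 (x + z) - (u s).toL2 x) * φ x) ∂ν)
      + ∫ s in (0 : ℝ)..t, ∫ x, (f s).toL2 x * φ x

/-! Functions on the grid `hℤ` are written as functions of `k ∈ ℤ`, the point being `x = kh`;
the mesh is `h = 1/p` with a positive integer `p`. -/

/-- `δ_{sh} φ`, for an integer `s ≠ 0`. -/
def gridDiff (h : ℝ) (s : ℤ) (φ : ℤ → ℝ) (k : ℤ) : ℝ := (φ (k + s) - φ k) / (s * h)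

/-- The symmetric difference `δ^h = (δ_h + δ_{-h}) / 2`. -/
def gridSymDiff (h : ℝ) (φ : ℤ → ℝ) (k : ℤ) : ℝ :=
  (gridDiff h 1 φ k + gridDiff h (-1) φ k) / 2

/-- `B^h_k = ((k-1)h, kh]` for `k ≥ 1` and `B^h_k = [kh, (k+1)h)` for `k ≤ -1`. -/
def gridCell (h : ℝ) (k : ℤ) : Set ℝ :=
  if 0 < k then Ioc ((k - 1) * h) (k * h) else Ico (k * h) ((k + 1) * h)

/-- `ζ^h_k = ∫_{B^h_k} z² ν(dz)`. -/
def gridZeta (ν : Measure ℝ) (h : ℝ) (k : ℤ) : ℝ := ∫ z in gridCell h k, z ^ 2 ∂ν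

/-- `θ_k^l = ∫_{l/|k|}^{(l+1)/|k|} (1 - θ) dθ`. -/
def gridTheta (k : ℤ) (l : ℕ) : ℝ :=
  ∫ θ in ((l : ℝ) / (k.natAbs : ℝ))..(((l : ℝ) + 1) / (k.natAbs : ℝ)), (1 - θ)

/-- `J_1^h`, the sum over `0 < |j| ≤ 1/h = p`. -/
def gridJ1 (ν : Measure ℝ) (p : ℕ) (φ : ℤ → ℝ) (k : ℤ) : ℝ :=
  ∑ j ∈ (Finset.Icc (-(p : ℤ)) (p : ℤ)).erase 0, gridZeta ν (1 / p) j *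
    ∑ l ∈ Finset.range j.natAbs, gridTheta j l *
      gridDiff (1 / p) (-1) (gridDiff (1 / p) 1 φ) (k + j.sign * l)

/-- `J_2^h`, the sum over `|j| > 1/h = p`. -/
def gridJ2 (ν : Measure ℝ) (p : ℕ) (φ : ℤ → ℝ) (k : ℤ) : ℝ :=
  ∑' j : {j : ℤ // (p : ℤ) < |j|}, (φ (k + j) - φ k) * ν.real (gridCell (1 / p) j)

/-- `J^h = J_1^h + J_2^h`. -/
def gridJ (ν : Measure ℝ) (p : ℕ) (φ : ℤ → ℝ) (k : ℤ) : ℝ :=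
  gridJ1 ν p φ k + gridJ2 ν p φ k

/-- `L^h = a δ^h δ^h + b δ^h + c`, for coefficients `a, b, c` at a fixed time. -/
def gridL (a b c : ℝ → ℝ) (h : ℝ) (φ : ℤ → ℝ) (k : ℤ) : ℝ :=
  a (k * h) * gridSymDiff h (gridSymDiff h φ) k + b (k * h) * gridSymDiff h φ k
    + c (k * h) * φ k

/-- `v = (v_i)_{i ≤ n}` solves the implicit scheme in `l₂(hℤ)`, `h = 1/p`, `τ = T/n`:
`v_i = v_{i-1} + τ ((L^h_{iτ} + J^h) v_i + f_{iτ})`, `v_0 = ψ`. -/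
structure IsSchemeSolution (T : ℝ) (ν : Measure ℝ) (a b c : ℝ → ℝ → ℝ) {m : ℕ}
    (ψ : HSob m) (f : ℝ → HSob m) (p n : ℕ) (v : Fin (n + 1) → ℤ → ℝ) : Prop where
  mem_l2 : ∀ i, Memℓp (v i) 2
  init : ∀ k : ℤ, v 0 k = ψ.val (k * (1 / p))
  step : ∀ (i : Fin n) (k : ℤ), v i.succ k = v i.castSucc k + (T / n) *
    (gridL (a ((i + 1 : ℕ) * (T / n))) (b ((i + 1 : ℕ) * (T / n)))
        (c ((i + 1 : ℕ) * (T / n))) (1 / p) (v i.succ) k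
      + gridJ ν p (v i.succ) k + (f ((i + 1 : ℕ) * (T / n))).val (k * (1 / p)))

/-- `max_{i ≤ n} sup_{x ∈ hℤ} |u_{iτ}(x) - v_i(x)|² + max_{i ≤ n} ‖u_{iτ} - v_i‖²_{l₂(hℤ)}`,
where `‖φ‖²_{l₂(hℤ)} = h ∑_{x ∈ hℤ} |φ(x)|²`. -/
def schemeError (T : ℝ) (p n : ℕ) (u : ℝ → HSob 1) (v : Fin (n + 1) → ℤ → ℝ) : ℝ≥0∞ :=
  (⨆ i : Fin (n + 1), ⨆ k : ℤ,
      ENNReal.ofReal (|(u ((i : ℕ) * (T / n))).val (k * (1 / p)) - v i k| ^ 2))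
    + ⨆ i : Fin (n + 1), ENNReal.ofReal (1 / p) * ∑' k : ℤ,
      ENNReal.ofReal (|(u ((i : ℕ) * (T / n))).val (k * (1 / p)) - v i k| ^ 2)

end

/-! The scheme is lifted from the grid to the line. On `HSob 1` the discrete operator `schemeOp` is
built from translations and multiplications, so the point values on hℤ of an H¹-valued solution V of
the implicit scheme solve the scheme on the grid (`isSchemeSolution_evH`). Solutions on the grid are
unique (`IsSchemeSolution.eq`), hence every grid solution arises in this way. The H¹ norm dominates
both the supremum and the ℓ₂(hℤ) norm of point values, uniformly in h ≤ 1
(`HSob.exists_continuous`), so it is enough to estimate u − V in H¹ at the time nodes.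

Stability. In every H^k, k ≥ 1, the form ((L^h + J^h)v, v) is at most N‖v‖² with N depending only on
k and K (`inner_schemeOp_le`). Since a ≥ 0 and |a''| ≤ K, the function σ = √a is Lipschitz and |a'|
≤ √(2K) σ. Commuting σ with the difference operator δ leaves the good term −½‖σ δ ∂^j v‖², and this
term absorbs the products in which a' meets one derivative too many. The operator J^h is
nonpositive: summation by parts turns it into a combination of S − 1 with nonnegative weights, where
S runs over translations, which are isometries. Lax–Milgram solves one time step, and a discrete
Gronwall inequality bounds the whole scheme (`norm_implicit_scheme_le`).

Consistency. The difference between L^h + J^h and L + J is O(h) at the cost of three derivatives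
(`norm_schemeOp_sub_contOp_le`). In H¹ this asks for u in H⁴, which is the reason for m ≥ 4.

Regularity. A solution is only assumed to be weakly continuous in H¹. The scheme itself proves that
it lies in H^m: its solutions are bounded in H^m by stability, their interpolations converge to u in
L₂ by an energy estimate for the bilinear form of L + J, and a weak limit keeps the H^m bound
(`exists_approx`, `exists_regular`).

Rate. Over one time step, u solves the scheme up to a residual made of the O(h) consistency error,
the Hölder increments of the coefficients and of f, and the increment of u in H³
(`norm_sub_scheme_le`). The equation makes u Lipschitz in time with values in H^(m−2). For m ≥ 5 the
H³ increments are therefore O(τ); for m = 4, interpolation between H² and H⁴ gives only O(τ^(1/2)).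
This is the whole difference between (i) and (ii) (`sq_norm_incr_le`). -/

noncomputable section

set_option linter.unusedSectionVars false

/-! ### Translations, multiplications and symmetric differences on L₂ of a group; used for both ℝ
and ℤ. -/

section ShiftMul

variable {X : Type*} [AddCommGroup X] [TopologicalSpace X] [IsTopologicalAddGroup X]
  [MeasurableSpace X] [BorelSpace X] [SecondCountableTopology X] {μ : Measure X}

/-- A continuous function bounded by `K`. -/
def ContBdd (K : ℝ) (a : X → ℝ) : Prop := Continuous a ∧ ∀ x, |a x| ≤ K

theorem ContBdd.memLp {K : ℝ} {a : X → ℝ} (ha : ContBdd K a) (g : Lp ℝ 2 μ) :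
    MemLp (fun x => a x * g x) 2 μ :=
  (Lp.memLp g).of_le_mul (c := K) (ha.1.aestronglyMeasurable.mul (Lp.aestronglyMeasurable g))
    (by
      filter_upwards with x
      rw [norm_mul]
      exact mul_le_mul_of_nonneg_right (ha.2 x) (norm_nonneg _))

theorem norm_le_of_ae_le_mul {g w : Lp ℝ 2 μ} {K : ℝ} (h : ∀ᵐ x ∂μ, |g x| ≤ K * |w x|) :
    ‖g‖ ≤ K * ‖w‖ :=
  Lp.norm_le_mul_norm_of_ae_le_mul h

open Classical in
/-- Multiplication by a bounded continuous function, as an operator on `L₂`. -/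
def mulL2 (μ : Measure X) (a : X → ℝ) : Lp ℝ 2 μ →L[ℝ] Lp ℝ 2 μ :=
  if h : ∃ K, ContBdd K a then
    LinearMap.mkContinuous
      { toFun := fun g => (h.choose_spec.memLp g).toLp _
        map_add' := fun g w => by
          refine Lp.ext ?_
          filter_upwards [MemLp.coeFn_toLp (h.choose_spec.memLp (g + w)),
            MemLp.coeFn_toLp (h.choose_spec.memLp g), MemLp.coeFn_toLp (h.choose_spec.memLp w),
            Lp.coeFn_add g w, Lp.coeFn_add ((h.choose_spec.memLp g).toLp _)
              ((h.choose_spec.memLp w).toLp _)] with x h1 h2 h3 h4 h5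
          rw [h1, h5, Pi.add_apply, h2, h3, h4, Pi.add_apply, mul_add]
        map_smul' := fun r g => by
          refine Lp.ext ?_
          filter_upwards [MemLp.coeFn_toLp (h.choose_spec.memLp (r • g)),
            MemLp.coeFn_toLp (h.choose_spec.memLp g),
            Lp.coeFn_smul r g, Lp.coeFn_smul r ((h.choose_spec.memLp g).toLp _)]
            with x h1 h2 h4 h5
          rw [h1, RingHom.id_apply, h5, Pi.smul_apply, h2, h4, Pi.smul_apply, smul_eq_mul,
            smul_eq_mul, mul_left_comm] }
      h.choose (fun g => by
        refine norm_le_of_ae_le_mul ?_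
        filter_upwards [MemLp.coeFn_toLp (h.choose_spec.memLp g)] with x h1
        simp only [LinearMap.coe_mk, AddHom.coe_mk]
        rw [h1, abs_mul]
        exact mul_le_mul_of_nonneg_right (h.choose_spec.2 x) (abs_nonneg _))
  -- A default value only: the lemmas on `mulL2` used below assume `ContBdd`, and the operator does
  -- not depend on the bound that was chosen.
  else 0

/-- The translation `(S_y g)(x) = g(x + y)` on `L₂`. -/
def shiftL2 (μ : Measure X) [μ.IsAddRightInvariant] (y : X) : Lp ℝ 2 μ →L[ℝ] Lp ℝ 2 μ :=
  (Lp.compMeasurePreservingₗᵢ ℝ (· + y) (measurePreserving_add_right μ y)).toContinuousLinearMap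

variable [μ.IsAddRightInvariant]

theorem shiftL2_ae (y : X) (g : Lp ℝ 2 μ) : shiftL2 μ y g =ᵐ[μ] fun x => g (x + y) :=
  Lp.coeFn_compMeasurePreserving g (measurePreserving_add_right μ y)

theorem ae_comp_add {p : X → Prop} (h : ∀ᵐ x ∂μ, p x) (y : X) : ∀ᵐ x ∂μ, p (x + y) :=
  (measurePreserving_add_right μ y).quasiMeasurePreserving.ae h

theorem norm_shiftL2 (y : X) (g : Lp ℝ 2 μ) : ‖shiftL2 μ y g‖ = ‖g‖ :=
  (Lp.compMeasurePreservingₗᵢ ℝ (· + y) (measurePreserving_add_right μ y)).norm_map g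

theorem inner_shiftL2_shiftL2 (y : X) (g w : Lp ℝ 2 μ) :
    inner ℝ (shiftL2 μ y g) (shiftL2 μ y w) = inner ℝ g w :=
  (Lp.compMeasurePreservingₗᵢ ℝ (· + y) (measurePreserving_add_right μ y)).inner_map_map g w

theorem shiftL2_zero (g : Lp ℝ 2 μ) : shiftL2 μ 0 g = g := by
  refine Lp.ext ?_
  filter_upwards [shiftL2_ae (0 : X) g] with x hx
  rw [hx, add_zero]

theorem shiftL2_shiftL2 (x y : X) (g : Lp ℝ 2 μ) :
    shiftL2 μ x (shiftL2 μ y g) = shiftL2 μ (x + y) g := by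
  refine Lp.ext ?_
  filter_upwards [shiftL2_ae x (shiftL2 μ y g), shiftL2_ae (x + y) g,
    ae_comp_add (shiftL2_ae y g) x] with t h1 h2 h3
  rw [h1, h2, h3, add_assoc]

theorem inner_shiftL2_left (y : X) (g w : Lp ℝ 2 μ) :
    inner ℝ (shiftL2 μ y g) w = inner ℝ g (shiftL2 μ (-y) w) := by
  rw [← inner_shiftL2_shiftL2 y g, shiftL2_shiftL2, add_neg_cancel, shiftL2_zero]

theorem mulL2_ae {K : ℝ} {a : X → ℝ} (ha : ContBdd K a) (g : Lp ℝ 2 μ) :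
    mulL2 μ a g =ᵐ[μ] fun x => a x * g x := by
  have h : ∃ K, ContBdd K a := ⟨K, ha⟩
  rw [mulL2, dif_pos h]
  exact MemLp.coeFn_toLp (h.choose_spec.memLp g)

theorem norm_mulL2_le {K : ℝ} {a : X → ℝ} (ha : ContBdd K a) (g : Lp ℝ 2 μ) :
    ‖mulL2 μ a g‖ ≤ K * ‖g‖ := by
  refine norm_le_of_ae_le_mul ?_
  filter_upwards [mulL2_ae ha g] with x h1
  rw [h1, abs_mul]
  exact mul_le_mul_of_nonneg_right (ha.2 x) (abs_nonneg _)

theorem norm_mulL2_le_norm_mulL2 {K K' c : ℝ} {a b : X → ℝ} (ha : ContBdd K a)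
    (hb : ContBdd K' b) (h : ∀ x, |a x| ≤ c * |b x|) (g : Lp ℝ 2 μ) :
    ‖mulL2 μ a g‖ ≤ c * ‖mulL2 μ b g‖ := by
  refine norm_le_of_ae_le_mul ?_
  filter_upwards [mulL2_ae ha g, mulL2_ae hb g] with x h1 h2
  rw [h1, h2, abs_mul, abs_mul, ← mul_assoc]
  exact mul_le_mul_of_nonneg_right (h x) (abs_nonneg _)

theorem inner_eq_integral_mul (g w : Lp ℝ 2 μ) : inner ℝ g w = ∫ x, g x * w x ∂μ := by
  rw [L2.inner_def]
  refine integral_congr_ae (Filter.Eventually.of_forall fun x => ?_)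
  simp [mul_comm]

theorem inner_mulL2_left {K : ℝ} {a : X → ℝ} (ha : ContBdd K a) (g w : Lp ℝ 2 μ) :
    inner ℝ (mulL2 μ a g) w = inner ℝ g (mulL2 μ a w) := by
  rw [inner_eq_integral_mul, inner_eq_integral_mul]
  refine integral_congr_ae ?_
  filter_upwards [mulL2_ae ha g, mulL2_ae ha w] with x h1 h2
  rw [h1, h2]; ring

theorem mulL2_mulL2 {K K' : ℝ} {a b : X → ℝ} (ha : ContBdd K a) (hb : ContBdd K' b)
    (g : Lp ℝ 2 μ) : mulL2 μ a (mulL2 μ b g) = mulL2 μ (fun x => a x * b x) g := by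
  have hab : ContBdd (K * K') fun x => a x * b x :=
    ⟨ha.1.mul hb.1, fun x => by
      rw [abs_mul]
      exact mul_le_mul (ha.2 x) (hb.2 x) (abs_nonneg _) ((abs_nonneg _).trans (ha.2 x))⟩
  refine Lp.ext ?_
  filter_upwards [mulL2_ae ha (mulL2 μ b g), mulL2_ae hb g, mulL2_ae hab g] with x h1 h2 h3
  rw [h1, h2, h3, mul_assoc]

theorem mulL2_sub {K K' : ℝ} {a b : X → ℝ} (ha : ContBdd K a) (hb : ContBdd K' b)
    (g : Lp ℝ 2 μ) : mulL2 μ (fun x => a x - b x) g = mulL2 μ a g - mulL2 μ b g := by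
  have hab : ContBdd (K + K') fun x => a x - b x :=
    ⟨ha.1.sub hb.1, fun x => (abs_sub _ _).trans (add_le_add (ha.2 x) (hb.2 x))⟩
  refine Lp.ext ?_
  filter_upwards [mulL2_ae ha g, mulL2_ae hb g, mulL2_ae hab g,
    Lp.coeFn_sub (mulL2 μ a g) (mulL2 μ b g)] with x h1 h2 h3 h4
  rw [h3, h4, Pi.sub_apply, h1, h2, sub_mul]

theorem ContBdd.comp_add {K : ℝ} {a : X → ℝ} (ha : ContBdd K a) (y : X) :
    ContBdd K fun x => a (x + y) :=
  ⟨ha.1.comp (continuous_add_const y), fun _ => ha.2 _⟩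

theorem ContBdd.sub {K K' : ℝ} {a b : X → ℝ} (ha : ContBdd K a) (hb : ContBdd K' b) :
    ContBdd (K + K') fun x => a x - b x :=
  ⟨ha.1.sub hb.1, fun x => (abs_sub _ _).trans (add_le_add (ha.2 x) (hb.2 x))⟩

theorem shiftL2_mulL2 {K : ℝ} {a : X → ℝ} (ha : ContBdd K a) (y : X) (g : Lp ℝ 2 μ) :
    shiftL2 μ y (mulL2 μ a g) = mulL2 μ (fun x => a (x + y)) (shiftL2 μ y g) := by
  refine Lp.ext ?_
  filter_upwards [shiftL2_ae y (mulL2 μ a g), mulL2_ae (ha.comp_add y) (shiftL2 μ y g),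
    shiftL2_ae y g, ae_comp_add (mulL2_ae ha g) y] with x h1 h2 h3 h4
  rw [h1, h2, h3, h4]

/-- The symmetric difference quotient `(S_y - S_{-y}) / (2h)`. -/
def symDiffL2 (μ : Measure X) [μ.IsAddRightInvariant] (h : ℝ) (y : X) :
    Lp ℝ 2 μ →L[ℝ] Lp ℝ 2 μ :=
  (2 * h)⁻¹ • (shiftL2 μ y - shiftL2 μ (-y))

theorem symDiffL2_apply (h : ℝ) (y : X) (g : Lp ℝ 2 μ) :
    symDiffL2 μ h y g = (2 * h)⁻¹ • (shiftL2 μ y g - shiftL2 μ (-y) g) := rfl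

theorem inner_symDiffL2_left (h : ℝ) (y : X) (g w : Lp ℝ 2 μ) :
    inner ℝ (symDiffL2 μ h y g) w = -inner ℝ g (symDiffL2 μ h y w) := by
  rw [symDiffL2_apply, symDiffL2_apply, real_inner_smul_left, real_inner_smul_right,
    inner_sub_left, inner_sub_right, inner_shiftL2_left, inner_shiftL2_left, neg_neg]
  ring

/-- The translation y and the mesh h are independent parameters: y = h on the line, but y = 1 on ℤ.
Bounds that refer to h alone serve both cases. -/
theorem norm_symDiffL2_le {h : ℝ} (hh : 0 < h) (y : X) (g : Lp ℝ 2 μ) :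
    h * ‖symDiffL2 μ h y g‖ ≤ ‖g‖ := by
  rw [symDiffL2_apply, norm_smul, Real.norm_of_nonneg (by positivity)]
  have h1 := norm_sub_le (shiftL2 μ y g) (shiftL2 μ (-y) g)
  rw [norm_shiftL2, norm_shiftL2] at h1
  calc h * ((2 * h)⁻¹ * ‖shiftL2 μ y g - shiftL2 μ (-y) g‖)
      = ‖shiftL2 μ y g - shiftL2 μ (-y) g‖ / 2 := by field_simp
    _ ≤ ‖g‖ := by linarith

theorem symDiffL2_comm_mulL2 {K : ℝ} {a : X → ℝ} (ha : ContBdd K a) (h : ℝ) (y : X)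
    (g : Lp ℝ 2 μ) :
    symDiffL2 μ h y (mulL2 μ a g) - mulL2 μ a (symDiffL2 μ h y g)
      = (2 * h)⁻¹ • (mulL2 μ (fun x => a (x + y) - a x) (shiftL2 μ y g)
        - mulL2 μ (fun x => a (x + -y) - a x) (shiftL2 μ (-y) g)) := by
  rw [symDiffL2_apply, symDiffL2_apply, shiftL2_mulL2 ha, shiftL2_mulL2 ha,
    mulL2_sub (ha.comp_add y) ha, mulL2_sub (ha.comp_add (-y)) ha, map_smul, map_sub, ← smul_sub]
  congr 1
  abel

/-- The commutator differentiates the coefficient, not the function: each increment of a is at most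
Lh, which cancels the factor 1/h, so the bound is uniform in h. -/
theorem norm_symDiffL2_comm_le {K L h : ℝ} {a : X → ℝ} (ha : ContBdd K a) (hh : 0 < h) {y : X}
    (hy : ∀ x, |a (x + y) - a x| ≤ L * h) (g : Lp ℝ 2 μ) :
    ‖symDiffL2 μ h y (mulL2 μ a g) - mulL2 μ a (symDiffL2 μ h y g)‖ ≤ L * ‖g‖ := by
  have hy' : ∀ x, |a (x + -y) - a x| ≤ L * h := fun x => by
    have := hy (x + -y)
    rwa [neg_add_cancel_right, abs_sub_comm] at this
  rw [symDiffL2_comm_mulL2 ha, norm_smul, Real.norm_of_nonneg (by positivity)]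
  have h1 := norm_mulL2_le (μ := μ) ⟨((ha.comp_add y).sub ha).1, hy⟩ (shiftL2 μ y g)
  have h2 := norm_mulL2_le (μ := μ) ⟨((ha.comp_add (-y)).sub ha).1, hy'⟩ (shiftL2 μ (-y) g)
  rw [norm_shiftL2] at h1 h2
  have h3 := norm_sub_le (mulL2 μ (fun x => a (x + y) - a x) (shiftL2 μ y g))
    (mulL2 μ (fun x => a (x + -y) - a x) (shiftL2 μ (-y) g))
  calc _ ≤ (2 * h)⁻¹ * (L * h * ‖g‖ + L * h * ‖g‖) := by gcongr; linarith
    _ = L * ‖g‖ := by field_simp; ring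

/-- A second commutator with a puts the square of the increment, at most (Lh)², in front of each
translation, while there is still only one division by h. The surplus factor h later pays for a
remaining difference quotient. -/
theorem norm_symDiffL2_comm_comm_le {K L h : ℝ} {a : X → ℝ} (ha : ContBdd K a) (hh : 0 < h)
    {y : X} (hy : ∀ x, |a (x + y) - a x| ≤ L * h) (g : Lp ℝ 2 μ) :
    ‖(symDiffL2 μ h y (mulL2 μ a (mulL2 μ a g)) - mulL2 μ a (symDiffL2 μ h y (mulL2 μ a g)))
      - mulL2 μ a (symDiffL2 μ h y (mulL2 μ a g) - mulL2 μ a (symDiffL2 μ h y g))‖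
      ≤ L ^ 2 * h * ‖g‖ := by
  have hy' : ∀ x, |a (x + -y) - a x| ≤ L * h := fun x => by
    have := hy (x + -y)
    rwa [neg_add_cancel_right, abs_sub_comm] at this
  have e : ∀ z : X, mulL2 μ (fun x => a (x + z) - a x) (shiftL2 μ z (mulL2 μ a g))
      - mulL2 μ a (mulL2 μ (fun x => a (x + z) - a x) (shiftL2 μ z g))
      = mulL2 μ (fun x => a (x + z) - a x)
          (mulL2 μ (fun x => a (x + z) - a x) (shiftL2 μ z g)) := by
    intro z
    rw [shiftL2_mulL2 ha, mulL2_mulL2 ((ha.comp_add z).sub ha) (ha.comp_add z),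
      mulL2_mulL2 ha ((ha.comp_add z).sub ha),
      mulL2_mulL2 ((ha.comp_add z).sub ha) ((ha.comp_add z).sub ha)]
    refine Lp.ext ?_
    have c1 : ContBdd ((K + K) * K) fun x => (a (x + z) - a x) * a (x + z) :=
      ⟨((ha.comp_add z).sub ha).1.mul (ha.comp_add z).1, fun x => by
        rw [abs_mul]
        exact mul_le_mul (((ha.comp_add z).sub ha).2 x) (ha.2 _) (abs_nonneg _)
          ((abs_nonneg _).trans (((ha.comp_add z).sub ha).2 x))⟩
    have c2 : ContBdd (K * (K + K)) fun x => a x * (a (x + z) - a x) :=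
      ⟨ha.1.mul ((ha.comp_add z).sub ha).1, fun x => by
        rw [abs_mul]
        exact mul_le_mul (ha.2 _) (((ha.comp_add z).sub ha).2 x) (abs_nonneg _)
          ((abs_nonneg _).trans (ha.2 x))⟩
    have c3 := c1.sub c2
    filter_upwards [Lp.coeFn_sub
        (mulL2 μ (fun x => (a (x + z) - a x) * a (x + z)) (shiftL2 μ z g))
        (mulL2 μ (fun x => a x * (a (x + z) - a x)) (shiftL2 μ z g)),
      mulL2_ae c1 (shiftL2 μ z g), mulL2_ae c2 (shiftL2 μ z g),
      mulL2_ae (a := fun x => (a (x + z) - a x) * (a (x + z) - a x))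
        (K := (K + K) * K + K * (K + K)) (by convert c3 using 2; ring) (shiftL2 μ z g)]
      with x h1 h2 h3 h4
    rw [h1, h4, Pi.sub_apply, h2, h3]
    ring
  rw [symDiffL2_comm_mulL2 ha, symDiffL2_comm_mulL2 ha, map_smul, ← smul_sub, map_sub,
    sub_sub_sub_comm, e, e, norm_smul, Real.norm_of_nonneg (by positivity)]
  have b1 : ContBdd (L * h) fun x => a (x + y) - a x := ⟨((ha.comp_add y).sub ha).1, hy⟩
  have b2 : ContBdd (L * h) fun x => a (x + -y) - a x := ⟨((ha.comp_add (-y)).sub ha).1, hy'⟩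
  have hLh : 0 ≤ L * h := (abs_nonneg _).trans (hy 0)
  have h1 := (norm_mulL2_le (μ := μ) b1 (mulL2 μ _ (shiftL2 μ y g))).trans
    (mul_le_mul_of_nonneg_left (norm_mulL2_le b1 (shiftL2 μ y g)) hLh)
  have h2 := (norm_mulL2_le (μ := μ) b2 (mulL2 μ _ (shiftL2 μ (-y) g))).trans
    (mul_le_mul_of_nonneg_left (norm_mulL2_le b2 (shiftL2 μ (-y) g)) hLh)
  rw [norm_shiftL2] at h1 h2
  calc _ ≤ (2 * h)⁻¹ * (L * h * (L * h * ‖g‖) + L * h * (L * h * ‖g‖)) := by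
        gcongr
        exact (norm_sub_le _ _).trans (add_le_add h1 h2)
    _ = L ^ 2 * h * ‖g‖ := by field_simp; ring

/-- Dissipativity of `σ² δ δ` for a Lipschitz function `σ`. -/
theorem inner_sq_symDiff_symDiff_le {K L h : ℝ} {a : X → ℝ} (ha : ContBdd K a) (hh : 0 < h)
    {y : X} (hy : ∀ x, |a (x + y) - a x| ≤ L * h) (g : Lp ℝ 2 μ) :
    inner ℝ (mulL2 μ (fun x => a x * a x) (symDiffL2 μ h y (symDiffL2 μ h y g))) g
      ≤ -(1 / 2) * ‖mulL2 μ a (symDiffL2 μ h y g)‖ ^ 2 + 3 * L ^ 2 * ‖g‖ ^ 2 := by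
  set D := symDiffL2 μ h y
  set σ := mulL2 μ a
  have hE : ‖D (σ g) - σ (D g)‖ ≤ L * ‖g‖ := norm_symDiffL2_comm_le ha hh hy g
  have hEE := norm_symDiffL2_comm_comm_le ha hh hy g
  have hD : h * ‖D g‖ ≤ ‖g‖ := norm_symDiffL2_le hh y g
  rw [← mulL2_mulL2 ha ha, inner_mulL2_left ha, inner_mulL2_left ha, inner_symDiffL2_left]
  change -inner ℝ (D g) (D (σ (σ g))) ≤ _
  -- With E = [D, σ], moving both copies of σ to the left gives Dσσ = σσD + 2σE + [E, σ]. Paired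
  -- with −Dg, the first term is −‖σDg‖², half of which absorbs the second one, and the double
  -- commutator is harmless because h‖Dg‖ ≤ ‖g‖.
  have e : D (σ (σ g)) = σ (σ (D g)) + (2 : ℝ) • σ (D (σ g) - σ (D g))
      + ((D (σ (σ g)) - σ (D (σ g))) - σ (D (σ g) - σ (D g))) := by
    rw [two_smul, map_sub]; abel
  rw [e, inner_add_right, inner_add_right, real_inner_smul_right,
    ← inner_mulL2_left ha (D g) (σ (D g)), ← inner_mulL2_left ha (D g) (D (σ g) - σ (D g)),
    real_inner_self_eq_norm_sq]
  have h1 := abs_le.1 ((abs_real_inner_le_norm (σ (D g)) (D (σ g) - σ (D g))).trans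
    (mul_le_mul_of_nonneg_left hE (norm_nonneg _)))
  have h2 := abs_le.1 ((abs_real_inner_le_norm (D g) _).trans
    (mul_le_mul_of_nonneg_left hEE (norm_nonneg _)))
  have h3 : ‖D g‖ * (L ^ 2 * h * ‖g‖) ≤ L ^ 2 * ‖g‖ ^ 2 := by
    have := mul_le_mul_of_nonneg_left hD (mul_nonneg (sq_nonneg L) (norm_nonneg g))
    nlinarith
  change -(‖σ (D g)‖ ^ 2 + 2 * inner ℝ (σ (D g)) (D (σ g) - σ (D g)) + _) ≤
    -(1 / 2) * ‖σ (D g)‖ ^ 2 + _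
  nlinarith [sq_nonneg (‖σ (D g)‖ - 2 * (L * ‖g‖)), h1.1, h2.1]

/-- The symmetric difference is antisymmetric, so the form equals its own negative up to the
commutator with b, which is bounded by the Lipschitz constant. -/
theorem inner_symDiff_le {K L h : ℝ} {b : X → ℝ} (hb : ContBdd K b) (hh : 0 < h)
    {y : X} (hy : ∀ x, |b (x + y) - b x| ≤ L * h) (g : Lp ℝ 2 μ) :
    inner ℝ (mulL2 μ b (symDiffL2 μ h y g)) g ≤ L * ‖g‖ ^ 2 := by
  have hE := norm_symDiffL2_comm_le hb hh hy g
  have e : inner ℝ (mulL2 μ b (symDiffL2 μ h y g)) g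
      = -inner ℝ (mulL2 μ b (symDiffL2 μ h y g)) g
        - inner ℝ (symDiffL2 μ h y (mulL2 μ b g) - mulL2 μ b (symDiffL2 μ h y g)) g := by
    rw [inner_sub_left, inner_symDiffL2_left h y (mulL2 μ b g) g, inner_mulL2_left hb g,
      real_inner_comm (mulL2 μ b (symDiffL2 μ h y g)) g]
    ring
  have h1 := abs_le.1 ((abs_real_inner_le_norm _ g).trans
    (mul_le_mul_of_nonneg_right hE (norm_nonneg g)))
  have h0 : 0 ≤ L * ‖g‖ := (norm_nonneg _).trans hE
  nlinarith [mul_nonneg h0 (norm_nonneg g), h1.1]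

theorem inner_mulL2_le {K : ℝ} {c : X → ℝ} (hc : ContBdd K c) (g : Lp ℝ 2 μ) :
    inner ℝ (mulL2 μ c g) g ≤ K * ‖g‖ ^ 2 := by
  have := (real_inner_le_norm (mulL2 μ c g) g).trans
    (mul_le_mul_of_nonneg_right (norm_mulL2_le hc g) (norm_nonneg g))
  rwa [mul_assoc, ← sq] at this

end ShiftMul

set_option linter.unusedSectionVars false

/-! ### The cells B^h_k as a partition of ℝ ∖ {0}. -/

section Cells

theorem gridCell_of_pos {h : ℝ} {j : ℤ} (hj : 0 < j) :
    gridCell h j = Ioc ((j - 1) * h) (j * h) := if_pos hj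

theorem gridCell_of_neg {h : ℝ} {j : ℤ} (hj : j < 0) :
    gridCell h j = Ico (j * h) ((j + 1) * h) := if_neg (by omega)

theorem measurableSet_gridCell (h : ℝ) (j : ℤ) : MeasurableSet (gridCell h j) := by
  unfold gridCell
  split_ifs
  · exact measurableSet_Ioc
  · exact measurableSet_Ico

/-- The index of the cell that contains `z`. -/
def cellIdx (p : ℕ) (z : ℝ) : ℤ := if 0 < z then ⌈p * z⌉ else ⌊p * z⌋

variable {p : ℕ}

/-- The cells are the level sets of rounding pz away from zero. Disjointness and the unions of cells
are all read off from this one index function. -/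
theorem mem_gridCell_iff (hp : 0 < p) {j : ℤ} (hj : j ≠ 0) {z : ℝ} :
    z ∈ gridCell (1 / p) j ↔ cellIdx p z = j := by
  have hp' : (0 : ℝ) < p := by exact_mod_cast hp
  unfold cellIdx
  rcases lt_or_gt_of_ne hj with hj' | hj'
  · rw [gridCell_of_neg hj', mem_Ico, mul_one_div, mul_one_div, div_le_iff₀ hp', lt_div_iff₀ hp']
    have hj1 : (j : ℝ) + 1 ≤ 0 := by exact_mod_cast hj'
    constructor
    · rintro ⟨h1, h2⟩
      have : ¬ 0 < z := fun hz => by nlinarith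
      rw [if_neg this, Int.floor_eq_iff]
      constructor <;> nlinarith
    · intro h1
      split_ifs at h1 with hz
      · have : 0 < ⌈(p : ℝ) * z⌉ := Int.ceil_pos.2 (by positivity)
        omega
      · rw [Int.floor_eq_iff] at h1
        constructor <;> nlinarith [h1.1, h1.2]
  · rw [gridCell_of_pos hj', mem_Ioc, mul_one_div, mul_one_div, le_div_iff₀ hp', div_lt_iff₀ hp']
    have hj1 : (1 : ℝ) ≤ j := by exact_mod_cast hj'
    constructor
    · rintro ⟨h1, h2⟩
      have : 0 < z := by
        by_contra hz
        nlinarith [not_lt.1 hz]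
      rw [if_pos this, Int.ceil_eq_iff]
      constructor <;> nlinarith
    · intro h1
      split_ifs at h1 with hz
      · rw [Int.ceil_eq_iff] at h1
        constructor <;> nlinarith [h1.1, h1.2]
      · have : ⌊(p : ℝ) * z⌋ ≤ 0 := Int.floor_le_iff.2 (by push_cast; nlinarith)
        omega

/-- Here it matters that 1/h is the integer p: no cell straddles the points ±1, so small and large
jumps are separated exactly as for ν. -/
theorem abs_cellIdx_le_iff (hp : 0 < p) (z : ℝ) : |cellIdx p z| ≤ p ↔ |z| ≤ 1 := by
  have hp' : (0 : ℝ) < p := by exact_mod_cast hp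
  unfold cellIdx
  rw [abs_le, abs_le]
  split_ifs with hz
  · have h0 : 0 < ⌈(p : ℝ) * z⌉ := Int.ceil_pos.2 (by positivity)
    constructor
    · rintro ⟨-, h2⟩
      have := Int.ceil_le.1 h2
      push_cast at this
      constructor <;> nlinarith
    · rintro ⟨-, h2⟩
      refine ⟨by omega, Int.ceil_le.2 ?_⟩
      push_cast
      nlinarith
  · have h0 : ⌊(p : ℝ) * z⌋ ≤ 0 := Int.floor_le_iff.2 (by push_cast; nlinarith)
    constructor
    · rintro ⟨h1, -⟩
      have := Int.le_floor.1 h1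
      push_cast at this
      constructor <;> nlinarith
    · rintro ⟨h1, -⟩
      refine ⟨Int.le_floor.2 ?_, by omega⟩
      push_cast
      nlinarith

theorem cellIdx_ne_zero (hp : 0 < p) {z : ℝ} (hz : z ≠ 0) : cellIdx p z ≠ 0 := by
  have hp' : (0 : ℝ) < p := by exact_mod_cast hp
  unfold cellIdx
  split_ifs with h
  · exact (Int.ceil_pos.2 (by positivity)).ne'
  · have : ⌊(p : ℝ) * z⌋ < 0 :=
      Int.floor_lt.2 (by
        have : z < 0 := lt_of_le_of_ne (not_lt.1 h) hz
        push_cast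
        nlinarith)
    omega

theorem disjoint_gridCell (hp : 0 < p) {i j : ℤ} (hi : i ≠ 0) (hj : j ≠ 0) (hij : i ≠ j) :
    Disjoint (gridCell (1 / p) i) (gridCell (1 / p) j) := by
  rw [Set.disjoint_left]
  intro z h1 h2
  rw [mem_gridCell_iff hp hi] at h1
  rw [mem_gridCell_iff hp hj] at h2
  exact hij (h1.symm.trans h2)

theorem ne_zero_of_lt_abs {j : ℤ} (hj : (p : ℤ) < |j|) : j ≠ 0 := by
  rintro rfl
  simp at hj
  omega

theorem iUnion_gridCell_large (hp : 0 < p) :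
    ⋃ j : {j : ℤ // (p : ℤ) < |j|}, gridCell (1 / p) j = {z : ℝ | 1 < |z|} := by
  ext z
  simp only [mem_iUnion, mem_ofPred_eq]
  constructor
  · rintro ⟨⟨j, hj⟩, hz⟩
    rw [mem_gridCell_iff hp (ne_zero_of_lt_abs hj)] at hz
    subst hz
    by_contra h
    exact absurd ((abs_cellIdx_le_iff hp z).2 (not_lt.1 h)) (not_le.2 hj)
  · intro hz
    have h1 : (p : ℤ) < |cellIdx p z| := by
      by_contra h
      exact absurd ((abs_cellIdx_le_iff hp z).1 (not_lt.1 h)) (not_le.2 hz)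
    exact ⟨⟨_, h1⟩, (mem_gridCell_iff hp (ne_zero_of_lt_abs h1)).2 rfl⟩

theorem biUnion_gridCell_small (hp : 0 < p) :
    ⋃ j ∈ (Finset.Icc (-(p : ℤ)) (p : ℤ)).erase 0, gridCell (1 / p) j
      = {z : ℝ | |z| ≤ 1} \ {0} := by
  ext z
  simp only [mem_iUnion, Finset.mem_erase, Finset.mem_Icc, mem_sdiff, mem_ofPred_eq,
    mem_singleton_iff, exists_prop]
  constructor
  · rintro ⟨j, ⟨hj, h1⟩, hz⟩
    rw [mem_gridCell_iff hp hj] at hz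
    subst hz
    refine ⟨(abs_cellIdx_le_iff hp z).1 (abs_le.2 h1), ?_⟩
    rintro rfl
    simp [cellIdx] at hj
  · rintro ⟨h1, h2⟩
    have h3 := cellIdx_ne_zero hp h2
    exact ⟨_, ⟨h3, abs_le.1 ((abs_cellIdx_le_iff hp z).2 h1)⟩, (mem_gridCell_iff hp h3).2 rfl⟩

theorem pairwise_disjoint_gridCell_large (hp : 0 < p) :
    Pairwise (Function.onFun Disjoint
      fun j : {j : ℤ // (p : ℤ) < |j|} => gridCell (1 / (p : ℝ)) j) := fun i j hij =>
  disjoint_gridCell hp (ne_zero_of_lt_abs i.2) (ne_zero_of_lt_abs j.2)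
    fun h => hij (Subtype.ext h)

theorem levy_large_eq : (Icc (-1 : ℝ) 1)ᶜ = {z : ℝ | 1 < |z|} := by
  ext z
  rw [mem_compl_iff, mem_Icc, mem_ofPred_eq, ← abs_le, not_le]

theorem IsLevyMeasure.large_lt_top {ν : Measure ℝ} (hν : IsLevyMeasure ν) :
    ν {z : ℝ | 1 < |z|} < ⊤ := by
  have hm : MeasurableSet {z : ℝ | 1 < |z|} := measurableSet_lt measurable_const measurable_norm
  refine lt_of_le_of_lt ?_ hν.finite
  rw [← setLIntegral_one]
  refine (setLIntegral_mono' hm fun z hz => ?_).trans (setLIntegral_le_lintegral _ _)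
  rw [mem_ofPred_eq] at hz
  have : (1 : ℝ) ≤ z ^ 2 := by rw [← sq_abs]; nlinarith
  rw [min_eq_left this, ENNReal.ofReal_one]

theorem measurableSet_small : MeasurableSet {z : ℝ | |z| ≤ 1} :=
  measurableSet_le measurable_norm measurable_const

theorem IsLevyMeasure.integrableOn_sq {ν : Measure ℝ} (hν : IsLevyMeasure ν) :
    IntegrableOn (fun z : ℝ => z ^ 2) {z : ℝ | |z| ≤ 1} ν := by
  refine ⟨(by fun_prop), ?_⟩
  rw [hasFiniteIntegral_iff_ofReal (Filter.Eventually.of_forall fun z => sq_nonneg z)]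
  refine lt_of_le_of_lt ?_ hν.finite
  refine (setLIntegral_mono' measurableSet_small fun z hz => ?_).trans
    (setLIntegral_le_lintegral _ _)
  rw [mem_ofPred_eq] at hz
  have : z ^ 2 ≤ (1 : ℝ) := by rw [← sq_abs]; nlinarith [abs_nonneg z]
  rw [min_eq_right this]

theorem hasSum_measure_gridCell_large {ν : Measure ℝ} (hν : IsLevyMeasure ν) (hp : 0 < p) :
    HasSum (fun j : {j : ℤ // (p : ℤ) < |j|} => ν.real (gridCell (1 / p) j)) (levyMu0 ν) := by
  have h1 := measure_iUnion (μ := ν) (pairwise_disjoint_gridCell_large hp)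
    fun j => measurableSet_gridCell _ j
  rw [iUnion_gridCell_large hp] at h1
  have h2 : ∑' j : {j : ℤ // (p : ℤ) < |j|}, ν (gridCell (1 / (p : ℝ)) j) ≠ ⊤ := by
    rw [← h1]; exact hν.large_lt_top.ne
  have h3 := (ENNReal.summable_toReal h2).hasSum
  rw [← ENNReal.tsum_toReal_eq (fun j => ENNReal.ne_top_of_tsum_ne_top h2 j), ← h1] at h3
  unfold levyMu0
  rw [levy_large_eq]
  exact h3

theorem gridZeta_nonneg (ν : Measure ℝ) (h : ℝ) (j : ℤ) : 0 ≤ gridZeta ν h j :=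
  integral_nonneg fun z => sq_nonneg z

theorem integral_small_eq_sum {E : Type*} [NormedAddCommGroup E] [NormedSpace ℝ E]
    {ν : Measure ℝ} (hν : IsLevyMeasure ν) (hp : 0 < p) {f : ℝ → E}
    (hf : IntegrableOn f {z : ℝ | |z| ≤ 1} ν) :
    ∫ z in {z : ℝ | |z| ≤ 1}, f z ∂ν
      = ∑ j ∈ (Finset.Icc (-(p : ℤ)) (p : ℤ)).erase 0, ∫ z in gridCell (1 / p) j, f z ∂ν := by
  -- The origin is the only point of [−1, 1] outside the cells, and ν has no mass there.
  have h1 : ({z : ℝ | |z| ≤ 1} : Set ℝ) =ᵐ[ν] ({z : ℝ | |z| ≤ 1} \ {0} : Set ℝ) :=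
    (sdiff_null_ae_eq_self hν.zero).symm
  rw [setIntegral_congr_set h1, ← biUnion_gridCell_small hp,
    integral_biUnion_finset _ (fun j _ => measurableSet_gridCell _ j)]
  · intro i hi j hj hij
    exact disjoint_gridCell hp (Finset.ne_of_mem_erase hi) (Finset.ne_of_mem_erase hj) hij
  · intro j hj
    refine hf.mono_set ?_
    have := Finset.subset_set_biUnion_of_mem (f := fun j => gridCell (1 / (p : ℝ)) j) hj
    rw [biUnion_gridCell_small hp] at this
    exact this.trans sdiff_subset

theorem sum_gridZeta {ν : Measure ℝ} (hν : IsLevyMeasure ν) (hp : 0 < p) :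
    ∑ j ∈ (Finset.Icc (-(p : ℤ)) (p : ℤ)).erase 0, gridZeta ν (1 / p) j = levyMu2 ν :=
  (integral_small_eq_sum hν hp hν.integrableOn_sq).symm

end Cells

/-! ### Dissipativity of J^h for an abstract family of contractions. -/

section Jump

theorem gridTheta_eq {j : ℤ} (hj : j ≠ 0) (l : ℕ) :
    gridTheta j l = (2 * ((j.natAbs : ℝ) - l) - 1) / (2 * (j.natAbs : ℝ) ^ 2) := by
  have hn : (j.natAbs : ℝ) ≠ 0 := by exact_mod_cast Int.natAbs_ne_zero.2 hj
  unfold gridTheta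
  rw [intervalIntegral.integral_sub (by simp) (by simp), intervalIntegral.integral_const,
    integral_id]
  simp only [smul_eq_mul]
  field_simp
  ring

/-- Summation by parts twice: passing from n to n + 1 adds twice the unweighted sum of second
differences, which telescopes. For n ≥ 1 the outcome is a combination, with nonnegative weights, of
values of f minus f 0, so a maximum of f at 0 makes it nonpositive. -/
theorem sum_range_second_diff (f : ℤ → ℝ) (n : ℕ) :
    ∑ l ∈ Finset.range n, (2 * ((n : ℝ) - l) - 1) * (f (l + 1) - 2 * f l + f (l - 1))
      = f n + f (n - 1) - 2 * f 0 + (2 * n - 1) * (f (-1) - f 0) := by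
  have h1 : ∀ n : ℕ, ∑ l ∈ Finset.range n, (f (l + 1) - 2 * f l + f (l - 1))
      = f n - f (n - 1) - f 0 + f (-1) := by
    intro n
    induction n with
    | zero => simp
    | succ n ih =>
      rw [Finset.sum_range_succ, ih]
      push_cast
      rw [add_sub_cancel_right]
      ring
  induction n with
  | zero => simp; ring
  | succ n ih =>
    have e : ∀ l ∈ Finset.range n, (2 * (((n + 1 : ℕ) : ℝ) - l) - 1)
        * (f (l + 1) - 2 * f l + f (l - 1))
        = (2 * ((n : ℝ) - l) - 1) * (f (l + 1) - 2 * f l + f (l - 1))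
          + 2 * (f (l + 1) - 2 * f l + f (l - 1)) := by
      intro l _
      push_cast
      ring
    rw [Finset.sum_range_succ, Finset.sum_congr rfl e, Finset.sum_add_distrib, ih,
      ← Finset.mul_sum, h1]
    push_cast
    rw [add_sub_cancel_right]
    ring

variable {H : Type*} [NormedAddCommGroup H] [InnerProductSpace ℝ H]

/-- The small jumps part of `J^h`, for a family `U_i` of translations by `ih`. -/
def smallJump (ν : Measure ℝ) (p : ℕ) (U : ℤ → H →L[ℝ] H) : H →L[ℝ] H :=
  ∑ j ∈ (Finset.Icc (-(p : ℤ)) (p : ℤ)).erase 0, gridZeta ν (1 / p) j •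
    ∑ l ∈ Finset.range j.natAbs, gridTheta j l • ((p : ℝ) ^ 2 •
      (U (j.sign * l + 1) - (2 : ℝ) • U (j.sign * l) + U (j.sign * l - 1)))

/-- The large jumps part of `J^h`, for a family `U_i` of translations by `ih`. -/
def largeJump (ν : Measure ℝ) (p : ℕ) (U : ℤ → H →L[ℝ] H) : H →L[ℝ] H :=
  ∑' j : {j : ℤ // (p : ℤ) < |j|},
    ν.real (gridCell (1 / p) j) • (U j - ContinuousLinearMap.id ℝ H)

theorem hasSum_largeJump [CompleteSpace H] {ν : Measure ℝ} (hν : IsLevyMeasure ν) {p : ℕ}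
    (hp : 0 < p) {U : ℤ → H →L[ℝ] H} (hU : ∀ i g, ‖U i g‖ ≤ ‖g‖) :
    HasSum (fun j : {j : ℤ // (p : ℤ) < |j|} =>
      ν.real (gridCell (1 / p) j) • (U j - ContinuousLinearMap.id ℝ H)) (largeJump ν p U) := by
  refine Summable.hasSum (Summable.of_norm_bounded
    (g := fun j : {j : ℤ // (p : ℤ) < |j|} => ν.real (gridCell (1 / p) j) * 2)
    ((hasSum_measure_gridCell_large hν hp).summable.mul_right 2) fun j => ?_)
  rw [norm_smul, Real.norm_of_nonneg measureReal_nonneg]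
  refine mul_le_mul_of_nonneg_left ?_ measureReal_nonneg
  refine ContinuousLinearMap.opNorm_le_bound _ (by norm_num) fun g => ?_
  refine (norm_sub_le _ _).trans ?_
  have := hU j g
  change ‖U j g‖ + ‖g‖ ≤ _
  linarith

theorem hasSum_largeJump_apply [CompleteSpace H] {ν : Measure ℝ} (hν : IsLevyMeasure ν) {p : ℕ}
    (hp : 0 < p) {U : ℤ → H →L[ℝ] H} (hU : ∀ i g, ‖U i g‖ ≤ ‖g‖) (g : H) :
    HasSum (fun j : {j : ℤ // (p : ℤ) < |j|} => ν.real (gridCell (1 / p) j) • (U j g - g))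
      (largeJump ν p U g) := by
  have := (hasSum_largeJump hν hp hU).mapL (ContinuousLinearMap.apply ℝ H g)
  simpa only [ContinuousLinearMap.apply_apply, smul_apply, sub_apply,
    ContinuousLinearMap.coe_id', id_eq] using this

theorem inner_le_of_norm_le {x g : H} (h : ‖x‖ ≤ ‖g‖) : inner ℝ x g ≤ ‖g‖ ^ 2 := by
  rw [sq]
  exact (real_inner_le_norm _ _).trans (mul_le_mul_of_nonneg_right h (norm_nonneg _))

/-- Each summand is a nonnegative mass times (U_j g, g) − ‖g‖², and U_j is a contraction. -/
theorem inner_largeJump_nonpos [CompleteSpace H] {ν : Measure ℝ} (hν : IsLevyMeasure ν) {p : ℕ}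
    (hp : 0 < p) {U : ℤ → H →L[ℝ] H} (hU : ∀ i g, ‖U i g‖ ≤ ‖g‖) (g : H) :
    inner ℝ (largeJump ν p U g) g ≤ 0 := by
  rw [real_inner_comm]
  refine ((innerSL ℝ g).hasSum (hasSum_largeJump_apply hν hp hU g)).nonpos fun j => ?_
  simp only [innerSL_apply_apply, inner_smul_right, inner_sub_right]
  refine mul_nonpos_of_nonneg_of_nonpos measureReal_nonneg ?_
  rw [real_inner_comm, real_inner_self_eq_norm_sq]
  linarith [inner_le_of_norm_le (hU j g)]

/-- The summation by parts formula is applied to i ↦ (U_i g, g), whose maximum is at i = 0 because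
each U_i is a contraction and U_0 is the identity. The weights `gridTheta` are exactly those of
`sum_range_second_diff`, up to a positive factor. -/
theorem inner_smallJump_nonpos (ν : Measure ℝ) (p : ℕ) {U : ℤ → H →L[ℝ] H}
    (hU : ∀ i g, ‖U i g‖ ≤ ‖g‖) (hU0 : ∀ g, U 0 g = g) (g : H) :
    inner ℝ (smallJump ν p U g) g ≤ 0 := by
  unfold smallJump
  rw [sum_apply, sum_inner]
  refine Finset.sum_nonpos fun j hj => ?_
  have hj0 := Finset.ne_of_mem_erase hj
  rw [smul_apply, real_inner_smul_left, sum_apply,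
    sum_inner]
  refine mul_nonpos_of_nonneg_of_nonpos (gridZeta_nonneg _ _ _) ?_
  have key : ∀ f : ℤ → ℝ, (∀ i, f i ≤ f 0) →
      ∑ l ∈ Finset.range j.natAbs,
        gridTheta j l * ((p : ℝ) ^ 2 * (f (l + 1) - 2 * f l + f (l - 1))) ≤ 0 := by
    intro f hf
    have hn : 0 < j.natAbs := Int.natAbs_pos.2 hj0
    have e : ∑ l ∈ Finset.range j.natAbs,
        gridTheta j l * ((p : ℝ) ^ 2 * (f (l + 1) - 2 * f l + f (l - 1)))
        = (p : ℝ) ^ 2 / (2 * (j.natAbs : ℝ) ^ 2) * ∑ l ∈ Finset.range j.natAbs,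
          (2 * ((j.natAbs : ℝ) - l) - 1) * (f (l + 1) - 2 * f l + f (l - 1)) := by
      rw [Finset.mul_sum]
      refine Finset.sum_congr rfl fun l _ => ?_
      rw [gridTheta_eq hj0]
      ring
    rw [e, sum_range_second_diff]
    refine mul_nonpos_of_nonneg_of_nonpos (by positivity) ?_
    have h1 : (1 : ℝ) ≤ j.natAbs := by exact_mod_cast hn
    nlinarith [hf j.natAbs, hf (j.natAbs - 1), hf (-1)]
  have hf : ∀ i, inner ℝ (U i g) g ≤ inner ℝ (U 0 g) g := fun i => by
    rw [hU0, real_inner_self_eq_norm_sq]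
    exact inner_le_of_norm_le (hU i g)
  rcases lt_or_gt_of_ne hj0 with h | h
  -- For j < 0 the translations run through −l, so the reflected sequence is used; the second
  -- difference is invariant under reflection.
  · refine le_trans (le_of_eq (Finset.sum_congr rfl fun l _ => ?_))
      (key (fun i => inner ℝ (U (-i) g) g) fun i => by simpa using hf (-i))
    simp only [smul_apply, add_apply,
      sub_apply, real_inner_smul_left, inner_add_left, inner_sub_left,
      Int.sign_eq_neg_one_of_neg h]
    rw [show (-1 * (l : ℤ) + 1) = -((l : ℤ) - 1) by ring, show (-1 * (l : ℤ)) = -(l : ℤ) by ring,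
      show (-(l : ℤ) - 1) = -((l : ℤ) + 1) by ring]
    ring
  · refine le_trans (le_of_eq (Finset.sum_congr rfl fun l _ => ?_))
      (key (fun i => inner ℝ (U i g) g) hf)
    simp only [smul_apply, add_apply,
      sub_apply, real_inner_smul_left, inner_add_left, inner_sub_left,
      Int.sign_eq_one_of_pos h, one_mul]

/-- `J^h`, for a family `U_i` of translations by `ih`. -/
def gridJump (ν : Measure ℝ) (p : ℕ) (U : ℤ → H →L[ℝ] H) : H →L[ℝ] H :=
  smallJump ν p U + largeJump ν p U

theorem inner_gridJump_nonpos [CompleteSpace H] {ν : Measure ℝ} (hν : IsLevyMeasure ν) {p : ℕ}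
    (hp : 0 < p) {U : ℤ → H →L[ℝ] H} (hU : ∀ i g, ‖U i g‖ ≤ ‖g‖) (hU0 : ∀ g, U 0 g = g) (g : H) :
    inner ℝ (gridJump ν p U g) g ≤ 0 := by
  rw [gridJump, add_apply, inner_add_left]
  linarith [inner_largeJump_nonpos hν hp hU g, inner_smallJump_nonpos ν p hU hU0 g]

end Jump

/-! ### The square root of a nonnegative function with bounded second derivative. -/

section Sqrt

/-- A function with values in `[0, ∞)` and `|a''| ≤ K` satisfies `(a')² ≤ 2 K a`. -/
theorem sq_deriv_le {K : ℝ} {a : ℝ → ℝ} (ha : ContDiff ℝ 2 a) (h0 : ∀ x, 0 ≤ a x)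
    (hK : ∀ x, |iteratedDeriv 2 a x| ≤ K) :
    (∀ x y, a y ≤ a x + deriv a x * (y - x) + K / 2 * (y - x) ^ 2) ∧
      ∀ x, deriv a x ^ 2 ≤ 2 * K * a x := by
  have hd : Differentiable ℝ a := ha.differentiable (by norm_num)
  have hd' : Differentiable ℝ (deriv a) :=
    (contDiff_succ_iff_deriv.1 (show ContDiff ℝ (1 + 1) a by simpa [one_add_one_eq_two] using ha)).2.2.differentiable (by norm_num)
  have hK' : ∀ x, deriv (deriv a) x ≤ K := fun x => by
    have := (abs_le.1 (hK x)).2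
    rwa [iteratedDeriv_succ, iteratedDeriv_one] at this
  have h1 : ∀ x y, a y ≤ a x + deriv a x * (y - x) + K / 2 * (y - x) ^ 2 := by
    intro x y
    -- The bound a'' ≤ K makes K t²/2 − a(t) convex, and a convex function lies above its tangents;
    -- this is the upper Taylor bound.
    have hc : ConvexOn ℝ univ fun t => K / 2 * t ^ 2 - a t := by
      refine convexOn_univ_of_deriv2_nonneg (by fun_prop) ?_ ?_
      · have : (deriv fun t => K / 2 * t ^ 2 - a t) = fun t => K * t - deriv a t := by
          funext t
          have := ((hasDerivAt_pow 2 t).const_mul (K / 2)).sub (hd t).hasDerivAt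
          rw [show (fun t => K / 2 * t ^ 2 - a t) = ((fun y => K / 2 * y ^ 2) - a) from rfl,
            this.deriv]
          simp
          ring
        rw [this]
        fun_prop
      · intro t
        have : (deriv fun t => K / 2 * t ^ 2 - a t) = fun t => K * t - deriv a t := by
          funext t
          have := ((hasDerivAt_pow 2 t).const_mul (K / 2)).sub (hd t).hasDerivAt
          rw [show (fun t => K / 2 * t ^ 2 - a t) = ((fun y => K / 2 * y ^ 2) - a) from rfl,
            this.deriv]
          simp
          ring
        rw [Function.iterate_succ, Function.iterate_one, Function.comp_apply, this]
        have := ((hasDerivAt_id t).const_mul K).sub (hd' t).hasDerivAt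
        rw [show (fun t => K * t - deriv a t) = ((fun y => K * id y) - deriv a) from rfl,
          this.deriv]
        linarith [hK' t]
    have hx : HasDerivAt (fun t => K / 2 * t ^ 2 - a t) (K * x - deriv a x) x := by
      have := ((hasDerivAt_pow 2 x).const_mul (K / 2)).sub (hd x).hasDerivAt
      refine this.congr_deriv ?_
      push_cast
      ring
    rcases lt_trichotomy x y with h | h | h
    · have := hc.le_slope_of_hasDerivAt (mem_univ x) (mem_univ y) h hx
      rw [slope_def_field, le_div_iff₀ (by linarith)] at this
      nlinarith
    · subst h; simp
    · have := hc.slope_le_of_hasDerivAt (mem_univ y) (mem_univ x) h hx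
      rw [slope_def_field, div_le_iff₀ (by linarith)] at this
      nlinarith
  refine ⟨h1, fun x => ?_⟩
  -- By the Taylor bound and a ≥ 0, the quadratic a(x) + a'(x)s + Ks²/2 is nonnegative for every s.
  have := discrim_le_zero (a := K / 2) (b := deriv a x) (c := a x) fun s => by
    have := h1 x (x + s)
    rw [add_sub_cancel_left] at this
    have := h0 (x + s)
    nlinarith
  rw [discrim] at this
  linarith

theorem abs_deriv_le_sqrt {K : ℝ} {a : ℝ → ℝ} (ha : ContDiff ℝ 2 a) (h0 : ∀ x, 0 ≤ a x)
    (hK : ∀ x, |iteratedDeriv 2 a x| ≤ K) (x : ℝ) :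
    |deriv a x| ≤ √(2 * K) * √(a x) := by
  have hK0 : 0 ≤ K := (abs_nonneg _).trans (hK 0)
  rw [← Real.sqrt_mul (by positivity)]
  exact Real.abs_le_sqrt ((sq_deriv_le ha h0 hK).2 x)

/-- The square root of a need not be differentiable where a vanishes. The upper Taylor bound
together with |a'| ≤ √(2K)√a gives a(y) ≤ (√a(x) + √(2K)|y − x|)², and taking roots finishes. -/
theorem abs_sqrt_sub_sqrt_le {K : ℝ} {a : ℝ → ℝ} (ha : ContDiff ℝ 2 a) (h0 : ∀ x, 0 ≤ a x)
    (hK : ∀ x, |iteratedDeriv 2 a x| ≤ K) (x y : ℝ) :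
    |√(a x) - √(a y)| ≤ √(2 * K) * |x - y| := by
  have hK0 : 0 ≤ K := (abs_nonneg _).trans (hK 0)
  have key : ∀ x y, √(a y) ≤ √(a x) + √(2 * K) * |y - x| := by
    intro x y
    have h1 := (sq_deriv_le ha h0 hK).1 x y
    have h2 : deriv a x * (y - x) ≤ √(2 * K) * √(a x) * |y - x| := by
      refine (le_abs_self _).trans ?_
      rw [abs_mul]
      exact mul_le_mul_of_nonneg_right (abs_deriv_le_sqrt ha h0 hK x) (abs_nonneg _)
    refine Real.sqrt_le_iff.2 ⟨by positivity, ?_⟩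
    have e1 := Real.sq_sqrt (h0 x)
    have e2 := Real.sq_sqrt (show 0 ≤ 2 * K by positivity)
    have e3 := sq_abs (y - x)
    have e4 : 0 ≤ √(2 * K) * √(a x) * |y - x| := by positivity
    have e5 : (√(a x) + √(2 * K) * |y - x|) ^ 2
        = a x + 2 * (√(2 * K) * √(a x) * |y - x|) + 2 * K * (y - x) ^ 2 := by
      rw [add_sq, mul_pow, e1, e2, e3]; ring
    rw [e5]
    nlinarith [mul_nonneg hK0 (sq_nonneg (y - x))]
  rw [abs_le]
  constructor
  · have := key x y
    rw [abs_sub_comm] at this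
    linarith
  · linarith [key y x]

end Sqrt

/-! ### Test functions as elements of L₂, and their density. -/

section TestFunctions

open Classical in
/-- The element of `L₂(ℝ)` given by a square integrable function. -/
def toL2 (ψ : ℝ → ℝ) : L2R := if h : MemLp ψ 2 volume then h.toLp ψ else 0

theorem toL2_ae {ψ : ℝ → ℝ} (h : MemLp ψ 2 volume) : toL2 ψ =ᵐ[volume] ψ := by
  rw [toL2, dif_pos h]
  exact h.coeFn_toLp

theorem inner_toL2 {ψ : ℝ → ℝ} (h : MemLp ψ 2 volume) (g : L2R) :
    inner ℝ g (toL2 ψ) = ∫ x, g x * ψ x := by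
  rw [inner_eq_integral_mul]
  refine integral_congr_ae ?_
  filter_upwards [toL2_ae h] with x hx
  rw [hx]

theorem IsTestFn.memLp {φ : ℝ → ℝ} (hφ : IsTestFn φ) : MemLp φ 2 volume := by
  simpa using hφ.memLp_iteratedDeriv 0

theorem IsTestFn.deriv {φ : ℝ → ℝ} (hφ : IsTestFn φ) : IsTestFn (deriv φ) :=
  ⟨(contDiff_infty_iff_deriv.1 hφ.1).2, hφ.2.deriv⟩

theorem IsTestFn.iteratedDeriv {φ : ℝ → ℝ} (hφ : IsTestFn φ) (j : ℕ) :
    IsTestFn (iteratedDeriv j φ) := by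
  induction j with
  | zero => simpa using hφ
  | succ j ih => rw [iteratedDeriv_succ]; exact ih.deriv

theorem IsTestFn.comp_add {φ : ℝ → ℝ} (hφ : IsTestFn φ) (y : ℝ) :
    IsTestFn fun x => φ (x + y) :=
  ⟨hφ.1.comp (contDiff_id.add contDiff_const),
    hφ.2.comp_homeomorph (Homeomorph.addRight y)⟩

theorem isWeakDeriv_iff {j : ℕ} {g g' : L2R} : IsWeakDeriv j g g' ↔ ∀ φ : ℝ → ℝ, IsTestFn φ →
    inner ℝ g (toL2 (iteratedDeriv j φ)) = (-1) ^ j * inner ℝ g' (toL2 φ) := by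
  refine forall₂_congr fun φ hφ => ?_
  rw [inner_toL2 (hφ.memLp_iteratedDeriv j), inner_toL2 hφ.memLp]

theorem isWeakDeriv_one_iff {g g' : L2R} : IsWeakDeriv 1 g g' ↔ ∀ φ : ℝ → ℝ, IsTestFn φ →
    inner ℝ g (toL2 (deriv φ)) = -inner ℝ g' (toL2 φ) := by
  simp [isWeakDeriv_iff]

/-- The fundamental lemma of the calculus of variations; identities in L₂ below are checked by
testing. -/
theorem eq_zero_of_inner_test {g : L2R}
    (h : ∀ φ : ℝ → ℝ, IsTestFn φ → inner ℝ g (toL2 φ) = 0) : g = 0 := by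
  refine (Lp.eq_zero_iff_ae_eq_zero).2 ?_
  refine ae_eq_zero_of_integral_contDiff_smul_eq_zero
    ((Lp.memLp g).locallyIntegrable (by norm_num)) fun φ h1 h2 => ?_
  have hφ : IsTestFn φ := ⟨h1, h2⟩
  rw [← h φ hφ, inner_toL2 hφ.memLp]
  simp [mul_comm]

theorem toL2_add {φ ψ : ℝ → ℝ} (hφ : MemLp φ 2 volume) (hψ : MemLp ψ 2 volume) :
    toL2 (fun x => φ x + ψ x) = toL2 φ + toL2 ψ := by
  refine Lp.ext ?_
  filter_upwards [toL2_ae hφ, toL2_ae hψ, toL2_ae (hφ.add hψ),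
    Lp.coeFn_add (toL2 φ) (toL2 ψ)] with x h1 h2 h3 h4
  change toL2 (φ + ψ) x = _
  rw [h3, h4, Pi.add_apply, Pi.add_apply, h1, h2]

theorem toL2_smul (r : ℝ) {φ : ℝ → ℝ} (hφ : MemLp φ 2 volume) :
    toL2 (fun x => r * φ x) = r • toL2 φ := by
  refine Lp.ext ?_
  filter_upwards [toL2_ae hφ, toL2_ae (hφ.const_mul r),
    Lp.coeFn_smul r (toL2 φ)] with x h1 h3 h4
  rw [h3, h4, Pi.smul_apply, h1, smul_eq_mul]

theorem IsTestFn.add {φ ψ : ℝ → ℝ} (hφ : IsTestFn φ) (hψ : IsTestFn ψ) :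
    IsTestFn fun x => φ x + ψ x := ⟨hφ.1.add hψ.1, hφ.2.add hψ.2⟩

theorem IsTestFn.const_mul {φ : ℝ → ℝ} (hφ : IsTestFn φ) (r : ℝ) :
    IsTestFn fun x => r * φ x := ⟨contDiff_const.mul hφ.1, hφ.2.mul_left⟩

theorem IsTestFn.zero : IsTestFn fun _ => 0 := ⟨contDiff_const, HasCompactSupport.zero⟩

/-- The subspace of test functions in `L₂`. -/
def testSub : Submodule ℝ L2R where
  carrier := {w | ∃ φ, IsTestFn φ ∧ toL2 φ = w}
  add_mem' := by
    rintro _ _ ⟨φ, hφ, rfl⟩ ⟨ψ, hψ, rfl⟩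
    exact ⟨_, hφ.add hψ, toL2_add hφ.memLp hψ.memLp⟩
  zero_mem' := ⟨_, IsTestFn.zero, by
    have := toL2_smul 0 IsTestFn.zero.memLp
    simpa using this⟩
  smul_mem' := by
    rintro r _ ⟨φ, hφ, rfl⟩
    exact ⟨_, hφ.const_mul r, toL2_smul r hφ.memLp⟩

theorem dense_testSub : Dense (testSub : Set L2R) := by
  rw [Submodule.dense_iff_topologicalClosure_eq_top, Submodule.topologicalClosure_eq_top_iff,
    Submodule.eq_bot_iff]
  intro g hg
  refine eq_zero_of_inner_test fun φ hφ => ?_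
  rw [real_inner_comm]
  exact hg _ ⟨φ, hφ, rfl⟩

theorem norm_le_of_inner_test {g : L2R} {c : ℝ} (hc : 0 ≤ c)
    (h : ∀ φ : ℝ → ℝ, IsTestFn φ → |inner ℝ g (toL2 φ)| ≤ c * ‖toL2 φ‖) : ‖g‖ ≤ c := by
  have h1 : ∀ w : L2R, |inner ℝ g w| ≤ c * ‖w‖ := by
    intro w
    refine dense_testSub.induction (P := fun w => |inner ℝ g w| ≤ c * ‖w‖) ?_
      (isClosed_le (by fun_prop) (by fun_prop)) w
    rintro _ ⟨φ, hφ, rfl⟩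
    exact h φ hφ
  have := h1 g
  rw [real_inner_self_eq_norm_sq, abs_of_nonneg (sq_nonneg _)] at this
  by_contra hlt
  nlinarith [norm_nonneg g]

end TestFunctions

/-! ### Weak derivatives as derivatives of the orbit of translations. -/

section WeakDeriv

/-- Translation on `L₂(ℝ)`. -/
abbrev shiftR (y : ℝ) : L2R →L[ℝ] L2R := shiftL2 volume y

theorem continuous_shiftR (g : L2R) : Continuous fun y => shiftR y g := by
  have h : Continuous fun y : ℝ => (⟨fun x => x + y, by fun_prop⟩ : C(ℝ, ℝ)) := by
    refine ContinuousMap.continuous_of_continuous_uncurry _ ?_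
    change Continuous fun q : ℝ × ℝ => q.2 + q.1
    fun_prop
  exact (continuous_const (y := g)).compMeasurePreservingLp h
    (fun y => measurePreserving_add_right volume y) ENNReal.ofNat_ne_top

theorem inner_shiftR_test (g : L2R) {φ : ℝ → ℝ} (hφ : IsTestFn φ) (y : ℝ) :
    inner ℝ (shiftR y g) (toL2 φ) = ∫ x, g x * φ (x - y) := by
  rw [inner_toL2 hφ.memLp, ← integral_add_right_eq_self (fun x => g x * φ (x - y)) y]
  refine integral_congr_ae ?_
  filter_upwards [shiftL2_ae y g] with x hx
  rw [hx, add_sub_cancel_right]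

/-- The translation is moved onto φ, where differentiation in y is classical; the definition of the
weak derivative then brings the derivative back to g. -/
theorem IsWeakDeriv.hasDerivAt_inner {g g' : L2R} (h : IsWeakDeriv 1 g g') {φ : ℝ → ℝ}
    (hφ : IsTestFn φ) (y : ℝ) :
    HasDerivAt (fun y => inner ℝ (shiftR y g) (toL2 φ)) (inner ℝ (shiftR y g') (toL2 φ)) y := by
  have hd : ∀ x, HasDerivAt φ (deriv φ x) x := fun x =>
    (hφ.1.differentiable (by norm_num) x).hasDerivAt
  obtain ⟨R, hR⟩ := hφ.deriv.2.isCompact.isBounded.subset_closedBall 0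
  obtain ⟨B, hB⟩ := hφ.deriv.2.exists_bound_of_continuous hφ.deriv.1.continuous
  have hB0 : 0 ≤ B := (norm_nonneg _).trans (hB 0)
  have hval : inner ℝ (shiftR y g') (toL2 φ) = ∫ x, g x * -deriv φ (x - y) := by
    rw [inner_shiftR_test g' hφ]
    have := isWeakDeriv_one_iff.1 h _ (hφ.comp_add (-y))
    rw [inner_toL2 (hφ.comp_add (-y)).memLp, inner_toL2 (hφ.comp_add (-y)).deriv.memLp] at this
    simp only [deriv_comp_add_const] at this
    simp only [sub_eq_add_neg, mul_neg, integral_neg]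
    linarith
  rw [hval]
  simp only [inner_shiftR_test g hφ]
  -- For translations within distance 1 of y, the support of the translated φ' stays in a fixed ball
  -- of radius R + |y| + 1, where g is integrable; this gives the dominating function.
  refine (hasDerivAt_integral_of_dominated_loc_of_deriv_le (s := Metric.ball y 1)
    (F := fun y x => g x * φ (x - y)) (F' := fun y x => g x * -deriv φ (x - y))
    (bound := (Metric.closedBall (0 : ℝ) (R + |y| + 1)).indicator fun x => B * ‖g x‖)
    (Metric.ball_mem_nhds y one_pos) (Filter.Eventually.of_forall fun z => ?_) ?_ ?_ ?_ ?_ ?_).2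
  · exact (Lp.aestronglyMeasurable g).mul
      (hφ.1.continuous.comp (continuous_id.sub continuous_const)).aestronglyMeasurable
  · have := (hφ.comp_add (-y)).integrable_mul 0 g
    simpa [sub_eq_add_neg] using this
  · exact (Lp.aestronglyMeasurable g).mul
      (hφ.deriv.1.continuous.comp (continuous_id.sub continuous_const)).neg.aestronglyMeasurable
  · refine Filter.Eventually.of_forall fun x z hz => ?_
    by_cases hx : x ∈ Metric.closedBall (0 : ℝ) (R + |y| + 1)
    · rw [indicator_of_mem hx, norm_mul, norm_neg, mul_comm]
      exact mul_le_mul_of_nonneg_right (hB _) (norm_nonneg _)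
    · rw [indicator_of_notMem hx]
      have : deriv φ (x - z) = 0 := by
        by_contra hne
        have h1 := hR (subset_tsupport _ (Function.mem_support.2 hne))
        rw [mem_closedBall_zero_iff] at h1 hx
        rw [Metric.mem_ball, Real.dist_eq] at hz
        apply hx
        have e : x = (x - z) + ((z - y) + y) := by ring
        rw [Real.norm_eq_abs] at h1 ⊢
        rw [e]
        refine (abs_add_le _ _).trans ?_
        have := abs_add_le (z - y) y
        linarith
      simp [this]
  · refine (integrable_indicator_iff Metric.isClosed_closedBall.measurableSet).2 ?_
    exact (((Lp.memLp g).locallyIntegrable (by norm_num)).integrableOn_isCompact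
      (isCompact_closedBall _ _)).norm.const_mul B
  · refine Filter.Eventually.of_forall fun x z _ => ?_
    have := ((hd (x - z)).comp z ((hasDerivAt_id z).const_sub x)).const_mul (g x)
    refine this.congr_deriv ?_
    ring

theorem IsWeakDeriv.shift_sub_eq {g g' : L2R} (h : IsWeakDeriv 1 g g') (y : ℝ) :
    shiftR y g - g = ∫ r in (0 : ℝ)..y, shiftR r g' := by
  rw [← sub_eq_zero]
  refine eq_zero_of_inner_test fun φ hφ => ?_
  have hi : IntervalIntegrable (fun r => shiftR r g') volume 0 y :=
    (continuous_shiftR g').intervalIntegrable _ _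
  have h1 : inner ℝ (∫ r in (0 : ℝ)..y, shiftR r g') (toL2 φ)
      = ∫ r in (0 : ℝ)..y, inner ℝ (shiftR r g') (toL2 φ) := by
    rw [real_inner_comm]
    have := (innerSL ℝ (toL2 φ)).intervalIntegral_comp_comm hi
    simp only [innerSL_apply_apply] at this
    rw [← this]
    simp only [real_inner_comm]
  rw [inner_sub_left, inner_sub_left, h1,
    intervalIntegral.integral_eq_sub_of_hasDerivAt (fun r _ => h.hasDerivAt_inner hφ r)
      (((continuous_shiftR g').inner continuous_const).intervalIntegrable _ _),
    shiftL2_zero, sub_self]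

/-- A weak derivative is a derivative, in the norm of L₂, of the curve y ↦ S_y g;
`isWeakDeriv_of_hasDerivAt` is the converse. Integration by parts, Taylor bounds and compatibility
with translation invariant operators become statements about this curve, and no mollification is
needed. -/
theorem IsWeakDeriv.hasDerivAt {g g' : L2R} (h : IsWeakDeriv 1 g g') (y : ℝ) :
    HasDerivAt (fun y => shiftR y g) (shiftR y g') y := by
  have h1 : (fun y => shiftR y g) = fun y => (∫ r in (0 : ℝ)..y, shiftR r g') + g := by
    funext y
    rw [← h.shift_sub_eq, sub_add_cancel]
  rw [h1]
  exact ((continuous_shiftR g').integral_hasStrictDerivAt 0 y).hasDerivAt.add_const g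

theorem IsWeakDeriv.hasDerivAt_zero {g g' : L2R} (h : IsWeakDeriv 1 g g') :
    HasDerivAt (fun y => shiftR y g) g' 0 := by
  simpa only [shiftL2_zero] using h.hasDerivAt 0

/-- Integration by parts is the derivative at y = 0 of (S_y g, w) = (g, S_{−y} w). -/
theorem inner_eq_neg_of_hasDerivAt {g g' w w' : L2R} (h : HasDerivAt (fun y => shiftR y g) g' 0)
    (hw : HasDerivAt (fun y => shiftR y w) w' 0) : inner ℝ g w' = -inner ℝ g' w := by
  have h1 : HasDerivAt (fun y => inner ℝ (shiftR y g) w) (inner ℝ g' w) 0 := by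
    have := h.inner ℝ (hasDerivAt_const (0 : ℝ) w)
    simpa using this
  have h2 : HasDerivAt (fun y => inner ℝ (shiftR y g) w) (-inner ℝ g w') 0 := by
    have e : (fun y => inner ℝ (shiftR y g) w) = fun y => inner ℝ g (shiftR (-y) w) := by
      funext y
      exact inner_shiftL2_left y g w
    rw [e]
    have h3 : HasDerivAt (fun y => shiftR (-y) w) (-w') 0 := by
      have := HasDerivAt.scomp (h := fun y : ℝ => -y) (g₁ := fun y => shiftR y w) (0 : ℝ)
        (h' := -1) (g₁' := w') (by simpa using hw) (hasDerivAt_neg 0)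
      simpa [Function.comp_def] using this
    have := (hasDerivAt_const (0 : ℝ) g).inner ℝ h3
    simpa using this
  linarith [h1.unique h2]

/-- One continuous derivative is all that is asked, because the product of a coefficient and a test
function is not smooth. -/
theorem isWeakDeriv_toL2 {χ : ℝ → ℝ} (h1 : ContDiff ℝ 1 χ) (h2 : HasCompactSupport χ) :
    IsWeakDeriv 1 (toL2 χ) (toL2 (deriv χ)) := by
  have hd : ∀ x, HasDerivAt χ (deriv χ x) x := fun x =>
    (h1.differentiable (by norm_num) x).hasDerivAt
  have hc : Continuous (deriv χ) := h1.continuous_deriv le_rfl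
  have m1 : MemLp χ 2 volume := h1.continuous.memLp_of_hasCompactSupport h2
  have m2 : MemLp (deriv χ) 2 volume := hc.memLp_of_hasCompactSupport h2.deriv
  rw [isWeakDeriv_one_iff]
  intro φ hφ
  have hdφ : ∀ x, HasDerivAt φ (deriv φ x) x := fun x =>
    (hφ.1.differentiable (by norm_num) x).hasDerivAt
  rw [real_inner_comm, real_inner_comm (toL2 φ), inner_toL2 m1, inner_toL2 m2]
  have e1 : ∫ x, toL2 (deriv φ) x * χ x = ∫ x, χ x * deriv φ x := by
    refine integral_congr_ae ?_
    filter_upwards [toL2_ae hφ.deriv.memLp] with x hx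
    rw [hx, mul_comm]
  have e2 : ∫ x, toL2 φ x * deriv χ x = ∫ x, deriv χ x * φ x := by
    refine integral_congr_ae ?_
    filter_upwards [toL2_ae hφ.memLp] with x hx
    rw [hx, mul_comm]
  rw [e1, e2]
  refine integral_mul_deriv_eq_deriv_mul_of_integrable (fun x _ => hd x) (fun x _ => hdφ x) ?_ ?_ ?_
  · exact (h1.continuous.mul hφ.deriv.1.continuous).integrable_of_hasCompactSupport h2.mul_right
  · exact (hc.mul hφ.1.continuous).integrable_of_hasCompactSupport h2.deriv.mul_right
  · exact (h1.continuous.mul hφ.1.continuous).integrable_of_hasCompactSupport h2.mul_right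

theorem IsTestFn.isWeakDeriv {φ : ℝ → ℝ} (hφ : IsTestFn φ) :
    IsWeakDeriv 1 (toL2 φ) (toL2 (_root_.deriv φ)) :=
  isWeakDeriv_toL2 (hφ.1.of_le (by exact_mod_cast le_top)) hφ.2

theorem isWeakDeriv_of_hasDerivAt {g g' : L2R} (h : HasDerivAt (fun y => shiftR y g) g' 0) :
    IsWeakDeriv 1 g g' :=
  isWeakDeriv_one_iff.2 fun _ hφ => inner_eq_neg_of_hasDerivAt h hφ.isWeakDeriv.hasDerivAt_zero

theorem IsWeakDeriv.inner_eq_neg {g g' w w' : L2R} (h : IsWeakDeriv 1 g g')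
    (hw : IsWeakDeriv 1 w w') : inner ℝ g w' = -inner ℝ g' w :=
  inner_eq_neg_of_hasDerivAt h.hasDerivAt_zero hw.hasDerivAt_zero

/-- The operator `T` commutes with translations. -/
def ShiftInvariant (T : L2R →L[ℝ] L2R) : Prop := ∀ y g, shiftR y (T g) = T (shiftR y g)

/-- A bounded operator that commutes with translations carries the differentiable orbit of g to that
of T g. -/
theorem IsWeakDeriv.map {T : L2R →L[ℝ] L2R} (hT : ShiftInvariant T) {g g' : L2R}
    (h : IsWeakDeriv 1 g g') : IsWeakDeriv 1 (T g) (T g') := by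
  refine isWeakDeriv_of_hasDerivAt ?_
  rw [show (fun y => shiftR y (T g)) = fun y => T (shiftR y g) from funext fun y => hT y g]
  exact T.hasFDerivAt.comp_hasDerivAt 0 h.hasDerivAt_zero

/-- The function aφ is admissible in the integration by parts for g, and the classical product rule
for aφ produces the two terms. -/
theorem IsWeakDeriv.mulL2 {K K' : ℝ} {a : ℝ → ℝ} (ha : ContDiff ℝ 1 a) (h0 : ContBdd K a)
    (h1 : ContBdd K' (deriv a)) {g g' : L2R} (h : IsWeakDeriv 1 g g') :
    IsWeakDeriv 1 (mulL2 volume a g) (mulL2 volume (deriv a) g + mulL2 volume a g') := by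
  rw [isWeakDeriv_one_iff]
  intro φ hφ
  have hd : ∀ x, HasDerivAt a (deriv a x) x := fun x =>
    (ha.differentiable (by norm_num) x).hasDerivAt
  have hdφ : ∀ x, HasDerivAt φ (deriv φ x) x := fun x =>
    (hφ.1.differentiable (by norm_num) x).hasDerivAt
  have hprod : ContDiff ℝ 1 fun x => a x * φ x := ha.mul (hφ.1.of_le (by exact_mod_cast le_top))
  have hsupp : HasCompactSupport fun x => a x * φ x := hφ.2.mul_left
  have hderiv : deriv (fun x => a x * φ x) = fun x => deriv a x * φ x + a x * deriv φ x := by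
    funext x
    exact ((hd x).mul (hdφ x)).deriv
  have hmul : ∀ {K : ℝ} {b : ℝ → ℝ}, ContBdd K b → ∀ {ψ : ℝ → ℝ}, IsTestFn ψ →
      MemLp (fun x => b x * ψ x) 2 volume ∧
      _root_.mulL2 volume b (toL2 ψ) = toL2 (fun x => b x * ψ x) := by
    intro K b hb ψ hψ
    have hm : MemLp (fun x => b x * ψ x) 2 volume :=
      (hb.1.mul hψ.1.continuous).memLp_of_hasCompactSupport hψ.2.mul_left
    refine ⟨hm, Lp.ext ?_⟩
    filter_upwards [mulL2_ae hb (toL2 ψ), toL2_ae hψ.memLp, toL2_ae hm] with x h1 h2 h3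
    rw [h1, h2, h3]
  have key := h.inner_eq_neg (isWeakDeriv_toL2 hprod hsupp)
  rw [hderiv, toL2_add (hmul h1 hφ).1 (hmul h0 hφ.deriv).1, ← (hmul h1 hφ).2,
    ← (hmul h0 hφ.deriv).2, ← (hmul h0 hφ).2, inner_add_right] at key
  rw [inner_add_left, inner_mulL2_left h0, inner_mulL2_left h1, inner_mulL2_left h0]
  linarith

theorem IsWeakDeriv.norm_shift_sub_le {g g' : L2R} (h : IsWeakDeriv 1 g g') (x y : ℝ) :
    ‖shiftR y g - shiftR x g‖ ≤ ‖g'‖ * |y - x| :=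
  Convex.norm_image_sub_le_of_norm_hasDerivWithin_le (s := univ)
    (fun z _ => (h.hasDerivAt z).hasDerivWithinAt) (fun z _ => (norm_shiftL2 z g').le)
    convex_univ (mem_univ x) (mem_univ y)

theorem IsWeakDeriv.norm_taylor_le {g g' g'' : L2R} (h : IsWeakDeriv 1 g g')
    (h' : IsWeakDeriv 1 g' g'') (y : ℝ) :
    ‖shiftR y g - g - y • g'‖ ≤ y ^ 2 * ‖g''‖ := by
  have h1 : ∀ z ∈ Icc (-|y|) |y|, HasDerivWithinAt (fun y => shiftR y g - y • g')
      (shiftR z g' - g') (Icc (-|y|) |y|) z := fun z _ => by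
    have := ((h.hasDerivAt z).sub ((hasDerivAt_id z).smul_const g')).hasDerivWithinAt
      (s := Icc (-|y|) |y|)
    rwa [one_smul] at this
  have h2 := Convex.norm_image_sub_le_of_norm_hasDerivWithin_le h1
    (C := ‖g''‖ * |y|) (fun z hz => ?_) (convex_Icc _ _)
    (show (0 : ℝ) ∈ _ by simp) (show y ∈ _ from abs_le.1 le_rfl)
  · simp only [shiftL2_zero, zero_smul, sub_zero] at h2
    rw [sub_right_comm] at h2
    refine h2.trans (le_of_eq ?_)
    rw [Real.norm_eq_abs, mul_assoc, abs_mul_abs_self]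
    ring
  · have := h'.norm_shift_sub_le 0 z
    rw [shiftL2_zero, sub_zero] at this
    exact this.trans (mul_le_mul_of_nonneg_left (abs_le.2 hz) (norm_nonneg _))

theorem shiftInvariant_shiftR (x : ℝ) : ShiftInvariant (shiftR x) := fun y g => by
  rw [shiftL2_shiftL2, shiftL2_shiftL2, add_comm]

theorem ShiftInvariant.sub {T T' : L2R →L[ℝ] L2R} (h : ShiftInvariant T)
    (h' : ShiftInvariant T') : ShiftInvariant (T - T') := fun y g => by
  rw [sub_apply, sub_apply, map_sub, h, h']

theorem ShiftInvariant.smul {T : L2R →L[ℝ] L2R} (h : ShiftInvariant T) (r : ℝ) :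
    ShiftInvariant (r • T) := fun y g => by
  rw [smul_apply, smul_apply, map_smul, h]

theorem shiftInvariant_id : ShiftInvariant (ContinuousLinearMap.id ℝ L2R) := fun _ _ => rfl

/-- The symmetric difference `δ^h` on `L₂(ℝ)`. -/
abbrev symDiffR (h : ℝ) : L2R →L[ℝ] L2R := symDiffL2 volume h h

theorem shiftInvariant_symDiffR (h : ℝ) : ShiftInvariant (symDiffR h) :=
  ((shiftInvariant_shiftR h).sub (shiftInvariant_shiftR (-h))).smul _

theorem IsWeakDeriv.norm_symDiffR_le {h : ℝ} (hh : 0 < h) {g g' : L2R} (hg : IsWeakDeriv 1 g g') :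
    ‖symDiffR h g‖ ≤ ‖g'‖ := by
  rw [symDiffL2_apply, norm_smul, Real.norm_of_nonneg (by positivity)]
  have h1 := hg.norm_shift_sub_le (-h) h
  rw [show h - -h = 2 * h by ring, abs_of_pos (by positivity)] at h1
  calc _ ≤ (2 * h)⁻¹ * (‖g'‖ * (2 * h)) := by gcongr
    _ = _ := by field_simp

/-- First order in h, at the cost of one further derivative, is enough, since the theorem asks only
for an error of order h. -/
theorem IsWeakDeriv.norm_symDiffR_sub_le {h : ℝ} (hh : 0 < h) {g g' g'' : L2R}
    (hg : IsWeakDeriv 1 g g') (hg' : IsWeakDeriv 1 g' g'') :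
    ‖symDiffR h g - g'‖ ≤ h * ‖g''‖ := by
  have e : symDiffR h g - g' = (2 * h)⁻¹ • ((shiftR h g - g - h • g')
      - (shiftR (-h) g - g - (-h) • g')) := by
    rw [symDiffL2_apply]
    have : g' = (2 * h)⁻¹ • ((2 * h) • g') := by rw [inv_smul_smul₀ (by positivity)]
    conv_lhs => rw [this]
    rw [← smul_sub]
    congr 1
    module
  rw [e, norm_smul, Real.norm_of_nonneg (by positivity)]
  have h1 := hg.norm_taylor_le hg' h
  have h2 := hg.norm_taylor_le hg' (-h)
  calc _ ≤ (2 * h)⁻¹ * (h ^ 2 * ‖g''‖ + (-h) ^ 2 * ‖g''‖) := by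
        gcongr
        exact (norm_sub_le _ _).trans (add_le_add h1 h2)
    _ = _ := by field_simp; ring

theorem IsWeakDeriv.sub {j : ℕ} {g g' w w' : L2R} (h : IsWeakDeriv j g g')
    (hw : IsWeakDeriv j w w') : IsWeakDeriv j (g - w) (g' - w') := by
  have := h.add (hw.smul (-1))
  simpa [sub_eq_add_neg] using this

theorem IsWeakDeriv.norm_symDiffR_symDiffR_sub_le {h : ℝ} (hh : 0 < h) {g g' g'' g''' : L2R}
    (hg : IsWeakDeriv 1 g g') (hg' : IsWeakDeriv 1 g' g'') (hg'' : IsWeakDeriv 1 g'' g''') :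
    ‖symDiffR h (symDiffR h g) - g''‖ ≤ 2 * h * ‖g'''‖ := by
  have e : symDiffR h (symDiffR h g) - g''
      = symDiffR h (symDiffR h g - g') + (symDiffR h g' - g'') := by
    rw [map_sub]; abel
  have h1 := ((hg.map (shiftInvariant_symDiffR h)).sub hg').norm_symDiffR_le hh
  have h2 := hg'.norm_symDiffR_sub_le hh hg''
  rw [e]
  refine (norm_add_le _ _).trans ?_
  linarith

/-- `δ_{-h} δ_h` on `L₂(ℝ)`. -/
def secondDiffR (h : ℝ) : L2R →L[ℝ] L2R :=
  (h⁻¹) ^ 2 • (shiftR h - (2 : ℝ) • ContinuousLinearMap.id ℝ L2R + shiftR (-h))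

theorem IsWeakDeriv.norm_secondDiffR_sub_le {h : ℝ} (hh : 0 < h) {g g' g'' g''' : L2R}
    (hg : IsWeakDeriv 1 g g') (hg' : IsWeakDeriv 1 g' g'') (hg'' : IsWeakDeriv 1 g'' g''') :
    ‖secondDiffR h g - g''‖ ≤ 2 * h * ‖g'''‖ := by
  have hF : ShiftInvariant (h⁻¹ • (shiftR h - ContinuousLinearMap.id ℝ L2R)) :=
    ((shiftInvariant_shiftR h).sub shiftInvariant_id).smul _
  set F := h⁻¹ • (shiftR h - ContinuousLinearMap.id ℝ L2R) with hFdef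
  set G := (-h)⁻¹ • (shiftR (-h) - ContinuousLinearMap.id ℝ L2R) with hGdef
  have hFa : ∀ x, F x = h⁻¹ • (shiftR h x - x) := fun x => rfl
  have hGa : ∀ x, G x = (-h)⁻¹ • (shiftR (-h) x - x) := fun x => rfl
  -- The second difference is the backward quotient G of the forward quotient F. One quotient is
  -- replaced by a derivative at a time, and the outer one is bounded by a derivative.
  have e : secondDiffR h g - g'' = G (F g - g') + (G g' - g'') := by
    have : secondDiffR h g = G (F g) := by
      rw [hGa, hFa, map_smul, map_sub, shiftL2_shiftL2, neg_add_cancel, shiftL2_zero]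
      change (h⁻¹) ^ 2 • (shiftR h g - (2 : ℝ) • g + shiftR (-h) g) = _
      rw [← smul_sub, smul_smul, show (-h)⁻¹ * h⁻¹ = -(h⁻¹ ^ 2) by rw [inv_neg]; ring]
      module
    rw [this, map_sub]; abel
  have hsub : ∀ (s : ℝ) (hs : s ≠ 0) {x x' x'' : L2R}, IsWeakDeriv 1 x x' → IsWeakDeriv 1 x' x'' →
      ‖s⁻¹ • (shiftR s x - x) - x'‖ ≤ |s| * ‖x''‖ := by
    intro s hs x x' x'' hx hx'
    have e : s⁻¹ • (shiftR s x - x) - x' = s⁻¹ • (shiftR s x - x - s • x') := by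
      rw [smul_sub s⁻¹ (shiftR s x - x), inv_smul_smul₀ hs]
    rw [e, norm_smul, norm_inv, Real.norm_eq_abs, inv_mul_le_iff₀ (abs_pos.2 hs)]
    have := hx.norm_taylor_le hx' s
    rwa [← mul_assoc, abs_mul_abs_self, ← sq]
  have hle : ∀ {x x' : L2R}, IsWeakDeriv 1 x x' → ‖G x‖ ≤ ‖x'‖ := by
    intro x x' hx
    have := hx.norm_shift_sub_le 0 (-h)
    rw [shiftL2_zero, sub_zero, abs_neg, abs_of_pos hh] at this
    rw [hGa, norm_smul, norm_inv, norm_neg, Real.norm_of_nonneg hh.le, inv_mul_le_iff₀ hh]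
    linarith
  have h1 := hle ((hg.map hF).sub hg')
  have h2 := hsub h hh.ne' hg' hg''
  have h3 := hsub (-h) (neg_ne_zero.2 hh.ne') hg' hg''
  rw [abs_of_pos hh] at h2
  rw [abs_neg, abs_of_pos hh] at h3
  rw [e]
  refine (norm_add_le _ _).trans ?_
  rw [← hFa] at h2
  rw [← hGa] at h3
  linarith

theorem norm_mulL2_shiftR_le {K L : ℝ} {σ : ℝ → ℝ} (hσ : ContBdd K σ)
    (hL : ∀ x y, |σ x - σ y| ≤ L * |x - y|) (y : ℝ) (g : L2R) :
    ‖mulL2 volume σ (shiftR y g)‖ ≤ ‖mulL2 volume σ g‖ + L * |y| * ‖g‖ := by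
  have e : mulL2 volume σ (shiftR y g)
      = shiftR y (mulL2 volume σ g + mulL2 volume (fun x => σ (x + -y) - σ x) g) := by
    rw [mulL2_sub (hσ.comp_add (-y)) hσ, add_sub_cancel, shiftL2_mulL2 (hσ.comp_add (-y))]
    simp only [add_neg_cancel_right]
  rw [e, norm_shiftL2]
  refine (norm_add_le _ _).trans (add_le_add_right ?_ _)
  refine norm_mulL2_le ⟨((hσ.comp_add (-y)).sub hσ).1, fun x => ?_⟩ g
  have := hL (x + -y) x
  rwa [add_sub_cancel_left, abs_neg] at this

/-- The outer difference is traded for a derivative without losing the weight σ: this matters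
because only ‖σ δ g'‖, and not ‖δ g'‖, is controlled by dissipativity. Moving σ across a translation
by |z| ≤ h costs Lh‖δ g'‖ ≤ L‖g'‖. -/
theorem IsWeakDeriv.norm_mulL2_symDiffR_symDiffR_le {K L h : ℝ} (hh : 0 < h) {σ : ℝ → ℝ}
    (hσ : ContBdd K σ) (hL0 : 0 ≤ L) (hL : ∀ x y, |σ x - σ y| ≤ L * |x - y|) {g g' : L2R}
    (hg : IsWeakDeriv 1 g g') :
    ‖_root_.mulL2 volume σ (symDiffR h (symDiffR h g))‖
      ≤ ‖_root_.mulL2 volume σ (symDiffR h g')‖ + L * ‖g'‖ := by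
  have hd := hg.map (shiftInvariant_symDiffR h)
  have h1 : ∀ z ∈ Icc (-h) h, HasDerivWithinAt
      (fun y => _root_.mulL2 volume σ (shiftR y (symDiffR h g)))
      (_root_.mulL2 volume σ (shiftR z (symDiffR h g'))) (Icc (-h) h) z := fun z _ =>
    ((_root_.mulL2 volume σ).hasFDerivAt.comp_hasDerivAt z (hd.hasDerivAt z)).hasDerivWithinAt
  have h2 := Convex.norm_image_sub_le_of_norm_hasDerivWithin_le h1
    (C := ‖_root_.mulL2 volume σ (symDiffR h g')‖ + L * ‖g'‖) (fun z hz => ?_) (convex_Icc _ _)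
    (show (-h : ℝ) ∈ _ from ⟨le_rfl, by linarith⟩) (show h ∈ _ from ⟨by linarith, le_rfl⟩)
  · rw [symDiffL2_apply h h (symDiffR h g), map_smul, map_sub, norm_smul,
      Real.norm_of_nonneg (by positivity), inv_mul_le_iff₀ (by positivity)]
    rw [show h - -h = 2 * h by ring, Real.norm_of_nonneg (by positivity)] at h2
    linarith
  · refine (norm_mulL2_shiftR_le hσ hL z _).trans (add_le_add_right ?_ _)
    rw [mul_assoc]
    refine mul_le_mul_of_nonneg_left ?_ hL0
    refine le_trans ?_ (norm_symDiffL2_le hh h g')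
    exact mul_le_mul_of_nonneg_right (abs_le.2 hz) (norm_nonneg _)

end WeakDeriv

/-! ### The Hilbert spaces H^k and the operators on them. -/

section SobolevSpace

theorem isWeakDeriv_zero_self (g : L2R) : IsWeakDeriv 0 g g := fun φ _ => by simp

theorem IsWeakDeriv.succ {j : ℕ} {g w w' : L2R} (h : IsWeakDeriv j g w)
    (h' : IsWeakDeriv 1 w w') : IsWeakDeriv (j + 1) g w' := by
  rw [isWeakDeriv_iff] at h ⊢
  rw [isWeakDeriv_one_iff] at h'
  intro φ hφ
  rw [iteratedDeriv_succ', h _ hφ.deriv, h' _ hφ, pow_succ]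
  ring

theorem IsWeakDeriv.of_succ {j : ℕ} {g w w' : L2R} (h : IsWeakDeriv j g w)
    (h' : IsWeakDeriv (j + 1) g w') : IsWeakDeriv 1 w w' := by
  rw [isWeakDeriv_iff] at h h'
  rw [isWeakDeriv_one_iff]
  intro φ hφ
  have h1 := h _ hφ.deriv
  have h2 := h' _ hφ
  rw [iteratedDeriv_succ', h1, pow_succ, mul_assoc] at h2
  have := mul_left_cancel₀ (pow_ne_zero j (by norm_num)) h2
  linarith

theorem IsWeakDeriv.unique {j : ℕ} {g w w' : L2R} (h : IsWeakDeriv j g w)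
    (h' : IsWeakDeriv j g w') : w = w' := by
  rw [← sub_eq_zero]
  refine eq_zero_of_inner_test fun φ hφ => ?_
  rw [isWeakDeriv_iff] at h h'
  have h1 := (h _ hφ).symm.trans (h' _ hφ)
  have := mul_left_cancel₀ (pow_ne_zero j (by norm_num)) h1
  rw [inner_sub_left, this, sub_self]

variable {k : ℕ}

/-- The `j`-th derivative as an operator from `H^k` to `L₂` (zero for `j > k`). -/
def dH (k j : ℕ) : HSob k →L[ℝ] L2R :=
  if h : j < k + 1 then
    (PiLp.proj 2 (fun _ : Fin (k + 1) => L2R) (⟨j, h⟩ : Fin (k + 1)) : _ →L[ℝ] L2R).comp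
      (sobolevSubmodule k).subtypeL
  else 0

theorem dH_apply {j : ℕ} (h : j < k + 1) (g : HSob k) : dH k j g = g.1 ⟨j, h⟩ := by
  rw [dH, dif_pos h]
  rfl

theorem dH_zero (g : HSob k) : dH k 0 g = g.toL2 := dH_apply (by omega) g

theorem dH_one (g : HSob 1) : dH 1 1 g = g.dx := dH_apply (by omega) g

theorem isWeakDeriv_dH_zero {j : ℕ} (h : j ≤ k) (g : HSob k) :
    IsWeakDeriv j (dH k 0 g) (dH k j g) := by
  rw [dH_apply (by omega), dH_apply (by omega)]
  exact g.2 ⟨j, by omega⟩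

theorem isWeakDeriv_dH {j : ℕ} (h : j < k) (g : HSob k) :
    IsWeakDeriv 1 (dH k j g) (dH k (j + 1) g) :=
  (isWeakDeriv_dH_zero h.le g).of_succ (isWeakDeriv_dH_zero h g)

theorem inner_HSob (g w : HSob k) :
    inner ℝ g w = ∑ j ∈ Finset.range (k + 1), inner ℝ (dH k j g) (dH k j w) := by
  rw [Submodule.coe_inner, PiLp.inner_apply, Finset.sum_range]
  refine Finset.sum_congr rfl fun j _ => ?_
  rw [dH_apply j.2, dH_apply j.2]

theorem norm_sq_HSob (g : HSob k) :
    ‖g‖ ^ 2 = ∑ j ∈ Finset.range (k + 1), ‖dH k j g‖ ^ 2 := by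
  rw [← real_inner_self_eq_norm_sq, inner_HSob]
  simp only [real_inner_self_eq_norm_sq]

theorem norm_dH_le (j : ℕ) (g : HSob k) : ‖dH k j g‖ ≤ ‖g‖ := by
  by_cases h : j < k + 1
  · refine le_of_sq_le_sq ?_ (norm_nonneg _)
    rw [norm_sq_HSob]
    exact Finset.single_le_sum (f := fun j => ‖dH k j g‖ ^ 2) (fun _ _ => sq_nonneg _)
      (Finset.mem_range.2 h)
  · rw [dH, dif_neg h]
    simp

theorem norm_HSob_le {g : HSob k} {B : ℝ} (h : ∀ j ≤ k, ‖dH k j g‖ ≤ B) :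
    ‖g‖ ≤ (k + 1) * B := by
  have hB : 0 ≤ B := (norm_nonneg _).trans (h 0 (by omega))
  refine le_of_sq_le_sq ?_ (by positivity)
  rw [norm_sq_HSob]
  calc _ ≤ ∑ j ∈ Finset.range (k + 1), B ^ 2 := Finset.sum_le_sum fun j hj =>
        pow_le_pow_left₀ (norm_nonneg _) (h j (by rw [Finset.mem_range] at hj; omega)) 2
    _ = (k + 1) * B ^ 2 := by simp
    _ ≤ _ := by
        rw [mul_pow]
        refine mul_le_mul_of_nonneg_right ?_ (sq_nonneg _)
        have : (0 : ℝ) ≤ k := Nat.cast_nonneg k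
        nlinarith

theorem norm_HSob_le_mul {k' : ℕ} {g : HSob k} {w : HSob k'} (hk : k ≤ k') {c : ℝ} (hc : 0 ≤ c)
    (h : ∀ j ≤ k, ‖dH k j g‖ ≤ c * ‖dH k' j w‖) : ‖g‖ ≤ c * ‖w‖ := by
  refine le_of_sq_le_sq ?_ (by positivity)
  rw [mul_pow, norm_sq_HSob, norm_sq_HSob, Finset.mul_sum]
  refine (Finset.sum_le_sum fun j hj => ?_).trans (Finset.sum_le_sum_of_subset_of_nonneg
    (Finset.range_mono (show k + 1 ≤ k' + 1 by omega)) fun _ _ _ => by positivity)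
  rw [← mul_pow]
  exact pow_le_pow_left₀ (norm_nonneg _) (h j (by rw [Finset.mem_range] at hj; omega)) 2

/-- Weak derivatives are unique, so the tuple is determined by its zeroth entry. Identities in H^k
thereby reduce to identities in L₂. -/
theorem HSob.ext_toL2 {g w : HSob k} (h : dH k 0 g = dH k 0 w) : g = w := by
  refine Subtype.ext (PiLp.ext fun j => ?_)
  have h1 := isWeakDeriv_dH_zero (show (j : ℕ) ≤ k by omega) g
  have h2 := isWeakDeriv_dH_zero (show (j : ℕ) ≤ k by omega) w
  rw [h] at h1
  have := h1.unique h2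
  rwa [dH_apply j.2, dH_apply j.2] at this

theorem isClosed_sobolevSubmodule (k : ℕ) :
    IsClosed (sobolevSubmodule k : Set (PiLp 2 fun _ : Fin (k + 1) => L2R)) := by
  have : (sobolevSubmodule k : Set (PiLp 2 fun _ : Fin (k + 1) => L2R))
      = ⋂ (j : Fin (k + 1)) (φ : ℝ → ℝ) (_ : IsTestFn φ),
        {g | inner ℝ (g 0) (toL2 (iteratedDeriv j φ)) = (-1) ^ (j : ℕ) * inner ℝ (g j) (toL2 φ)} := by
    ext g
    simp only [mem_iInter]
    exact forall_congr' fun j => isWeakDeriv_iff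
  rw [this]
  refine isClosed_iInter fun j => isClosed_iInter fun φ => isClosed_iInter fun _ => ?_
  exact isClosed_eq (by fun_prop) (by fun_prop)

instance instCompleteSpaceHSob (k : ℕ) : CompleteSpace (HSob k) :=
  (isClosed_sobolevSubmodule k).completeSpace_coe

variable {E : Type*} [NormedAddCommGroup E] [NormedSpace ℝ E]

/-- An operator into `H^k` is given by the derivatives of its values. -/
def HSob.mkCLM (k : ℕ) (B : ℕ → E →L[ℝ] L2R)
    (hB : ∀ j < k, ∀ x, IsWeakDeriv 1 (B j x) (B (j + 1) x)) : E →L[ℝ] HSob k :=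
  (((PiLp.continuousLinearEquiv 2 ℝ fun _ : Fin (k + 1) => L2R).symm.toContinuousLinearMap).comp
    (ContinuousLinearMap.pi fun j : Fin (k + 1) => B j)).codRestrict (sobolevSubmodule k)
    (fun x j => by
      have : ∀ j ≤ k, IsWeakDeriv j (B 0 x) (B j x) := by
        intro j
        induction j with
        | zero => exact fun _ => isWeakDeriv_zero_self _
        | succ j ih => exact fun h => (ih (by omega)).succ (hB j (by omega) x)
      exact this j (by omega))

theorem dH_mkCLM {B : ℕ → E →L[ℝ] L2R}
    (hB : ∀ j < k, ∀ x, IsWeakDeriv 1 (B j x) (B (j + 1) x)) {j : ℕ} (hj : j ≤ k) (x : E) :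
    dH k j (HSob.mkCLM k B hB x) = B j x :=
  dH_apply (by omega) _

/-- The derivative `∂^i : H^k → H^{k'}`, for `k' + i ≤ k`. -/
def derivH {k k' : ℕ} (i : ℕ) (h : k' + i ≤ k) : HSob k →L[ℝ] HSob k' :=
  HSob.mkCLM k' (fun j => dH k (j + i)) fun j hj x => by
    rw [show j + 1 + i = j + i + 1 by omega]
    exact isWeakDeriv_dH (by omega) x

theorem dH_derivH {k k' i j : ℕ} (h : k' + i ≤ k) (hj : j ≤ k') (g : HSob k) :
    dH k' j (derivH i h g) = dH k (j + i) g := dH_mkCLM _ hj g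

/-- The inclusion `H^k → H^{k'}`, for `k' ≤ k`. -/
abbrev truncH {k k' : ℕ} (h : k' ≤ k) : HSob k →L[ℝ] HSob k' := derivH 0 h

theorem dH_truncH {k k' j : ℕ} (h : k' ≤ k) (hj : j ≤ k') (g : HSob k) :
    dH k' j (truncH h g) = dH k j g := dH_derivH h hj g

theorem norm_derivH_le {k k' i : ℕ} (h : k' + i ≤ k) (g : HSob k) : ‖derivH i h g‖ ≤ ‖g‖ := by
  refine le_of_sq_le_sq ?_ (norm_nonneg _)
  rw [norm_sq_HSob, norm_sq_HSob, Finset.range_eq_Ico,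
    Finset.sum_congr rfl fun j hj => by rw [dH_derivH h (by rw [Finset.mem_Ico] at hj; omega)],
    Finset.sum_Ico_add' (fun j => ‖dH k j g‖ ^ 2)]
  refine Finset.sum_le_sum_of_subset_of_nonneg (fun j hj => ?_) fun _ _ _ => by positivity
  rw [Finset.mem_Ico] at hj
  rw [Finset.mem_range]
  omega

theorem norm_truncH_le {k k' : ℕ} (h : k' ≤ k) (g : HSob k) : ‖truncH h g‖ ≤ ‖g‖ :=
  norm_derivH_le h g

/-- The extension of a translation invariant operator on `L₂` to `H^k`. -/
def liftH (k : ℕ) (T : L2R →L[ℝ] L2R) (hT : ShiftInvariant T) : HSob k →L[ℝ] HSob k :=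
  HSob.mkCLM k (fun j => T.comp (dH k j)) fun _ hj x => (isWeakDeriv_dH hj x).map hT

theorem dH_liftH {T : L2R →L[ℝ] L2R} (hT : ShiftInvariant T) {j : ℕ} (hj : j ≤ k) (g : HSob k) :
    dH k j (liftH k T hT g) = T (dH k j g) := dH_mkCLM _ hj g

theorem norm_liftH_le {T : L2R →L[ℝ] L2R} (hT : ShiftInvariant T) {c : ℝ} (hc : 0 ≤ c)
    (h : ∀ g, ‖T g‖ ≤ c * ‖g‖) (g : HSob k) : ‖liftH k T hT g‖ ≤ c * ‖g‖ :=
  norm_HSob_le_mul le_rfl hc fun j hj => by rw [dH_liftH hT hj]; exact h _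

/-- `a` and its derivatives up to order `k` are continuous and bounded by `K`. -/
def Coef (k : ℕ) (K : ℝ) (a : ℝ → ℝ) : Prop :=
  ContDiff ℝ k a ∧ ∀ j ≤ k, ∀ x, |iteratedDeriv j a x| ≤ K

theorem Coef.mono {k k' : ℕ} {K : ℝ} {a : ℝ → ℝ} (h : Coef k K a) (hk : k' ≤ k) : Coef k' K a :=
  ⟨h.1.of_le (by exact_mod_cast hk), fun j hj => h.2 j (hj.trans hk)⟩

theorem Coef.contBdd {K : ℝ} {a : ℝ → ℝ} (h : Coef k K a) {j : ℕ} (hj : j ≤ k) :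
    ContBdd K (iteratedDeriv j a) :=
  ⟨h.1.continuous_iteratedDeriv j (by exact_mod_cast hj), h.2 j hj⟩

theorem Coef.contBdd_zero {K : ℝ} {a : ℝ → ℝ} (h : Coef k K a) : ContBdd K a := by
  simpa using h.contBdd (Nat.zero_le k)

theorem Coef.nonneg {K : ℝ} {a : ℝ → ℝ} (h : Coef k K a) : 0 ≤ K :=
  (abs_nonneg _).trans (h.2 0 (Nat.zero_le k) 0)

theorem Coef.isWeakDeriv {K : ℝ} {a : ℝ → ℝ} (h : Coef k K a) {i : ℕ} (hi : i < k) {g g' : L2R}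
    (hg : IsWeakDeriv 1 g g') : IsWeakDeriv 1 (mulL2 volume (iteratedDeriv i a) g)
      (mulL2 volume (iteratedDeriv (i + 1) a) g + mulL2 volume (iteratedDeriv i a) g') := by
  have h0 : ContDiff ℝ ((1 + i : ℕ) : ℕ∞) a := h.1.of_le (by norm_cast; omega)
  have h1 : ContDiff ℝ 1 (iteratedDeriv i a) := by
    rw [iteratedDeriv_eq_iterate]
    exact ContDiff.iterate_deriv' 1 i (by exact_mod_cast h0)
  have h2 := h.contBdd (show i + 1 ≤ k from hi)
  rw [iteratedDeriv_succ] at h2 ⊢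
  exact hg.mulL2 h1 (h.contBdd hi.le) h2

/-- The `j`-th derivative of the product of `a` and an element of `H^k`. -/
def leibnizH (k : ℕ) (a : ℝ → ℝ) (j : ℕ) : HSob k →L[ℝ] L2R :=
  ∑ q ∈ Finset.HasAntidiagonal.antidiagonal j,
    j.choose q.1 • (mulL2 volume (iteratedDeriv q.1 a)).comp (dH k q.2)

theorem leibnizH_apply (a : ℝ → ℝ) (j : ℕ) (g : HSob k) : leibnizH k a j g
    = ∑ q ∈ Finset.HasAntidiagonal.antidiagonal j, j.choose q.1 • mulL2 volume (iteratedDeriv q.1 a) (dH k q.2 g) := by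
  simp only [leibnizH, sum_apply, smul_apply, ContinuousLinearMap.comp_apply]

theorem isWeakDeriv_sum {ι : Type*} (s : Finset ι) {g g' : ι → L2R} {j : ℕ}
    (h : ∀ i ∈ s, IsWeakDeriv j (g i) (g' i)) :
    IsWeakDeriv j (∑ i ∈ s, g i) (∑ i ∈ s, g' i) := by
  classical
  induction s using Finset.induction_on with
  | empty => simpa using IsWeakDeriv.zero j
  | insert i s hi ih =>
    rw [Finset.sum_insert hi, Finset.sum_insert hi]
    exact (h i (Finset.mem_insert_self _ _)).add
      (ih fun i hi => h i (Finset.mem_insert_of_mem hi))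

/-- Differentiating the Leibniz sum of order j gives that of order j + 1 by Pascal's rule for the
binomial coefficients. -/
theorem Coef.isWeakDeriv_leibnizH {K : ℝ} {a : ℝ → ℝ} (h : Coef k K a) {j : ℕ} (hj : j < k)
    (g : HSob k) : IsWeakDeriv 1 (leibnizH k a j g) (leibnizH k a (j + 1) g) := by
  rw [leibnizH_apply, leibnizH_apply, Finset.sum_antidiagonal_choose_succ_nsmul
    (fun i l => mulL2 volume (iteratedDeriv i a) (dH k l g)), ← Finset.sum_add_distrib]
  refine isWeakDeriv_sum _ fun q hq => ?_
  rw [Finset.HasAntidiagonal.mem_antidiagonal] at hq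
  have h1 := h.isWeakDeriv (show q.1 < k by omega) (isWeakDeriv_dH (show q.2 < k by omega) g)
  have h2 := h1.smul (j.choose q.1 : ℝ)
  have hc : j.choose q.2 = j.choose q.1 := Nat.choose_symm_of_eq_add (by omega)
  rw [Nat.cast_smul_eq_nsmul, Nat.cast_smul_eq_nsmul, nsmul_add] at h2
  rw [hc, add_comm (j.choose q.1 • _)]
  exact h2

open Classical in
/-- Multiplication by a bounded function with `k` bounded derivatives, as an operator on `H^k`. -/
def mulH (k : ℕ) (a : ℝ → ℝ) : HSob k →L[ℝ] HSob k :=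
  if h : ∃ K, Coef k K a then
    HSob.mkCLM k (leibnizH k a) fun _ hj x => h.choose_spec.isWeakDeriv_leibnizH hj x
  else 0

theorem dH_mulH {K : ℝ} {a : ℝ → ℝ} (h : Coef k K a) {j : ℕ} (hj : j ≤ k) (g : HSob k) :
    dH k j (mulH k a g) = leibnizH k a j g := by
  rw [mulH, dif_pos ⟨K, h⟩]
  exact dH_mkCLM _ hj g

theorem dH_zero_mulH {K : ℝ} {a : ℝ → ℝ} (h : Coef k K a) (g : HSob k) :
    dH k 0 (mulH k a g) = mulL2 volume a (dH k 0 g) := by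
  rw [dH_mulH h (Nat.zero_le k), leibnizH_apply]
  simp

theorem dH_one_mulH {K : ℝ} {a : ℝ → ℝ} (h : Coef k K a) (hk : 1 ≤ k) (g : HSob k) :
    dH k 1 (mulH k a g)
      = mulL2 volume a (dH k 1 g) + mulL2 volume (deriv a) (dH k 0 g) := by
  rw [dH_mulH h hk, leibnizH_apply, Finset.Nat.antidiagonal_succ]
  simp

theorem norm_mulH_le {K : ℝ} {a : ℝ → ℝ} (h : Coef k K a) (g : HSob k) :
    ‖mulH k a g‖ ≤ (k + 1) * 2 ^ k * K * ‖g‖ := by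
  have hK := h.nonneg
  have : ∀ j ≤ k, ‖dH k j (mulH k a g)‖ ≤ 2 ^ k * K * ‖g‖ := by
    intro j hj
    rw [dH_mulH h hj, leibnizH_apply]
    calc _ ≤ ∑ q ∈ Finset.HasAntidiagonal.antidiagonal j, (j.choose q.1 : ℝ) * (K * ‖g‖) := by
          refine norm_sum_le_of_le _ fun q hq => ?_
          rw [Finset.HasAntidiagonal.mem_antidiagonal] at hq
          rw [← Nat.cast_smul_eq_nsmul ℝ, norm_smul, Real.norm_natCast]
          refine mul_le_mul_of_nonneg_left ?_ (Nat.cast_nonneg _)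
          refine (norm_mulL2_le (h.contBdd (by omega)) _).trans ?_
          exact mul_le_mul_of_nonneg_left (norm_dH_le _ _) hK
      _ = 2 ^ j * (K * ‖g‖) := by
          rw [← Finset.sum_mul, Finset.Nat.sum_antidiagonal_eq_sum_range_succ_mk]
          norm_cast
          rw [Nat.sum_range_choose]
      _ ≤ _ := by
          rw [mul_assoc]
          refine mul_le_mul_of_nonneg_right ?_ (by positivity)
          exact pow_le_pow_right₀ one_le_two hj
  refine (norm_HSob_le this).trans (le_of_eq ?_)
  ring

theorem Coef.sub {K K' : ℝ} {a b : ℝ → ℝ} (ha : Coef k K a) (hb : Coef k K' b) :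
    Coef k (K + K') fun x => a x - b x := by
  refine ⟨ha.1.sub hb.1, fun j hj x => ?_⟩
  have : iteratedDeriv j (fun x => a x - b x) x = iteratedDeriv j a x - iteratedDeriv j b x :=
    iteratedDeriv_fun_sub (ha.1.of_le (by exact_mod_cast hj)).contDiffAt
      (hb.1.of_le (by exact_mod_cast hj)).contDiffAt
  rw [this]
  exact (abs_sub _ _).trans (add_le_add (ha.2 j hj x) (hb.2 j hj x))

theorem mulH_sub {K K' : ℝ} {a b : ℝ → ℝ} (ha : Coef k K a) (hb : Coef k K' b) (g : HSob k) :
    mulH k (fun x => a x - b x) g = mulH k a g - mulH k b g := by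
  refine HSob.ext_toL2 ?_
  rw [map_sub, dH_zero_mulH (ha.sub hb), dH_zero_mulH ha, dH_zero_mulH hb,
    mulL2_sub ha.contBdd_zero hb.contBdd_zero]

/-- Test functions as elements of `H^k`. -/
def testH (k : ℕ) {φ : ℝ → ℝ} (hφ : IsTestFn φ) : HSob k :=
  HSob.mkCLM k (fun j => ContinuousLinearMap.toSpanSingleton ℝ (toL2 (iteratedDeriv j φ)))
    (fun j _ r => by
      have := (hφ.iteratedDeriv j).isWeakDeriv.smul r
      rw [← iteratedDeriv_succ] at this
      exact this) (1 : ℝ)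

theorem dH_testH {j : ℕ} (hj : j ≤ k) {φ : ℝ → ℝ} (hφ : IsTestFn φ) :
    dH k j (testH k hφ) = toL2 (iteratedDeriv j φ) := by
  exact (dH_mkCLM _ hj _).trans (one_smul ℝ _)

/-- Test functions are dense in `H¹`. -/
theorem HSob.dense_induction {P : HSob 1 → Prop} (hP : IsClosed {g | P g})
    (h : ∀ φ (hφ : IsTestFn φ), P (testH 1 hφ)) (g : HSob 1) : P g := by
  let V : Submodule ℝ (HSob 1) :=
    { carrier := {w | ∃ φ, ∃ hφ : IsTestFn φ, testH 1 hφ = w}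
      add_mem' := by
        rintro _ _ ⟨φ, hφ, rfl⟩ ⟨ψ, hψ, rfl⟩
        refine ⟨_, hφ.add hψ, HSob.ext_toL2 ?_⟩
        rw [map_add, dH_testH (by omega), dH_testH (by omega), dH_testH (by omega)]
        simp only [iteratedDeriv_zero]
        exact toL2_add hφ.memLp hψ.memLp
      zero_mem' := by
        refine ⟨_, IsTestFn.zero, HSob.ext_toL2 ?_⟩
        rw [dH_testH (by omega), map_zero]
        have := toL2_smul 0 IsTestFn.zero.memLp
        simpa using this
      smul_mem' := by
        rintro r _ ⟨φ, hφ, rfl⟩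
        refine ⟨_, hφ.const_mul r, HSob.ext_toL2 ?_⟩
        rw [map_smul, dH_testH (by omega), dH_testH (by omega)]
        simp only [iteratedDeriv_zero]
        exact toL2_smul r hφ.memLp }
  have hV : Dense (V : Set (HSob 1)) := by
    rw [Submodule.dense_iff_topologicalClosure_eq_top, Submodule.topologicalClosure_eq_top_iff,
      Submodule.eq_bot_iff]
    intro g hg
    -- Orthogonality of g to all test functions in H¹ says that g'' = g weakly. Integrating by parts
    -- against g itself gives ‖g'‖² = −‖g‖², hence g = 0.
    have h1 : IsWeakDeriv 1 (dH 1 1 g) (dH 1 0 g) := by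
      rw [isWeakDeriv_one_iff]
      intro φ hφ
      have h2 : inner ℝ (testH 1 hφ) g = 0 := hg _ ⟨φ, hφ, rfl⟩
      rw [inner_HSob, Finset.sum_range_succ, Finset.sum_range_one, dH_testH (by omega),
        dH_testH (by omega), iteratedDeriv_zero, iteratedDeriv_one] at h2
      rw [real_inner_comm, real_inner_comm (_root_.toL2 φ)]
      linarith
    have h2 := (isWeakDeriv_dH (Nat.lt_one_iff.2 rfl) g).inner_eq_neg h1
    rw [zero_add, real_inner_self_eq_norm_sq, real_inner_self_eq_norm_sq] at h2
    refine HSob.ext_toL2 ?_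
    rw [map_zero, ← norm_eq_zero]
    nlinarith [sq_nonneg ‖dH 1 0 g‖, sq_nonneg ‖dH 1 1 g‖]
  refine hV.induction (P := P) ?_ hP g
  rintro _ ⟨φ, hφ, rfl⟩
  exact h φ hφ

/-- Weak limits of bounded sequences of `H^k` belong to `H^k`. -/
theorem HSob.exists_of_weak_limit {g : L2R} {G : ℕ → HSob k} {B : ℝ} (hB : ∀ n, ‖G n‖ ≤ B)
    (h : ∀ w, Filter.Tendsto (fun n => inner ℝ (dH k 0 (G n)) w) Filter.atTop
      (nhds (inner ℝ g w))) :
    ∃ F : HSob k, dH k 0 F = g ∧ ‖F‖ ≤ B := by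
  -- Banach–Alaoglu in the dual of H^k. Passing to an ultrafilter replaces the extraction of a
  -- weakly convergent subsequence.
  obtain ⟨U, hU⟩ := Filter.exists_ultrafilter_le (f := (Filter.atTop : Filter ℕ))
  have hK := WeakDual.isCompact_closedBall (𝕜 := ℝ) (E := HSob k) 0 B
  have hm : ∀ n, StrongDual.toWeakDual (InnerProductSpace.toDual ℝ (HSob k) (G n)) ∈
      WeakDual.toStrongDual ⁻¹' Metric.closedBall 0 B := fun n => by
    exact (dist_zero_right (InnerProductSpace.toDual ℝ (HSob k) (G n))).trans_le
      (((InnerProductSpace.toDual ℝ (HSob k)).norm_map (G n)).trans_le (hB n))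
  obtain ⟨x, hx, hlim⟩ := hK.ultrafilter_le_nhds
    (U.map fun n => StrongDual.toWeakDual (InnerProductSpace.toDual ℝ (HSob k) (G n)))
    (by
      rw [Filter.le_principal_iff, Ultrafilter.coe_map]
      exact Filter.mem_map.2 (Filter.univ_mem' hm))
  obtain ⟨F, hF⟩ := (InnerProductSpace.toDual ℝ (HSob k)).surjective (WeakDual.toStrongDual x)
  have hFn : ‖F‖ ≤ B := by
    rw [← (InnerProductSpace.toDual ℝ (HSob k)).norm_map F, hF]
    exact (dist_zero_right (WeakDual.toStrongDual x)).symm.trans_le hx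
  refine ⟨F, ?_, hFn⟩
  refine ext_inner_right ℝ fun w => ?_
  -- Through the adjoint of the embedding into L₂, weak convergence in H^k becomes weak convergence
  -- in L₂, where the limit is already known to be g.
  have h1 : Filter.Tendsto (fun n => inner ℝ (G n) ((dH k 0).adjoint w)) U
      (nhds (inner ℝ F ((dH k 0).adjoint w))) := by
    have := (WeakDual.eval_continuous (𝕜 := ℝ) ((dH k 0).adjoint w)).tendsto x
    have h2 := this.comp (show Filter.Tendsto (fun n => StrongDual.toWeakDual
      (InnerProductSpace.toDual ℝ (HSob k) (G n))) U (nhds x) from hlim)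
    have h3 : x ((dH k 0).adjoint w) = inner ℝ F ((dH k 0).adjoint w) := by
      change WeakDual.toStrongDual x _ = _
      rw [← hF]
      rfl
    rw [h3] at h2
    exact h2
  simp only [ContinuousLinearMap.adjoint_inner_right] at h1
  exact tendsto_nhds_unique h1 ((h w).mono_left hU)

end SobolevSpace

/-! ### Sobolev embedding and summability of point values on a grid. -/

section PointValues

/-- Integrate the derivative of −(x + h − y)φ(y)² over the interval and apply Young's inequality to
the cross term. The interval has length h, so the bounds at different grid points add up over
disjoint intervals. -/
theorem mul_sq_le_integral {φ : ℝ → ℝ} (hφ : IsTestFn φ) {h : ℝ} (hh : 0 < h) (x : ℝ) :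
    h * φ x ^ 2 ≤ ∫ y in Ioc x (x + h), (2 * φ y ^ 2 + h ^ 2 * deriv φ y ^ 2) := by
  have hd : ∀ x, HasDerivAt φ (deriv φ x) x := fun x =>
    (hφ.1.differentiable (by norm_num) x).hasDerivAt
  have hc := hφ.1.continuous
  have hc' := hφ.deriv.1.continuous
  have h1 : ∫ y in x..(x + h), (φ y ^ 2 - (x + h - y) * (2 * φ y * deriv φ y)) = h * φ x ^ 2 := by
    have := intervalIntegral.integral_eq_sub_of_hasDerivAt (a := x) (b := x + h)
      (f := fun y => -((x + h - y) * φ y ^ 2))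
      (f' := fun y => φ y ^ 2 - (x + h - y) * (2 * φ y * deriv φ y)) (fun y _ => by
        have := (((hasDerivAt_id y).const_sub (x + h)).mul ((hd y).pow 2)).neg
        refine this.congr_deriv ?_
        simp
        ring) ((by fun_prop : Continuous _).intervalIntegrable _ _)
    rw [this]
    ring
  rw [← intervalIntegral.integral_of_le (by linarith), ← h1]
  refine intervalIntegral.integral_mono_on (by linarith)
    ((by fun_prop : Continuous _).intervalIntegrable _ _)
    ((by fun_prop : Continuous _).intervalIntegrable _ _) fun y hy => ?_
  have h2 : 0 ≤ x + h - y := by linarith [hy.2]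
  have h3 : x + h - y ≤ h := by linarith [hy.1]
  have h4 : (x + h - y) ^ 2 ≤ h ^ 2 := pow_le_pow_left₀ h2 h3 2
  nlinarith [sq_nonneg (φ y + (x + h - y) * deriv φ y),
    mul_le_mul_of_nonneg_right h4 (sq_nonneg (deriv φ y))]

theorem integral_test_le {φ : ℝ → ℝ} (hφ : IsTestFn φ) {h : ℝ} (hh : 0 < h) (h1 : h ≤ 1) :
    Integrable (fun y => 2 * φ y ^ 2 + h ^ 2 * deriv φ y ^ 2) ∧
      ∫ y, (2 * φ y ^ 2 + h ^ 2 * deriv φ y ^ 2) ≤ 2 * ‖testH 1 hφ‖ ^ 2 := by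
  have i1 := hφ.memLp.integrable_sq
  have i2 := hφ.deriv.memLp.integrable_sq
  refine ⟨(i1.const_mul 2).add (i2.const_mul (h ^ 2)), ?_⟩
  have e : ∀ {ψ : ℝ → ℝ}, IsTestFn ψ → ∫ y, ψ y ^ 2 = ‖toL2 ψ‖ ^ 2 := by
    intro ψ hψ
    rw [← real_inner_self_eq_norm_sq, inner_toL2 hψ.memLp]
    refine integral_congr_ae ?_
    filter_upwards [toL2_ae hψ.memLp] with x hx
    rw [hx, sq]
  rw [integral_add (i1.const_mul 2) (i2.const_mul (h ^ 2)), integral_const_mul,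
    integral_const_mul, e hφ, e hφ.deriv, norm_sq_HSob, Finset.sum_range_succ,
    Finset.sum_range_one, dH_testH (by omega), dH_testH (by omega), iteratedDeriv_zero,
    iteratedDeriv_one]
  have : h ^ 2 ≤ 1 := pow_le_one₀ hh.le h1
  nlinarith [sq_nonneg ‖toL2 (deriv φ)‖]

theorem sq_test_le {φ : ℝ → ℝ} (hφ : IsTestFn φ) (x : ℝ) : φ x ^ 2 ≤ 2 * ‖testH 1 hφ‖ ^ 2 := by
  have h1 := mul_sq_le_integral hφ one_pos x
  have h2 := integral_test_le hφ one_pos le_rfl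
  rw [one_mul] at h1
  refine h1.trans (le_trans (setIntegral_le_integral h2.1 ?_) h2.2)
  exact Filter.Eventually.of_forall fun y => by positivity

theorem sum_sq_test_le {φ : ℝ → ℝ} (hφ : IsTestFn φ) {h : ℝ} (hh : 0 < h) (h1 : h ≤ 1)
    (s : Finset ℤ) : ∑ k ∈ s, h * φ (k * h) ^ 2 ≤ 2 * ‖testH 1 hφ‖ ^ 2 := by
  have h2 := integral_test_le hφ hh h1
  have hdisj : (s : Set ℤ).Pairwise
      (Function.onFun Disjoint fun k : ℤ => Ioc (k * h) (k * h + h)) := by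
    have e : (fun k : ℤ => Ioc (k * h) (k * h + h)) = fun k : ℤ => Ioc (k • h) ((k + 1) • h) := by
      funext k
      simp [add_mul]
    rw [e]
    exact (pairwise_disjoint_Ioc_zsmul h).set_pairwise _
  refine (Finset.sum_le_sum fun (k : ℤ) _ => mul_sq_le_integral hφ hh ((k : ℝ) * h)).trans ?_
  rw [← integral_biUnion_finset s (fun _ _ => measurableSet_Ioc) hdisj
    fun _ _ => h2.1.integrableOn]
  refine le_trans (setIntegral_le_integral h2.1 ?_) h2.2
  exact Filter.Eventually.of_forall fun y => by positivity

theorem testH_sub {φ ψ : ℝ → ℝ} (hφ : IsTestFn φ) (hψ : IsTestFn ψ) :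
    ∃ h : IsTestFn (fun x => φ x - ψ x), testH 1 h = testH 1 hφ - testH 1 hψ := by
  have h0 := hψ.const_mul (-1)
  have h1 := hφ.add h0
  have e : (fun x => φ x + -1 * ψ x) = fun x => φ x - ψ x := by funext x; ring
  have h2 : IsTestFn (fun x => φ x - ψ x) := e ▸ h1
  refine ⟨h2, HSob.ext_toL2 ?_⟩
  rw [map_sub, dH_testH (by omega), dH_testH (by omega), dH_testH (by omega)]
  simp only [iteratedDeriv_zero]
  rw [← e, toL2_add hφ.memLp h0.memLp, toL2_smul _ hψ.memLp]
  module

/-- Test functions converging to g in H¹ are Cauchy in the supremum norm. Their uniform limit agrees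
almost everywhere with g, along a subsequence of the L₂ limit, and both bounds survive pointwise
limits. The constant 2 does not depend on h. -/
theorem HSob.exists_continuous (g : HSob 1) : ∃ w : ℝ → ℝ, Continuous w ∧ g.toL2 =ᵐ[volume] w ∧
    (∀ x, w x ^ 2 ≤ 2 * ‖g‖ ^ 2) ∧
    ∀ h : ℝ, 0 < h → h ≤ 1 → ∀ s : Finset ℤ, ∑ k ∈ s, h * w (k * h) ^ 2 ≤ 2 * ‖g‖ ^ 2 := by
  have hcl : g ∈ closure {w | ∃ φ, ∃ hφ : IsTestFn φ, testH 1 hφ = w} :=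
    HSob.dense_induction (P := fun g => g ∈ closure {w | ∃ φ, ∃ hφ : IsTestFn φ, testH 1 hφ = w})
      isClosed_closure (fun φ hφ => subset_closure ⟨φ, hφ, rfl⟩) g
  obtain ⟨G, hG, hlim⟩ := mem_closure_iff_seq_limit.1 hcl
  choose φ hφ hφG using hG
  have hsub : ∀ n m x, |φ n x - φ m x| ≤ √2 * ‖G n - G m‖ := by
    intro n m x
    obtain ⟨h1, h2⟩ := testH_sub (hφ n) (hφ m)
    have h3 := sq_test_le h1 x
    rw [h2, hφG, hφG] at h3
    refine (Real.abs_le_sqrt h3).trans (le_of_eq ?_)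
    rw [Real.sqrt_mul (by norm_num), Real.sqrt_sq (norm_nonneg _)]
  let F : ℕ → BoundedContinuousFunction ℝ ℝ := fun n =>
    BoundedContinuousFunction.ofNormedAddCommGroup (φ n) (hφ n).1.continuous
      (√(2 * ‖G n‖ ^ 2)) fun x => by
        rw [Real.norm_eq_abs, ← hφG n]
        exact Real.abs_le_sqrt (sq_test_le (hφ n) x)
  have hF : CauchySeq F := by
    rw [Metric.cauchySeq_iff']
    intro ε hε
    obtain ⟨N, hN⟩ := Metric.cauchySeq_iff'.1 hlim.cauchySeq (ε / 2) (by positivity)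
    refine ⟨N, fun n hn => ?_⟩
    have h1 := hN n hn
    rw [dist_eq_norm] at h1
    refine lt_of_le_of_lt ((BoundedContinuousFunction.dist_le (by positivity)).2
      fun x => hsub n N x) ?_
    have : √2 ≤ 2 := by rw [Real.sqrt_le_left (by norm_num)]; norm_num
    nlinarith [norm_nonneg (G n - G N)]
  obtain ⟨w, hw⟩ := cauchySeq_tendsto_of_complete hF
  have hpt : ∀ x, Filter.Tendsto (fun n => φ n x) Filter.atTop (nhds (w x)) := fun x =>
    ((BoundedContinuousFunction.tendsto_iff_tendstoUniformly.1 hw).tendsto_at x)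
  have hn : Filter.Tendsto (fun n => 2 * ‖G n‖ ^ 2) Filter.atTop (nhds (2 * ‖g‖ ^ 2)) :=
    (hlim.norm.pow 2).const_mul 2
  refine ⟨w, w.continuous, ?_, fun x => ?_, fun h hh h1 s => ?_⟩
  · have h1 : Filter.Tendsto (fun n => _root_.toL2 (φ n)) Filter.atTop (nhds g.toL2) := by
      have := ((dH 1 0).continuous.tendsto g).comp hlim
      rw [dH_zero] at this
      refine this.congr fun n => ?_
      rw [Function.comp_apply, ← hφG n, dH_testH (by omega), iteratedDeriv_zero]
    have h2 := tendstoInMeasure_of_tendsto_Lp h1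
    obtain ⟨ns, hns, h3⟩ := h2.exists_seq_tendsto_ae
    have h4 : ∀ᵐ x, ∀ n, _root_.toL2 (φ n) x = φ n x := ae_all_iff.2 fun n => toL2_ae (hφ n).memLp
    filter_upwards [h3, h4] with x h5 h6
    simp only [h6] at h5
    exact tendsto_nhds_unique h5 ((hpt x).comp hns.tendsto_atTop)
  · refine le_of_tendsto_of_tendsto' ((hpt x).pow 2) hn fun n => ?_
    rw [← hφG n]
    exact sq_test_le (hφ n) x
  · refine le_of_tendsto_of_tendsto' (tendsto_finsetSum s fun k _ =>
      ((hpt (k * h)).pow 2).const_mul h) hn fun n => ?_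
    rw [← hφG n]
    exact sum_sq_test_le (hφ n) hh h1 s

/-- Two continuous functions equal almost everywhere are equal, so the choice in `contRep` is
immaterial. -/
theorem contRep_eq {g : L2R} {w : ℝ → ℝ} (hw : Continuous w) (h : g =ᵐ[volume] w) :
    contRep g = w := by
  have h0 : ∃ w : ℝ → ℝ, Continuous w ∧ g =ᵐ[volume] w := ⟨w, hw, h⟩
  rw [contRep, dif_pos h0]
  exact (Continuous.ae_eq_iff_eq volume h0.choose_spec.1 hw).1 (h0.choose_spec.2.symm.trans h)

theorem HSob.continuous_val (g : HSob 1) : Continuous g.val ∧ g.toL2 =ᵐ[volume] g.val := by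
  obtain ⟨w, h1, h2, -⟩ := g.exists_continuous
  have e : g.val = w := by
    funext x
    exact congrFun (contRep_eq h1 h2) x
  rw [e]
  exact ⟨h1, h2⟩

theorem HSob.val_eq {k : ℕ} {g : HSob k} {w : ℝ → ℝ} (hw : Continuous w)
    (h : g.toL2 =ᵐ[volume] w) (x : ℝ) : g.val x = w x :=
  congrFun (contRep_eq hw h) x

theorem HSob.sq_val_le (g : HSob 1) (x : ℝ) : g.val x ^ 2 ≤ 2 * ‖g‖ ^ 2 := by
  obtain ⟨w, h1, h2, h3, -⟩ := g.exists_continuous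
  rw [HSob.val_eq h1 h2]
  exact h3 x

theorem HSob.sum_sq_val_le (g : HSob 1) {h : ℝ} (hh : 0 < h) (h1 : h ≤ 1) (s : Finset ℤ) :
    ∑ k ∈ s, h * g.val (k * h) ^ 2 ≤ 2 * ‖g‖ ^ 2 := by
  obtain ⟨w, h2, h3, -, h4⟩ := g.exists_continuous
  simp only [HSob.val_eq h2 h3]
  exact h4 h hh h1 s

/-- The value at a point, as a functional on `H¹`. -/
def evH (x : ℝ) : HSob 1 →L[ℝ] ℝ :=
  LinearMap.mkContinuous
    { toFun := fun g => g.val x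
      map_add' := fun g w => by
        refine HSob.val_eq (g.continuous_val.1.add w.continuous_val.1) ?_ x
        rw [← dH_zero, map_add]
        filter_upwards [Lp.coeFn_add (dH 1 0 g) (dH 1 0 w), g.continuous_val.2,
          w.continuous_val.2] with x h1 h2 h3
        rw [h1, Pi.add_apply, dH_zero, dH_zero, h2, h3]
        rfl
      map_smul' := fun r g => by
        refine HSob.val_eq (g.continuous_val.1.const_smul r) ?_ x
        rw [← dH_zero, map_smul]
        filter_upwards [Lp.coeFn_smul r (dH 1 0 g), g.continuous_val.2] with x h1 h2
        rw [h1, Pi.smul_apply, dH_zero, h2]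
        rfl }
    (√2) fun g => by
      refine (Real.abs_le_sqrt (g.sq_val_le x)).trans (le_of_eq ?_)
      rw [Real.sqrt_mul (by norm_num), Real.sqrt_sq (norm_nonneg _)]

theorem evH_apply (x : ℝ) (g : HSob 1) : evH x g = g.val x := rfl

theorem evH_truncH {k : ℕ} (hk : 1 ≤ k) (x : ℝ) (g : HSob k) : evH x (truncH hk g) = g.val x := by
  have : (truncH hk g).toL2 = g.toL2 := by
    rw [← dH_zero, ← dH_zero, dH_truncH hk (by omega)]
  rw [evH_apply, HSob.val, this, HSob.val]

/-- Translation on `H^k`. -/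
abbrev shiftH (k : ℕ) (y : ℝ) : HSob k →L[ℝ] HSob k := liftH k (shiftR y) (shiftInvariant_shiftR y)

theorem evH_shiftH (x y : ℝ) (g : HSob 1) : evH x (shiftH 1 y g) = evH (x + y) g := by
  rw [evH_apply, evH_apply]
  refine HSob.val_eq (w := fun x => g.val (x + y))
    (g.continuous_val.1.comp (continuous_id.add continuous_const)) ?_ x
  rw [← dH_zero, dH_liftH _ (by omega)]
  filter_upwards [shiftL2_ae y (dH 1 0 g), ae_comp_add g.continuous_val.2 y] with x h1 h2
  rw [h1, dH_zero, h2]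

theorem evH_mulH {K : ℝ} {a : ℝ → ℝ} (ha : Coef 1 K a) (x : ℝ) (g : HSob 1) :
    evH x (mulH 1 a g) = a x * evH x g := by
  rw [evH_apply, evH_apply]
  refine HSob.val_eq (w := fun x => a x * g.val x) (ha.1.continuous.mul g.continuous_val.1) ?_ x
  rw [← dH_zero, dH_zero_mulH ha]
  filter_upwards [mulL2_ae ha.contBdd_zero (dH 1 0 g), g.continuous_val.2] with x h1 h2
  rw [h1, dH_zero, h2]

end PointValues

/-! ### Solvability and stability of implicit schemes for dissipative operators. -/

section ImplicitScheme

variable {H : Type*} [NormedAddCommGroup H] [InnerProductSpace ℝ H]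

theorem norm_sub_smul_ge {A : H →L[ℝ] H} {N τ : ℝ} (hA : ∀ v, inner ℝ (A v) v ≤ N * ‖v‖ ^ 2)
    (hτ : 0 ≤ τ) (v : H) : (1 - τ * N) * ‖v‖ ≤ ‖v - τ • A v‖ := by
  rcases (norm_nonneg v).eq_or_lt with h0 | h0
  · rw [← h0, mul_zero]
    exact norm_nonneg _
  · have h1 := real_inner_le_norm (v - τ • A v) v
    rw [inner_sub_left, real_inner_smul_left, real_inner_self_eq_norm_sq] at h1
    have h2 := mul_le_mul_of_nonneg_left (hA v) hτ
    refine le_of_mul_le_mul_right ?_ h0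
    nlinarith

/-- Lax–Milgram: for τN < 1 the one-sided bound makes the form of 1 − τA coercive. For a fixed mesh
A is bounded, and its norm, which blows up as h tends to 0, does not enter the condition. -/
theorem exists_sub_smul_eq [CompleteSpace H] {A : H →L[ℝ] H} {N τ : ℝ}
    (hA : ∀ v, inner ℝ (A v) v ≤ N * ‖v‖ ^ 2) (hτ : 0 ≤ τ) (hN : τ * N < 1) (g : H) :
    ∃ v, v - τ • A v = g := by
  let T : H →L[ℝ] H := ContinuousLinearMap.id ℝ H - τ • A
  let B : H →L[ℝ] H →L[ℝ] ℝ := (innerSL ℝ).comp T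
  have hB : IsCoercive B := by
    refine ⟨1 - τ * N, by linarith, fun v => ?_⟩
    have h2 := mul_le_mul_of_nonneg_left (hA v) hτ
    change _ ≤ inner ℝ (v - τ • A v) v
    rw [inner_sub_left, real_inner_smul_left, real_inner_self_eq_norm_sq]
    nlinarith
  obtain ⟨v, hv⟩ := hB.continuousLinearEquivOfBilin.surjective g
  refine ⟨v, ?_⟩
  rw [← hv]
  refine ext_inner_right ℝ fun w => ?_
  rw [hB.continuousLinearEquivOfBilin_apply]
  rfl

theorem implicit_gronwall {q : ℝ} (hq0 : 0 ≤ q) (hq : q ≤ 1 / 2) {y r : ℕ → ℝ} {n : ℕ}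
    (hy : 0 ≤ y 0) (hr : ∀ i < n, 0 ≤ r i) (h : ∀ i < n, (1 - q) * y (i + 1) ≤ y i + r i) :
    ∀ i ≤ n, y i ≤ Real.exp (2 * q * i) * (y 0 + ∑ l ∈ Finset.range i, r l) := by
  -- For 0 ≤ q ≤ 1/2 one has (1 + 2q)(1 − q) ≥ 1; this is where 1/2 comes from.
  have he : 1 ≤ Real.exp (2 * q) * (1 - q) := by
    have := Real.add_one_le_exp (2 * q)
    nlinarith
  intro i
  induction i with
  | zero => simp
  | succ i ih =>
    intro hi
    have h1 := ih (by omega)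
    have h2 := h i (by omega)
    have h3 := hr i (by omega)
    have h4 : 0 ≤ ∑ l ∈ Finset.range i, r l := Finset.sum_nonneg fun l hl => hr l (by
      rw [Finset.mem_range] at hl
      omega)
    rw [Finset.sum_range_succ]
    have e : Real.exp (2 * q * ((i + 1 : ℕ) : ℝ)) = Real.exp (2 * q) * Real.exp (2 * q * i) := by
      rw [← Real.exp_add]
      congr 1
      push_cast
      ring
    have e1 : 1 ≤ Real.exp (2 * q * i) := Real.one_le_exp (by positivity)
    have h5 : y i + r i ≤ Real.exp (2 * q * i) * (y 0 + (∑ l ∈ Finset.range i, r l + r i)) := by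
      nlinarith
    have h6 : 0 ≤ Real.exp (2 * q * i) * (y 0 + (∑ l ∈ Finset.range i, r l + r i)) := by
      positivity
    rw [e]
    have h7 : (1 - q) * y (i + 1) ≤ (1 - q) * (Real.exp (2 * q) * Real.exp (2 * q * i) *
        (y 0 + (∑ l ∈ Finset.range i, r l + r i))) := by
      calc _ ≤ 1 * (Real.exp (2 * q * i) * (y 0 + (∑ l ∈ Finset.range i, r l + r i))) := by
            rw [one_mul]; exact h2.trans h5
        _ ≤ (Real.exp (2 * q) * (1 - q)) *
            (Real.exp (2 * q * i) * (y 0 + (∑ l ∈ Finset.range i, r l + r i))) :=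
            mul_le_mul_of_nonneg_right he h6
        _ = _ := by ring
    exact le_of_mul_le_mul_left h7 (by linarith)

theorem exists_implicit_scheme [CompleteSpace H] {A : ℕ → H →L[ℝ] H} {N τ : ℝ} {n : ℕ}
    (hA : ∀ i < n, ∀ v, inner ℝ (A (i + 1) v) v ≤ N * ‖v‖ ^ 2) (hτ : 0 ≤ τ) (hN : τ * N < 1)
    (f : ℕ → H) (ψ : H) :
    ∃ V : ℕ → H, V 0 = ψ ∧ ∀ i < n, V (i + 1) = V i + τ • (A (i + 1) (V (i + 1)) + f (i + 1)) := by
  -- Nothing is known about A beyond step n, so the step map is made total by a vacuous claim there,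
  -- and the recursion runs over all of ℕ.
  have h1 : ∀ (i : ℕ) (g : H), ∃ v, i < n → v = g + τ • (A (i + 1) v + f (i + 1)) := by
    intro i g
    by_cases hi : i < n
    · obtain ⟨v, hv⟩ := exists_sub_smul_eq (hA i hi) hτ hN (g + τ • f (i + 1))
      refine ⟨v, fun _ => ?_⟩
      rw [sub_eq_iff_eq_add] at hv
      conv_lhs => rw [hv]
      rw [smul_add]
      abel
    · exact ⟨0, fun h => absurd h hi⟩
  choose S hS using h1
  exact ⟨fun i => Nat.rec ψ S i, rfl, fun i hi => hS i _ hi⟩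

/-- The estimate is for norms rather than their squares, so the free term enters through its time
sum, without a square. -/
theorem norm_implicit_scheme_le {A : ℕ → H →L[ℝ] H} {N τ : ℝ} {n : ℕ}
    (hA : ∀ i < n, ∀ v, inner ℝ (A (i + 1) v) v ≤ N * ‖v‖ ^ 2) (hτ : 0 ≤ τ) (hN0 : 0 ≤ N)
    (hN : τ * N ≤ 1 / 2) {f V : ℕ → H}
    (hV : ∀ i < n, V (i + 1) = V i + τ • (A (i + 1) (V (i + 1)) + f (i + 1))) :
    ∀ i ≤ n, ‖V i‖ ≤ Real.exp (2 * (τ * N) * i) *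
      (‖V 0‖ + ∑ l ∈ Finset.range i, τ * ‖f (l + 1)‖) := by
  refine implicit_gronwall (by positivity) hN (norm_nonneg _) (fun i _ => by positivity)
    fun i hi => ?_
  refine (norm_sub_smul_ge (hA i hi) hτ (V (i + 1))).trans ?_
  have : V (i + 1) - τ • A (i + 1) (V (i + 1)) = V i + τ • f (i + 1) := by
    conv_lhs => enter [1]; rw [hV i hi]
    rw [smul_add]
    abel
  rw [this]
  refine (norm_add_le _ _).trans ?_
  rw [norm_smul, Real.norm_of_nonneg hτ]

end ImplicitScheme

/-! ### Dissipativity of L^h + J^h in H^k, uniformly in h. -/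

section SchemeOperator

variable {k : ℕ}

/-- The symmetric difference `δ^h` on `H^k`. -/
abbrev symDiffH (k : ℕ) (h : ℝ) : HSob k →L[ℝ] HSob k :=
  liftH k (symDiffR h) (shiftInvariant_symDiffR h)

/-- The operator `L^h + J^h` on `H^k`, with `h = 1/p`. -/
def schemeOp (k : ℕ) (ν : Measure ℝ) (p : ℕ) (a b c : ℝ → ℝ) : HSob k →L[ℝ] HSob k :=
  (mulH k a).comp ((symDiffH k (1 / p)).comp (symDiffH k (1 / p)))
    + (mulH k b).comp (symDiffH k (1 / p)) + mulH k c
    + gridJump ν p fun i => shiftH k (i * (1 / p))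

theorem Coef.abs_sub_le {K : ℝ} {b : ℝ → ℝ} (hb : Coef 1 K b) (x y : ℝ) :
    |b x - b y| ≤ K * |x - y| := by
  have := Convex.norm_image_sub_le_of_norm_deriv_le (f := b) (s := univ) (C := K)
    (fun x _ => hb.1.differentiable (by norm_num) x)
    (fun x _ => by
      have := hb.2 1 le_rfl x
      rwa [iteratedDeriv_one] at this) convex_univ (mem_univ y) (mem_univ x)
  exact this

theorem norm_shiftH (y : ℝ) (g : HSob k) : ‖shiftH k y g‖ ≤ ‖g‖ := by
  have := norm_liftH_le (k := k) (shiftInvariant_shiftR y) zero_le_one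
    (fun g => by rw [one_mul, norm_shiftL2]) g
  rwa [one_mul] at this

theorem shiftH_zero (g : HSob k) : shiftH k 0 g = g := by
  refine HSob.ext_toL2 ?_
  rw [dH_liftH _ (by omega), shiftL2_zero]

theorem inner_gridJumpH_nonpos {ν : Measure ℝ} (hν : IsLevyMeasure ν) {p : ℕ} (hp : 0 < p)
    (g : HSob k) : inner ℝ (gridJump ν p (fun i => shiftH k (i * (1 / p))) g) g ≤ 0 :=
  inner_gridJump_nonpos hν hp (fun _ _ => norm_shiftH _ _)
    (fun g => by rw [Int.cast_zero, zero_mul, shiftH_zero]) g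

/-- The properties of a nonnegative second order coefficient that give dissipativity. -/
theorem Coef.sqrt_facts {K : ℝ} {a : ℝ → ℝ} (ha : Coef 2 K a) (h0 : ∀ x, 0 ≤ a x) :
    ContBdd (√K) (fun x => √(a x)) ∧ (∀ x y, |√(a x) - √(a y)| ≤ √(2 * K) * |x - y|) ∧
      (fun x => √(a x) * √(a x)) = a ∧ ∀ x, |deriv a x| ≤ √(2 * K) * |√(a x)| := by
  have hc : ContDiff ℝ 2 a := ha.1
  refine ⟨⟨hc.continuous.sqrt, fun x => ?_⟩, abs_sqrt_sub_sqrt_le hc h0 (ha.2 2 le_rfl), ?_,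
    fun x => ?_⟩
  · rw [abs_of_nonneg (Real.sqrt_nonneg _)]
    refine Real.sqrt_le_sqrt ?_
    have := ha.2 0 (by norm_num) x
    rw [iteratedDeriv_zero] at this
    exact (le_abs_self _).trans this
  · funext x
    exact Real.mul_self_sqrt (h0 x)
  · rw [abs_of_nonneg (Real.sqrt_nonneg _)]
    exact abs_deriv_le_sqrt hc h0 (ha.2 2 le_rfl) x

theorem inner_sum_range_le {f : ℕ → L2R} {g : L2R} {n : ℕ} {B : ℕ → ℝ}
    (h : ∀ i < n, ‖f i‖ ≤ B i) : inner ℝ (∑ i ∈ Finset.range n, f i) g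
      ≤ (∑ i ∈ Finset.range n, B i) * ‖g‖ := by
  rw [sum_inner, Finset.sum_mul]
  refine Finset.sum_le_sum fun i hi => (real_inner_le_norm _ _).trans ?_
  exact mul_le_mul_of_nonneg_right (h i (Finset.mem_range.1 hi)) (norm_nonneg _)

theorem sum_choose_le {i₀ j n : ℕ} (h : n + i₀ ≤ j + 1) :
    ∑ i ∈ Finset.range n, (j.choose (i + i₀) : ℝ) ≤ 2 ^ j := by
  have h1 : ∑ i ∈ Finset.range (j + 1), (j.choose i : ℝ) = 2 ^ j := by
    exact_mod_cast Nat.sum_range_choose j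
  rw [← h1, Finset.range_eq_Ico, Finset.sum_Ico_add' (fun i => (j.choose i : ℝ)) 0 n i₀]
  refine Finset.sum_le_sum_of_subset_of_nonneg (fun i hi => ?_) fun _ _ _ => Nat.cast_nonneg _
  rw [Finset.mem_Ico] at hi
  rw [Finset.mem_range]
  omega

theorem leibnizH_eq_sum_range (a : ℝ → ℝ) (j : ℕ) (g : HSob k) : leibnizH k a j g
    = ∑ i ∈ Finset.range (j + 1),
      (j.choose i : ℝ) • mulL2 volume (iteratedDeriv i a) (dH k (j - i) g) := by
  rw [leibnizH_apply, Finset.Nat.sum_antidiagonal_eq_sum_range_succ_mk]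
  simp only [Nat.cast_smul_eq_nsmul]

theorem norm_choose_smul_le {K R : ℝ} {a : ℝ → ℝ} {i j : ℕ} (ha : ContBdd K a)
    {g : L2R} (hg : ‖g‖ ≤ R) :
    ‖(j.choose i : ℝ) • mulL2 volume a g‖ ≤ j.choose i * (K * R) := by
  have hK : 0 ≤ K := (abs_nonneg _).trans (ha.2 0)
  rw [norm_smul, Real.norm_natCast]
  exact mul_le_mul_of_nonneg_left
    ((norm_mulL2_le ha g).trans (mul_le_mul_of_nonneg_left hg hK)) (Nat.cast_nonneg _)

/-- The Leibniz terms are of three kinds, according to how many derivatives fall on a. With none,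
dissipativity gives −½X², where X = ‖σ δ ∂^j v‖. With one, a direct bound would need j + 1
derivatives of v, but |a'| ≤ √(2K) σ brings back X. With two or more, δδ acts on at most j − 2
derivatives of v. -/
theorem inner_leibnizH_second_le {K h : ℝ} (hh : 0 < h) {a : ℝ → ℝ} (ha : Coef (max k 2) K a)
    (h0 : ∀ x, 0 ≤ a x) {j : ℕ} (hj : j ≤ k) (v : HSob k) :
    inner ℝ (leibnizH k a j (symDiffH k h (symDiffH k h v))) (dH k j v)
      ≤ K * (6 + j ^ 2 + 2 * j + 2 ^ j) * ‖v‖ ^ 2 := by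
  obtain ⟨s1, s2, s3, s4⟩ := (ha.mono (le_max_right k 2)).sqrt_facts h0
  have hK := ha.nonneg
  set L := √(2 * K) with hL
  have hL0 : 0 ≤ L := Real.sqrt_nonneg _
  have hL2 : L ^ 2 = 2 * K := Real.sq_sqrt (by positivity)
  have hcB : ∀ i ≤ k, ContBdd K (iteratedDeriv i a) := fun i hi =>
    ha.contBdd (hi.trans (le_max_left k 2))
  set X := ‖mulL2 volume (fun x => √(a x)) (symDiffR h (dH k j v))‖ with hX
  have hdv := norm_dH_le j v
  have hn0 := norm_nonneg (dH k j v)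
  have hs2 : ∀ x, |√(a (x + h)) - √(a x)| ≤ L * h := fun x => by
    have := s2 (x + h) x
    rwa [add_sub_cancel_left, abs_of_pos hh] at this
  have hd : ∀ l ≤ k, dH k l (symDiffH k h (symDiffH k h v))
      = symDiffR h (symDiffR h (dH k l v)) := fun l hl => by
    rw [dH_liftH _ hl, dH_liftH _ hl]
  have t0 : inner ℝ ((j.choose 0 : ℝ) • mulL2 volume (iteratedDeriv 0 a)
      (dH k (j - 0) (symDiffH k h (symDiffH k h v)))) (dH k j v)
      ≤ -(1 / 2) * X ^ 2 + 3 * L ^ 2 * ‖v‖ ^ 2 := by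
    have := inner_sq_symDiff_symDiff_le s1 hh hs2 (dH k j v)
    rw [s3] at this
    rw [Nat.choose_zero_right, Nat.cast_one, one_smul, Nat.sub_zero, hd j hj, iteratedDeriv_zero]
    refine this.trans (add_le_add_right ?_ _)
    exact mul_le_mul_of_nonneg_left (pow_le_pow_left₀ hn0 hdv 2) (by positivity)
  rw [leibnizH_eq_sum_range, Finset.sum_range_succ', inner_add_left]
  rcases j with _ | j
  · simp only [Finset.range_zero, Finset.sum_empty, inner_zero_left, zero_add]
    refine t0.trans ?_
    rw [hL2]
    have := mul_nonneg hK (sq_nonneg ‖v‖)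
    push_cast
    nlinarith [sq_nonneg X]
  · rw [Finset.sum_range_succ', inner_add_left]
    -- The critical term: the weight σ replaces a', and one difference is exchanged for a derivative
    -- under that weight.
    have t1 : inner ℝ (((j + 1).choose (0 + 1) : ℝ) • mulL2 volume (iteratedDeriv (0 + 1) a)
        (dH k (j + 1 - (0 + 1)) (symDiffH k h (symDiffH k h v)))) (dH k (j + 1) v)
        ≤ ((j + 1 : ℕ) : ℝ) * (L * (X + L * ‖v‖) * ‖v‖) := by
      rw [zero_add, Nat.choose_one_right, iteratedDeriv_one, Nat.add_sub_cancel, hd j (by omega),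
        real_inner_smul_left]
      refine mul_le_mul_of_nonneg_left ?_ (Nat.cast_nonneg _)
      refine (real_inner_le_norm _ _).trans ?_
      refine mul_le_mul ?_ hdv (norm_nonneg _) (by positivity)
      have h1 := hcB 1 (by omega)
      rw [iteratedDeriv_one] at h1
      refine (norm_mulL2_le_norm_mulL2 h1 s1 s4 _).trans (mul_le_mul_of_nonneg_left ?_ hL0)
      refine ((isWeakDeriv_dH (show j < k by omega) v).norm_mulL2_symDiffR_symDiffR_le hh s1 hL0
        s2).trans (add_le_add_right ?_ _)
      exact mul_le_mul_of_nonneg_left hdv hL0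
    have t2 : inner ℝ (∑ i ∈ Finset.range j, ((j + 1).choose (i + 1 + 1) : ℝ) •
        mulL2 volume (iteratedDeriv (i + 1 + 1) a)
        (dH k (j + 1 - (i + 1 + 1)) (symDiffH k h (symDiffH k h v)))) (dH k (j + 1) v)
        ≤ 2 ^ (j + 1) * (K * ‖v‖) * ‖v‖ := by
      refine (inner_sum_range_le (B := fun i => ((j + 1).choose (i + 2) : ℝ) * (K * ‖v‖))
        fun i hi => ?_).trans ?_
      · refine norm_choose_smul_le (hcB _ (by omega)) ?_
        have e1 := isWeakDeriv_dH (show j + 1 - (i + 1 + 1) < k by omega) v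
        have e2 := isWeakDeriv_dH (show j + 1 - (i + 1 + 1) + 1 < k by omega) v
        rw [hd _ (by omega)]
        refine ((e1.map (shiftInvariant_symDiffR h)).norm_symDiffR_le hh).trans ?_
        exact (e2.norm_symDiffR_le hh).trans (norm_dH_le _ _)
      · rw [← Finset.sum_mul]
        exact mul_le_mul (mul_le_mul_of_nonneg_right (sum_choose_le (by omega)) (by positivity))
          hdv hn0 (by positivity)
    refine (add_le_add (add_le_add t2 t1) t0).trans ?_
    set J : ℝ := ((j + 1 : ℕ) : ℝ)
    have hJ : 0 ≤ J := Nat.cast_nonneg _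
    -- Young's inequality spends exactly the available ½X². With L² = 2K the remainder is K(J² +
    -- 2J)‖v‖², the middle part of the constant; 6K comes from the term without derivatives on a.
    have e : J * (L * (X + L * ‖v‖) * ‖v‖) ≤ 1 / 2 * X ^ 2 + (1 / 2 * J ^ 2 + J) * L ^ 2 * ‖v‖ ^ 2 := by
      nlinarith [sq_nonneg (X - J * L * ‖v‖)]
    rw [hL2] at e ⊢
    nlinarith

/-- The term with all derivatives on v is bounded by the antisymmetry of δ; in every other term δ
can be paid for by one derivative of v. -/
theorem inner_leibnizH_first_le {K h : ℝ} (hh : 0 < h) (hk : 1 ≤ k) {b : ℝ → ℝ} (hb : Coef k K b)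
    {j : ℕ} (hj : j ≤ k) (v : HSob k) :
    inner ℝ (leibnizH k b j (symDiffH k h v)) (dH k j v) ≤ K * (1 + 2 ^ j) * ‖v‖ ^ 2 := by
  have hK := hb.nonneg
  have hdv := norm_dH_le j v
  have hn0 := norm_nonneg (dH k j v)
  have hb1 : ∀ x, |b (x + h) - b x| ≤ K * h := fun x => by
    have := (hb.mono hk).abs_sub_le (x + h) x
    rwa [add_sub_cancel_left, abs_of_pos hh] at this
  rw [leibnizH_eq_sum_range, Finset.sum_range_succ', inner_add_left]
  have t0 : inner ℝ ((j.choose 0 : ℝ) • mulL2 volume (iteratedDeriv 0 b)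
      (dH k (j - 0) (symDiffH k h v))) (dH k j v) ≤ K * ‖v‖ ^ 2 := by
    have := inner_symDiff_le hb.contBdd_zero hh hb1 (dH k j v)
    rw [Nat.choose_zero_right, Nat.cast_one, one_smul, Nat.sub_zero, dH_liftH _ hj,
      iteratedDeriv_zero]
    refine this.trans ?_
    exact mul_le_mul_of_nonneg_left (pow_le_pow_left₀ hn0 hdv 2) hK
  have t2 : inner ℝ (∑ i ∈ Finset.range j, (j.choose (i + 1) : ℝ) •
      mulL2 volume (iteratedDeriv (i + 1) b) (dH k (j - (i + 1)) (symDiffH k h v))) (dH k j v)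
      ≤ 2 ^ j * (K * ‖v‖) * ‖v‖ := by
    refine (inner_sum_range_le (B := fun i => (j.choose (i + 1) : ℝ) * (K * ‖v‖))
      fun i hi => ?_).trans ?_
    · refine norm_choose_smul_le (hb.contBdd (by omega)) ?_
      rw [dH_liftH _ (by omega)]
      exact ((isWeakDeriv_dH (show j - (i + 1) < k by omega) v).norm_symDiffR_le hh).trans
        (norm_dH_le _ _)
    · rw [← Finset.sum_mul]
      exact mul_le_mul (mul_le_mul_of_nonneg_right (sum_choose_le (by omega)) (by positivity))
        hdv hn0 (by positivity)
  refine (add_le_add t2 t0).trans (le_of_eq ?_)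
  ring

/-- The dissipativity constant of `L^h + J^h` in `H^k`. -/
def dissipConst (k : ℕ) (K : ℝ) : ℝ :=
  (k + 1) * (K * (6 + k ^ 2 + 2 * k + 2 ^ k)) + (k + 1) * (K * (1 + 2 ^ k)) + (k + 1) * 2 ^ k * K

theorem dissipConst_nonneg (k : ℕ) {K : ℝ} (hK : 0 ≤ K) : 0 ≤ dissipConst k K := by
  unfold dissipConst
  positivity

/-- The constant involves only k and K: the jump part contributes nothing, and the bounds for the
local part hold for each mesh. -/
theorem inner_schemeOp_le {K : ℝ} (hk : 1 ≤ k) {ν : Measure ℝ} (hν : IsLevyMeasure ν) {p : ℕ}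
    (hp : 0 < p) {a b c : ℝ → ℝ} (ha : Coef (max k 2) K a) (h0 : ∀ x, 0 ≤ a x)
    (hb : Coef k K b) (hc : Coef k K c) (v : HSob k) :
    inner ℝ (schemeOp k ν p a b c v) v ≤ dissipConst k K * ‖v‖ ^ 2 := by
  have hh : (0 : ℝ) < 1 / p := by positivity
  have hK := ha.nonneg
  have hjk : ∀ j ∈ Finset.range (k + 1), j ≤ k := fun j hj => by
    rw [Finset.mem_range] at hj; omega
  change inner ℝ (mulH k a (symDiffH k (1 / p) (symDiffH k (1 / p) v))
    + mulH k b (symDiffH k (1 / p) v) + mulH k c v + gridJump ν p _ v) v ≤ _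
  rw [inner_add_left, inner_add_left, inner_add_left]
  have tJ := inner_gridJumpH_nonpos hν hp v
  have tc : inner ℝ (mulH k c v) v ≤ (k + 1) * 2 ^ k * K * ‖v‖ ^ 2 := by
    refine (real_inner_le_norm _ _).trans ?_
    rw [sq, ← mul_assoc]
    exact mul_le_mul_of_nonneg_right (norm_mulH_le hc v) (norm_nonneg _)
  have ta : inner ℝ (mulH k a (symDiffH k (1 / p) (symDiffH k (1 / p) v))) v
      ≤ (k + 1) * (K * (6 + k ^ 2 + 2 * k + 2 ^ k)) * ‖v‖ ^ 2 := by
    rw [inner_HSob]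
    calc _ ≤ ∑ j ∈ Finset.range (k + 1), K * (6 + k ^ 2 + 2 * k + 2 ^ k) * ‖v‖ ^ 2 := by
          refine Finset.sum_le_sum fun j hj => ?_
          rw [dH_mulH (ha.mono (le_max_left k 2)) (hjk j hj)]
          refine (inner_leibnizH_second_le hh ha h0 (hjk j hj) v).trans ?_
          have hjk' : (j : ℝ) ≤ k := by exact_mod_cast hjk j hj
          have : (2 : ℝ) ^ j ≤ 2 ^ k := pow_le_pow_right₀ one_le_two (hjk j hj)
          gcongr
      _ = _ := by rw [Finset.sum_const, Finset.card_range, nsmul_eq_mul]; push_cast; ring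
  have tb : inner ℝ (mulH k b (symDiffH k (1 / p) v)) v
      ≤ (k + 1) * (K * (1 + 2 ^ k)) * ‖v‖ ^ 2 := by
    rw [inner_HSob]
    calc _ ≤ ∑ j ∈ Finset.range (k + 1), K * (1 + 2 ^ k) * ‖v‖ ^ 2 := by
          refine Finset.sum_le_sum fun j hj => ?_
          rw [dH_mulH hb (hjk j hj)]
          refine (inner_leibnizH_first_le hh hk hb (hjk j hj) v).trans ?_
          have : (2 : ℝ) ^ j ≤ 2 ^ k := pow_le_pow_right₀ one_le_two (hjk j hj)
          gcongr
      _ = _ := by rw [Finset.sum_const, Finset.card_range, nsmul_eq_mul]; push_cast; ring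
  unfold dissipConst
  linarith

end SchemeOperator

/-! ### The jump operators on L₂ and the consistency of J^h. -/

section LevyOperators

theorem continuous_avg_integrand (g : L2R) (z : ℝ) :
    Continuous fun θ : ℝ => (1 - θ) • shiftR (θ * z) g :=
  (continuous_const.sub continuous_id).smul
    ((continuous_shiftR g).comp (continuous_id.mul continuous_const))

/-- The average `∫_0^1 (1 - θ) S_{θz} g dθ`. -/
def avgShift (z : ℝ) (g : L2R) : L2R := ∫ θ in (0 : ℝ)..1, (1 - θ) • shiftR (θ * z) g

theorem continuous_avgShift (g : L2R) : Continuous fun z => avgShift z g := by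
  refine intervalIntegral.continuous_parametric_intervalIntegral_of_continuous' ?_ 0 1
  change Continuous fun q : ℝ × ℝ => (1 - q.2) • shiftR (q.2 * q.1) g
  exact (continuous_const.sub continuous_snd).smul
    ((continuous_shiftR g).comp (continuous_snd.mul continuous_fst))

theorem norm_avgShift_le (z : ℝ) (g : L2R) : ‖avgShift z g‖ ≤ ‖g‖ := by
  have := intervalIntegral.norm_integral_le_of_norm_le_const (a := (0 : ℝ)) (b := 1) (C := ‖g‖)
    (f := fun θ => (1 - θ) • shiftR (θ * z) g) fun θ hθ => by
      rw [uIoc_of_le zero_le_one] at hθ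
      rw [norm_smul, norm_shiftL2, Real.norm_of_nonneg (by linarith [hθ.2])]
      exact mul_le_of_le_one_left (norm_nonneg _) (by linarith [hθ.1])
  simpa [avgShift] using this

theorem avgShift_add (z : ℝ) (g w : L2R) : avgShift z (g + w) = avgShift z g + avgShift z w := by
  unfold avgShift
  rw [← intervalIntegral.integral_add ((continuous_avg_integrand g z).intervalIntegrable _ _)
    ((continuous_avg_integrand w z).intervalIntegrable _ _)]
  simp only [map_add, smul_add]

theorem avgShift_smul (z r : ℝ) (g : L2R) : avgShift z (r • g) = r • avgShift z g := by
  unfold avgShift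
  rw [← intervalIntegral.integral_smul]
  simp only [map_smul, smul_comm r]

theorem inner_avgShift (z : ℝ) (g w : L2R) : inner ℝ (avgShift z g) w
    = ∫ θ in (0 : ℝ)..1, (1 - θ) * inner ℝ (shiftR (θ * z) g) w := by
  have h := (innerSL ℝ w).intervalIntegral_comp_comm
    ((continuous_avg_integrand g z).intervalIntegrable (μ := volume) 0 1)
  simp only [innerSL_apply_apply, inner_smul_right] at h
  rw [avgShift, real_inner_comm, ← h]
  simp only [real_inner_comm]

theorem shiftR_avgShift (y z : ℝ) (g : L2R) :
    shiftR y (avgShift z g) = avgShift z (shiftR y g) := by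
  have h := (shiftR y).intervalIntegral_comp_comm
    ((continuous_avg_integrand g z).intervalIntegrable (μ := volume) 0 1)
  rw [avgShift, ← h, avgShift]
  simp only [map_smul, shiftL2_shiftL2, add_comm]

/-- Taylor's formula with integral remainder on [0, 1] for θ ↦ (S_{θz} w, w). Its second derivative
is −z²(S_{θz} w', w'), and its first derivative at 0 vanishes since (w', w) = 0. -/
theorem IsWeakDeriv.inner_avgShift {w w' : L2R} (h : IsWeakDeriv 1 w w') (z : ℝ) :
    z ^ 2 * inner ℝ (avgShift z w') w' = ‖w‖ ^ 2 - inner ℝ (shiftR z w) w := by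
  have hS : ∀ θ, HasDerivAt (fun θ => shiftR (θ * z) w) (z • shiftR (θ * z) w') θ := fun θ => by
    have := (h.hasDerivAt (θ * z)).scomp θ ((hasDerivAt_id θ).mul_const z)
    simpa [Function.comp_def] using this
  have hS' : ∀ θ, HasDerivAt (fun θ => shiftR (-(θ * z)) w) (-(z • shiftR (-(θ * z)) w')) θ :=
    fun θ => by
    have := (h.hasDerivAt (-(θ * z))).scomp θ ((hasDerivAt_id θ).mul_const z).neg
    simpa [Function.comp_def] using this
  have hq : ∀ θ, HasDerivAt (fun θ => inner ℝ (shiftR (θ * z) w) w)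
      (z * inner ℝ (shiftR (θ * z) w') w) θ := fun θ => by
    have := (hS θ).inner ℝ (hasDerivAt_const θ w)
    simpa [real_inner_smul_left] using this
  have hr : ∀ θ, HasDerivAt (fun θ => inner ℝ (shiftR (θ * z) w') w)
      (-(z * inner ℝ (shiftR (θ * z) w') w')) θ := fun θ => by
    have := (hasDerivAt_const θ w').inner ℝ (hS' θ)
    simp only [inner_zero_left, add_zero, inner_neg_right, real_inner_smul_right] at this
    simpa only [inner_shiftL2_left] using this
  have hF : ∀ θ, HasDerivAt
      (fun θ => (1 - θ) * (z * inner ℝ (shiftR (θ * z) w') w) + inner ℝ (shiftR (θ * z) w) w)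
      (-(z ^ 2 * ((1 - θ) * inner ℝ (shiftR (θ * z) w') w'))) θ := fun θ => by
    have := (((hasDerivAt_id θ).const_sub 1).mul ((hr θ).const_mul z)).add (hq θ)
    refine this.congr_deriv ?_
    simp only [id]
    ring
  have hc : Continuous fun θ : ℝ => -(z ^ 2 * ((1 - θ) * inner ℝ (shiftR (θ * z) w') w')) := by
    have : Continuous fun θ : ℝ => shiftR (θ * z) w' :=
      (continuous_shiftR w').comp (continuous_id.mul continuous_const)
    fun_prop
  have h1 := intervalIntegral.integral_eq_sub_of_hasDerivAt (a := (0 : ℝ)) (b := 1)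
    (fun θ _ => hF θ) (hc.intervalIntegrable _ _)
  have h2 : inner ℝ w' w = 0 := by
    have := h.inner_eq_neg h
    rw [real_inner_comm] at this
    linarith
  rw [intervalIntegral.integral_neg, intervalIntegral.integral_const_mul,
    ← _root_.inner_avgShift] at h1
  simp only [zero_mul, one_mul, sub_self, shiftL2_zero, sub_zero, h2, mul_zero,
    real_inner_self_eq_norm_sq, zero_add] at h1
  linarith

variable {ν : Measure ℝ}

theorem integrableOn_sq_avgShift (hν : IsLevyMeasure ν) (g : L2R) :
    IntegrableOn (fun z : ℝ => z ^ 2 • avgShift z g) {z : ℝ | |z| ≤ 1} ν := by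
  refine (hν.integrableOn_sq.mul_const ‖g‖).mono'
    (((continuous_pow 2).smul (continuous_avgShift g)).aestronglyMeasurable) ?_
  refine Filter.Eventually.of_forall fun z => ?_
  rw [norm_smul, Real.norm_of_nonneg (sq_nonneg z)]
  exact mul_le_mul_of_nonneg_left (norm_avgShift_le z g) (sq_nonneg z)

theorem integrableOn_shift_sub (hν : IsLevyMeasure ν) (g : L2R) :
    IntegrableOn (fun z : ℝ => shiftR z g - g) {z : ℝ | 1 < |z|} ν := by
  refine Measure.integrableOn_of_bounded hν.large_lt_top.ne (M := 2 * ‖g‖)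
    ((continuous_shiftR g).sub continuous_const).aestronglyMeasurable ?_
  refine Filter.Eventually.of_forall fun z => (norm_sub_le _ _).trans ?_
  rw [norm_shiftL2]
  linarith

theorem levyMu0_eq (ν : Measure ℝ) : levyMu0 ν = ν.real {z : ℝ | 1 < |z|} := by
  rw [levyMu0, levy_large_eq]

theorem levyMu0_nonneg (ν : Measure ℝ) : 0 ≤ levyMu0 ν := measureReal_nonneg

theorem levyMu2_nonneg (ν : Measure ℝ) : 0 ≤ levyMu2 ν := integral_nonneg fun z => sq_nonneg z

/-- The operator `∫_{|z| ≤ 1} z² ∫_0^1 (1 - θ) S_{θz} dθ ν(dz)`. -/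
def smallOp (hν : IsLevyMeasure ν) : L2R →L[ℝ] L2R :=
  LinearMap.mkContinuous
    { toFun := fun g => ∫ z in {z : ℝ | |z| ≤ 1}, z ^ 2 • avgShift z g ∂ν
      map_add' := fun g w => by
        rw [← integral_add (integrableOn_sq_avgShift hν g) (integrableOn_sq_avgShift hν w)]
        simp only [avgShift_add, smul_add]
      map_smul' := fun r g => by
        rw [RingHom.id_apply, ← integral_smul]
        simp only [avgShift_smul, smul_comm r] }
    (levyMu2 ν) fun g => by
      refine (norm_integral_le_of_norm_le (hν.integrableOn_sq.mul_const ‖g‖)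
        (Filter.Eventually.of_forall fun z => ?_)).trans (le_of_eq (integral_mul_const _ _))
      rw [norm_smul, Real.norm_of_nonneg (sq_nonneg z)]
      exact mul_le_mul_of_nonneg_left (norm_avgShift_le z g) (sq_nonneg z)

theorem smallOp_apply (hν : IsLevyMeasure ν) (g : L2R) :
    smallOp hν g = ∫ z in {z : ℝ | |z| ≤ 1}, z ^ 2 • avgShift z g ∂ν := rfl

theorem norm_smallOp_le (hν : IsLevyMeasure ν) (g : L2R) :
    ‖smallOp hν g‖ ≤ levyMu2 ν * ‖g‖ :=
  by
    refine (norm_integral_le_of_norm_le (hν.integrableOn_sq.mul_const ‖g‖)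
      (Filter.Eventually.of_forall fun z => ?_)).trans (le_of_eq (integral_mul_const _ _))
    rw [norm_smul, Real.norm_of_nonneg (sq_nonneg z)]
    exact mul_le_mul_of_nonneg_left (norm_avgShift_le z g) (sq_nonneg z)

theorem shiftInvariant_smallOp (hν : IsLevyMeasure ν) : ShiftInvariant (smallOp hν) :=
  fun y g => by
  rw [smallOp_apply, smallOp_apply,
    ← (shiftR y).integral_comp_comm (integrableOn_sq_avgShift hν g)]
  simp only [map_smul, shiftR_avgShift]

theorem inner_smallOp (hν : IsLevyMeasure ν) (g w : L2R) : inner ℝ (smallOp hν g) w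
    = ∫ z in {z : ℝ | |z| ≤ 1}, z ^ 2 * inner ℝ (avgShift z g) w ∂ν := by
  have h := (innerSL ℝ w).integral_comp_comm (integrableOn_sq_avgShift hν g)
  simp only [innerSL_apply_apply, inner_smul_right] at h
  rw [smallOp_apply, real_inner_comm, ← h]
  simp only [real_inner_comm]

/-- Dissipativity of the small jumps for functions with one derivative only: for each z the
integrand is ‖w‖² − (S_z w, w) ≥ 0. -/
theorem IsWeakDeriv.inner_smallOp_nonneg (hν : IsLevyMeasure ν) {w w' : L2R}
    (h : IsWeakDeriv 1 w w') : 0 ≤ inner ℝ (smallOp hν w') w' := by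
  rw [inner_smallOp]
  refine integral_nonneg fun z => ?_
  change 0 ≤ z ^ 2 * inner ℝ (avgShift z w') w'
  rw [h.inner_avgShift]
  linarith [inner_le_of_norm_le (norm_shiftL2 z w).le]

/-- The operator `∫_{|z| > 1} (S_z - 1) ν(dz)`. -/
def largeOp (hν : IsLevyMeasure ν) : L2R →L[ℝ] L2R :=
  LinearMap.mkContinuous
    { toFun := fun g => ∫ z in {z : ℝ | 1 < |z|}, (shiftR z g - g) ∂ν
      map_add' := fun g w => by
        rw [← integral_add (integrableOn_shift_sub hν g) (integrableOn_shift_sub hν w)]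
        simp only [map_add, add_sub_add_comm]
      map_smul' := fun r g => by
        rw [RingHom.id_apply, ← integral_smul]
        simp only [map_smul, smul_sub] }
    (2 * levyMu0 ν) fun g => by
      refine (norm_setIntegral_le_of_norm_le_const hν.large_lt_top (C := 2 * ‖g‖)
        fun z _ => (norm_sub_le _ _).trans ?_).trans (le_of_eq ?_)
      · rw [norm_shiftL2]
        linarith
      · rw [levyMu0_eq]
        ring

theorem largeOp_apply (hν : IsLevyMeasure ν) (g : L2R) :
    largeOp hν g = ∫ z in {z : ℝ | 1 < |z|}, (shiftR z g - g) ∂ν := rfl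

theorem norm_largeOp_le (hν : IsLevyMeasure ν) (g : L2R) :
    ‖largeOp hν g‖ ≤ 2 * levyMu0 ν * ‖g‖ := by
  refine (norm_setIntegral_le_of_norm_le_const hν.large_lt_top (C := 2 * ‖g‖)
    fun z _ => (norm_sub_le _ _).trans ?_).trans (le_of_eq ?_)
  · rw [norm_shiftL2]
    linarith
  · rw [levyMu0_eq]
    ring

theorem shiftInvariant_largeOp (hν : IsLevyMeasure ν) : ShiftInvariant (largeOp hν) :=
  fun y g => by
  rw [largeOp_apply, largeOp_apply,
    ← (shiftR y).integral_comp_comm (integrableOn_shift_sub hν g)]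
  simp only [map_sub, shiftL2_shiftL2, add_comm]

theorem inner_largeOp (hν : IsLevyMeasure ν) (g w : L2R) : inner ℝ (largeOp hν g) w
    = ∫ z in {z : ℝ | 1 < |z|}, inner ℝ (shiftR z g - g) w ∂ν := by
  have h := (innerSL ℝ w).integral_comp_comm (integrableOn_shift_sub hν g)
  simp only [innerSL_apply_apply] at h
  rw [largeOp_apply, real_inner_comm, ← h]
  simp only [real_inner_comm]

theorem inner_largeOp_nonpos (hν : IsLevyMeasure ν) (g : L2R) :
    inner ℝ (largeOp hν g) g ≤ 0 := by
  rw [inner_largeOp]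
  refine integral_nonpos fun z => ?_
  change inner ℝ (shiftR z g - g) g ≤ 0
  rw [inner_sub_left, real_inner_self_eq_norm_sq]
  linarith [inner_le_of_norm_le (norm_shiftL2 z g).le]

variable {p : ℕ}

/-- The operator `J^h` on `L₂(ℝ)`. -/
abbrev gridJumpR (ν : Measure ℝ) (p : ℕ) : L2R →L[ℝ] L2R :=
  gridJump ν p fun i => shiftR (i * (1 / p))

theorem mem_gridCell_sign {h : ℝ} {j : ℤ} (hj : j ≠ 0) {z : ℝ} (hz : z ∈ gridCell h j) :
    ((j.natAbs : ℝ) - 1) * h ≤ j.sign * z ∧ j.sign * z ≤ j.natAbs * h := by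
  rcases lt_or_gt_of_ne hj with h' | h'
  · have e : (j.natAbs : ℝ) = -j := by
      rw [Nat.cast_natAbs, abs_of_neg h', Int.cast_neg]
    rw [gridCell_of_neg h'] at hz
    rw [e, Int.sign_eq_neg_one_of_neg h']
    push_cast
    constructor <;> nlinarith [hz.1, hz.2]
  · have e : (j.natAbs : ℝ) = j := by
      rw [Nat.cast_natAbs, abs_of_pos h']
    rw [gridCell_of_pos h'] at hz
    rw [e, Int.sign_eq_one_of_pos h']
    push_cast
    constructor <;> nlinarith [hz.1, hz.2]

theorem abs_int_sign {j : ℤ} (hj : j ≠ 0) : |(j.sign : ℝ)| = 1 := by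
  rcases lt_or_gt_of_ne hj with h' | h'
  · rw [Int.sign_eq_neg_one_of_neg h']; simp
  · rw [Int.sign_eq_one_of_pos h']; simp

/-- On the cell of index j, |z| lies between (|j| − 1)h and |j|h. For θ in the slice from l/|j| to
(l + 1)/|j|, the point θz is then within h of the l-th grid point in the direction of z. This
justifies the slices in the definition of θ_k^r. -/
theorem abs_mul_sub_grid_le {h : ℝ} (hh : 0 < h) {j : ℤ} (hj : j ≠ 0) {z θ : ℝ}
    (hz : z ∈ gridCell h j) {l : ℕ} (hl : l < j.natAbs)
    (h1 : l / (j.natAbs : ℝ) ≤ θ) (h2 : θ ≤ (l + 1) / (j.natAbs : ℝ)) :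
    |θ * z - j.sign * l * h| ≤ h := by
  obtain ⟨h3, h4⟩ := mem_gridCell_sign hj hz
  have hs : (j.sign : ℝ) * j.sign = 1 := by
    rw [← abs_mul_abs_self, abs_int_sign hj, one_mul]
  set n : ℝ := (j.natAbs : ℝ) with hn
  have hl' : (l : ℝ) + 1 ≤ n := by rw [hn]; exact_mod_cast hl
  have hl0 : (0 : ℝ) ≤ l := Nat.cast_nonneg l
  have hn0 : 0 < n := by linarith
  have hθ : 0 ≤ θ := le_trans (by positivity) h1
  rw [div_le_iff₀ hn0] at h1
  rw [le_div_iff₀ hn0] at h2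
  have hθ1 : θ ≤ 1 := by nlinarith
  have e : θ * z - j.sign * l * h = j.sign * (θ * (j.sign * z) - l * h) := by
    linear_combination (-(θ * z)) * hs
  rw [e, abs_mul, abs_int_sign hj, one_mul, abs_le]
  constructor
  · have := mul_le_mul_of_nonneg_left h3 hθ
    nlinarith
  · have := mul_le_mul_of_nonneg_left h4 hθ
    nlinarith

theorem abs_sub_grid_le {h : ℝ} (hh : 0 < h) {j : ℤ} (hj : j ≠ 0) {z : ℝ}
    (hz : z ∈ gridCell h j) : |z - j * h| ≤ h := by
  rcases lt_or_gt_of_ne hj with h' | h'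
  · rw [gridCell_of_neg h'] at hz
    rw [abs_le]
    constructor <;> nlinarith [hz.1, hz.2]
  · rw [gridCell_of_pos h'] at hz
    rw [abs_le]
    constructor <;> nlinarith [hz.1, hz.2]

/-- The inner sum in `J_1^h`, as an operator on `L₂`. -/
theorem sum_gridTheta_eq (p : ℕ) (j : ℤ) (g : L2R) :
    (∑ l ∈ Finset.range j.natAbs, gridTheta j l • ((p : ℝ) ^ 2 •
      (shiftR (((j.sign * l + 1 : ℤ) : ℝ) * (1 / p))
        - (2 : ℝ) • shiftR (((j.sign * l : ℤ) : ℝ) * (1 / p))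
        + shiftR (((j.sign * l - 1 : ℤ) : ℝ) * (1 / p))))) g
      = ∑ l ∈ Finset.range j.natAbs,
        gridTheta j l • shiftR (j.sign * l * (1 / p)) (secondDiffR (1 / p) g) := by
  rw [sum_apply]
  refine Finset.sum_congr rfl fun l _ => ?_
  rw [smul_apply, smul_apply]
  congr 1
  change (p : ℝ) ^ 2 • (shiftR _ g - (2 : ℝ) • shiftR _ g + shiftR _ g)
    = shiftR _ (((1 / (p : ℝ))⁻¹) ^ 2 • (shiftR (1 / p) g - (2 : ℝ) • g + shiftR (-(1 / p)) g))
  rw [map_smul, map_add, map_sub, map_smul, shiftL2_shiftL2, shiftL2_shiftL2, one_div, inv_inv]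
  push_cast
  congr 5 <;> ring

/-- The interval [0, 1] is cut into |j| slices. On each, freezing the translation at the grid point
costs h‖g'''‖ and replacing the second difference by g'' costs 2h‖g'''‖; the slice lengths sum to 1.
-/
theorem norm_sum_gridTheta_sub_le (hp : 0 < p) {j : ℤ} (hj : j ≠ 0) {z : ℝ}
    (hz : z ∈ gridCell (1 / p) j) {g g' g'' g''' : L2R} (hg : IsWeakDeriv 1 g g')
    (hg' : IsWeakDeriv 1 g' g'') (hg'' : IsWeakDeriv 1 g'' g''') :
    ‖∑ l ∈ Finset.range j.natAbs,
        gridTheta j l • shiftR (j.sign * l * (1 / p)) (secondDiffR (1 / p) g) - avgShift z g''‖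
      ≤ 3 * (1 / p) * ‖g'''‖ := by
  have hh : (0 : ℝ) < 1 / p := by positivity
  set h : ℝ := 1 / p
  have hn : 0 < j.natAbs := Int.natAbs_pos.2 hj
  have hn' : (0 : ℝ) < j.natAbs := by exact_mod_cast hn
  have hint : ∀ x y : ℝ, IntervalIntegrable (fun θ => (1 - θ) • shiftR (θ * z) g'') volume x y :=
    fun x y => (continuous_avg_integrand g'' z).intervalIntegrable x y
  have e1 : avgShift z g'' = ∑ l ∈ Finset.range j.natAbs,
      ∫ θ in ((l : ℝ) / j.natAbs)..(((l : ℝ) + 1) / j.natAbs), (1 - θ) • shiftR (θ * z) g'' := by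
    have := intervalIntegral.sum_integral_adjacent_intervals (μ := volume) (n := j.natAbs)
      (a := fun l : ℕ => (l : ℝ) / j.natAbs) (f := fun θ => (1 - θ) • shiftR (θ * z) g'')
      fun l _ => hint _ _
    simp only [Nat.cast_add, Nat.cast_one, Nat.cast_zero, zero_div, div_self hn'.ne'] at this
    rw [this, avgShift]
  rw [e1, ← Finset.sum_sub_distrib]
  have key : ∀ l ∈ Finset.range j.natAbs,
      ‖gridTheta j l • shiftR (j.sign * l * h) (secondDiffR h g)
        - ∫ θ in ((l : ℝ) / j.natAbs)..(((l : ℝ) + 1) / j.natAbs), (1 - θ) • shiftR (θ * z) g''‖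
        ≤ 3 * h * ‖g'''‖ * (1 / j.natAbs) := by
    intro l hl
    rw [Finset.mem_range] at hl
    have hl' : (l : ℝ) + 1 ≤ j.natAbs := by exact_mod_cast hl
    have e2 : gridTheta j l • shiftR (j.sign * l * h) (secondDiffR h g)
        = ∫ θ in ((l : ℝ) / j.natAbs)..(((l : ℝ) + 1) / j.natAbs),
          (1 - θ) • shiftR (j.sign * l * h) (secondDiffR h g) := by
      rw [intervalIntegral.integral_smul_const]
      rfl
    rw [e2, ← intervalIntegral.integral_sub (by
      refine Continuous.intervalIntegrable ?_ _ _
      fun_prop) (hint _ _)]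
    have hle : (l : ℝ) / j.natAbs ≤ ((l : ℝ) + 1) / j.natAbs := by gcongr; linarith
    refine (intervalIntegral.norm_integral_le_of_norm_le_const (C := 3 * h * ‖g'''‖)
      fun θ hθ => ?_).trans (le_of_eq ?_)
    · rw [uIoc_of_le hle] at hθ
      have hθ0 : 0 ≤ θ := le_trans (by positivity) hθ.1.le
      have hθ1 : θ ≤ 1 := hθ.2.trans ((div_le_one hn').2 hl')
      rw [← smul_sub, norm_smul, Real.norm_of_nonneg (by linarith)]
      have h1 := hg''.norm_shift_sub_le (θ * z) (j.sign * l * h)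
      have h2 := abs_mul_sub_grid_le hh hj hz hl hθ.1.le hθ.2
      rw [abs_sub_comm] at h2
      have h3 : ‖shiftR (j.sign * l * h) (secondDiffR h g) - shiftR (j.sign * l * h) g''‖
          ≤ 2 * h * ‖g'''‖ := by
        rw [← map_sub, norm_shiftL2]
        exact hg.norm_secondDiffR_sub_le hh hg' hg''
      have h4 := norm_sub_le_norm_sub_add_norm_sub
        (shiftR (j.sign * l * h) (secondDiffR h g)) (shiftR (j.sign * l * h) g'')
        (shiftR (θ * z) g'')
      have h5 := mul_le_mul_of_nonneg_left h2 (norm_nonneg g''')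
      refine (mul_le_of_le_one_left (norm_nonneg _) (by linarith)).trans ?_
      linarith
    · rw [← sub_div, add_sub_cancel_left, abs_of_pos (by positivity)]
  refine (norm_sum_le_of_le _ key).trans (le_of_eq ?_)
  rw [Finset.sum_const, Finset.card_range, nsmul_eq_mul]
  field_simp

/-- The error is uniform over each cell, so it is integrated against z² ν(dz) and the total mass is
μ₂; no other moment of ν is involved. -/
theorem norm_smallJump_sub_le (hν : IsLevyMeasure ν) (hp : 0 < p) {g g' g'' g''' : L2R}
    (hg : IsWeakDeriv 1 g g') (hg' : IsWeakDeriv 1 g' g'') (hg'' : IsWeakDeriv 1 g'' g''') :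
    ‖smallJump ν p (fun i => shiftR (i * (1 / p))) g - smallOp hν g''‖
      ≤ 3 * levyMu2 ν * (1 / p) * ‖g'''‖ := by
  have hI := integrableOn_sq_avgShift hν g''
  rw [smallOp_apply, integral_small_eq_sum hν hp hI, smallJump, sum_apply, ← Finset.sum_sub_distrib,
    ← sum_gridZeta hν hp, Finset.mul_sum, Finset.sum_mul, Finset.sum_mul]
  refine norm_sum_le_of_le _ fun j hj => ?_
  have hj0 := Finset.ne_of_mem_erase hj
  have hsub : gridCell (1 / (p : ℝ)) j ⊆ {z : ℝ | |z| ≤ 1} := by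
    have := Finset.subset_set_biUnion_of_mem (f := fun j => gridCell (1 / (p : ℝ)) j) hj
    rw [biUnion_gridCell_small hp] at this
    exact this.trans sdiff_subset
  have i1 : IntegrableOn (fun z : ℝ => z ^ 2) (gridCell (1 / p) j) ν :=
    hν.integrableOn_sq.mono_set hsub
  rw [smul_apply, sum_gridTheta_eq, gridZeta, ← integral_smul_const,
    ← integral_sub (i1.smul_const _) (hI.mono_set hsub)]
  have e : ∀ x : ℝ, 3 * x * (1 / p) * ‖g'''‖ = x * (3 * (1 / p) * ‖g'''‖) := fun x => by ring
  rw [e, ← integral_mul_const]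
  refine norm_integral_le_of_norm_le (i1.mul_const _) ?_
  refine (ae_restrict_iff' (measurableSet_gridCell _ _)).2 (Filter.Eventually.of_forall
    fun z hz => ?_)
  rw [← smul_sub, norm_smul, Real.norm_of_nonneg (sq_nonneg z)]
  exact mul_le_mul_of_nonneg_left (norm_sum_gridTheta_sub_le hp hj0 hz hg hg' hg'') (sq_nonneg z)

theorem norm_real_smul_sub_setIntegral_le {s : Set ℝ} (hs : ν s < ⊤) {F : ℝ → L2R}
    (hF : IntegrableOn F s ν) {w : L2R} {R : ℝ} (h : ∀ z ∈ s, ‖w - F z‖ ≤ R) :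
    ‖ν.real s • w - ∫ z in s, F z ∂ν‖ ≤ ν.real s * R := by
  have e1 : ν.real s • w - ∫ z in s, F z ∂ν = ∫ z in s, (w - F z) ∂ν := by
    have h1 : IntegrableOn (fun _ : ℝ => w) s ν := integrableOn_const hs.ne
    rw [integral_sub h1 hF, setIntegral_const]
  rw [e1, mul_comm]
  exact norm_setIntegral_le_of_norm_le_const hs h

/-- On each cell z is replaced by a grid point within h, at the cost of one derivative. The total
mass of the cells is the finite number μ₀. -/
theorem norm_largeJump_sub_le (hν : IsLevyMeasure ν) (hp : 0 < p) {g g' : L2R}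
    (hg : IsWeakDeriv 1 g g') :
    ‖largeJump ν p (fun i => shiftR (i * (1 / p))) g - largeOp hν g‖
      ≤ levyMu0 ν * (1 / p) * ‖g'‖ := by
  have hh : (0 : ℝ) < 1 / p := by positivity
  have hI := integrableOn_shift_sub hν g
  rw [← iUnion_gridCell_large hp] at hI
  have hs := fun j : {j : ℤ // (p : ℤ) < |j|} =>
    subset_iUnion (fun j : {j : ℤ // (p : ℤ) < |j|} => gridCell (1 / (p : ℝ)) j) j
  have h1 := hasSum_integral_iUnion (fun j : {j : ℤ // (p : ℤ) < |j|} =>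
    measurableSet_gridCell (1 / (p : ℝ)) j) (pairwise_disjoint_gridCell_large hp) hI
  rw [iUnion_gridCell_large hp, ← largeOp_apply hν] at h1
  have h2 := (hasSum_largeJump_apply hν hp (U := fun i => shiftR (i * (1 / p)))
    (fun i g => (norm_shiftL2 _ g).le) g).sub h1
  have h3 := (hasSum_measure_gridCell_large hν hp).mul_right (1 / p * ‖g'‖)
  rw [← h2.tsum_eq, mul_assoc]
  refine tsum_of_norm_bounded h3 fun j => ?_
  refine norm_real_smul_sub_setIntegral_le ?_ (hI.mono_set (hs j)) fun z hz => ?_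
  · refine lt_of_le_of_lt (measure_mono (hs j)) ?_
    rw [iUnion_gridCell_large hp]
    exact hν.large_lt_top
  · rw [sub_sub_sub_cancel_right, mul_comm (1 / (p : ℝ))]
    refine (hg.norm_shift_sub_le z _).trans (mul_le_mul_of_nonneg_left ?_ (norm_nonneg _))
    rw [abs_sub_comm]
    exact abs_sub_grid_le hh (ne_zero_of_lt_abs j.2) hz

end LevyOperators

/-! ### The operator L + J between Sobolev spaces, and consistency of the scheme. -/

section ContinuousOperator

variable {ν : Measure ℝ} {p k k' : ℕ} {a b c : ℝ → ℝ} {K : ℝ}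

/-- An intertwiner of the two families of translations intertwines the jump operators; applied to
the derivatives H^k → L₂, it reduces J^h on H^k to J^h on L₂. -/
theorem map_gridJump {H H' : Type*} [NormedAddCommGroup H] [InnerProductSpace ℝ H]
    [CompleteSpace H] [NormedAddCommGroup H'] [InnerProductSpace ℝ H'] [CompleteSpace H']
    (hν : IsLevyMeasure ν) (hp : 0 < p) {U : ℤ → H →L[ℝ] H} (hU : ∀ i g, ‖U i g‖ ≤ ‖g‖)
    {U' : ℤ → H' →L[ℝ] H'} (hU' : ∀ i g, ‖U' i g‖ ≤ ‖g‖) (Φ : H →L[ℝ] H')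
    (hΦ : ∀ i g, Φ (U i g) = U' i (Φ g)) (g : H) :
    Φ (gridJump ν p U g) = gridJump ν p U' (Φ g) := by
  rw [gridJump, gridJump, add_apply, add_apply, map_add]
  congr 1
  · simp only [smallJump, sum_apply, smul_apply, add_apply, sub_apply, map_sum, map_smul, map_add,
      map_sub, hΦ]
  · have h1 := (hasSum_largeJump_apply hν hp hU g).mapL Φ
    simp only [map_smul, map_sub, hΦ] at h1
    exact h1.unique (hasSum_largeJump_apply hν hp hU' (Φ g))

theorem dH_gridJump (hν : IsLevyMeasure ν) (hp : 0 < p) {j : ℕ} (hj : j ≤ k) (g : HSob k) :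
    dH k j (gridJump ν p (fun i => shiftH k (i * (1 / p))) g) = gridJumpR ν p (dH k j g) :=
  map_gridJump hν hp (fun _ _ => norm_shiftH _ _) (fun _ _ => (norm_shiftL2 _ _).le) (dH k j)
    (fun _ g => dH_liftH _ hj g) g

/-- The operator `L + J` from `H^{k'}` to `H^k`, `k + 2 ≤ k'`. -/
def contOp (hν : IsLevyMeasure ν) (h : k + 2 ≤ k') (a b c : ℝ → ℝ) : HSob k' →L[ℝ] HSob k :=
  (mulH k a).comp (derivH 2 h) + (mulH k b).comp (derivH 1 (by omega))
    + (mulH k c).comp (truncH (by omega))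
    + (liftH k (smallOp hν) (shiftInvariant_smallOp hν)).comp (derivH 2 h)
    + (liftH k (largeOp hν) (shiftInvariant_largeOp hν)).comp (truncH (by omega))

theorem contOp_apply (hν : IsLevyMeasure ν) (h : k + 2 ≤ k') (g : HSob k') :
    contOp hν h a b c g = mulH k a (derivH 2 h g) + mulH k b (derivH 1 (by omega) g)
      + mulH k c (truncH (by omega) g)
      + liftH k (smallOp hν) (shiftInvariant_smallOp hν) (derivH 2 h g)
      + liftH k (largeOp hν) (shiftInvariant_largeOp hν) (truncH (by omega) g) := rfl

theorem dH_zero_contOp (hν : IsLevyMeasure ν) (h : k + 2 ≤ k') (ha : Coef k K a) (hb : Coef k K b)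
    (hc : Coef k K c) (g : HSob k') : dH k 0 (contOp hν h a b c g)
      = mulL2 volume a (dH k' 2 g) + mulL2 volume b (dH k' 1 g) + mulL2 volume c (dH k' 0 g)
        + smallOp hν (dH k' 2 g) + largeOp hν (dH k' 0 g) := by
  rw [contOp_apply, map_add, map_add, map_add, map_add, dH_zero_mulH ha, dH_zero_mulH hb,
    dH_zero_mulH hc, dH_liftH _ (by omega), dH_liftH _ (by omega), dH_derivH _ (by omega),
    dH_derivH _ (by omega), dH_truncH _ (by omega)]

/-- The bound of `L + J` as an operator from `H^{k'}` to `H^k`. -/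
def contConst (k : ℕ) (K μ₀ μ₂ : ℝ) : ℝ := 3 * ((k + 1) * 2 ^ k * K) + μ₂ + 2 * μ₀

/-- The constant in the consistency estimate for `L^h + J^h`. -/
def gridConst (k : ℕ) (K μ₀ μ₂ : ℝ) : ℝ :=
  3 * ((k + 1) * 2 ^ k * K) + (k + 1) * (3 * μ₂ + μ₀)

theorem contConst_nonneg (k : ℕ) (hK : 0 ≤ K) (ν : Measure ℝ) :
    0 ≤ contConst k K (levyMu0 ν) (levyMu2 ν) := by
  have := levyMu2_nonneg ν
  have := levyMu0_nonneg ν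
  unfold contConst
  positivity

theorem gridConst_nonneg (k : ℕ) (hK : 0 ≤ K) (ν : Measure ℝ) :
    0 ≤ gridConst k K (levyMu0 ν) (levyMu2 ν) := by
  have := levyMu2_nonneg ν
  have := levyMu0_nonneg ν
  unfold gridConst
  positivity

theorem norm_contOp_le (hν : IsLevyMeasure ν) (h : k + 2 ≤ k') (ha : Coef k K a) (hb : Coef k K b)
    (hc : Coef k K c) (g : HSob k') : ‖contOp hν h a b c g‖
      ≤ contConst k K (levyMu0 ν) (levyMu2 ν) * ‖g‖ := by
  have hK := ha.nonneg
  have h2 := levyMu2_nonneg ν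
  have h0 := levyMu0_nonneg ν
  have hm : ∀ {a : ℝ → ℝ}, Coef k K a → ∀ w : HSob k, ‖w‖ ≤ ‖g‖ →
      ‖mulH k a w‖ ≤ (k + 1) * 2 ^ k * K * ‖g‖ := fun ha w hw =>
    (norm_mulH_le ha w).trans (mul_le_mul_of_nonneg_left hw (by positivity))
  have t1 := hm ha _ (norm_derivH_le h g)
  have t2 := hm hb _ (norm_derivH_le (show k + 1 ≤ k' by omega) g)
  have t3 := hm hc _ (norm_truncH_le (show k ≤ k' by omega) g)
  have t4 := (norm_liftH_le (shiftInvariant_smallOp hν) h2 (norm_smallOp_le hν)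
    (derivH 2 h g)).trans (mul_le_mul_of_nonneg_left (norm_derivH_le h g) h2)
  have t5 := (norm_liftH_le (shiftInvariant_largeOp hν) (by positivity) (norm_largeOp_le hν)
    (truncH (show k ≤ k' by omega) g)).trans (mul_le_mul_of_nonneg_left
      (norm_truncH_le (show k ≤ k' by omega) g) (by positivity))
  rw [contOp_apply]
  refine (norm_add_le_of_le (norm_add_le_of_le (norm_add_le_of_le (norm_add_le_of_le t1 t2) t3)
    t4) t5).trans (le_of_eq ?_)
  unfold contConst
  ring

/-- Three derivatives buy one power of h. The terms with c are identical and cancel. -/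
theorem norm_schemeOp_sub_contOp_le (hν : IsLevyMeasure ν) (hp : 0 < p) (h : k + 3 ≤ k')
    (ha : Coef k K a) (hb : Coef k K b) (g : HSob k') :
    ‖schemeOp k ν p a b c (truncH (by omega) g) - contOp hν (by omega) a b c g‖
      ≤ gridConst k K (levyMu0 ν) (levyMu2 ν) * (1 / p * ‖g‖) := by
  have hh : (0 : ℝ) < 1 / p := by positivity
  have hK := ha.nonneg
  have h2 := levyMu2_nonneg ν
  have h0 := levyMu0_nonneg ν
  have hd : ∀ {j}, j < k' → IsWeakDeriv 1 (dH k' j g) (dH k' (j + 1) g) := fun hj =>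
    isWeakDeriv_dH hj g
  have hng := norm_nonneg g
  have e1 : ‖symDiffH k (1 / p) (symDiffH k (1 / p) (truncH (by omega) g))
      - derivH 2 (show k + 2 ≤ k' by omega) g‖ ≤ 2 * (1 / p) * ‖g‖ := by
    refine (norm_HSob_le_mul (w := derivH 3 h g) le_rfl (by positivity) fun j hj => ?_).trans
      (mul_le_mul_of_nonneg_left (norm_derivH_le h g) (by positivity))
    rw [map_sub, dH_liftH _ hj, dH_liftH _ hj, dH_truncH _ hj, dH_derivH _ hj, dH_derivH _ hj]
    exact (hd (by omega)).norm_symDiffR_symDiffR_sub_le hh (hd (by omega)) (hd (by omega))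
  have e2 : ‖symDiffH k (1 / p) (truncH (by omega) g) - derivH 1 (show k + 1 ≤ k' by omega) g‖
      ≤ 1 / p * ‖g‖ := by
    refine (norm_HSob_le_mul (w := derivH 2 (show k + 2 ≤ k' by omega) g) le_rfl (by positivity)
      fun j hj => ?_).trans (mul_le_mul_of_nonneg_left (norm_derivH_le _ g) (by positivity))
    rw [map_sub, dH_liftH _ hj, dH_truncH _ hj, dH_derivH _ hj, dH_derivH _ hj]
    exact (hd (by omega)).norm_symDiffR_sub_le hh (hd (by omega))
  have e3 : ‖gridJump ν p (fun i => shiftH k (i * (1 / p))) (truncH (by omega) g)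
      - (liftH k _ (shiftInvariant_smallOp hν) (derivH 2 (show k + 2 ≤ k' by omega) g)
      + liftH k _ (shiftInvariant_largeOp hν) (truncH (by omega) g))‖
      ≤ (k + 1) * ((3 * levyMu2 ν * (1 / p) + levyMu0 ν * (1 / p)) * ‖g‖) := by
    have e4 : ∀ j ≤ k, ‖smallJump ν p (fun i => shiftR (i * (1 / p))) (dH k' j g)
        - smallOp hν (dH k' (j + 2) g)‖ ≤ 3 * levyMu2 ν * (1 / p) * ‖dH k' (j + 3) g‖ :=
      fun j hj => norm_smallJump_sub_le hν hp (hd (by omega)) (hd (by omega)) (hd (by omega))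
    have e5 : ∀ j ≤ k, ‖largeJump ν p (fun i => shiftR (i * (1 / p))) (dH k' j g)
        - largeOp hν (dH k' j g)‖ ≤ levyMu0 ν * (1 / p) * ‖dH k' (j + 1) g‖ :=
      fun j hj => norm_largeJump_sub_le hν hp (hd (by omega))
    refine norm_HSob_le fun j hj => ?_
    rw [map_sub, map_add, dH_gridJump hν hp hj, dH_liftH _ hj, dH_liftH _ hj, dH_truncH _ hj,
      dH_derivH _ hj, gridJumpR, gridJump, add_apply, add_sub_add_comm, add_mul]
    exact norm_add_le_of_le
      ((e4 j hj).trans (mul_le_mul_of_nonneg_left (norm_dH_le _ _) (by positivity)))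
      ((e5 j hj).trans (mul_le_mul_of_nonneg_left (norm_dH_le _ _) (by positivity)))
  rw [contOp_apply]
  change ‖mulH k a (symDiffH k (1 / p) (symDiffH k (1 / p) _))
    + mulH k b (symDiffH k (1 / p) _) + mulH k c _ + gridJump ν p _ _ - _‖ ≤ _
  have t1 := (norm_mulH_le ha _).trans (mul_le_mul_of_nonneg_left e1
    (show 0 ≤ (k + 1) * 2 ^ k * K by positivity))
  have t2 := (norm_mulH_le hb _).trans (mul_le_mul_of_nonneg_left e2
    (show 0 ≤ (k + 1) * 2 ^ k * K by positivity))
  rw [map_sub] at t1 t2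
  refine le_trans (le_of_eq ?_) ((norm_add_le_of_le (norm_add_le_of_le t1 t2) e3).trans
    (le_of_eq ?_))
  · congr 1
    abel
  · unfold gridConst
    ring

theorem dH_zero_schemeOp (hν : IsLevyMeasure ν) (hp : 0 < p) (ha : Coef k K a) (hb : Coef k K b)
    (hc : Coef k K c) (g : HSob k) : dH k 0 (schemeOp k ν p a b c g)
      = mulL2 volume a (symDiffR (1 / p) (symDiffR (1 / p) (dH k 0 g)))
        + mulL2 volume b (symDiffR (1 / p) (dH k 0 g)) + mulL2 volume c (dH k 0 g)
        + gridJumpR ν p (dH k 0 g) := by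
  change dH k 0 (mulH k a (symDiffH k (1 / p) (symDiffH k (1 / p) g))
    + mulH k b (symDiffH k (1 / p) g) + mulH k c g
    + gridJump ν p (fun i => shiftH k (i * (1 / p))) g) = _
  rw [map_add, map_add, map_add, dH_zero_mulH ha, dH_zero_mulH hb, dH_zero_mulH hc,
    dH_gridJump hν hp (by omega), dH_liftH _ (by omega), dH_liftH _ (by omega)]

/-- The scheme in H^{k'} is the same as in H^k, so a bound in H^m and a consistency estimate in H¹
may be used for one and the same solution. -/
theorem truncH_schemeOp (hν : IsLevyMeasure ν) (hp : 0 < p) (hk : k ≤ k') (ha : Coef k' K a)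
    (hb : Coef k' K b) (hc : Coef k' K c) (g : HSob k') :
    truncH hk (schemeOp k' ν p a b c g) = schemeOp k ν p a b c (truncH hk g) := by
  refine HSob.ext_toL2 ?_
  rw [dH_truncH _ (by omega), dH_zero_schemeOp hν hp ha hb hc,
    dH_zero_schemeOp hν hp (ha.mono hk) (hb.mono hk) (hc.mono hk), dH_truncH _ (by omega)]

end ContinuousOperator

/-! ### The bilinear form of L + J on H¹. -/

section BilinearForm

variable {ν : Measure ℝ} {a b c : ℝ → ℝ} {K : ℝ}

/-- The part of the bilinear form of `L + J` that is paired with the derivative. -/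
def formP (hν : IsLevyMeasure ν) (a b : ℝ → ℝ) : HSob 1 →L[ℝ] L2R :=
  -((dH 1 1).comp (mulH 1 a)) + (mulL2 volume b).comp (dH 1 0)
    - (ContinuousLinearMap.adjoint (smallOp hν)).comp (dH 1 1)

/-- The part of the bilinear form of `L + J` that is paired with the function. -/
def formQ (hν : IsLevyMeasure ν) (c : ℝ → ℝ) : HSob 1 →L[ℝ] L2R :=
  (mulL2 volume c).comp (dH 1 0) + (ContinuousLinearMap.adjoint (largeOp hν)).comp (dH 1 0)

/-- The functional `χ ↦ ((L + J) w, χ)` on `H¹`, for `w ∈ H¹`. -/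
def formF (hν : IsLevyMeasure ν) (a b c : ℝ → ℝ) (w : HSob 1) : HSob 1 →L[ℝ] ℝ :=
  (innerSL ℝ (dH 1 1 w)).comp (formP hν a b) + (innerSL ℝ (dH 1 0 w)).comp (formQ hν c)

theorem formF_apply (hν : IsLevyMeasure ν) (a b c : ℝ → ℝ) (w χ : HSob 1) :
    formF hν a b c w χ
      = inner ℝ (dH 1 1 w) (formP hν a b χ) + inner ℝ (dH 1 0 w) (formQ hν c χ) := rfl

/-- The form is defined with all operators on the side of χ, so that for a fixed χ a weakly
continuous w is paired with functions varying strongly in time. Undoing the adjoints gives the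
familiar expression. -/
theorem formF_eq (hν : IsLevyMeasure ν) (ha : Coef 1 K a) (hb : ContBdd K b) (hc : ContBdd K c)
    (w χ : HSob 1) : formF hν a b c w χ
      = -inner ℝ (dH 1 1 w) (mulL2 volume a (dH 1 1 χ) + mulL2 volume (deriv a) (dH 1 0 χ))
        + inner ℝ (mulL2 volume b (dH 1 1 w)) (dH 1 0 χ)
        - inner ℝ (smallOp hν (dH 1 1 w)) (dH 1 1 χ)
        + inner ℝ (mulL2 volume c (dH 1 0 w)) (dH 1 0 χ)
        + inner ℝ (largeOp hν (dH 1 0 w)) (dH 1 0 χ) := by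
  rw [formF_apply]
  change inner ℝ _ (-dH 1 1 (mulH 1 a χ) + mulL2 volume b (dH 1 0 χ)
    - ContinuousLinearMap.adjoint (smallOp hν) (dH 1 1 χ)) + inner ℝ _ (mulL2 volume c (dH 1 0 χ)
    + ContinuousLinearMap.adjoint (largeOp hν) (dH 1 0 χ)) = _
  rw [inner_sub_right, inner_add_right, inner_neg_right, inner_add_right,
    ContinuousLinearMap.adjoint_inner_right, ContinuousLinearMap.adjoint_inner_right,
    dH_one_mulH ha le_rfl, inner_mulL2_left hb, inner_mulL2_left hc]
  ring

theorem norm_formP_le (hν : IsLevyMeasure ν) (ha : Coef 1 K a) (hb : ContBdd K b) (χ : HSob 1) :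
    ‖formP hν a b χ‖ ≤ (5 * K + levyMu2 ν) * ‖χ‖ := by
  have h2 := levyMu2_nonneg ν
  have hK := ha.nonneg
  have t1 : ‖-dH 1 1 (mulH 1 a χ)‖ ≤ 4 * K * ‖χ‖ := by
    rw [norm_neg]
    refine (norm_dH_le _ _).trans ((norm_mulH_le ha χ).trans (le_of_eq ?_))
    norm_num
  have t2 := (norm_mulL2_le (μ := volume) hb (dH 1 0 χ)).trans
    (mul_le_mul_of_nonneg_left (norm_dH_le _ _) hK)
  have t3 : ‖ContinuousLinearMap.adjoint (smallOp hν) (dH 1 1 χ)‖ ≤ levyMu2 ν * ‖χ‖ := by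
    refine (ContinuousLinearMap.le_opNorm _ _).trans ?_
    rw [LinearIsometryEquiv.norm_map]
    exact mul_le_mul (ContinuousLinearMap.opNorm_le_bound _ h2 (norm_smallOp_le hν))
      (norm_dH_le _ _) (norm_nonneg _) h2
  refine (norm_sub_le_of_le (norm_add_le_of_le t1 t2) t3).trans (le_of_eq ?_)
  ring

theorem norm_formQ_le (hν : IsLevyMeasure ν) (hc : ContBdd K c) (χ : HSob 1) :
    ‖formQ hν c χ‖ ≤ (K + 2 * levyMu0 ν) * ‖χ‖ := by
  have h0 := levyMu0_nonneg ν
  have hK : 0 ≤ K := (abs_nonneg _).trans (hc.2 0)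
  have t2 := (norm_mulL2_le (μ := volume) hc (dH 1 0 χ)).trans
    (mul_le_mul_of_nonneg_left (norm_dH_le _ _) hK)
  have t3 : ‖ContinuousLinearMap.adjoint (largeOp hν) (dH 1 0 χ)‖ ≤ 2 * levyMu0 ν * ‖χ‖ := by
    refine (ContinuousLinearMap.le_opNorm _ _).trans ?_
    rw [LinearIsometryEquiv.norm_map]
    exact mul_le_mul (ContinuousLinearMap.opNorm_le_bound _ (by positivity) (norm_largeOp_le hν))
      (norm_dH_le _ _) (norm_nonneg _) (by positivity)
  refine (norm_add_le_of_le t2 t3).trans (le_of_eq ?_)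
  ring

/-- The bound of the bilinear form of `L + J` on `H¹`. -/
def formBound (ν : Measure ℝ) (K : ℝ) : ℝ := 6 * K + levyMu2 ν + 2 * levyMu0 ν

theorem formBound_nonneg (ν : Measure ℝ) (hK : 0 ≤ K) : 0 ≤ formBound ν K := by
  have := levyMu2_nonneg ν
  have := levyMu0_nonneg ν
  unfold formBound
  positivity

theorem formF_add (hν : IsLevyMeasure ν) (a b c : ℝ → ℝ) (w w' χ : HSob 1) :
    formF hν a b c (w + w') χ = formF hν a b c w χ + formF hν a b c w' χ := by
  simp only [formF_apply, map_add, inner_add_left]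
  ring

theorem norm_formF_le (hν : IsLevyMeasure ν) (ha : Coef 1 K a) (hb : ContBdd K b)
    (hc : ContBdd K c) (w : HSob 1) : ‖formF hν a b c w‖ ≤ formBound ν K * ‖w‖ := by
  have hB := formBound_nonneg ν ha.nonneg
  refine ContinuousLinearMap.opNorm_le_bound _ (by positivity) fun χ => ?_
  rw [formF_apply]
  have h1 := norm_inner_le_norm (𝕜 := ℝ) (dH 1 1 w) (formP hν a b χ)
  have h2 := norm_inner_le_norm (𝕜 := ℝ) (dH 1 0 w) (formQ hν c χ)
  have h3 := mul_le_mul (norm_dH_le 1 w) (norm_formP_le hν ha hb χ) (norm_nonneg _) (norm_nonneg _)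
  have h4 := mul_le_mul (norm_dH_le 0 w) (norm_formQ_le hν hc χ) (norm_nonneg _) (norm_nonneg _)
  refine (norm_add_le_of_le (h1.trans h3) (h2.trans h4)).trans (le_of_eq ?_)
  rw [formBound]
  ring

/-- The continuous counterpart of the dissipativity of the scheme, for w in H¹. The term with a' is
absorbed by −‖√a w'‖² at the price of K/2; antisymmetry of ∂ gives K/2 for b, the coefficient c
gives K, and both jump parts have the good sign. -/
theorem formF_self_le (hν : IsLevyMeasure ν) (ha : Coef 2 K a) (h0 : ∀ x, 0 ≤ a x)
    (hb : Coef 1 K b) (hc : ContBdd K c) (w : HSob 1) :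
    formF hν a b c w w ≤ 2 * K * ‖dH 1 0 w‖ ^ 2 := by
  obtain ⟨s1, s2, s3, s4⟩ := ha.sqrt_facts h0
  have hK := ha.nonneg
  have ha1 := ha.mono (show 1 ≤ 2 by norm_num)
  have hw := isWeakDeriv_dH one_pos w
  rw [zero_add] at hw
  have hL2 : √(2 * K) ^ 2 = 2 * K := Real.sq_sqrt (by positivity)
  set L := √(2 * K)
  have hL0 : 0 ≤ L := Real.sqrt_nonneg _
  rw [formF_eq hν ha1 hb.contBdd_zero hc, inner_add_right]
  set X := ‖mulL2 volume (fun x => √(a x)) (dH 1 1 w)‖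
  have t1 : inner ℝ (dH 1 1 w) (mulL2 volume a (dH 1 1 w)) = X ^ 2 := by
    rw [← real_inner_self_eq_norm_sq, inner_mulL2_left s1, mulL2_mulL2 s1 s1, s3]
  have hd := ha1.contBdd le_rfl
  rw [iteratedDeriv_one] at hd
  have t2 : -(L * X * ‖dH 1 0 w‖) ≤ inner ℝ (dH 1 1 w) (mulL2 volume (deriv a) (dH 1 0 w)) := by
    rw [← inner_mulL2_left hd]
    refine neg_le_of_abs_le ((abs_real_inner_le_norm _ _).trans ?_)
    exact mul_le_mul_of_nonneg_right (norm_mulL2_le_norm_mulL2 hd s1 s4 _) (norm_nonneg _)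
  have hbd := hb.contBdd le_rfl
  have hbw := hb.isWeakDeriv one_pos hw
  rw [zero_add, iteratedDeriv_zero] at hbw
  have t3 : inner ℝ (mulL2 volume b (dH 1 1 w)) (dH 1 0 w) ≤ K / 2 * ‖dH 1 0 w‖ ^ 2 := by
    have e := hw.inner_eq_neg hbw
    rw [inner_add_right, ← inner_mulL2_left hb.contBdd_zero (dH 1 0 w),
      ← inner_mulL2_left hb.contBdd_zero (dH 1 1 w),
      inner_mulL2_left hb.contBdd_zero (dH 1 0 w)] at e
    have e2 : inner ℝ (dH 1 0 w) (mulL2 volume b (dH 1 1 w))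
        = inner ℝ (mulL2 volume b (dH 1 1 w)) (dH 1 0 w) := real_inner_comm _ _
    have e3 := abs_real_inner_le_norm (dH 1 0 w) (mulL2 volume (iteratedDeriv 1 b) (dH 1 0 w))
    have e4 := mul_le_mul_of_nonneg_left (norm_mulL2_le (μ := volume) hbd (dH 1 0 w))
      (norm_nonneg (dH 1 0 w))
    have e5 := neg_abs_le (inner ℝ (dH 1 0 w) (mulL2 volume (iteratedDeriv 1 b) (dH 1 0 w)))
    nlinarith
  have t4 := hw.inner_smallOp_nonneg hν
  have t5 : inner ℝ (mulL2 volume c (dH 1 0 w)) (dH 1 0 w) ≤ K * ‖dH 1 0 w‖ ^ 2 := by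
    refine (real_inner_le_norm _ _).trans ?_
    rw [sq, ← mul_assoc]
    exact mul_le_mul_of_nonneg_right (norm_mulL2_le hc _) (norm_nonneg _)
  have t6 := inner_largeOp_nonpos hν (dH 1 0 w)
  rw [t1]
  nlinarith [sq_nonneg (X - L / 2 * ‖dH 1 0 w‖)]

/-- With two more derivatives at hand, integration by parts returns the form to the operator. -/
theorem formF_truncH {k k' : ℕ} (hν : IsLevyMeasure ν) (hk : 1 ≤ k) (h : k + 2 ≤ k')
    (ha : Coef k K a) (hb : Coef k K b) (hc : Coef k K c) (g : HSob k') (χ : HSob 1) :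
    formF hν a b c (truncH (by omega) g) χ
      = inner ℝ (dH k 0 (contOp hν h a b c g)) (dH 1 0 χ) := by
  have hχ := isWeakDeriv_dH one_pos χ
  have hg := isWeakDeriv_dH (show 1 < k' by omega) g
  rw [zero_add] at hχ
  have haχ := (ha.mono hk).isWeakDeriv one_pos hχ
  rw [zero_add, iteratedDeriv_zero, iteratedDeriv_one] at haχ
  rw [formF_eq hν (ha.mono hk) hb.contBdd_zero hc.contBdd_zero, dH_zero_contOp hν h ha hb hc,
    dH_truncH _ le_rfl, dH_truncH _ zero_le_one]
  simp only [inner_add_left]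
  have e1 := hg.inner_eq_neg haχ
  have e2 := (hg.map (shiftInvariant_smallOp hν)).inner_eq_neg hχ
  rw [inner_mulL2_left ha.contBdd_zero]
  rw [add_comm (mulL2 volume (deriv a) _)] at e1
  rw [e1, e2]
  ring

end BilinearForm

/-! ### Energy identity and Gronwall inequality for weakly continuous solutions. -/

section Energy

variable {H E : Type*} [NormedAddCommGroup H] [NormedSpace ℝ H] [NormedAddCommGroup E]
  [InnerProductSpace ℝ E]

theorem ceil_sub_div_eq {s δ r : ℝ} (hδ : 0 < δ) {i : ℕ} (h1 : s + i * δ < r)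
    (h2 : r ≤ s + (i + 1) * δ) : ⌈(r - s) / δ⌉ = (i : ℤ) + 1 := by
  rw [Int.ceil_eq_iff, lt_div_iff₀ hδ, div_le_iff₀ hδ]
  push_cast
  constructor <;> linarith

/-- The energy identity for weakly continuous solutions. -/
theorem energy_identity (D : H →L[ℝ] E) {w : ℝ → H} {G : ℝ → H →L[ℝ] ℝ} {B R s t : ℝ}
    (hst : s < t) (hG : ∀ r ∈ Icc s t, ‖G r‖ ≤ B) (hw : ∀ r ∈ Icc s t, ‖w r‖ ≤ R)
    (hwc : ∀ F : H →L[ℝ] ℝ, ContinuousOn (fun r => F (w r)) (Icc s t))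
    (hGi : ∀ χ, IntervalIntegrable (fun r => G r χ) volume s t)
    (heq : ∀ r₁ ∈ Icc s t, ∀ r₂ ∈ Icc s t, ∀ χ,
      inner ℝ (D (w r₂) - D (w r₁)) (D χ) = ∫ r in r₁..r₂, G r χ) :
    IntervalIntegrable (fun r => G r (w r)) volume s t ∧
      ‖D (w t)‖ ^ 2 - ‖D (w s)‖ ^ 2 = 2 * ∫ r in s..t, G r (w r) := by
  have hR : 0 ≤ R := (norm_nonneg _).trans (hw s (left_mem_Icc.2 hst.le))
  have hB : 0 ≤ B := (norm_nonneg _).trans (hG s (left_mem_Icc.2 hst.le))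
  set δ : ℕ → ℝ := fun n => (t - s) / (n + 1) with hδdef
  have hδ : ∀ n, 0 < δ n := fun n => div_pos (sub_pos.2 hst) (by positivity)
  have hδn : ∀ n : ℕ, ((n : ℝ) + 1) * δ n = t - s := fun n => by
    simp only [hδdef]; field_simp
  -- On each subinterval the equation for the increment is tested with the sum of the two endpoint
  -- values; by (x − y, x + y) = ‖x‖² − ‖y‖² the sum telescopes exactly. As the mesh shrinks, both
  -- endpoints tend to r, and weak continuity with dominated convergence gives 2 G r (w r).
  set F : ℕ → ℝ → ℝ := fun n r => G r (w (s + ⌈(r - s) / δ n⌉ * δ n)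
    + w (s + (⌈(r - s) / δ n⌉ - 1) * δ n)) with hF
  have hnode : ∀ n i : ℕ, i ≤ n + 1 → s + i * δ n ∈ Icc s t := fun n i hi => by
    have h1 : (i : ℝ) ≤ n + 1 := by exact_mod_cast hi
    have h2 := mul_le_mul_of_nonneg_right h1 (hδ n).le
    rw [hδn] at h2
    exact ⟨by have := mul_nonneg (Nat.cast_nonneg (α := ℝ) i) (hδ n).le; linarith, by linarith⟩
  have hEq : ∀ n i : ℕ, i < n + 1 → EqOn
      (fun r => G r (w (s + (i + 1 : ℕ) * δ n) + w (s + i * δ n))) (F n)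
      (uIoc (s + i * δ n) (s + (i + 1 : ℕ) * δ n)) := fun n i hi r hr => by
    rw [uIoc_of_le (by push_cast; nlinarith [hδ n])] at hr
    push_cast at hr
    simp only [hF, ceil_sub_div_eq (hδ n) hr.1 hr.2]
    push_cast
    rw [add_sub_cancel_right]
  have hsub : ∀ n i : ℕ, i < n + 1 →
      uIcc (s + i * δ n) (s + (i + 1 : ℕ) * δ n) ⊆ uIcc s t := fun n i hi => by
    rw [uIcc_of_le hst.le]
    exact (convex_Icc s t).ordConnected.uIcc_subset (hnode n i hi.le) (hnode n (i + 1) hi)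
  have hFi : ∀ n i : ℕ, i < n + 1 →
      IntervalIntegrable (F n) volume (s + i * δ n) (s + (i + 1 : ℕ) * δ n) := fun n i hi =>
    ((hGi _).mono_set (hsub n i hi)).congr (hEq n i hi)
  have hend : ∀ n : ℕ, s + (n + 1 : ℕ) * δ n = t := fun n => by
    push_cast; rw [hδn]; ring
  have hFint : ∀ n, IntervalIntegrable (F n) volume s t := fun n => by
    have := IntervalIntegrable.trans_iterate (a := fun i : ℕ => s + i * δ n) (hFi n)
    simpa only [Nat.cast_zero, zero_mul, add_zero, hend] using this
  have hsum : ∀ n, ∫ r in s..t, F n r = ‖D (w t)‖ ^ 2 - ‖D (w s)‖ ^ 2 := fun n => by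
    have := intervalIntegral.sum_integral_adjacent_intervals
      (a := fun i : ℕ => s + i * δ n) (hFi n)
    simp only [Nat.cast_zero, zero_mul, add_zero, hend] at this
    rw [← this]
    have h1 : ∀ i ∈ Finset.range (n + 1), ∫ r in (s + i * δ n)..(s + (i + 1 : ℕ) * δ n), F n r
        = ‖D (w (s + (i + 1 : ℕ) * δ n))‖ ^ 2 - ‖D (w (s + i * δ n))‖ ^ 2 := fun i hi => by
      rw [Finset.mem_range] at hi
      rw [← intervalIntegral.integral_congr_ae (Filter.Eventually.of_forall fun r hr =>
        hEq n i hi hr), ← heq _ (hnode n i hi.le) _ (hnode n (i + 1) hi), map_add,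
        inner_sub_left, inner_add_right, inner_add_right, real_inner_self_eq_norm_sq,
        real_inner_self_eq_norm_sq, real_inner_comm (D (w (s + i * δ n)))]
      ring
    rw [Finset.sum_congr rfl h1,
      Finset.sum_range_sub (fun i : ℕ => ‖D (w (s + i * δ n))‖ ^ 2), hend]
    simp
  have hce : ∀ n, ∀ r ∈ Ioc s t, s + ⌈(r - s) / δ n⌉ * δ n ∈ Icc s t ∧
      s + (⌈(r - s) / δ n⌉ - 1) * δ n ∈ Icc s t ∧ |s + ⌈(r - s) / δ n⌉ * δ n - r| ≤ δ n ∧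
      |s + (⌈(r - s) / δ n⌉ - 1) * δ n - r| ≤ δ n := fun n r hr => by
    have h1 := Int.le_ceil ((r - s) / δ n)
    have h2 := Int.ceil_lt_add_one ((r - s) / δ n)
    have h3 : (1 : ℝ) ≤ ⌈(r - s) / δ n⌉ := by
      exact_mod_cast Int.one_le_ceil_iff.2 (div_pos (sub_pos.2 hr.1) (hδ n))
    have h4 : (⌈(r - s) / δ n⌉ : ℝ) ≤ n + 1 := by
      have : ⌈(r - s) / δ n⌉ ≤ ((n + 1 : ℕ) : ℤ) := by
        rw [Int.ceil_le, div_le_iff₀ (hδ n)]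
        push_cast
        rw [hδn]
        linarith [hr.2]
      exact_mod_cast this
    rw [div_le_iff₀ (hδ n)] at h1
    have h2' : (⌈(r - s) / δ n⌉ - 1) * δ n < r - s := by
      rw [← lt_div_iff₀ (hδ n)]; linarith
    have h5 := mul_le_mul_of_nonneg_right h4 (hδ n).le
    have h6 := mul_le_mul_of_nonneg_right h3 (hδ n).le
    rw [hδn] at h5
    have := hδ n
    simp only [mem_Icc, abs_le]
    refine ⟨⟨?_, ?_⟩, ⟨?_, ?_⟩, ⟨?_, ?_⟩, ⟨?_, ?_⟩⟩ <;> linarith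
  have hδ0 : Filter.Tendsto δ Filter.atTop (nhds 0) := by
    have := (tendsto_one_div_add_atTop_nhds_zero_nat (𝕜 := ℝ)).const_mul (t - s)
    simpa only [hδdef, mul_one_div, mul_zero] using this
  have hconv : ∀ (q : ℕ → ℝ) (r : ℝ), r ∈ Icc s t → (∀ n, q n ∈ Icc s t) →
      (∀ n, |q n - r| ≤ δ n) → ∀ F : H →L[ℝ] ℝ,
      Filter.Tendsto (fun n => F (w (q n))) Filter.atTop (nhds (F (w r))) := by
    intro q r hr hq hqr F
    refine (hwc F r hr).tendsto.comp (tendsto_nhdsWithin_iff.2 ⟨?_, .of_forall hq⟩)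
    rw [tendsto_iff_dist_tendsto_zero]
    exact squeeze_zero (fun _ => dist_nonneg) hqr hδ0
  have hbd : ∀ n, ∀ r ∈ Ioc s t, ‖F n r‖ ≤ B * (2 * R) := fun n r hr => by
    obtain ⟨h1, h2, -, -⟩ := hce n r hr
    refine (ContinuousLinearMap.le_opNorm _ _).trans ?_
    refine mul_le_mul (hG r ⟨hr.1.le, hr.2⟩) ?_ (norm_nonneg _) hB
    rw [two_mul]
    exact norm_add_le_of_le (hw _ h1) (hw _ h2)
  have hpt : ∀ r ∈ Ioc s t, Filter.Tendsto (fun n => F n r) Filter.atTop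
      (nhds (2 * G r (w r))) := fun r hr => by
    have hr' : r ∈ Icc s t := ⟨hr.1.le, hr.2⟩
    have h1 := hconv (fun n => s + ⌈(r - s) / δ n⌉ * δ n) r hr' (fun n => (hce n r hr).1)
      (fun n => (hce n r hr).2.2.1) (G r)
    have h2 := hconv (fun n => s + (⌈(r - s) / δ n⌉ - 1) * δ n) r hr'
      (fun n => (hce n r hr).2.1) (fun n => (hce n r hr).2.2.2) (G r)
    rw [two_mul]
    simpa only [hF, map_add] using h1.add h2
  -- Measurability of r ↦ G r (w r) is not assumed; it is inherited from the approximations.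
  have hmeas : AEStronglyMeasurable (fun r => 2 * G r (w r)) (volume.restrict (uIoc s t)) := by
    refine aestronglyMeasurable_of_tendsto_ae (u := Filter.atTop) (f := F)
      (fun n => (intervalIntegrable_iff.1 (hFint n)).aestronglyMeasurable) ?_
    rw [uIoc_of_le hst.le]
    exact (ae_restrict_iff' measurableSet_Ioc).2 (.of_forall hpt)
  have hlim := intervalIntegral.tendsto_integral_filter_of_dominated_convergence
    (μ := volume) (a := s) (b := t) (l := Filter.atTop) (F := F) (f := fun r => 2 * G r (w r))
    (fun _ => B * (2 * R))
    (.of_forall fun n => (intervalIntegrable_iff.1 (hFint n)).aestronglyMeasurable)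
    (.of_forall fun n => .of_forall fun r hr => hbd n r (by rwa [uIoc_of_le hst.le] at hr))
    intervalIntegrable_const
    (.of_forall fun r hr => hpt r (by rwa [uIoc_of_le hst.le] at hr))
  simp only [hsum] at hlim
  have hres := tendsto_nhds_unique hlim tendsto_const_nhds
  rw [intervalIntegral.integral_const_mul] at hres
  refine ⟨?_, hres.symm⟩
  have hi : IntervalIntegrable (fun r => 2 * G r (w r)) volume s t := by
    refine (intervalIntegrable_const (c := B * (2 * R))).mono_fun hmeas ?_
    rw [uIoc_of_le hst.le]
    refine (ae_restrict_iff' measurableSet_Ioc).2 (.of_forall fun r hr => ?_)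
    have hr' : r ∈ Icc s t := ⟨hr.1.le, hr.2⟩
    change ‖2 * G r (w r)‖ ≤ ‖B * (2 * R)‖
    rw [norm_mul, Real.norm_of_nonneg (show 0 ≤ B * (2 * R) by positivity), Real.norm_two]
    have := (ContinuousLinearMap.le_opNorm (G r) (w r)).trans
      (mul_le_mul (hG r hr') (hw r hr') (norm_nonneg _) hB)
    linarith
  have := hi.const_mul (1 / 2)
  refine this.congr fun r _ => ?_
  ring

/-- The energy identity supplies continuity of ‖D w‖², although w is only weakly continuous. Since r
↦ G r (w r) is merely integrable, the comparison runs through right difference quotients rather than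
derivatives. -/
theorem energy_gronwall (D : H →L[ℝ] E) {w : ℝ → H} {G : ℝ → H →L[ℝ] ℝ} {B R N ε s t : ℝ}
    (hst : s < t) (hG : ∀ r ∈ Icc s t, ‖G r‖ ≤ B) (hw : ∀ r ∈ Icc s t, ‖w r‖ ≤ R)
    (hwc : ∀ F : H →L[ℝ] ℝ, ContinuousOn (fun r => F (w r)) (Icc s t))
    (hGi : ∀ χ, IntervalIntegrable (fun r => G r χ) volume s t)
    (heq : ∀ r₁ ∈ Icc s t, ∀ r₂ ∈ Icc s t, ∀ χ,
      inner ℝ (D (w r₂) - D (w r₁)) (D χ) = ∫ r in r₁..r₂, G r χ)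
    (hle : ∀ r ∈ Icc s t, G r (w r) ≤ N * ‖D (w r)‖ ^ 2 + ε) :
    ‖D (w t)‖ ^ 2 ≤ gronwallBound (‖D (w s)‖ ^ 2) (2 * N) (2 * ε) (t - s) := by
  have hid : ∀ x ∈ Icc s t, ∀ z ∈ Icc s t, x < z →
      IntervalIntegrable (fun r => G r (w r)) volume x z ∧
      ‖D (w z)‖ ^ 2 - ‖D (w x)‖ ^ 2 = 2 * ∫ r in x..z, G r (w r) := fun x hx z hz hxz => by
    have hs : Icc x z ⊆ Icc s t := Icc_subset_Icc hx.1 hz.2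
    refine energy_identity D hxz (fun r hr => hG r (hs hr)) (fun r hr => hw r (hs hr))
      (fun F => (hwc F).mono hs) (fun χ => (hGi χ).mono_set ?_)
      (fun r₁ h₁ r₂ h₂ χ => heq r₁ (hs h₁) r₂ (hs h₂) χ)
    rwa [uIcc_of_le hxz.le, uIcc_of_le hst.le]
  have hsm := left_mem_Icc.2 hst.le
  have htm := right_mem_Icc.2 hst.le
  have hI := (hid s hsm t htm hst).1
  have hc : ContinuousOn (fun x => ‖D (w x)‖ ^ 2) (Icc s t) := by
    have h1 := intervalIntegral.continuousOn_primitive_interval' hI left_mem_uIcc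
    rw [uIcc_of_le hst.le] at h1
    refine ((continuousOn_const (c := (2 : ℝ)).mul h1).add
      (continuousOn_const (c := ‖D (w s)‖ ^ 2))).congr fun x hx => ?_
    rcases hx.1.eq_or_lt with rfl | h
    · simp
    · change _ = 2 * (∫ r in s..x, G r (w r)) + ‖D (w s)‖ ^ 2
      rw [← (hid s hsm x hx h).2]
      ring
  refine le_gronwallBound_of_liminf_deriv_right_le (a := s) (b := t)
    (f' := fun x => 2 * (N * ‖D (w x)‖ ^ 2 + ε)) hc ?_ le_rfl (fun x _ => by linarith) t htm
  intro x hx q hq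
  refine Filter.Eventually.frequently ?_
  have hx' : x ∈ Icc s t := ⟨hx.1, hx.2.le⟩
  -- The threshold is the midpoint between q and the claimed bound at x. By continuity of the bound
  -- it holds throughout a short interval to the right of x, and so for the averages of the energy.
  have hev : ∀ᶠ y in nhdsWithin x (Icc s t), 2 * (N * ‖D (w y)‖ ^ 2 + ε) < (q +
      2 * (N * ‖D (w x)‖ ^ 2 + ε)) / 2 := by
    have : ContinuousOn (fun y => 2 * (N * ‖D (w y)‖ ^ 2 + ε)) (Icc s t) := by fun_prop
    exact (this x hx').eventually_lt_const (by simp only; linarith)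
  rw [eventually_nhdsWithin_iff, Metric.eventually_nhds_iff] at hev
  obtain ⟨η, hη, hev⟩ := hev
  have h3 : ∀ᶠ z in nhdsWithin x (Ioi x), z < x + η ∧ z < t :=
    nhdsWithin_le_nhds ((gt_mem_nhds (by linarith)).and (gt_mem_nhds hx.2))
  filter_upwards [h3, self_mem_nhdsWithin] with z hz hxz
  rw [mem_Ioi] at hxz
  have hz' : z ∈ Icc s t := ⟨hx.1.trans hxz.le, hz.2.le⟩
  obtain ⟨h4, h5⟩ := hid x hx' z hz' hxz
  set q' := (q + 2 * (N * ‖D (w x)‖ ^ 2 + ε)) / 2 with hq'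
  have h6 : ∫ r in x..z, G r (w r) ≤ ∫ _ in x..z, q' / 2 := by
    refine intervalIntegral.integral_mono_on hxz.le h4 intervalIntegrable_const fun r hr => ?_
    have hr' : r ∈ Icc s t := ⟨hx.1.trans hr.1, hr.2.trans hz'.2⟩
    have := hev (y := r) (by rw [Real.dist_eq, abs_of_nonneg (by linarith [hr.1])]; linarith [hr.2, hz.1]) hr'
    linarith [hle r hr']
  rw [intervalIntegral.integral_const, smul_eq_mul] at h6
  have h7 : (z - x)⁻¹ * (‖D (w z)‖ ^ 2 - ‖D (w x)‖ ^ 2) ≤ q' := by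
    rw [inv_mul_le_iff₀ (by linarith), h5]
    linarith
  refine h7.trans_lt ?_
  linarith

end Energy

/-! ### Hölder dependence of the form on time. -/

section TimeDependence

/-- The modulus of continuity `√(C r^γ)`. -/
def holderMod (C γ r : ℝ) : ℝ := √(C * r ^ γ)

theorem holderMod_nonneg (C γ r : ℝ) : 0 ≤ holderMod C γ r := Real.sqrt_nonneg _

theorem tendsto_holderMod (C : ℝ) {γ : ℝ} (hγ : 0 < γ) :
    Filter.Tendsto (holderMod C γ) (nhds 0) (nhds 0) := by
  have h : ContinuousAt (fun r : ℝ => √(C * r ^ γ)) 0 :=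
    ((Real.continuousAt_rpow_const 0 γ (.inr hγ.le)).const_mul C).sqrt
  have := h.tendsto
  rwa [Real.zero_rpow hγ.ne', mul_zero, Real.sqrt_zero] at this

theorem holderMod_mono {C γ r s : ℝ} (hC : 0 ≤ C) (hγ : 0 < γ) (hr : 0 ≤ r) (hrs : r ≤ s) :
    holderMod C γ r ≤ holderMod C γ s :=
  Real.sqrt_le_sqrt (mul_le_mul_of_nonneg_left (Real.rpow_le_rpow hr hrs hγ.le) hC)

/-- The assumptions on the coefficients: `k` derivatives bounded by `K`, nonnegativity of `a`, and
Hölder continuity in time of the coefficients and of their first derivatives. -/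
structure TimeCoef (T K C γ : ℝ) (k : ℕ) (a b c : ℝ → ℝ → ℝ) : Prop where
  coef_a : ∀ t ∈ Icc (0 : ℝ) T, Coef (max k 2) K (a t)
  coef_b : ∀ t ∈ Icc (0 : ℝ) T, Coef k K (b t)
  coef_c : ∀ t ∈ Icc (0 : ℝ) T, Coef k K (c t)
  nonneg : ∀ t ∈ Icc (0 : ℝ) T, ∀ x, 0 ≤ a t x
  sub_a : ∀ t ∈ Icc (0 : ℝ) T, ∀ s ∈ Icc (0 : ℝ) T,
    Coef 1 (holderMod C γ |t - s|) fun x => a t x - a s x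
  sub_b : ∀ t ∈ Icc (0 : ℝ) T, ∀ s ∈ Icc (0 : ℝ) T,
    Coef 1 (holderMod C γ |t - s|) fun x => b t x - b s x
  sub_c : ∀ t ∈ Icc (0 : ℝ) T, ∀ s ∈ Icc (0 : ℝ) T,
    Coef 1 (holderMod C γ |t - s|) fun x => c t x - c s x

variable {T K C γ : ℝ} {k : ℕ} {a b c : ℝ → ℝ → ℝ} {ν : Measure ℝ}

theorem continuousOn_of_holderMod (hγ : 0 < γ) {E : Type*} [NormedAddCommGroup E] {F : ℝ → E}
    {S : Set ℝ} {R : ℝ} (h : ∀ t ∈ S, ∀ s ∈ S, ‖F t - F s‖ ≤ R * holderMod C γ |t - s|) :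
    ContinuousOn F S := by
  intro s hs
  have h1 : Filter.Tendsto (fun t => R * holderMod C γ |t - s|) (nhdsWithin s S) (nhds 0) := by
    have h2 : Filter.Tendsto (fun t : ℝ => |t - s|) (nhds s) (nhds 0) := by
      have : Continuous fun t : ℝ => |t - s| := by fun_prop
      simpa using this.tendsto s
    have := (((tendsto_holderMod C hγ).comp h2).const_mul R).mono_left
      (nhdsWithin_le_nhds (s := S))
    simpa using this
  refine tendsto_iff_norm_sub_tendsto_zero.2 (squeeze_zero' (.of_forall fun _ => norm_nonneg _)
    ?_ h1)
  filter_upwards [self_mem_nhdsWithin] with t ht using h t ht s hs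

/-- The form is linear in the coefficients and the jump part does not depend on time, so only
differences of coefficients remain; these are controlled with one derivative. -/
theorem norm_formP_sub_le (hν : IsLevyMeasure ν) (h : TimeCoef T K C γ k a b c) (hk : 1 ≤ k)
    {t s : ℝ} (ht : t ∈ Icc 0 T) (hs : s ∈ Icc 0 T) (χ : HSob 1) :
    ‖formP hν (a t) (b t) χ - formP hν (a s) (b s) χ‖ ≤ 5 * holderMod C γ |t - s| * ‖χ‖ := by
  have ha := fun t ht => (h.coef_a t ht).mono (hk.trans (le_max_left k 2))
  have e : formP hν (a t) (b t) χ - formP hν (a s) (b s) χ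
      = -dH 1 1 (mulH 1 (fun x => a t x - a s x) χ)
        + mulL2 volume (fun x => b t x - b s x) (dH 1 0 χ) := by
    rw [mulH_sub (ha t ht) (ha s hs), mulL2_sub (h.coef_b t ht).contBdd_zero
      (h.coef_b s hs).contBdd_zero, map_sub]
    change (-dH 1 1 (mulH 1 (a t) χ) + mulL2 volume (b t) (dH 1 0 χ) - _)
      - (-dH 1 1 (mulH 1 (a s) χ) + mulL2 volume (b s) (dH 1 0 χ) - _) = _
    abel
  rw [e]
  have t1 : ‖-dH 1 1 (mulH 1 (fun x => a t x - a s x) χ)‖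
      ≤ 4 * holderMod C γ |t - s| * ‖χ‖ := by
    rw [norm_neg]
    refine (norm_dH_le _ _).trans ((norm_mulH_le (h.sub_a t ht s hs) χ).trans (le_of_eq ?_))
    norm_num
  have t2 := (norm_mulL2_le (μ := volume) (h.sub_b t ht s hs).contBdd_zero (dH 1 0 χ)).trans
    (mul_le_mul_of_nonneg_left (norm_dH_le _ _) (holderMod_nonneg _ _ _))
  refine (norm_add_le_of_le t1 t2).trans (le_of_eq ?_)
  ring

theorem norm_formQ_sub_le (hν : IsLevyMeasure ν) (h : TimeCoef T K C γ k a b c)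
    {t s : ℝ} (ht : t ∈ Icc 0 T) (hs : s ∈ Icc 0 T) (χ : HSob 1) :
    ‖formQ hν (c t) χ - formQ hν (c s) χ‖ ≤ holderMod C γ |t - s| * ‖χ‖ := by
  have e : formQ hν (c t) χ - formQ hν (c s) χ
      = mulL2 volume (fun x => c t x - c s x) (dH 1 0 χ) := by
    rw [mulL2_sub (h.coef_c t ht).contBdd_zero (h.coef_c s hs).contBdd_zero]
    change (mulL2 volume (c t) (dH 1 0 χ) + _) - (mulL2 volume (c s) (dH 1 0 χ) + _) = _
    abel
  rw [e]
  exact (norm_mulL2_le (μ := volume) (h.sub_c t ht s hs).contBdd_zero (dH 1 0 χ)).trans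
    (mul_le_mul_of_nonneg_left (norm_dH_le _ _) (holderMod_nonneg _ _ _))

theorem abs_formF_sub_le (hν : IsLevyMeasure ν) (h : TimeCoef T K C γ k a b c) (hk : 1 ≤ k)
    {t s : ℝ} (ht : t ∈ Icc 0 T) (hs : s ∈ Icc 0 T) (w χ : HSob 1) :
    |formF hν (a t) (b t) (c t) w χ - formF hν (a s) (b s) (c s) w χ|
      ≤ 6 * holderMod C γ |t - s| * ‖w‖ * ‖χ‖ := by
  rw [formF_apply, formF_apply, add_sub_add_comm, ← inner_sub_right, ← inner_sub_right]
  have h1 := norm_inner_le_norm (𝕜 := ℝ) (dH 1 1 w)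
    (formP hν (a t) (b t) χ - formP hν (a s) (b s) χ)
  have h2 := norm_inner_le_norm (𝕜 := ℝ) (dH 1 0 w) (formQ hν (c t) χ - formQ hν (c s) χ)
  have h3 := mul_le_mul (norm_dH_le 1 w) (norm_formP_sub_le hν h hk ht hs χ)
    (norm_nonneg _) (norm_nonneg _)
  have h4 := mul_le_mul (norm_dH_le 0 w) (norm_formQ_sub_le hν h ht hs χ)
    (norm_nonneg _) (norm_nonneg _)
  refine (norm_add_le_of_le (h1.trans h3) (h2.trans h4)).trans (le_of_eq ?_)
  ring

/-- The pairing of a bounded weakly continuous function with a strongly continuous one is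
continuous. -/
theorem continuousOn_inner_of_weak {S : Set ℝ} {w : ℝ → HSob 1} {B : ℝ}
    (hB : ∀ t ∈ S, ‖w t‖ ≤ B) (hw : ∀ F : HSob 1 →L[ℝ] ℝ, ContinuousOn (fun t => F (w t)) S)
    (j : ℕ) {x : ℝ → L2R} (hx : ContinuousOn x S) :
    ContinuousOn (fun t => inner ℝ (dH 1 j (w t)) (x t)) S := by
  intro s hs
  have h1 : Filter.Tendsto (fun t => inner ℝ (dH 1 j (w t)) (x s)) (nhdsWithin s S)
      (nhds (inner ℝ (dH 1 j (w s)) (x s))) := by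
    have := hw ((innerSL ℝ (x s)).comp (dH 1 j)) s hs
    simp only [ContinuousWithinAt, ContinuousLinearMap.comp_apply, innerSL_apply_apply] at this
    simpa only [real_inner_comm] using this
  have h2 : Filter.Tendsto (fun t => inner ℝ (dH 1 j (w t)) (x t - x s)) (nhdsWithin s S)
      (nhds 0) := by
    have h3 : Filter.Tendsto (fun t => B * ‖x t - x s‖) (nhdsWithin s S) (nhds 0) := by
      have := (tendsto_iff_norm_sub_tendsto_zero.1 (hx s hs)).const_mul B
      simpa using this
    refine squeeze_zero_norm' ?_ h3
    filter_upwards [self_mem_nhdsWithin] with t ht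
    refine (norm_inner_le_norm _ _).trans (mul_le_mul_of_nonneg_right ?_ (norm_nonneg _))
    exact (norm_dH_le _ _).trans (hB t ht)
  have h4 := h2.add h1
  simp only [← inner_add_right, sub_add_cancel, zero_add] at h4
  exact h4

theorem continuousOn_formF (hν : IsLevyMeasure ν) (h : TimeCoef T K C γ k a b c) (hk : 1 ≤ k)
    (hγ : 0 < γ) {S : Set ℝ} (hS : S ⊆ Icc 0 T) {w : ℝ → HSob 1} {B : ℝ}
    (hB : ∀ t ∈ S, ‖w t‖ ≤ B) (hw : ∀ F : HSob 1 →L[ℝ] ℝ, ContinuousOn (fun t => F (w t)) S)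
    (χ : HSob 1) : ContinuousOn (fun t => formF hν (a t) (b t) (c t) (w t) χ) S := by
  simp only [formF_apply]
  refine (continuousOn_inner_of_weak hB hw 1 ?_).add (continuousOn_inner_of_weak hB hw 0 ?_)
  · refine continuousOn_of_holderMod (C := C) (R := 5 * ‖χ‖) hγ fun t ht s hs =>
      (norm_formP_sub_le hν h hk (hS ht) (hS hs) χ).trans (le_of_eq ?_)
    ring
  · refine continuousOn_of_holderMod (C := C) (R := ‖χ‖) hγ fun t ht s hs =>
      (norm_formQ_sub_le hν h (hS ht) (hS hs) χ).trans (le_of_eq ?_)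
    ring

end TimeDependence

/-! ### The weak formulation, tested with elements of H¹. -/

section WeakEquation

variable {ν : Measure ℝ}

/-- Weak continuity on a compact set gives pointwise bounded functionals, and the uniform
boundedness principle applies. -/
theorem exists_bound_of_weak {H : Type*} [NormedAddCommGroup H] [InnerProductSpace ℝ H]
    [CompleteSpace H] {S : Set ℝ} (hS : IsCompact S) {w : ℝ → H}
    (hw : ∀ F : H →L[ℝ] ℝ, ContinuousOn (fun t => F (w t)) S) : ∃ B, ∀ t ∈ S, ‖w t‖ ≤ B := by
  obtain ⟨B, hB⟩ := banach_steinhaus (g := fun t : S => innerSL ℝ (w t)) fun x => by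
    obtain ⟨C, hC⟩ := hS.exists_bound_of_continuousOn (hw (innerSL ℝ x))
    refine ⟨C, fun t => ?_⟩
    have := hC t t.2
    rwa [innerSL_apply_apply, real_inner_comm] at this
  exact ⟨B, fun t ht => by simpa using hB ⟨t, ht⟩⟩

variable {φ : ℝ → ℝ}

theorem integral_local_eq {a b c : ℝ → ℝ} {K : ℝ} (ha : Coef 1 K a) (hb : ContBdd K b)
    (hc : ContBdd K c) (hφ : IsTestFn φ) (w : HSob 1) :
    (∫ x, w.dx x * (-(φ x * deriv a x) - a x * deriv φ x + b x * φ x))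
        + ∫ x, c x * w.toL2 x * φ x
      = -inner ℝ (dH 1 1 w) (mulL2 volume a (dH 1 1 (testH 1 hφ))
          + mulL2 volume (deriv a) (dH 1 0 (testH 1 hφ)))
        + inner ℝ (mulL2 volume b (dH 1 1 w)) (dH 1 0 (testH 1 hφ))
        + inner ℝ (mulL2 volume c (dH 1 0 w)) (dH 1 0 (testH 1 hφ)) := by
  have ha' := ha.contBdd le_rfl
  rw [iteratedDeriv_one] at ha'
  rw [dH_testH le_rfl, dH_testH zero_le_one, iteratedDeriv_one, iteratedDeriv_zero,
    ← inner_neg_right, inner_mulL2_left hb, ← inner_add_right, inner_toL2 hφ.memLp,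
    inner_eq_integral_mul, dH_zero, dH_one]
  congr 1
  · refine integral_congr_ae ?_
    filter_upwards [toL2_ae hφ.memLp, toL2_ae hφ.deriv.memLp,
      mulL2_ae ha.contBdd_zero (toL2 (deriv φ)), mulL2_ae ha' (toL2 φ), mulL2_ae hb (toL2 φ),
      Lp.coeFn_add (-(mulL2 volume a (toL2 (deriv φ)) + mulL2 volume (deriv a) (toL2 φ)))
        (mulL2 volume b (toL2 φ)),
      Lp.coeFn_neg (mulL2 volume a (toL2 (deriv φ)) + mulL2 volume (deriv a) (toL2 φ)),
      Lp.coeFn_add (mulL2 volume a (toL2 (deriv φ))) (mulL2 volume (deriv a) (toL2 φ))]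
      with x h1 h2 h3 h4 h5 h6 h7 h8
    rw [h6, Pi.add_apply, h7, Pi.neg_apply, h8, Pi.add_apply, h3, h4, h5, h1, h2]
    ring
  · refine integral_congr_ae ?_
    filter_upwards [mulL2_ae hc w.toL2] with x h1
    rw [h1]

theorem integral_shiftR_eq (hφ : IsTestFn φ) (g : L2R) (y : ℝ) :
    ∫ x, g (x + y) * φ x = inner ℝ (shiftR y g) (toL2 φ) := by
  rw [inner_toL2 hφ.memLp]
  refine integral_congr_ae ?_
  filter_upwards [shiftL2_ae y g] with x hx
  rw [hx]

theorem integral_small_eq (hν : IsLevyMeasure ν) (hφ : IsTestFn φ) (g : L2R) :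
    ∫ z in {z : ℝ | |z| ≤ 1}, (∫ θ in (0 : ℝ)..1,
        (1 - θ) * z ^ 2 * ∫ x, g (x + θ * z) * φ x) ∂ν
      = inner ℝ (smallOp hν g) (toL2 φ) := by
  simp only [integral_shiftR_eq hφ, inner_smallOp, inner_avgShift,
    ← intervalIntegral.integral_const_mul]
  congr 1
  funext z
  congr 1
  funext θ
  ring

theorem integral_large_eq (hν : IsLevyMeasure ν) (hφ : IsTestFn φ) (g : L2R) :
    ∫ z in {z : ℝ | 1 < |z|}, (∫ x, (g (x + z) - g x) * φ x) ∂ν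
      = inner ℝ (largeOp hν g) (toL2 φ) := by
  rw [inner_largeOp]
  congr 1
  funext z
  rw [inner_toL2 hφ.memLp]
  refine integral_congr_ae ?_
  filter_upwards [shiftL2_ae z g, Lp.coeFn_sub (shiftR z g) g] with x h1 h2
  rw [h2, Pi.sub_apply, h1]

variable {T K C γ : ℝ} {k m : ℕ} {a b c : ℝ → ℝ → ℝ} {ψ : HSob m} {f : ℝ → HSob m}
  {u : ℝ → HSob 1}

theorem IsPIDESolution.inner_test (hν : IsLevyMeasure ν) (h : TimeCoef T K C γ k a b c)
    (hk : 1 ≤ k) (hγ : 0 < γ) (hf : ContinuousOn (fun t => dH m 0 (f t)) (Icc 0 T))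
    (hu : IsPIDESolution T ν a b c ψ f u) (hφ : IsTestFn φ) {t : ℝ} (ht : t ∈ Icc 0 T) :
    inner ℝ (dH 1 0 (u t)) (toL2 φ) = inner ℝ (dH m 0 ψ) (toL2 φ)
      + ∫ r in (0 : ℝ)..t, (formF hν (a r) (b r) (c r) (u r) (testH 1 hφ)
        + inner ℝ (dH m 0 (f r)) (toL2 φ)) := by
  obtain ⟨B, hB⟩ := exists_bound_of_weak isCompact_Icc hu.weak_cont
  have hst : Icc 0 t ⊆ Icc 0 T := Icc_subset_Icc_right ht.2
  have hII : ∀ F : ℝ → ℝ, ContinuousOn F (Icc 0 T) → IntervalIntegrable F volume 0 t :=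
    fun F hF => (hF.mono hst).intervalIntegrable_of_Icc ht.1
  set χ := testH 1 hφ with hχ
  have h0 : dH 1 0 χ = toL2 φ := by rw [hχ, dH_testH zero_le_one, iteratedDeriv_zero]
  have h1 : dH 1 1 χ = toL2 (deriv φ) := by rw [hχ, dH_testH le_rfl, iteratedDeriv_one]
  have cF : ContinuousOn (fun r => formF hν (a r) (b r) (c r) (u r) χ) (Icc 0 T) :=
    continuousOn_formF hν h hk hγ subset_rfl hB hu.weak_cont χ
  have cS : ContinuousOn (fun r => inner ℝ (smallOp hν (dH 1 1 (u r))) (dH 1 1 χ)) (Icc 0 T) := by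
    have := hu.weak_cont ((innerSL ℝ (dH 1 1 χ)).comp ((smallOp hν).comp (dH 1 1)))
    simp only [ContinuousLinearMap.comp_apply, innerSL_apply_apply] at this
    simpa only [real_inner_comm] using this
  have cL : ContinuousOn (fun r => inner ℝ (largeOp hν (dH 1 0 (u r))) (dH 1 0 χ)) (Icc 0 T) := by
    have := hu.weak_cont ((innerSL ℝ (dH 1 0 χ)).comp ((largeOp hν).comp (dH 1 0)))
    simp only [ContinuousLinearMap.comp_apply, innerSL_apply_apply] at this
    simpa only [real_inner_comm] using this
  have cf : ContinuousOn (fun r => inner ℝ (dH m 0 (f r)) (dH 1 0 χ)) (Icc 0 T) :=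
    hf.inner continuousOn_const
  have cFS : ContinuousOn (fun r => formF hν (a r) (b r) (c r) (u r) χ
      + inner ℝ (smallOp hν (dH 1 1 (u r))) (dH 1 1 χ)) (Icc 0 T) := cF.add cS
  have heq := hu.eqn φ hφ t ht
  simp only [integral_large_eq hν hφ, integral_small_eq hν hφ.deriv,
    ← inner_toL2 hφ.memLp] at heq
  -- The definition of a solution integrates the jump terms separately, whereas the form contains
  -- them. They are taken out again, and continuity in time allows the integrals to be split.
  have e1 : ∫ s in (0 : ℝ)..t,
      ((∫ x, (u s).dx x * (-(φ x * deriv (a s) x) - a s x * deriv φ x + b s x * φ x))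
        + ∫ x, c s x * (u s).toL2 x * φ x)
      = ∫ s in (0 : ℝ)..t, (formF hν (a s) (b s) (c s) (u s) χ
        + inner ℝ (smallOp hν (dH 1 1 (u s))) (dH 1 1 χ)
        - inner ℝ (largeOp hν (dH 1 0 (u s))) (dH 1 0 χ)) := by
    refine intervalIntegral.integral_congr fun s hs => ?_
    rw [uIcc_of_le ht.1] at hs
    have hs' := hst hs
    have ha := (h.coef_a s hs').mono (hk.trans (le_max_left k 2))
    rw [integral_local_eq ha (h.coef_b s hs').contBdd_zero (h.coef_c s hs').contBdd_zero hφ,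
      formF_eq hν ha (h.coef_b s hs').contBdd_zero (h.coef_c s hs').contBdd_zero]
    ring
  simp only [← dH_one, ← dH_zero, ← h0, ← h1] at heq e1 ⊢
  rw [heq, e1, intervalIntegral.integral_sub (hII _ cFS) (hII _ cL),
    intervalIntegral.integral_add (hII _ cF) (hII _ cS),
    intervalIntegral.integral_add (hII _ cF) (hII _ cf)]
  ring

theorem IsPIDESolution.init (hu : IsPIDESolution T ν a b c ψ f u) (hT : 0 ≤ T) :
    dH 1 0 (u 0) = dH m 0 ψ := by
  rw [← sub_eq_zero]
  refine eq_zero_of_inner_test fun φ hφ => ?_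
  have := hu.eqn φ hφ 0 (left_mem_Icc.2 hT)
  simp only [intervalIntegral.integral_same, add_zero, sub_zero] at this
  rw [inner_sub_left, inner_toL2 hφ.memLp, inner_toL2 hφ.memLp, dH_zero, dH_zero, this, sub_self]

/-- Both sides are continuous in χ in the H¹ norm, by the bound on the form, and test functions are
dense. The difference u − v of the energy argument thereby becomes an admissible χ. -/
theorem IsPIDESolution.inner_eq (hν : IsLevyMeasure ν) (h : TimeCoef T K C γ k a b c)
    (hk : 1 ≤ k) (hγ : 0 < γ) (hf : ContinuousOn (fun t => dH m 0 (f t)) (Icc 0 T))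
    (hu : IsPIDESolution T ν a b c ψ f u) {s t : ℝ} (hs : s ∈ Icc 0 T) (ht : t ∈ Icc 0 T)
    (χ : HSob 1) :
    inner ℝ (dH 1 0 (u t) - dH 1 0 (u s)) (dH 1 0 χ)
      = ∫ r in s..t, (formF hν (a r) (b r) (c r) (u r) χ
        + inner ℝ (dH m 0 (f r)) (dH 1 0 χ)) := by
  obtain ⟨B, hB⟩ := exists_bound_of_weak isCompact_Icc hu.weak_cont
  obtain ⟨R, hR⟩ := isCompact_Icc.exists_bound_of_continuousOn hf
  have hB0 : 0 ≤ B := (norm_nonneg _).trans (hB s hs)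
  have hc : ∀ χ, ContinuousOn (fun r => formF hν (a r) (b r) (c r) (u r) χ
      + inner ℝ (dH m 0 (f r)) (dH 1 0 χ)) (Icc 0 T) := fun χ =>
    (continuousOn_formF hν h hk hγ subset_rfl hB hu.weak_cont χ).add
      (hf.inner continuousOn_const)
  have hsub : uIcc s t ⊆ Icc 0 T := (convex_Icc 0 T).ordConnected.uIcc_subset hs ht
  have hII : ∀ χ, IntervalIntegrable (fun r => formF hν (a r) (b r) (c r) (u r) χ
      + inner ℝ (dH m 0 (f r)) (dH 1 0 χ)) volume s t := fun χ =>
    ((hc χ).mono hsub).intervalIntegrable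
  have hbd : ∀ χ, ∀ r ∈ Icc 0 T, ‖formF hν (a r) (b r) (c r) (u r) χ
      + inner ℝ (dH m 0 (f r)) (dH 1 0 χ)‖ ≤ (formBound ν K * B + R) * ‖χ‖ := fun χ r hr => by
    have h1 := norm_formF_le hν ((h.coef_a r hr).mono (hk.trans (le_max_left k 2)))
      (h.coef_b r hr).contBdd_zero (h.coef_c r hr).contBdd_zero (u r)
    have h2 := (ContinuousLinearMap.le_opNorm _ χ).trans (mul_le_mul_of_nonneg_right (h1.trans
      (mul_le_mul_of_nonneg_left (hB r hr) (formBound_nonneg ν (h.coef_a r hr).nonneg)))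
      (norm_nonneg χ))
    have h3 := (norm_inner_le_norm (𝕜 := ℝ) (dH m 0 (f r)) (dH 1 0 χ)).trans (mul_le_mul (hR r hr)
      (norm_dH_le 0 χ) (norm_nonneg _) ((norm_nonneg _).trans (hR r hr)))
    rw [add_mul]
    exact norm_add_le_of_le h2 h3
  refine HSob.dense_induction (P := fun χ => inner ℝ (dH 1 0 (u t) - dH 1 0 (u s)) (dH 1 0 χ)
    = ∫ r in s..t, (formF hν (a r) (b r) (c r) (u r) χ + inner ℝ (dH m 0 (f r)) (dH 1 0 χ)))
    (isClosed_eq (by fun_prop) ?_) (fun φ hφ => ?_) χ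
  · refine continuous_iff_continuousAt.2 fun χ₀ => ?_
    have hR0 : 0 ≤ formBound ν K * B + R :=
      add_nonneg (mul_nonneg (formBound_nonneg ν (h.coef_a s hs).nonneg) hB0)
        ((norm_nonneg _).trans (hR s hs))
    refine intervalIntegral.continuousAt_of_dominated_interval
      (bound := fun _ => (formBound ν K * B + R) * (‖χ₀‖ + 1))
      (.of_forall fun χ => (intervalIntegrable_iff.1 (hII χ)).aestronglyMeasurable) ?_
      intervalIntegrable_const (.of_forall fun r _ => by fun_prop)
    have hev : ∀ᶠ χ in nhds χ₀, ‖χ‖ < ‖χ₀‖ + 1 :=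
      continuous_norm.continuousAt.eventually_lt_const (by simp)
    filter_upwards [hev] with χ hχ
    refine .of_forall fun r hr => (hbd χ r (hsub (uIoc_subset_uIcc hr))).trans ?_
    exact mul_le_mul_of_nonneg_left hχ.le hR0
  · have e0 : dH 1 0 (testH 1 hφ) = toL2 φ := by rw [dH_testH zero_le_one, iteratedDeriv_zero]
    have hI0 : ∀ q ∈ Icc (0 : ℝ) T, IntervalIntegrable
        (fun r => formF hν (a r) (b r) (c r) (u r) (testH 1 hφ)
          + inner ℝ (dH m 0 (f r)) (toL2 φ)) volume 0 q := fun q hq => by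
      have := hc (testH 1 hφ)
      rw [e0] at this
      exact (this.mono (Icc_subset_Icc_right hq.2)).intervalIntegrable_of_Icc hq.1
    rw [e0, inner_sub_left, hu.inner_test hν h hk hγ hf hφ ht, hu.inner_test hν h hk hγ hf hφ hs,
      add_sub_add_left_eq_sub, intervalIntegral.integral_interval_sub_left (hI0 t ht) (hI0 s hs)]

end WeakEquation

/-! ### Piecewise linear interpolation in time. -/

section Interpolation

variable {H : Type*} [NormedAddCommGroup H] [NormedSpace ℝ H]

theorem norm_sub_average_le [CompleteSpace H] {F : ℝ → H} {x y ρ : ℝ} (hxy : x < y)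
    (hF : IntervalIntegrable F volume x y) {w : H} (h : ∀ s ∈ Icc x y, ‖w - F s‖ ≤ ρ) :
    ‖w - (y - x)⁻¹ • ∫ s in x..y, F s‖ ≤ ρ := by
  have hpos : 0 < y - x := sub_pos.2 hxy
  have e : w - (y - x)⁻¹ • ∫ s in x..y, F s = (y - x)⁻¹ • ∫ s in x..y, (w - F s) := by
    rw [intervalIntegral.integral_sub intervalIntegrable_const hF,
      intervalIntegral.integral_const, smul_sub, inv_smul_smul₀ hpos.ne']
  rw [e, norm_smul, Real.norm_of_nonneg (by positivity), inv_mul_le_iff₀ hpos, mul_comm]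
  have := intervalIntegral.norm_integral_le_of_norm_le_const (a := x) (b := y)
    (f := fun s => w - F s) (C := ρ) fun s hs => h s (by
      rw [uIoc_of_le hxy.le] at hs
      exact ⟨hs.1.le, hs.2⟩)
  rwa [abs_of_pos hpos] at this

/-- The continuous piecewise linear interpolation of a time discretization. -/
theorem exists_interpolation [CompleteSpace H] {V W : ℕ → H} {τ ρ : ℝ} (hτ : 0 < τ) {n : ℕ}
    (hn : 0 < n)
    (hV : ∀ i < n, V (i + 1) = V i + τ • W (i + 1)) (hW : ∀ i < n, ‖W (i + 1)‖ ≤ ρ) :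
    ∃ v g : ℝ → H, v 0 = V 0 ∧ v (n * τ) = V n ∧ IntervalIntegrable g volume 0 (n * τ) ∧
      ContinuousOn v (Icc 0 (n * τ)) ∧
      (∀ r₁ ∈ Icc 0 (n * τ), ∀ r₂ ∈ Icc 0 (n * τ), v r₂ - v r₁ = ∫ r in r₁..r₂, g r) ∧
      ∀ r ∈ Icc 0 (n * τ), ∃ i < n, g r = W (i + 1) ∧ r ∈ Icc (i * τ) ((i + 1 : ℕ) * τ) ∧
        ‖v r - V (i + 1)‖ ≤ τ * ρ := by
  -- The slope is constant on the half-open steps (iτ, (i + 1)τ]; the maximum with 1 puts r = 0 into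
  -- the first step, so that W 0 is never used.
  set g : ℝ → H := fun r => W (max 1 ⌈r / τ⌉₊) with hg
  have hgi : ∀ i : ℕ, ∀ r ∈ uIoc (i * τ) ((i + 1 : ℕ) * τ), g r = W (i + 1) := fun i r hr => by
    rw [uIoc_of_le (by push_cast; nlinarith)] at hr
    have : ⌈r / τ⌉₊ = i + 1 := by
      rw [Nat.ceil_eq_iff (by omega), lt_div_iff₀ hτ, div_le_iff₀ hτ]
      exact ⟨hr.1, hr.2⟩
    rw [hg]
    simp only [this]
    rw [max_eq_right (by omega)]
  have hII : ∀ i : ℕ, IntervalIntegrable g volume (i * τ) ((i + 1 : ℕ) * τ) := fun i =>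
    (intervalIntegrable_const (c := W (i + 1))).congr fun r hr => (hgi i r hr).symm
  have hint : ∀ i : ℕ, ∫ r in (i * τ)..((i + 1 : ℕ) * τ), g r = τ • W (i + 1) := fun i => by
    rw [intervalIntegral.integral_congr_ae (.of_forall fun r hr => hgi i r hr),
      intervalIntegral.integral_const]
    congr 1
    push_cast
    ring
  have hI : ∀ i : ℕ, IntervalIntegrable g volume 0 (i * τ) := fun i => by
    have := IntervalIntegrable.trans_iterate (a := fun i : ℕ => i * τ) (n := i) fun k _ => hII k
    simpa using this
  have hsub : ∀ r₁ ∈ Icc 0 (n * τ), ∀ r₂ ∈ Icc 0 (n * τ), IntervalIntegrable g volume r₁ r₂ :=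
    fun r₁ h₁ r₂ h₂ => (hI n).mono_set (by
      rw [uIcc_of_le (show (0 : ℝ) ≤ n * τ by positivity)]
      exact (convex_Icc _ _).ordConnected.uIcc_subset h₁ h₂)
  have h00 : (0 : ℝ) ∈ Icc 0 (n * τ) := left_mem_Icc.2 (by positivity)
  set v : ℝ → H := fun r => V 0 + ∫ s in (0 : ℝ)..r, g s with hv
  have hnode : ∀ i ≤ n, v (i * τ) = V i := by
    intro i
    induction i with
    | zero => intro _; simp [hv]
    | succ i ih =>
      intro hi
      rw [hV i (by omega), ← ih (by omega), ← hint i]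
      simp only [hv]
      rw [add_assoc, intervalIntegral.integral_add_adjacent_intervals (hI i) (hII i)]
  have hdiff : ∀ r₁ ∈ Icc 0 (n * τ), ∀ r₂ ∈ Icc 0 (n * τ), v r₂ - v r₁ = ∫ r in r₁..r₂, g r :=
    fun r₁ h₁ r₂ h₂ => by
    simp only [hv]
    rw [add_sub_add_left_eq_sub, intervalIntegral.integral_interval_sub_left
      (hsub _ h00 _ h₂) (hsub _ h00 _ h₁)]
  refine ⟨v, g, by simp [hv], hnode n le_rfl, hI n, ?_, hdiff, fun r hr => ?_⟩
  · have h1 := intervalIntegral.continuousOn_primitive_interval' (hI n) left_mem_uIcc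
    rw [uIcc_of_le (show (0 : ℝ) ≤ n * τ by positivity)] at h1
    exact continuousOn_const.add h1
  · have h1 : 1 ≤ max 1 ⌈r / τ⌉₊ := le_max_left _ _
    have h2 : ⌈r / τ⌉₊ ≤ n := by
      rw [Nat.ceil_le, div_le_iff₀ hτ]
      exact hr.2
    have h3 : max 1 ⌈r / τ⌉₊ ≤ n := max_le hn h2
    obtain ⟨i, hi⟩ : ∃ i, max 1 ⌈r / τ⌉₊ = i + 1 := ⟨_, (Nat.sub_add_cancel h1).symm⟩
    have hmem : r ∈ Icc (i * τ) ((i + 1 : ℕ) * τ) := by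
      constructor
      · rcases Nat.eq_zero_or_pos i with rfl | hi0
        · simpa using hr.1
        · have : i < ⌈r / τ⌉₊ := by omega
          rw [Nat.lt_ceil, lt_div_iff₀ hτ] at this
          exact this.le
      · rw [← div_le_iff₀ hτ]
        refine (Nat.le_ceil _).trans ?_
        rw [← hi]
        exact_mod_cast le_max_right _ _
    have hi' : ((i + 1 : ℕ) : ℝ) * τ ∈ Icc 0 (n * τ) := by
      refine ⟨by positivity, mul_le_mul_of_nonneg_right ?_ hτ.le⟩
      exact_mod_cast (show i + 1 ≤ n by omega)
    refine ⟨i, by omega, by simp only [hg, hi], hmem, ?_⟩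
    rw [← hnode (i + 1) (by omega), norm_sub_rev, hdiff r hr _ hi']
    have hρ : 0 ≤ ρ := (norm_nonneg _).trans (hW i (by omega))
    refine (intervalIntegral.norm_integral_le_of_norm_le_const (C := ρ) fun s hs => ?_).trans ?_
    · rw [uIoc_of_le hmem.2] at hs
      rw [hgi i s (by
        rw [uIoc_of_le (by push_cast; nlinarith)]
        exact ⟨hmem.1.trans_lt hs.1, hs.2⟩)]
      exact hW i (by omega)
    · rw [mul_comm, abs_of_nonneg (sub_nonneg.2 hmem.2)]
      refine mul_le_mul_of_nonneg_right ?_ hρ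
      have := hmem.1
      push_cast
      linarith

end Interpolation

/-! ### Approximation of a weak solution by the scheme in H^m. -/

section Regularity

/-- The assumptions on the free term, with `R` bounding its norm in `H^{m-2}`. -/
structure TimeForcing (T C γ R : ℝ) {m : ℕ} (f : ℝ → HSob m) : Prop where
  int : IntervalIntegrable f volume 0 T
  bound : ∀ t ∈ Icc (0 : ℝ) T, ∀ k (hk : k ≤ m), k + 2 ≤ m → ‖truncH hk (f t)‖ ≤ R
  sub : ∀ t ∈ Icc (0 : ℝ) T, ∀ s ∈ Icc (0 : ℝ) T, ∀ hk : 1 ≤ m,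
    ‖truncH hk (f t) - truncH hk (f s)‖ ≤ holderMod C γ |t - s|

variable {T K C γ R : ℝ} {m : ℕ} {a b c : ℝ → ℝ → ℝ} {ψ : HSob m} {f : ℝ → HSob m}
  {u : ℝ → HSob 1} {ν : Measure ℝ}

theorem TimeForcing.continuousOn (hf : TimeForcing T C γ R f) (hγ : 0 < γ) (hm : 1 ≤ m) :
    ContinuousOn (fun t => dH m 0 (f t)) (Icc 0 T) := by
  refine continuousOn_of_holderMod (C := C) (R := 1) hγ fun t ht s hs => ?_
  have := (norm_dH_le 0 _).trans (hf.sub t ht s hs hm)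
  rwa [map_sub, dH_truncH _ (by omega), dH_truncH _ (by omega), ← one_mul (holderMod _ _ _)] at this

/-- The bound of the solution in `H^m`. -/
def regBound (K : ℝ) {m : ℕ} (ψ : HSob m) (f : ℝ → HSob m) (t : ℝ) : ℝ :=
  Real.exp (2 * dissipConst m K * t) * (‖ψ‖ + ∫ r in (0 : ℝ)..t, ‖f r‖)

/-- The error of the approximation in the proof of regularity, for the time step `τ` and the mesh
`h`. -/
def regErr (ν : Measure ℝ) (K C γ R Bu B τ h : ℝ) : ℝ :=
  (formBound ν K * (τ * ((contConst 1 K (levyMu0 ν) (levyMu2 ν)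
      + gridConst 1 K (levyMu0 ν) (levyMu2 ν)) * B + R)) + 6 * holderMod C γ τ * B
    + gridConst 1 K (levyMu0 ν) (levyMu2 ν) * (h * B) + holderMod C γ τ)
  * (Bu + B + τ * ((contConst 1 K (levyMu0 ν) (levyMu2 ν)
      + gridConst 1 K (levyMu0 ν) (levyMu2 ν)) * B + R))

theorem tendsto_regErr (ν : Measure ℝ) (K C R Bu B : ℝ) (hγ : 0 < γ) (t : ℝ) :
    Filter.Tendsto (fun n : ℕ => regErr ν K C γ R Bu B (t / n) (1 / n)) Filter.atTop
      (nhds 0) := by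
  have h1 : Filter.Tendsto (fun n : ℕ => t / (n : ℝ)) Filter.atTop (nhds 0) :=
    tendsto_const_div_atTop_nhds_zero_nat t
  have h2 : Filter.Tendsto (fun n : ℕ => 1 / (n : ℝ)) Filter.atTop (nhds 0) :=
    tendsto_const_div_atTop_nhds_zero_nat 1
  have h3 := (tendsto_holderMod C hγ).comp h1
  have := (((((h1.mul_const ((contConst 1 K (levyMu0 ν) (levyMu2 ν)
      + gridConst 1 K (levyMu0 ν) (levyMu2 ν)) * B + R)).const_mul (formBound ν K)).add
    ((h3.const_mul 6).mul_const B)).add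
    ((h2.mul_const B).const_mul (gridConst 1 K (levyMu0 ν) (levyMu2 ν)))).add h3).mul
    ((h1.mul_const ((contConst 1 K (levyMu0 ν) (levyMu2 ν)
      + gridConst 1 K (levyMu0 ν) (levyMu2 ν)) * B + R)).const_add (Bu + B))
  simp only [zero_mul, mul_zero, add_zero] at this
  exact this

/-- Here x is the solution, y the interpolation and V the value at the node q. The form at x is the
form at x − y, which is dissipative, plus the form at y − V, plus the form at V. In the last one
time is moved from r to q, where two more derivatives turn the form into the operator, and that is
compared with the discrete A. -/
theorem formF_residual_le (hν : IsLevyMeasure ν) (h : TimeCoef T K C γ m a b c) (hm : 1 + 2 ≤ m)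
    (hγ : 0 < γ) (hC : 0 ≤ C) {r q τ : ℝ} (hr : r ∈ Icc 0 T) (hq : q ∈ Icc 0 T)
    (hrq : |r - q| ≤ τ) {x y A : HSob 1} {V : HSob m} {g g' : L2R} {B E₁ E₂ E₃ Bw : ℝ}
    (h₁ : ‖y - truncH (by omega) V‖ ≤ E₁) (hV : ‖V‖ ≤ B)
    (h₂ : ‖A - contOp hν hm (a q) (b q) (c q) V‖ ≤ E₂) (h₃ : ‖g - g'‖ ≤ E₃)
    (hw : ‖x - y‖ ≤ Bw) :
    (formF hν (a r) (b r) (c r) x (x - y) + inner ℝ g (dH 1 0 (x - y)))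
        - inner ℝ (dH 1 0 A + g') (dH 1 0 (x - y))
      ≤ 2 * K * ‖dH 1 0 (x - y)‖ ^ 2
        + (formBound ν K * E₁ + 6 * holderMod C γ τ * B + E₂ + E₃) * Bw := by
  have hm1 : 1 ≤ m := by omega
  have ha := (h.coef_a r hr).mono (le_max_left m 2)
  have hb := h.coef_b r hr
  have hc := h.coef_c r hr
  have hK := hb.nonneg
  have hF := formBound_nonneg ν hK
  set w := x - y with hwdef
  have hBw0 : 0 ≤ Bw := (norm_nonneg _).trans hw
  have hin : ∀ {z : L2R} {e : ℝ}, ‖z‖ ≤ e → inner ℝ z (dH 1 0 w) ≤ e * Bw := fun hz =>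
    (real_inner_le_norm _ _).trans (mul_le_mul hz ((norm_dH_le _ _).trans hw) (norm_nonneg _)
      ((norm_nonneg _).trans hz))
  have t0 := formF_self_le hν ((h.coef_a r hr).mono (le_max_right m 2)) (h.nonneg r hr)
    (hb.mono hm1) hc.contBdd_zero w
  have t1 : formF hν (a r) (b r) (c r) (y - truncH hm1 V) w ≤ formBound ν K * E₁ * Bw := by
    refine (Real.le_norm_self _).trans ((ContinuousLinearMap.le_opNorm _ _).trans ?_)
    refine mul_le_mul ((norm_formF_le hν (ha.mono hm1) hb.contBdd_zero hc.contBdd_zero _).trans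
      (mul_le_mul_of_nonneg_left h₁ hF)) hw (norm_nonneg _) ?_
    exact mul_nonneg hF ((norm_nonneg _).trans h₁)
  have t2 : formF hν (a r) (b r) (c r) (truncH hm1 V) w
      - formF hν (a q) (b q) (c q) (truncH hm1 V) w ≤ 6 * holderMod C γ τ * B * Bw := by
    refine (le_abs_self _).trans ((abs_formF_sub_le hν h hm1 hr hq (truncH hm1 V) w).trans ?_)
    have e1 := holderMod_mono hC hγ (abs_nonneg _) hrq
    have e2 := (norm_truncH_le hm1 V).trans hV
    have e3 := holderMod_nonneg C γ τ
    have e4 := (norm_nonneg _).trans hV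
    gcongr
  have t3 := formF_truncH hν le_rfl hm (((h.coef_a q hq).mono (le_max_left m 2)).mono hm1)
    ((h.coef_b q hq).mono hm1) ((h.coef_c q hq).mono hm1) V w
  have t4 : inner ℝ (dH 1 0 (contOp hν hm (a q) (b q) (c q) V)) (dH 1 0 w)
      - inner ℝ (dH 1 0 A) (dH 1 0 w) ≤ E₂ * Bw := by
    rw [← inner_sub_left, ← map_sub]
    refine hin ((norm_dH_le _ _).trans ?_)
    rwa [norm_sub_rev]
  have t5 : inner ℝ g (dH 1 0 w) - inner ℝ g' (dH 1 0 w) ≤ E₃ * Bw := by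
    rw [← inner_sub_left]
    exact hin h₃
  have e1 : formF hν (a r) (b r) (c r) x w = formF hν (a r) (b r) (c r) w w
      + (formF hν (a r) (b r) (c r) (y - truncH hm1 V) w
        + formF hν (a r) (b r) (c r) (truncH hm1 V) w) := by
    rw [← formF_add, ← formF_add]
    congr 2
    rw [hwdef]
    abel
  rw [inner_add_left, e1, add_mul, add_mul, add_mul]
  linarith

-- The numerical scheme serves as the existence theory for smooth solutions: the mesh 1/n is tied to
-- the step t/n, stability in H^m gives a bound independent of n, and consistency in H¹ makes the
-- interpolation an approximate solution whose L₂ distance to u is controlled by Gronwall. The bound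
-- on u in H¹ enters only through the error, which vanishes as n grows.
set_option maxHeartbeats 800000 in
theorem exists_approx (hν : IsLevyMeasure ν) (h : TimeCoef T K C γ m a b c) (hm : 4 ≤ m)
    (hγ : 0 < γ) (hC : 0 ≤ C) (hf : TimeForcing T C γ R f)
    (hu : IsPIDESolution T ν a b c ψ f u) {Bu : ℝ} (hBu : ∀ t ∈ Icc 0 T, ‖u t‖ ≤ Bu) {t : ℝ}
    (ht0 : 0 < t) (htT : t ≤ T) {n : ℕ} (hn : 0 < n) (hτ : t / n * dissipConst m K ≤ 1 / 2) :
    ∃ v : HSob m, ‖v‖ ≤ regBound K ψ f t ∧ ‖dH 1 0 (u t) - dH m 0 v‖ ^ 2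
      ≤ gronwallBound 0 (2 * (2 * K)) (2 * regErr ν K C γ R Bu (regBound K ψ f t) (t / n) (1 / n))
        t := by
  have hn' : (0 : ℝ) < n := by exact_mod_cast hn
  have hm1 : 1 ≤ m := by omega
  set τ : ℝ := t / n with hτdef
  have hτ0 : 0 < τ := by positivity
  have hnτ : n * τ = t := by rw [hτdef]; field_simp
  have hT0 : (0 : ℝ) ∈ Icc 0 T := ⟨le_rfl, ht0.le.trans htT⟩
  have hK := (h.coef_b 0 hT0).nonneg
  have hD := dissipConst_nonneg m hK
  have hnode : ∀ i ≤ n, (i : ℝ) * τ ∈ Icc 0 T := fun i hi => by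
    refine ⟨by positivity, le_trans ?_ htT⟩
    rw [← hnτ]
    exact mul_le_mul_of_nonneg_right (by exact_mod_cast hi) hτ0.le
  have hsubT : ∀ i < n, Icc ((i : ℝ) * τ) ((i + 1 : ℕ) * τ) ⊆ Icc 0 T := fun i hi =>
    Icc_subset_Icc (hnode i hi.le).1 (hnode (i + 1) hi).2
  have hlen : ∀ i : ℕ, ((i + 1 : ℕ) : ℝ) * τ - i * τ = τ := fun i => by push_cast; ring
  have hlt : ∀ i : ℕ, (i : ℝ) * τ < (i + 1 : ℕ) * τ := fun i => by linarith [hlen i]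
  have hfI : ∀ i < n, IntervalIntegrable f volume (i * τ) ((i + 1 : ℕ) * τ) := fun i hi =>
    hf.int.mono_set (by
      rw [uIcc_of_le (hlt i).le, uIcc_of_le (ht0.le.trans htT)]
      exact hsubT i hi)
  set A : ℕ → HSob m →L[ℝ] HSob m := fun i =>
    schemeOp m ν n (a (i * τ)) (b (i * τ)) (c (i * τ)) with hA
  -- Averages over the steps replace the nodal values of f: in H^m the free term is only integrable
  -- in time, and the averages satisfy ∑ τ‖Fa‖ ≤ ∫ ‖f‖. The truncated subtraction i − 1 is harmless,
  -- as only i ≥ 1 occurs.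
  set Fa : ℕ → HSob m := fun i => ((i : ℝ) * τ - (i - 1 : ℕ) * τ)⁻¹ •
    ∫ r in ((i - 1 : ℕ) * τ)..(i * τ), f r with hFa
  have hAd : ∀ i < n, ∀ v, inner ℝ (A (i + 1) v) v ≤ dissipConst m K * ‖v‖ ^ 2 := fun i hi v =>
    inner_schemeOp_le hm1 hν hn (h.coef_a _ (hnode (i + 1) hi)) (h.nonneg _ (hnode (i + 1) hi))
      (h.coef_b _ (hnode (i + 1) hi)) (h.coef_c _ (hnode (i + 1) hi)) v
  obtain ⟨V, hV0, hV⟩ := exists_implicit_scheme hAd hτ0.le (by linarith) Fa ψ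
  have hfn : ∀ l < n, τ * ‖Fa (l + 1)‖ ≤ ∫ r in (l * τ)..((l + 1 : ℕ) * τ), ‖f r‖ := fun l hl => by
    simp only [hFa, Nat.add_sub_cancel]
    rw [hlen, norm_smul, norm_inv, Real.norm_of_nonneg hτ0.le, mul_inv_cancel_left₀ hτ0.ne']
    exact intervalIntegral.norm_integral_le_integral_norm (hlt l).le
  set B := regBound K ψ f t with hB
  have hVB : ∀ i ≤ n, ‖V i‖ ≤ B := fun i hi => by
    refine (norm_implicit_scheme_le hAd hτ0.le hD hτ hV i hi).trans ?_
    have hi' : (i : ℝ) ≤ n := by exact_mod_cast hi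
    have h1 : 2 * (τ * dissipConst m K) * i ≤ 2 * dissipConst m K * t := by
      rw [← hnτ]
      have := mul_le_mul_of_nonneg_left hi' (mul_nonneg hτ0.le hD)
      linarith
    have h2 : ∑ l ∈ Finset.range i, τ * ‖Fa (l + 1)‖ ≤ ∫ r in (0 : ℝ)..t, ‖f r‖ := by
      have h3 := intervalIntegral.sum_integral_adjacent_intervals (n := n) (μ := volume)
        (a := fun l : ℕ => (l : ℝ) * τ) (f := fun r => ‖f r‖) fun l hl => (hfI l hl).norm
      simp only [Nat.cast_zero, zero_mul, hnτ] at h3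
      rw [← h3]
      refine (Finset.sum_le_sum_of_subset_of_nonneg (Finset.range_mono hi)
        fun l _ _ => by positivity).trans (Finset.sum_le_sum fun l hl => hfn l ?_)
      exact Finset.mem_range.1 hl
    rw [hB, regBound, hV0]
    exact mul_le_mul (Real.exp_le_exp.2 h1) (by linarith)
      (add_nonneg (norm_nonneg _) (Finset.sum_nonneg fun l _ => by positivity))
      (Real.exp_pos _).le
  have hB0 : 0 ≤ B := (norm_nonneg _).trans (hVB 0 (by omega))
  have hFaT : ∀ i < n, truncH hm1 (Fa (i + 1)) = (((i + 1 : ℕ) : ℝ) * τ - i * τ)⁻¹ •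
      ∫ r in (i * τ)..((i + 1 : ℕ) * τ), truncH hm1 (f r) := fun i hi => by
    simp only [hFa, Nat.add_sub_cancel]
    rw [map_smul, ContinuousLinearMap.intervalIntegral_comp_comm _ (hfI i hi)]
  have hfT : ∀ i < n, IntervalIntegrable (fun r => truncH hm1 (f r)) volume (i * τ)
      ((i + 1 : ℕ) * τ) := fun i hi =>
    ⟨(truncH hm1).integrable_comp (hfI i hi).1, (truncH hm1).integrable_comp (hfI i hi).2⟩
  have hFaR : ∀ i < n, ‖truncH hm1 (Fa (i + 1))‖ ≤ R := fun i hi => by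
    have := norm_sub_average_le (w := 0) (ρ := R) (hlt i) (hfT i hi) fun s hs => by
      rw [zero_sub, norm_neg]
      exact hf.bound s (hsubT i hi hs) 1 hm1 (by omega)
    rwa [zero_sub, norm_neg, ← hFaT i hi] at this
  have hFaω : ∀ i < n, ∀ r ∈ Icc ((i : ℝ) * τ) ((i + 1 : ℕ) * τ),
      ‖truncH hm1 (f r) - truncH hm1 (Fa (i + 1))‖ ≤ holderMod C γ τ := fun i hi r hr => by
    rw [hFaT i hi]
    refine norm_sub_average_le (hlt i) (hfT i hi) fun s hs => ?_
    refine (hf.sub r (hsubT i hi hr) s (hsubT i hi hs) hm1).trans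
      (holderMod_mono hC hγ (abs_nonneg _) ?_)
    exact (Real.dist_le_of_mem_Icc hr hs).trans_eq (hlen i)
  set c₀ := contConst 1 K (levyMu0 ν) (levyMu2 ν)
  set c₁ := gridConst 1 K (levyMu0 ν) (levyMu2 ν)
  have hc₀ : 0 ≤ c₀ := contConst_nonneg 1 hK ν
  have hc₁ : 0 ≤ c₁ := gridConst_nonneg 1 hK ν
  have hR0 : 0 ≤ R := (norm_nonneg _).trans (hf.bound 0 hT0 1 hm1 (by omega))
  set ρ := (c₀ + c₁) * B + R with hρ
  have hρ0 : 0 ≤ ρ := by positivity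
  have hh1 : 1 / (n : ℝ) ≤ 1 := by
    rw [div_le_one hn']
    exact_mod_cast hn
  -- Consistency in H¹ uses four derivatives of V, available uniformly in n because m ≥ 4.
  have hcons : ∀ i < n, ‖truncH hm1 (A (i + 1) (V (i + 1)))
      - contOp hν (show 1 + 2 ≤ m by omega) (a ((i + 1 : ℕ) * τ)) (b ((i + 1 : ℕ) * τ))
        (c ((i + 1 : ℕ) * τ)) (V (i + 1))‖ ≤ c₁ * (1 / n * B) := fun i hi => by
    have ht := hnode (i + 1) hi
    have ha := (h.coef_a _ ht).mono (le_max_left m 2)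
    have hb := h.coef_b _ ht
    simp only [hA]
    rw [truncH_schemeOp hν hn hm1 ha hb (h.coef_c _ ht)]
    refine (norm_schemeOp_sub_contOp_le hν hn (show 1 + 3 ≤ m by omega) (ha.mono hm1)
      (hb.mono hm1) (V (i + 1))).trans ?_
    exact mul_le_mul_of_nonneg_left (mul_le_mul_of_nonneg_left (hVB _ hi) (by positivity)) hc₁
  have hWρ : ∀ i < n, ‖truncH hm1 (A (i + 1) (V (i + 1)) + Fa (i + 1))‖ ≤ ρ := fun i hi => by
    have ht := hnode (i + 1) hi
    have h1 := norm_contOp_le hν (show 1 + 2 ≤ m by omega)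
      ((h.coef_a _ ht).mono (hm1.trans (le_max_left m 2))) ((h.coef_b _ ht).mono hm1)
      ((h.coef_c _ ht).mono hm1) (V (i + 1))
    have h2 := mul_le_mul_of_nonneg_left (hVB _ hi) hc₀
    have h3 := norm_le_norm_add_norm_sub' (truncH hm1 (A (i + 1) (V (i + 1))))
      (contOp hν (show 1 + 2 ≤ m by omega) (a ((i + 1 : ℕ) * τ)) (b ((i + 1 : ℕ) * τ))
        (c ((i + 1 : ℕ) * τ)) (V (i + 1)))
    have h4 := mul_le_mul_of_nonneg_left (mul_le_of_le_one_left hB0 hh1) hc₁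
    rw [map_add]
    refine (norm_add_le_of_le (h3.trans (add_le_add (h1.trans h2) ((hcons i hi).trans h4)))
      (hFaR i hi)).trans (le_of_eq ?_)
    rw [hρ]
    ring
  obtain ⟨v, g, hv0, hvn, hgI, hvc, hvd, hvJ⟩ := exists_interpolation
    (V := fun i => truncH hm1 (V i)) (W := fun i => truncH hm1 (A i (V i) + Fa i)) hτ0 hn
    (fun i hi => by rw [← map_smul, ← map_add, ← hV i hi]) hWρ
  rw [hnτ] at hvn hgI hvc hvd hvJ
  have hsub : Icc 0 t ⊆ Icc 0 T := Icc_subset_Icc_right htT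
  have htm : t ∈ Icc 0 T := ⟨ht0.le, htT⟩
  have hcf := hf.continuousOn hγ hm1
  obtain ⟨Rf, hRf⟩ := isCompact_Icc.exists_bound_of_continuousOn hcf
  have hgρ : ∀ r ∈ Icc 0 t, ‖g r‖ ≤ ρ := fun r hr => by
    obtain ⟨i, hi, h1, -, -⟩ := hvJ r hr
    rw [h1]
    exact hWρ i hi
  have hvB : ∀ r ∈ Icc 0 t, ‖v r‖ ≤ B + τ * ρ := fun r hr => by
    obtain ⟨i, hi, -, -, h1⟩ := hvJ r hr
    have h2 := norm_le_norm_add_norm_sub' (v r) (truncH hm1 (V (i + 1)))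
    exact h2.trans (add_le_add ((norm_truncH_le _ _).trans (hVB _ hi)) h1)
  set w : ℝ → HSob 1 := fun r => u r - v r with hw
  have hwB : ∀ r ∈ Icc 0 t, ‖w r‖ ≤ Bu + B + τ * ρ := fun r hr => by
    rw [add_assoc]
    exact norm_sub_le_of_le (hBu r (hsub hr)) (hvB r hr)
  -- The functional driving u − v: the weak equation for u minus the slope g of the interpolation v.
  set G : ℝ → HSob 1 →L[ℝ] ℝ := fun r => formF hν (a r) (b r) (c r) (u r)
    + (innerSL ℝ (dH m 0 (f r) - dH 1 0 (g r))).comp (dH 1 0) with hG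
  have hGa : ∀ r χ, G r χ = (formF hν (a r) (b r) (c r) (u r) χ
      + inner ℝ (dH m 0 (f r)) (dH 1 0 χ)) - inner ℝ (dH 1 0 (g r)) (dH 1 0 χ) := fun r χ => by
    change formF hν (a r) (b r) (c r) (u r) χ
      + inner ℝ (dH m 0 (f r) - dH 1 0 (g r)) (dH 1 0 χ) = _
    rw [inner_sub_left, add_sub_assoc]
  have hI1 : ∀ r₁ ∈ Icc 0 t, ∀ r₂ ∈ Icc 0 t, ∀ χ, IntervalIntegrable
      (fun r => formF hν (a r) (b r) (c r) (u r) χ + inner ℝ (dH m 0 (f r)) (dH 1 0 χ))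
      volume r₁ r₂ := fun r₁ h₁ r₂ h₂ χ => by
    refine ContinuousOn.intervalIntegrable (ContinuousOn.mono ?_
      (((convex_Icc 0 t).ordConnected.uIcc_subset h₁ h₂).trans hsub))
    exact (continuousOn_formF hν h hm1 hγ subset_rfl hBu hu.weak_cont χ).add
      (hcf.inner continuousOn_const)
  have hI2 : ∀ r₁ ∈ Icc 0 t, ∀ r₂ ∈ Icc 0 t, IntervalIntegrable g volume r₁ r₂ :=
    fun r₁ h₁ r₂ h₂ => hgI.mono_set (by
      rw [uIcc_of_le ht0.le]
      exact (convex_Icc 0 t).ordConnected.uIcc_subset h₁ h₂)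
  have hI3 : ∀ r₁ ∈ Icc 0 t, ∀ r₂ ∈ Icc 0 t, ∀ χ, IntervalIntegrable
      (fun r => inner ℝ (dH 1 0 (g r)) (dH 1 0 χ)) volume r₁ r₂ ∧
      ∫ r in r₁..r₂, inner ℝ (dH 1 0 (g r)) (dH 1 0 χ)
        = inner ℝ (dH 1 0 (v r₂) - dH 1 0 (v r₁)) (dH 1 0 χ) := fun r₁ h₁ r₂ h₂ χ => by
    have h3 := hI2 r₁ h₁ r₂ h₂
    have h4 := ((innerSL ℝ (dH 1 0 χ)).comp (dH 1 0)).intervalIntegral_comp_comm h3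
    have h5 : IntervalIntegrable (fun r => ((innerSL ℝ (dH 1 0 χ)).comp (dH 1 0)) (g r))
      volume r₁ r₂ := ⟨ContinuousLinearMap.integrable_comp _ h3.1,
        ContinuousLinearMap.integrable_comp _ h3.2⟩
    simp only [ContinuousLinearMap.comp_apply, innerSL_apply_apply] at h4 h5
    rw [← hvd r₁ h₁ r₂ h₂] at h4
    simp only [real_inner_comm (dH 1 0 χ)] at h4 h5 ⊢
    rw [← map_sub]
    exact ⟨h5, h4⟩
  have h0m : (0 : ℝ) ∈ Icc 0 t := left_mem_Icc.2 ht0.le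
  have htm' : t ∈ Icc 0 t := right_mem_Icc.2 ht0.le
  refine ⟨V n, hVB n le_rfl, ?_⟩
  have hfin := energy_gronwall (dH 1 0) (w := w) (G := G) (s := 0) (t := t) (N := 2 * K)
    (B := formBound ν K * Bu + (Rf + ρ)) (R := Bu + B + τ * ρ)
    (ε := regErr ν K C γ R Bu B τ (1 / n)) ht0 (fun r hr => ?_) hwB (fun F => ?_) (fun χ => ?_)
    (fun r₁ h₁ r₂ h₂ χ => ?_) (fun r hr => ?_)
  · have e0 : dH 1 0 (w 0) = 0 := by
      simp only [hw]
      rw [map_sub, hu.init hT0.2, hv0, hV0, dH_truncH _ (by omega), sub_self]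
    have e1 : dH 1 0 (w t) = dH 1 0 (u t) - dH m 0 (V n) := by
      simp only [hw]
      rw [map_sub, hvn, dH_truncH _ (by omega)]
    rwa [e0, e1, norm_zero, sub_zero, zero_pow two_ne_zero] at hfin
  · have hr' := hsub hr
    refine (ContinuousLinearMap.opNorm_add_le _ _).trans (add_le_add ((norm_formF_le hν ((h.coef_a r hr').mono
      (hm1.trans (le_max_left m 2))) (h.coef_b r hr').contBdd_zero
      (h.coef_c r hr').contBdd_zero (u r)).trans
      (mul_le_mul_of_nonneg_left (hBu r hr') (formBound_nonneg ν hK))) ?_)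
    refine ContinuousLinearMap.opNorm_le_bound _ ?_ fun χ => ?_
    · exact add_nonneg ((norm_nonneg _).trans (hRf 0 hT0)) hρ0
    · refine (norm_inner_le_norm _ _).trans (mul_le_mul ?_ (norm_dH_le _ _) (norm_nonneg _) ?_)
      · exact norm_sub_le_of_le (hRf r hr') ((norm_dH_le _ _).trans (hgρ r hr))
      · exact add_nonneg ((norm_nonneg _).trans (hRf 0 hT0)) hρ0
  · have h1 : ContinuousOn (fun r => F (u r) - F (v r)) (Icc 0 t) :=
      ((hu.weak_cont F).mono hsub).sub (F.continuous.comp_continuousOn hvc)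
    simpa only [hw, map_sub] using h1
  · simp only [hGa]
    exact (hI1 0 h0m t htm' χ).sub (hI3 0 h0m t htm' χ).1
  · simp only [hGa, hw]
    rw [intervalIntegral.integral_sub (hI1 r₁ h₁ r₂ h₂ χ) (hI3 r₁ h₁ r₂ h₂ χ).1,
      (hI3 r₁ h₁ r₂ h₂ χ).2, ← hu.inner_eq hν h hm1 hγ hcf (hsub h₁) (hsub h₂) χ, ← inner_sub_left,
      map_sub, map_sub]
    congr 1
    abel
  · obtain ⟨i, hi, hgi, hri, hvi⟩ := hvJ r hr
    have hdist : |r - (i + 1 : ℕ) * τ| ≤ τ :=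
      (Real.dist_le_of_mem_Icc hri (right_mem_Icc.2 (hlt i).le)).trans_eq (hlen i)
    have h1 : ‖dH m 0 (f r) - dH 1 0 (truncH hm1 (Fa (i + 1)))‖ ≤ holderMod C γ τ := by
      rw [← dH_truncH hm1 (by omega) (f r), ← map_sub]
      exact (norm_dH_le _ _).trans (hFaω i hi r hri)
    have h2 := formF_residual_le hν h (by omega) hγ hC (hsub hr) (hnode (i + 1) hi) hdist hvi
      (hVB _ hi) (hcons i hi) h1 (hwB r hr)
    rw [hGa, hgi, map_add, map_add]
    exact h2

end Regularity

/-! ### Regularity of the solution, and the error of the scheme on the line. -/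

section RegularSolution

variable {T K C γ R : ℝ} {m : ℕ} {a b c : ℝ → ℝ → ℝ} {ψ : HSob m} {f : ℝ → HSob m}
  {u : ℝ → HSob 1} {ν : Measure ℝ}

theorem regBound_mono (hK : 0 ≤ K) (hf : IntervalIntegrable f volume 0 T) {t : ℝ}
    (ht : t ∈ Icc 0 T) : regBound K ψ f t ≤ regBound K ψ f T := by
  have hD := dissipConst_nonneg m hK
  have h1 : 2 * dissipConst m K * t ≤ 2 * dissipConst m K * T :=
    mul_le_mul_of_nonneg_left ht.2 (by positivity)
  have h2 : ∫ r in (0 : ℝ)..t, ‖f r‖ ≤ ∫ r in (0 : ℝ)..T, ‖f r‖ := by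
    refine intervalIntegral.integral_mono_interval le_rfl ht.1 ht.2
      (.of_forall fun r => norm_nonneg _) hf.norm
  have h3 : 0 ≤ ∫ r in (0 : ℝ)..t, ‖f r‖ :=
    intervalIntegral.integral_nonneg ht.1 fun r _ => norm_nonneg _
  exact mul_le_mul (Real.exp_le_exp.2 h1) (by linarith) (by positivity) (Real.exp_pos _).le

/-- Solutions are as regular as the data. -/
theorem exists_regular (hν : IsLevyMeasure ν) (h : TimeCoef T K C γ m a b c) (hm : 4 ≤ m)
    (hγ : 0 < γ) (hC : 0 ≤ C) (hf : TimeForcing T C γ R f)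
    (hu : IsPIDESolution T ν a b c ψ f u) {t : ℝ} (ht : t ∈ Icc 0 T) :
    ∃ U : HSob m, truncH (by omega) U = u t ∧ ‖U‖ ≤ regBound K ψ f T := by
  have hK := (h.coef_b t ht).nonneg
  suffices ∃ U : HSob m, dH m 0 U = dH 1 0 (u t) ∧ ‖U‖ ≤ regBound K ψ f t by
    obtain ⟨U, h1, h2⟩ := this
    refine ⟨U, HSob.ext_toL2 ?_, h2.trans (regBound_mono hK hf.int ht)⟩
    rw [dH_truncH _ (by omega), h1]
  rcases ht.1.eq_or_lt with rfl | ht0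
  · refine ⟨ψ, (hu.init ht.2).symm, ?_⟩
    rw [regBound]
    simp
  · obtain ⟨Bu, hBu⟩ := exists_bound_of_weak isCompact_Icc hu.weak_cont
    have hev : ∀ᶠ n : ℕ in Filter.atTop, 0 < n ∧ t / n * dissipConst m K ≤ 1 / 2 := by
      have h1 : Filter.Tendsto (fun n : ℕ => t / (n : ℝ) * dissipConst m K) Filter.atTop
          (nhds 0) := by
        simpa using (tendsto_const_div_atTop_nhds_zero_nat t).mul_const (dissipConst m K)
      exact (Filter.eventually_gt_atTop 0).and
        ((h1.eventually_lt_const (by norm_num : (0 : ℝ) < 1 / 2)).mono fun _ h => h.le)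
    obtain ⟨n₀, hn₀⟩ := Filter.eventually_atTop.1 hev
    choose v hv1 hv2 using fun n : ℕ => exists_approx hν h hm hγ hC hf hu hBu ht0 ht.2
      (hn₀ (n + n₀) (by omega)).1 (hn₀ (n + n₀) (by omega)).2
    -- The approximations are bounded in H^m and converge to u(t) in L₂, so the limit is in H^m with
    -- the same bound.
    refine HSob.exists_of_weak_limit hv1 fun w => ?_
    have h1 := (((tendsto_regErr ν K C R Bu (regBound K ψ f t) hγ t).const_mul 2).comp
      (Filter.tendsto_add_atTop_nat n₀))
    rw [mul_zero] at h1
    have h2 := ((gronwallBound_continuous_ε 0 (2 * (2 * K)) t).tendsto 0).comp h1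
    rw [gronwallBound_ε0_δ0] at h2
    have h3 : Filter.Tendsto (fun n => ‖dH 1 0 (u t) - dH m 0 (v n)‖ ^ 2) Filter.atTop (nhds 0) :=
      squeeze_zero (fun _ => by positivity) hv2 h2
    have h4 : Filter.Tendsto (fun n => ‖dH 1 0 (u t) - dH m 0 (v n)‖) Filter.atTop (nhds 0) := by
      have := h3.sqrt
      simpa only [Real.sqrt_sq (norm_nonneg _), Real.sqrt_zero] using this
    have h5 : Filter.Tendsto (fun n => dH m 0 (v n)) Filter.atTop (nhds (dH 1 0 (u t))) := by
      rw [tendsto_iff_norm_sub_tendsto_zero]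
      refine h4.congr fun n => norm_sub_rev _ _
    exact h5.inner tendsto_const_nhds

/-- The j-th derivative of w is tested with φ by testing w with the j-th derivative of φ, and under
the time integral the derivatives go back to g. Only scalar integrals occur, so g need not be
measurable as an H^k-valued function. The factor k + 1 comes from adding up the components crudely.
-/
theorem norm_HSob_le_of_inner {k : ℕ} {w : HSob k} {s t ρ : ℝ} (hst : s ≤ t) {g : ℝ → HSob k}
    (h : ∀ φ : ℝ → ℝ, IsTestFn φ →
      inner ℝ (dH k 0 w) (toL2 φ) = ∫ r in s..t, inner ℝ (dH k 0 (g r)) (toL2 φ))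
    (hg : ∀ r ∈ Icc s t, ‖g r‖ ≤ ρ) : ‖w‖ ≤ (k + 1) * ((t - s) * ρ) := by
  have hρ : 0 ≤ ρ := (norm_nonneg _).trans (hg s (left_mem_Icc.2 hst))
  have habs : ∀ (w : HSob k) {j : ℕ}, j ≤ k → ∀ φ : ℝ → ℝ, IsTestFn φ →
      |inner ℝ (dH k j w) (toL2 φ)| = |inner ℝ (dH k 0 w) (toL2 (iteratedDeriv j φ))| :=
    fun w j hj φ hφ => by
    rw [isWeakDeriv_iff.1 (isWeakDeriv_dH_zero hj w) φ hφ, abs_mul, abs_pow, abs_neg, abs_one,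
      one_pow, one_mul]
  refine norm_HSob_le fun j hj => norm_le_of_inner_test (by
    have := sub_nonneg.2 hst
    positivity) fun φ hφ => ?_
  rw [habs w hj φ hφ, h _ (hφ.iteratedDeriv j)]
  have := intervalIntegral.norm_integral_le_of_norm_le_const (a := s) (b := t)
    (f := fun r => inner ℝ (dH k 0 (g r)) (toL2 (iteratedDeriv j φ))) (C := ρ * ‖toL2 φ‖)
    fun r hr => by
      rw [uIoc_of_le hst] at hr
      rw [Real.norm_eq_abs, ← habs _ hj φ hφ]
      refine (abs_real_inner_le_norm _ _).trans (mul_le_mul_of_nonneg_right ?_ (norm_nonneg _))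
      exact (norm_dH_le _ _).trans (hg r ⟨hr.1.le, hr.2⟩)
  rw [abs_of_nonneg (sub_nonneg.2 hst)] at this
  exact this.trans (le_of_eq (by ring))

variable {U : ℝ → HSob m} {B : ℝ}

theorem inner_regular_eq (hν : IsLevyMeasure ν) (h : TimeCoef T K C γ m a b c) (hγ : 0 < γ)
    (hf : TimeForcing T C γ R f) (hu : IsPIDESolution T ν a b c ψ f u) {k : ℕ} (hk : 1 ≤ k)
    (hkm : k + 2 ≤ m) (hU : ∀ t ∈ Icc 0 T, truncH (by omega) (U t) = u t) {s t : ℝ}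
    (hs : s ∈ Icc 0 T) (ht : t ∈ Icc 0 T) (χ : HSob 1) :
    inner ℝ (dH 1 0 (u t) - dH 1 0 (u s)) (dH 1 0 χ)
      = ∫ r in s..t, inner ℝ (dH k 0 (contOp hν hkm (a r) (b r) (c r) (U r)
        + truncH (by omega) (f r))) (dH 1 0 χ) := by
  rw [hu.inner_eq hν h (by omega) hγ (hf.continuousOn hγ (by omega)) hs ht]
  refine intervalIntegral.integral_congr fun r hr => ?_
  have hr' := (convex_Icc 0 T).ordConnected.uIcc_subset hs ht hr
  have hkm' : k ≤ m := by omega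
  change formF hν (a r) (b r) (c r) (u r) χ + inner ℝ (dH m 0 (f r)) (dH 1 0 χ) = _
  rw [← hU r hr', formF_truncH hν hk hkm ((h.coef_a r hr').mono (hkm'.trans (le_max_left m 2)))
    ((h.coef_b r hr').mono hkm') ((h.coef_c r hr').mono hkm'), map_add, inner_add_left,
    dH_truncH _ (by omega)]

/-- Lipschitz continuity in time at the cost of two derivatives: u is the time integral of (L + J)u
+ f. -/
theorem norm_truncH_sub_le (hν : IsLevyMeasure ν) (h : TimeCoef T K C γ m a b c) (hγ : 0 < γ)
    (hf : TimeForcing T C γ R f) (hu : IsPIDESolution T ν a b c ψ f u) {k : ℕ} (hk : 1 ≤ k)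
    (hkm : k + 2 ≤ m) (hU : ∀ t ∈ Icc 0 T, truncH (by omega) (U t) = u t)
    (hB : ∀ t ∈ Icc 0 T, ‖U t‖ ≤ B) {s t : ℝ}
    (hs : s ∈ Icc 0 T) (ht : t ∈ Icc 0 T) (hst : s ≤ t) :
    ‖truncH (show k ≤ m by omega) (U t - U s)‖
      ≤ (k + 1) * ((t - s) * (contConst k K (levyMu0 ν) (levyMu2 ν) * B + R)) := by
  have hkm' : k ≤ m := by omega
  refine norm_HSob_le_of_inner hst (g := fun r => contOp hν hkm (a r) (b r) (c r) (U r)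
    + truncH hkm' (f r)) (fun φ hφ => ?_) fun r hr => ?_
  · have h1 := inner_regular_eq hν h hγ hf hu hk hkm hU hs ht (testH 1 hφ)
    rw [dH_testH zero_le_one, iteratedDeriv_zero, ← hU t ht, ← hU s hs, dH_truncH _ (by omega),
      dH_truncH _ (by omega), ← map_sub] at h1
    exact h1
  · have hr' : r ∈ Icc 0 T := ⟨hs.1.trans hr.1, hr.2.trans ht.2⟩
    refine norm_add_le_of_le ((norm_contOp_le hν hkm
      ((h.coef_a r hr').mono (hkm'.trans (le_max_left m 2))) ((h.coef_b r hr').mono hkm')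
      ((h.coef_c r hr').mono hkm') (U r)).trans (mul_le_mul_of_nonneg_left (hB r hr')
      (contConst_nonneg k (h.coef_b r hr').nonneg ν))) (hf.bound r hr' k hkm' hkm)

/-- Interpolation between H² and H⁴ by one integration by parts: ‖∂³g‖² = −(∂²g, ∂⁴g). -/
theorem norm_truncH_three_sq_le (hm : 4 ≤ m) (g : HSob m) :
    ‖truncH (show 3 ≤ m by omega) g‖ ^ 2
      ≤ ‖truncH (show 2 ≤ m by omega) g‖ * (2 * ‖g‖) := by
  have h3 : 3 ≤ m := by omega
  have h2 : 2 ≤ m := by omega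
  have e1 : ‖truncH h3 g‖ ^ 2 = ‖truncH h2 g‖ ^ 2 + ‖dH m 3 g‖ ^ 2 := by
    rw [norm_sq_HSob, norm_sq_HSob, Finset.sum_range_succ, dH_truncH _ le_rfl]
    congr 1
  have e2 : ‖dH m 3 g‖ ^ 2 ≤ ‖truncH h2 g‖ * ‖g‖ := by
    have h4 := (isWeakDeriv_dH (show 2 < m by omega) g).inner_eq_neg
      (isWeakDeriv_dH (show 3 < m by omega) g)
    have h5 : ‖dH m 3 g‖ ^ 2 = -inner ℝ (dH m 2 g) (dH m 4 g) := by
      rw [← real_inner_self_eq_norm_sq]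
      linarith
    rw [h5, ← inner_neg_right]
    refine (real_inner_le_norm _ _).trans ?_
    rw [norm_neg, ← dH_truncH h2 le_rfl]
    exact mul_le_mul (norm_dH_le _ _) (norm_dH_le _ _) (norm_nonneg _) (norm_nonneg _)
  have e3 := mul_le_mul_of_nonneg_left (norm_truncH_le h2 g) (norm_nonneg (truncH h2 g))
  rw [e1, sq ‖truncH h2 g‖]
  linarith

theorem norm_contOp_sub_le (hν : IsLevyMeasure ν) (h : TimeCoef T K C γ m a b c)
    (hm : 1 + 2 ≤ m) {r q : ℝ} (hr : r ∈ Icc 0 T) (hq : q ∈ Icc 0 T) (g : HSob m) :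
    ‖contOp hν hm (a r) (b r) (c r) g - contOp hν hm (a q) (b q) (c q) g‖
      ≤ 12 * holderMod C γ |r - q| * ‖g‖ := by
  have hm1 : 1 ≤ m := by omega
  have ha := fun t ht => (h.coef_a t ht).mono (hm1.trans (le_max_left m 2))
  have hb := fun t ht => (h.coef_b t ht).mono hm1
  have hc := fun t ht => (h.coef_c t ht).mono hm1
  have e : contOp hν hm (a r) (b r) (c r) g - contOp hν hm (a q) (b q) (c q) g
      = mulH 1 (fun x => a r x - a q x) (derivH 2 hm g)
        + mulH 1 (fun x => b r x - b q x) (derivH 1 (by omega) g)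
        + mulH 1 (fun x => c r x - c q x) (truncH hm1 g) := by
    rw [contOp_apply, contOp_apply, mulH_sub (ha r hr) (ha q hq), mulH_sub (hb r hr) (hb q hq),
      mulH_sub (hc r hr) (hc q hq)]
    abel
  have hω := holderMod_nonneg C γ |r - q|
  have key : ∀ {d : ℝ → ℝ} {w : HSob 1}, Coef 1 (holderMod C γ |r - q|) d → ‖w‖ ≤ ‖g‖ →
      ‖mulH 1 d w‖ ≤ 4 * holderMod C γ |r - q| * ‖g‖ := fun hd hw => by
    refine (norm_mulH_le hd _).trans (le_trans (le_of_eq ?_)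
      (mul_le_mul_of_nonneg_left hw (by positivity)))
    norm_num
  rw [e]
  refine (norm_add_le_of_le (norm_add_le_of_le (key (h.sub_a r hr q hq) (norm_derivH_le _ _))
    (key (h.sub_b r hr q hq) (norm_derivH_le _ _))) (key (h.sub_c r hr q hq)
    (norm_derivH_le _ _))).trans (le_of_eq ?_)
  ring

/-- The error of the implicit scheme on the line. -/
theorem norm_sub_scheme_le (hν : IsLevyMeasure ν) (h : TimeCoef T K C γ m a b c) (hm : 4 ≤ m)
    (hγ : 0 < γ) (hC : 0 ≤ C) (hf : TimeForcing T C γ R f)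
    (hu : IsPIDESolution T ν a b c ψ f u)
    (hU : ∀ t ∈ Icc 0 T, truncH (by omega) (U t) = u t) (hB : ∀ t ∈ Icc 0 T, ‖U t‖ ≤ B)
    (hT : 0 < T) {p n : ℕ} (hp : 0 < p) (hn : 0 < n) (hτ : T / n * dissipConst 1 K ≤ 1 / 2)
    {η : ℝ} (hη : ∀ s ∈ Icc 0 T, ∀ t ∈ Icc 0 T, s ≤ t → t - s ≤ T / n →
      ‖truncH (show 3 ≤ m by omega) (U t - U s)‖ ≤ η) {V : ℕ → HSob 1}
    (hV0 : V 0 = truncH (by omega) ψ)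
    (hV : ∀ i < n, V (i + 1) = V i + (T / n) • (schemeOp 1 ν p (a ((i + 1 : ℕ) * (T / n)))
      (b ((i + 1 : ℕ) * (T / n))) (c ((i + 1 : ℕ) * (T / n))) (V (i + 1))
        + truncH (by omega) (f ((i + 1 : ℕ) * (T / n))))) :
    ∀ i ≤ n, ‖u (i * (T / n)) - V i‖ ≤ Real.exp (2 * dissipConst 1 K * T) * (2 * T *
      (contConst 1 K (levyMu0 ν) (levyMu2 ν) * η + 12 * holderMod C γ (T / n) * B
        + gridConst 1 K (levyMu0 ν) (levyMu2 ν) * (1 / p * B) + holderMod C γ (T / n))) := by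
  have hn' : (0 : ℝ) < n := by exact_mod_cast hn
  have hm1 : 1 ≤ m := by omega
  have hm3 : 1 + 2 ≤ m := by omega
  set τ : ℝ := T / n with hτdef
  have hτ0 : 0 < τ := by positivity
  have hnτ : n * τ = T := by rw [hτdef]; field_simp
  have hT0 : (0 : ℝ) ∈ Icc 0 T := ⟨le_rfl, hT.le⟩
  have hK := (h.coef_b 0 hT0).nonneg
  have hD := dissipConst_nonneg 1 hK
  have hnode : ∀ i ≤ n, (i : ℝ) * τ ∈ Icc 0 T := fun i hi => by
    refine ⟨by positivity, ?_⟩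
    rw [← hnτ]
    exact mul_le_mul_of_nonneg_right (by exact_mod_cast hi) hτ0.le
  have hlen : ∀ i : ℕ, ((i + 1 : ℕ) : ℝ) * τ - i * τ = τ := fun i => by push_cast; ring
  have hle : ∀ i : ℕ, (i : ℝ) * τ ≤ (i + 1 : ℕ) * τ := fun i => by linarith [hlen i]
  set A : ℕ → HSob 1 →L[ℝ] HSob 1 := fun i =>
    schemeOp 1 ν p (a (i * τ)) (b (i * τ)) (c (i * τ)) with hA
  set ρ := contConst 1 K (levyMu0 ν) (levyMu2 ν) * η + 12 * holderMod C γ τ * B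
    + gridConst 1 K (levyMu0 ν) (levyMu2 ν) * (1 / p * B) + holderMod C γ τ with hρ
  -- The residual of the exact solution in one step of the scheme.
  set S : ℕ → HSob 1 := fun j => u (j * τ) - u ((j - 1 : ℕ) * τ)
    - τ • (A j (u (j * τ)) + truncH hm1 (f (j * τ))) with hS
  have hAd : ∀ i < n, ∀ v, inner ℝ (A (i + 1) v) v ≤ dissipConst 1 K * ‖v‖ ^ 2 := fun i hi v => by
    have ht := hnode (i + 1) hi
    exact inner_schemeOp_le le_rfl hν hp ((h.coef_a _ ht).mono (max_le_max_right 2 hm1))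
      (h.nonneg _ ht) ((h.coef_b _ ht).mono hm1) ((h.coef_c _ ht).mono hm1) v
  have hSρ : ∀ i < n, ‖S (i + 1)‖ ≤ 2 * (τ * ρ) := fun i hi => by
    have hi0 := hnode i hi.le
    have hi1 := hnode (i + 1) hi
    set q := ((i + 1 : ℕ) : ℝ) * τ with hq
    -- The residual is the time integral over the step of (L_r + J)U_r + f_r minus its discrete
    -- counterpart at the node. The factor 2 below is k + 1 for k = 1.
    have h1 := norm_HSob_le_of_inner (w := S (i + 1)) (ρ := ρ) (hle i)
      (g := fun r => contOp hν hm3 (a r) (b r) (c r) (U r) + truncH hm1 (f r)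
        - (A (i + 1) (u q) + truncH hm1 (f q))) (fun φ hφ => ?_) fun r hr => ?_
    · rw [hlen] at h1
      refine h1.trans (le_of_eq ?_)
      push_cast
      ring
    · have h2 := inner_regular_eq hν h hγ hf hu le_rfl hm3 hU hi0 hi1 (testH 1 hφ)
      have hII : IntervalIntegrable (fun r => inner ℝ (dH 1 0 (contOp hν hm3 (a r) (b r) (c r)
          (U r) + truncH hm1 (f r))) (toL2 φ)) volume (i * τ) q := by
        obtain ⟨Bu, hBu⟩ := exists_bound_of_weak isCompact_Icc hu.weak_cont
        have hsub : uIcc (i * τ) q ⊆ Icc 0 T := (convex_Icc 0 T).ordConnected.uIcc_subset hi0 hi1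
        refine ContinuousOn.intervalIntegrable ((ContinuousOn.congr
          (f := fun r => formF hν (a r) (b r) (c r) (u r) (testH 1 hφ)
            + inner ℝ (dH m 0 (f r)) (toL2 φ)) ?_ fun r hr => ?_).mono hsub)
        · exact (continuousOn_formF hν h hm1 hγ subset_rfl hBu hu.weak_cont _).add
            ((hf.continuousOn hγ hm1).inner continuousOn_const)
        · simp only
          rw [← hU r hr, formF_truncH hν le_rfl hm3
            ((h.coef_a r hr).mono (hm1.trans (le_max_left m 2)))
            ((h.coef_b r hr).mono hm1) ((h.coef_c r hr).mono hm1), map_add, inner_add_left,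
            dH_truncH _ (by omega), dH_testH zero_le_one, iteratedDeriv_zero]
      rw [dH_testH zero_le_one, iteratedDeriv_zero] at h2
      simp only [hS, Nat.add_sub_cancel, map_sub (dH 1 0), map_smul, inner_sub_left]
      rw [intervalIntegral.integral_sub hII intervalIntegrable_const, ← h2,
        intervalIntegral.integral_const, hq, hlen, inner_sub_left, real_inner_smul_left, smul_eq_mul]
    · have hr' : r ∈ Icc 0 T := ⟨hi0.1.trans hr.1, hr.2.trans hi1.2⟩
      have hdist : |r - q| ≤ τ :=
        (Real.dist_le_of_mem_Icc hr (right_mem_Icc.2 (hle i))).trans_eq (hlen i)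
      have hω := holderMod_mono hC hγ (abs_nonneg _) hdist
      have hB0 : 0 ≤ B := (norm_nonneg _).trans (hB 0 hT0)
      have t1 : ‖contOp hν hm3 (a r) (b r) (c r) (U r) - contOp hν hm3 (a r) (b r) (c r) (U q)‖
          ≤ contConst 1 K (levyMu0 ν) (levyMu2 ν) * η := by
        -- In H¹ the operator L + J sees three derivatives of its argument, so the increment of the
        -- solution enters only through its H³ norm.
        have e1 : contOp hν hm3 (a r) (b r) (c r) (U r) - contOp hν hm3 (a r) (b r) (c r) (U q)
            = contOp hν (show 1 + 2 ≤ 3 by norm_num) (a r) (b r) (c r)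
              (truncH (show 3 ≤ m by omega) (U r - U q)) := by
          rw [← map_sub]
          refine HSob.ext_toL2 ?_
          have ha' := (h.coef_a r hr').mono (hm1.trans (le_max_left m 2))
          rw [dH_zero_contOp hν hm3 ha' ((h.coef_b r hr').mono hm1) ((h.coef_c r hr').mono hm1),
            dH_zero_contOp hν _ ha' ((h.coef_b r hr').mono hm1) ((h.coef_c r hr').mono hm1),
            dH_truncH _ (by omega), dH_truncH _ (by omega), dH_truncH _ (by omega)]
        rw [e1]
        refine (norm_contOp_le hν _ ((h.coef_a r hr').mono (hm1.trans (le_max_left m 2)))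
          ((h.coef_b r hr').mono hm1) ((h.coef_c r hr').mono hm1) _).trans
          (mul_le_mul_of_nonneg_left ?_ (contConst_nonneg 1 hK ν))
        rw [← norm_neg, ← map_neg, neg_sub]
        refine hη r hr' q hi1 hr.2 ?_
        have := hlen i
        linarith [hr.1]
      have t2 : ‖contOp hν hm3 (a r) (b r) (c r) (U q) - contOp hν hm3 (a q) (b q) (c q) (U q)‖
          ≤ 12 * holderMod C γ τ * B := by
        refine (norm_contOp_sub_le hν h hm3 hr' hi1 (U q)).trans ?_
        exact mul_le_mul (mul_le_mul_of_nonneg_left hω (by norm_num)) (hB q hi1) (norm_nonneg _)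
          (mul_nonneg (by norm_num) (holderMod_nonneg _ _ _))
      have t3 : ‖contOp hν hm3 (a q) (b q) (c q) (U q) - A (i + 1) (u q)‖
          ≤ gridConst 1 K (levyMu0 ν) (levyMu2 ν) * (1 / p * B) := by
        rw [norm_sub_rev, ← hU q hi1]
        refine (norm_schemeOp_sub_contOp_le hν hp (show 1 + 3 ≤ m by omega)
          ((h.coef_a q hi1).mono (hm1.trans (le_max_left m 2))) ((h.coef_b q hi1).mono hm1)
          (U q)).trans ?_
        exact mul_le_mul_of_nonneg_left (mul_le_mul_of_nonneg_left (hB q hi1) (by positivity))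
          (gridConst_nonneg 1 hK ν)
      have t4 : ‖truncH hm1 (f r) - truncH hm1 (f q)‖ ≤ holderMod C γ τ :=
        (hf.sub r hr' q hi1 hm1).trans hω
      refine le_trans (le_of_eq ?_)
        (norm_add_le_of_le (norm_add_le_of_le (norm_add_le_of_le t1 t2) t3) t4)
      congr 1
      abel
  have hρ0 : 0 ≤ ρ := by
    have := (norm_nonneg _).trans (hSρ 0 hn)
    have h1 : 0 ≤ τ * ρ := by linarith
    exact nonneg_of_mul_nonneg_right h1 hτ0
  -- The error solves the scheme with free term S/τ and zero initial value, so stability sums the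
  -- residuals.
  have hscheme := norm_implicit_scheme_le (V := fun i : ℕ => u (i * τ) - V i)
    (f := fun j => τ⁻¹ • S j) hAd hτ0.le hD hτ fun i hi => by
      have e := congrArg (fun w => u (((i + 1 : ℕ) : ℝ) * τ) - w) (hV i hi)
      rw [smul_add, smul_inv_smul₀ hτ0.ne', map_sub]
      refine e.trans ?_
      simp only [hS, hA, Nat.add_sub_cancel, smul_add, smul_sub]
      abel
  have h0 : u ((0 : ℕ) * τ) - V 0 = 0 := by
    rw [hV0, Nat.cast_zero, zero_mul, sub_eq_zero]
    refine HSob.ext_toL2 ?_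
    rw [dH_truncH _ (by omega)]
    exact hu.init hT.le
  intro i hi
  have hiT : i * τ ≤ T := (hnode i hi).2
  have hsum : ∑ l ∈ Finset.range i, τ * ‖τ⁻¹ • S (l + 1)‖ ≤ 2 * T * ρ := by
    calc ∑ l ∈ Finset.range i, τ * ‖τ⁻¹ • S (l + 1)‖
        ≤ ∑ _l ∈ Finset.range i, 2 * (τ * ρ) := Finset.sum_le_sum fun l hl => by
          rw [norm_smul, norm_inv, Real.norm_of_nonneg hτ0.le, mul_inv_cancel_left₀ hτ0.ne']
          exact hSρ l ((Finset.mem_range.1 hl).trans_le hi)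
      _ = 2 * (i * τ) * ρ := by
          rw [Finset.sum_const, Finset.card_range, nsmul_eq_mul]
          ring
      _ ≤ 2 * T * ρ := mul_le_mul_of_nonneg_right (by linarith) hρ0
  refine (hscheme i hi).trans (mul_le_mul (Real.exp_le_exp.2 ?_) ?_ (by positivity)
    (Real.exp_pos _).le)
  · calc 2 * (τ * dissipConst 1 K) * i = 2 * dissipConst 1 K * (i * τ) := by ring
      _ ≤ 2 * dissipConst 1 K * T := mul_le_mul_of_nonneg_left hiT (by positivity)
  · rw [h0, norm_zero, zero_add]
    exact hsum

end RegularSolution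

/-! ### Point evaluation carries the scheme on the line to the scheme on the grid. -/

section GridEvaluation

variable {H : Type*} [NormedAddCommGroup H] [InnerProductSpace ℝ H]

/-- A continuous functional sees the operator J^h only through its values along the translates of g.
One argument therefore covers evaluation on H¹ and on ℓ₂. -/
theorem apply_gridJump [CompleteSpace H] {ν : Measure ℝ} (hν : IsLevyMeasure ν) {p : ℕ}
    (hp : 0 < p) {U : ℤ → H →L[ℝ] H} (hU : ∀ i g, ‖U i g‖ ≤ ‖g‖) (F : H →L[ℝ] ℝ) {g : H}
    {φ : ℤ → ℝ} {k : ℤ} (hF : ∀ i, F (U i g) = φ (k + i)) (hF0 : F g = φ k) :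
    F (gridJump ν p U g) = gridJ ν p φ k := by
  have hp' : (p : ℝ) ≠ 0 := by positivity
  rw [gridJump, add_apply, map_add, gridJ]
  congr 1
  · rw [smallJump, gridJ1, sum_apply, map_sum]
    refine Finset.sum_congr rfl fun j _ => ?_
    rw [smul_apply, map_smul, sum_apply, map_sum, smul_eq_mul]
    congr 1
    refine Finset.sum_congr rfl fun l _ => ?_
    simp only [smul_apply, add_apply, sub_apply, map_smul, map_add, map_sub, smul_eq_mul, hF,
      gridDiff]
    rw [show k + (j.sign * l + 1) = k + j.sign * l + 1 by ring,
      show k + (j.sign * l - 1) = k + j.sign * l + -1 by ring,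
      show k + j.sign * (l : ℤ) + -1 + 1 = k + j.sign * l by ring]
    congr 1
    push_cast
    field_simp
    ring
  · rw [gridJ2, ((hasSum_largeJump_apply hν hp hU g).mapL F).tsum_eq.symm]
    refine tsum_congr fun j => ?_
    rw [map_smul, map_sub, hF, hF0, smul_eq_mul, mul_comm]

theorem gridSymDiff_eq (h : ℝ) (φ : ℤ → ℝ) (k : ℤ) :
    gridSymDiff h φ k = (2 * h)⁻¹ * (φ (k + 1) - φ (k - 1)) := by
  rcases eq_or_ne h 0 with rfl | hh
  · simp [gridSymDiff, gridDiff]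
  · simp only [gridSymDiff, gridDiff, ← sub_eq_add_neg]
    push_cast
    field_simp
    ring

theorem evH_symDiffH (h : ℝ) (k : ℤ) (g : HSob 1) :
    evH (k * h) (symDiffH 1 h g) = gridSymDiff h (fun i => evH (i * h) g) k := by
  have e : symDiffH 1 h g = (2 * h)⁻¹ • (shiftH 1 h g - shiftH 1 (-h) g) := by
    refine HSob.ext_toL2 ?_
    rw [dH_liftH _ (by omega), map_smul, map_sub, dH_liftH _ (by omega), dH_liftH _ (by omega)]
    rfl
  rw [e, map_smul, map_sub, evH_shiftH, evH_shiftH, gridSymDiff_eq, smul_eq_mul]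
  push_cast
  ring_nf

theorem evH_schemeOp {ν : Measure ℝ} (hν : IsLevyMeasure ν) {p : ℕ} (hp : 0 < p) {K : ℝ}
    {a b c : ℝ → ℝ} (ha : Coef 1 K a) (hb : Coef 1 K b) (hc : Coef 1 K c) (g : HSob 1) (k : ℤ) :
    evH (k * (1 / p)) (schemeOp 1 ν p a b c g)
      = gridL a b c (1 / p) (fun i => evH (i * (1 / p)) g) k
        + gridJ ν p (fun i => evH (i * (1 / p)) g) k := by
  change evH _ (mulH 1 a (symDiffH 1 (1 / p) (symDiffH 1 (1 / p) g))
    + mulH 1 b (symDiffH 1 (1 / p) g) + mulH 1 c g + gridJump ν p _ g) = _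
  rw [map_add, map_add, map_add, evH_mulH ha, evH_mulH hb, evH_mulH hc, evH_symDiffH,
    evH_symDiffH, apply_gridJump hν hp (fun _ _ => norm_shiftH _ _) _
      (φ := fun i => evH (i * (1 / p)) g) (fun i => ?_) rfl, gridL]
  · simp only [evH_symDiffH]
  · rw [evH_shiftH]
    push_cast
    ring_nf

end GridEvaluation

/-! ### The scheme operator on ℓ₂(ℤ), realized as L₂ of the counting measure. -/

section GridL2

instance : (Measure.count : Measure ℤ).IsAddRightInvariant where
  map_add_right_eq_self g := by
    refine Measure.ext fun s hs => ?_
    rw [Measure.map_apply (measurable_add_const g) hs, Measure.count_apply hs,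
      Measure.count_apply (measurable_add_const g hs)]
    congr 1
    exact Set.encard_preimage_of_bijective (Equiv.addRight g).bijective s

/-- The space `ℓ₂(ℤ)`. -/
abbrev L2Z : Type := Lp ℝ 2 (Measure.count : Measure ℤ)

/-- The value at a point, as a functional on `ℓ₂(ℤ)`. -/
def evZ (k : ℤ) : L2Z →L[ℝ] ℝ :=
  innerSL ℝ (indicatorConstLp 2 (measurableSet_singleton k)
    (by simp : (Measure.count : Measure ℤ) {k} ≠ ⊤) (1 : ℝ))

theorem evZ_apply (k : ℤ) (g : L2Z) : evZ k g = g k := by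
  rw [evZ, innerSL_apply_apply, L2.inner_indicatorConstLp_one]
  simp

theorem shiftZ_apply (i k : ℤ) (g : L2Z) : shiftL2 Measure.count i g k = g (k + i) :=
  Measure.ae_count_iff.1 (shiftL2_ae i g) k

theorem mulZ_apply {K : ℝ} {a : ℤ → ℝ} (ha : ContBdd K a) (k : ℤ) (g : L2Z) :
    mulL2 Measure.count a g k = a k * g k :=
  Measure.ae_count_iff.1 (mulL2_ae ha g) k

theorem evZ_symDiffL2 (h : ℝ) (k : ℤ) (g : L2Z) :
    evZ k (symDiffL2 Measure.count h 1 g) = gridSymDiff h g k := by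
  rw [symDiffL2_apply, map_smul, map_sub, evZ_apply, evZ_apply, shiftZ_apply, shiftZ_apply,
    gridSymDiff_eq, smul_eq_mul, ← sub_eq_add_neg]

/-- The operator `L^h + J^h` on `ℓ₂`, with `h = 1/p`. -/
def schemeOpZ (ν : Measure ℝ) (p : ℕ) (a b c : ℝ → ℝ) : L2Z →L[ℝ] L2Z :=
  (mulL2 Measure.count fun k : ℤ => a (k * (1 / p))).comp
      ((symDiffL2 Measure.count (1 / p) 1).comp (symDiffL2 Measure.count (1 / p) 1))
    + (mulL2 Measure.count fun k : ℤ => b (k * (1 / p))).comp (symDiffL2 Measure.count (1 / p) 1)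
    + mulL2 Measure.count (fun k : ℤ => c (k * (1 / p)))
    + gridJump ν p (shiftL2 Measure.count)

variable {ν : Measure ℝ} {p : ℕ} {K : ℝ} {a b c : ℝ → ℝ}

theorem ContBdd.restrict_grid (h : ℝ) (ha : ContBdd K a) : ContBdd K fun k : ℤ => a (k * h) :=
  ⟨continuous_of_discreteTopology, fun _ => ha.2 _⟩

theorem evZ_schemeOpZ (hν : IsLevyMeasure ν) (hp : 0 < p) (ha : Coef 1 K a) (hb : Coef 1 K b)
    (hc : Coef 1 K c) (g : L2Z) (k : ℤ) :
    evZ k (schemeOpZ ν p a b c g) = gridL a b c (1 / p) g k + gridJ ν p g k := by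
  change evZ k (mulL2 Measure.count _ (symDiffL2 Measure.count (1 / p) 1
    (symDiffL2 Measure.count (1 / p) 1 g)) + mulL2 Measure.count _ (symDiffL2 Measure.count
      (1 / p) 1 g) + mulL2 Measure.count _ g + gridJump ν p _ g) = _
  have hD : ⇑(symDiffL2 Measure.count (1 / p : ℝ) (1 : ℤ) g) = gridSymDiff (1 / p) g := by
    funext i
    rw [← evZ_apply, evZ_symDiffL2]
  rw [map_add, map_add, map_add, apply_gridJump hν hp (fun _ _ => (norm_shiftL2 _ _).le) (evZ k)
    (φ := g) (fun i => by rw [evZ_apply, shiftZ_apply]) (evZ_apply k g), evZ_apply, evZ_apply,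
    evZ_apply, mulZ_apply (ha.contBdd_zero.restrict_grid _),
    mulZ_apply (hb.contBdd_zero.restrict_grid _), mulZ_apply (hc.contBdd_zero.restrict_grid _),
    ← evZ_apply k (symDiffL2 _ _ _ _), evZ_symDiffL2, hD, gridL]

theorem inner_schemeOpZ_le (hν : IsLevyMeasure ν) (hp : 0 < p) (ha : Coef 2 K a)
    (h0 : ∀ x, 0 ≤ a x) (hb : Coef 1 K b) (hc : Coef 1 K c) (g : L2Z) :
    inner ℝ (schemeOpZ ν p a b c g) g ≤ dissipConst 1 K * ‖g‖ ^ 2 := by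
  have hh : (0 : ℝ) < 1 / p := by positivity
  have hK := ha.nonneg
  obtain ⟨hσ, hLip, hsq, -⟩ := ha.sqrt_facts h0
  have hstep : ∀ k : ℤ, |((k + 1 : ℤ) : ℝ) * (1 / p) - k * (1 / p)| = 1 / p := fun k => by
    rw [← sub_mul]
    push_cast
    rw [add_sub_cancel_left, one_mul, abs_of_pos hh]
  have ta := inner_sq_symDiff_symDiff_le (hσ.restrict_grid (1 / p)) hh (y := (1 : ℤ))
    (L := √(2 * K)) (fun k => (hLip _ _).trans_eq (by rw [hstep])) g
  have tb := inner_symDiff_le (hb.contBdd_zero.restrict_grid (1 / p)) hh (y := (1 : ℤ))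
    (L := K) (fun k => (hb.abs_sub_le _ _).trans_eq (by rw [hstep])) g
  have tc := inner_mulL2_le (hc.contBdd_zero.restrict_grid (1 / p)) g
  have tJ := inner_gridJump_nonpos hν hp (U := shiftL2 (Measure.count : Measure ℤ))
    (fun _ _ => (norm_shiftL2 _ _).le) shiftL2_zero g
  have e : (fun k : ℤ => √(a (k * (1 / p))) * √(a (k * (1 / p)))) = fun k : ℤ => a (k * (1 / p)) :=
    funext fun k => congrFun hsq _
  rw [e, Real.sq_sqrt (by positivity)] at ta
  change inner ℝ (mulL2 Measure.count _ (symDiffL2 Measure.count (1 / p) 1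
    (symDiffL2 Measure.count (1 / p) 1 g)) + mulL2 Measure.count _ (symDiffL2 Measure.count
      (1 / p) 1 g) + mulL2 Measure.count _ g + gridJump ν p _ g) g ≤ _
  rw [inner_add_left, inner_add_left, inner_add_left]
  -- The ℓ₂ bound is 6K + K + K; enlarging it to the constant of H¹ gives uniqueness under the same
  -- restriction on the time step.
  have h8 : 8 * K * ‖g‖ ^ 2 ≤ dissipConst 1 K * ‖g‖ ^ 2 := by
    refine mul_le_mul_of_nonneg_right ?_ (by positivity)
    norm_num [dissipConst]
    linarith
  have := sq_nonneg ‖mulL2 Measure.count (fun k : ℤ => √(a (k * (1 / p))))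
    (symDiffL2 Measure.count (1 / p) 1 g)‖
  nlinarith

theorem memLp_count_of_memℓp {w : ℤ → ℝ} (hw : Memℓp w 2) : MemLp w 2 Measure.count := by
  rw [memLp_two_iff_integrable_sq (measurable_of_countable w).aestronglyMeasurable,
    integrable_count_iff]
  have := (memℓp_gen_iff (by norm_num)).1 hw
  simpa using this

end GridL2

/-! ### Existence and uniqueness for the scheme on the grid. -/

section GridScheme

variable {T K C γ : ℝ} {m p n : ℕ} {a b c : ℝ → ℝ → ℝ} {ψ : HSob m} {f : ℝ → HSob m}
  {ν : Measure ℝ}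

theorem node_mem_Icc (hT : 0 ≤ T) {i : ℕ} (hi : i ≤ n) : (i : ℝ) * (T / n) ∈ Icc 0 T := by
  rcases Nat.eq_zero_or_pos n with rfl | hn
  · simpa using hT
  · have hn' : (0 : ℝ) < n := by exact_mod_cast hn
    refine ⟨by positivity, ?_⟩
    rw [← mul_div_assoc, div_le_iff₀ hn', mul_comm]
    exact mul_le_mul_of_nonneg_left (by exact_mod_cast hi) hT

/-- Solutions of the scheme in `H¹` solve it on the grid. -/
theorem isSchemeSolution_evH (hν : IsLevyMeasure ν) (h : TimeCoef T K C γ m a b c) (hm : 1 ≤ m)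
    (hT : 0 ≤ T) (hp : 0 < p) {V : ℕ → HSob 1} (hV0 : V 0 = truncH hm ψ)
    (hV : ∀ i < n, V (i + 1) = V i + (T / n) • (schemeOp 1 ν p (a ((i + 1 : ℕ) * (T / n)))
      (b ((i + 1 : ℕ) * (T / n))) (c ((i + 1 : ℕ) * (T / n))) (V (i + 1))
        + truncH hm (f ((i + 1 : ℕ) * (T / n))))) :
    IsSchemeSolution T ν a b c ψ f p n fun i k => evH (k * (1 / p)) (V i) where
  mem_l2 i := by
    have hp1 : (1 : ℝ) ≤ p := by exact_mod_cast hp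
    refine memℓp_gen' (C := p * (2 * ‖V i‖ ^ 2)) fun s => ?_
    have := (V i).sum_sq_val_le (h := 1 / p) (by positivity)
      (by rw [div_le_one (by positivity)]; exact hp1) s
    rw [← Finset.mul_sum, one_div, inv_mul_le_iff₀ (by positivity)] at this
    simpa [evH_apply] using this
  init k := by
    simp only [Fin.val_zero]
    rw [hV0, evH_truncH]
  step i k := by
    have ht := node_mem_Icc hT (Nat.succ_le_of_lt i.2)
    have e := congrArg (evH (k * (1 / p))) (hV i i.2)
    rw [map_add, map_smul, map_add, evH_schemeOp hν hp
      ((h.coef_a _ ht).mono (hm.trans (le_max_left m 2))) ((h.coef_b _ ht).mono hm)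
      ((h.coef_c _ ht).mono hm), evH_truncH] at e
    simpa using e

/-- A competitor on the grid is only known to be in ℓ₂, not to come from H¹, so dissipativity on ℓ₂
itself is used, one time step after another. -/
theorem IsSchemeSolution.eq (hν : IsLevyMeasure ν) (h : TimeCoef T K C γ m a b c) (hm : 1 ≤ m)
    (hT : 0 ≤ T) (hp : 0 < p) (hτ : T / n * dissipConst 1 K < 1) {v w : Fin (n + 1) → ℤ → ℝ}
    (hv : IsSchemeSolution T ν a b c ψ f p n v) (hw : IsSchemeSolution T ν a b c ψ f p n w) :
    v = w := by
  funext i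
  induction i using Fin.induction with
  | zero => exact funext fun k => (hv.init k).trans (hw.init k).symm
  | succ i ih =>
    have ht := node_mem_Icc hT (Nat.succ_le_of_lt i.2)
    set t : ℝ := (i + 1 : ℕ) * (T / n)
    set A := schemeOpZ ν p (a t) (b t) (c t)
    have ha := (h.coef_a t ht).mono (max_le_max_right 2 hm)
    have hb := (h.coef_b t ht).mono hm
    have hc := (h.coef_c t ht).mono hm
    have hcoe : ∀ {z : ℤ → ℝ} (hz : Memℓp z 2), ⇑((memLp_count_of_memℓp hz).toLp z) = z :=
      fun hz => funext (Measure.ae_count_iff.1 (memLp_count_of_memℓp hz).coeFn_toLp)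
    have key : ∀ {z : Fin (n + 1) → ℤ → ℝ}, IsSchemeSolution T ν a b c ψ f p n z →
        ∃ g : L2Z, ⇑g = z i.succ ∧ ∀ k, evZ k (g - (T / n) • A g)
          = z i.castSucc k + T / n * (f t).val (k * (1 / p)) := fun {z} hz => by
      refine ⟨_, hcoe (hz.mem_l2 i.succ), fun k => ?_⟩
      rw [map_sub, map_smul, evZ_schemeOpZ hν hp (ha.mono (by norm_num)) hb hc, evZ_apply,
        hcoe (hz.mem_l2 i.succ), hz.step i k, smul_eq_mul]
      ring
    obtain ⟨g, hg1, hg2⟩ := key hv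
    obtain ⟨g', hg1', hg2'⟩ := key hw
    have hzero : (g - g') - (T / n : ℝ) • A (g - g') = 0 := by
      refine Lp.ext (.of_forall fun k => ?_)
      have e : (g - g') - (T / n : ℝ) • A (g - g')
          = (g - (T / n : ℝ) • A g) - (g' - (T / n : ℝ) • A g') := by
        rw [map_sub, smul_sub]
        abel
      rw [← evZ_apply, ← evZ_apply, e, map_sub, hg2, hg2', ih, sub_self, map_zero]
    have hle := norm_sub_smul_ge (fun g => inner_schemeOpZ_le hν hp ha (h.nonneg t ht) hb hc g)
      (by positivity : (0 : ℝ) ≤ T / n) (g - g')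
    rw [hzero, norm_zero] at hle
    have h0 : g - g' = 0 := norm_le_zero_iff.1
      (nonpos_of_mul_nonpos_right hle (by linarith))
    rw [← hg1, ← hg1', sub_eq_zero.1 h0]

end GridScheme

/-! ### From the assumptions of the theorem to the working hypotheses. -/

section Hypotheses

variable {T K C γ K' : ℝ} {m l : ℕ} {a b c : ℝ → ℝ → ℝ} {ψ : HSob m} {f : ℝ → HSob m}
  {u : ℝ → HSob 1} {ν : Measure ℝ}

theorem TimeHolder.const_nonneg (h : TimeHolder T C γ l a b c f) (hT : 0 < T) : 0 ≤ C := by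
  have h1 := h.coeff T (right_mem_Icc.2 hT.le) 0 (left_mem_Icc.2 hT.le) 0 (Nat.zero_le l) 0
  rw [sub_zero, abs_of_pos hT] at h1
  have h2 : 0 ≤ C * T ^ γ := le_trans (by positivity) h1
  exact nonneg_of_mul_nonneg_left h2 (Real.rpow_pos_of_pos hT γ)

theorem coef_sub_of_holder {g w : ℝ → ℝ} {k : ℕ} (hk : 1 ≤ k) (hg : Coef k K g) (hw : Coef k K w)
    {R : ℝ} (h : ∀ j ≤ 1, ∀ x, |iteratedDeriv j g x - iteratedDeriv j w x| ^ 2 ≤ R) :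
    Coef 1 (√R) fun x => g x - w x := by
  have hg1 := (hg.mono hk).1
  have hw1 := (hw.mono hk).1
  refine ⟨hg1.sub hw1, fun j hj x => ?_⟩
  have hj' : ((j : ℕ) : WithTop ℕ∞) ≤ (1 : ℕ) := by exact_mod_cast hj
  rw [show (fun x => g x - w x) = g - w from rfl,
    iteratedDeriv_sub (hg1.of_le hj').contDiffAt (hw1.of_le hj').contDiffAt]
  refine Real.abs_le_sqrt ?_
  rw [← sq_abs]
  exact h j hj x

theorem TimeHolder.timeCoef (h : TimeHolder T C γ l a b c f) (hl : 1 ≤ l) (hm : 1 ≤ m)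
    (ha : CoeffBound T K (max m 2) a) (hb : CoeffBound T K m b) (hc : CoeffBound T K m c)
    (h0 : ∀ t ∈ Icc (0 : ℝ) T, ∀ x, 0 ≤ a t x) : TimeCoef T K C γ m a b c := by
  have ha' : ∀ t ∈ Icc (0 : ℝ) T, Coef (max m 2) K (a t) :=
    fun t ht => ⟨ha.smooth t ht, ha.bound t ht⟩
  have hb' : ∀ t ∈ Icc (0 : ℝ) T, Coef m K (b t) := fun t ht => ⟨hb.smooth t ht, hb.bound t ht⟩
  have hc' : ∀ t ∈ Icc (0 : ℝ) T, Coef m K (c t) := fun t ht => ⟨hc.smooth t ht, hc.bound t ht⟩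
  refine ⟨ha', hb', hc', h0, fun t ht s hs => ?_, fun t ht s hs => ?_, fun t ht s hs => ?_⟩
  · refine coef_sub_of_holder (hm.trans (le_max_left m 2)) (ha' t ht) (ha' s hs) fun j hj x => ?_
    refine le_trans ?_ (h.coeff t ht s hs j (hj.trans hl) x)
    rw [add_assoc]
    exact le_add_of_nonneg_right (by positivity)
  · refine coef_sub_of_holder hm (hb' t ht) (hb' s hs) fun j hj x => ?_
    refine le_trans ?_ (h.coeff t ht s hs j (hj.trans hl) x)
    rw [add_right_comm]
    exact le_add_of_nonneg_left (by positivity)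
  · refine coef_sub_of_holder hm (hc' t ht) (hc' s hs) fun j hj x => ?_
    refine le_trans ?_ (h.coeff t ht s hs j (hj.trans hl) x)
    exact le_add_of_nonneg_left (by positivity)

theorem ForcingL2.intervalIntegrable (hf : ForcingL2 T f) (hT : 0 ≤ T) :
    IntervalIntegrable f volume 0 T ∧ IntervalIntegrable (fun t => ‖f t‖ ^ 2) volume 0 T := by
  rw [intervalIntegrable_iff_integrableOn_Icc_of_le hT,
    intervalIntegrable_iff_integrableOn_Icc_of_le hT]
  refine ⟨?_, hf.sq_int⟩
  have h1 : AEStronglyMeasurable f (volume.restrict (Icc 0 T)) := by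
    rw [← map_comap_subtype_coe measurableSet_Icc, (MeasurableEmbedding.subtype_coe
      measurableSet_Icc).aestronglyMeasurable_map_iff]
    exact hf.meas.aestronglyMeasurable
  refine Integrable.mono' (g := fun t => 1 + ‖f t‖ ^ 2)
    ((integrable_const 1).add hf.sq_int) h1 (.of_forall fun t => ?_)
  nlinarith [sq_nonneg (‖f t‖ - 1)]

/-- The witness in `SobolevSqLE` is determined by its L₂ function, so its bound passes to any
element of H^k, k ≤ n, with the same function. -/
theorem norm_truncH_le_of_sobolevSqLE {k n : ℕ} {w : L2R} {R : ℝ} (h : SobolevSqLE n w R)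
    (hkn : k ≤ n) {g : HSob k} (hg : dH k 0 g = w) : ‖g‖ ≤ √R := by
  obtain ⟨z, hz1, hz2⟩ := h
  have : g = truncH hkn z := HSob.ext_toL2 (by rw [dH_truncH _ (by omega), hg, dH_zero, hz1])
  rw [this]
  exact (norm_truncH_le hkn z).trans (Real.le_sqrt_of_sq_le hz2)

theorem TimeHolder.timeForcing (h : TimeHolder T C γ l a b c f) (hl : 1 ≤ l) (hT : 0 ≤ T)
    (hf : ForcingL2 T f) (hK' : ∀ t ∈ Icc (0 : ℝ) T, SobolevSqLE (m - 2) (f t).toL2 K') :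
    TimeForcing T C γ (√K') f where
  int := (hf.intervalIntegrable hT).1
  bound t ht k hk hkm := norm_truncH_le_of_sobolevSqLE (hK' t ht) (by omega)
    (by rw [dH_truncH _ (by omega), dH_zero])
  sub t ht s hs hm := norm_truncH_le_of_sobolevSqLE (h.forcing t ht s hs) hl
    (by rw [map_sub, dH_truncH _ (by omega), dH_truncH _ (by omega), dH_zero, dH_zero])

/-- Cauchy–Schwarz, from expanding the integral of (Tg − A)², where A is the integral of g. -/
theorem sq_intervalIntegral_le {g : ℝ → ℝ} (hT : 0 < T) (hg : IntervalIntegrable g volume 0 T)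
    (hg2 : IntervalIntegrable (fun t => g t ^ 2) volume 0 T) :
    (∫ t in (0 : ℝ)..T, g t) ^ 2 ≤ T * ∫ t in (0 : ℝ)..T, g t ^ 2 := by
  set A := ∫ t in (0 : ℝ)..T, g t with hA
  have h1 : 0 ≤ ∫ t in (0 : ℝ)..T, (T * g t - A) ^ 2 :=
    intervalIntegral.integral_nonneg hT.le fun t _ => sq_nonneg _
  have h2 : ∫ t in (0 : ℝ)..T, (T * g t - A) ^ 2
      = T * (T * (∫ t in (0 : ℝ)..T, g t ^ 2) - A ^ 2) := by
    rw [show (fun t => (T * g t - A) ^ 2)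
        = fun t => T ^ 2 * g t ^ 2 - 2 * T * A * g t + A ^ 2 from funext fun t => by ring,
      intervalIntegral.integral_add ((hg2.const_mul _).sub (hg.const_mul _))
        intervalIntegrable_const,
      intervalIntegral.integral_sub (hg2.const_mul _) (hg.const_mul _),
      intervalIntegral.integral_const_mul, intervalIntegral.integral_const_mul,
      intervalIntegral.integral_const, ← hA, smul_eq_mul]
    ring
  rw [h2] at h1
  linarith [nonneg_of_mul_nonneg_right h1 hT]

theorem sq_regBound_le (hT : 0 < T) (hf : ForcingL2 T f) :
    regBound K ψ f T ^ 2 ≤ Real.exp (2 * dissipConst m K * T) ^ 2 * (2 * (1 + T))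
      * dataSq T ψ f := by
  obtain ⟨i1, i2⟩ := hf.intervalIntegrable hT.le
  have h1 := sq_intervalIntegral_le hT i1.norm i2
  have h2 : 0 ≤ ∫ t in (0 : ℝ)..T, ‖f t‖ ^ 2 :=
    intervalIntegral.integral_nonneg hT.le fun t _ => sq_nonneg _
  rw [regBound, mul_pow, mul_assoc _ (2 * (1 + T))]
  refine mul_le_mul_of_nonneg_left ?_ (sq_nonneg _)
  refine (add_sq_le (a := ‖ψ‖) (b := ∫ t in (0 : ℝ)..T, ‖f t‖)).trans ?_
  rw [dataSq]
  have := mul_nonneg hT.le (sq_nonneg ‖ψ‖)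
  nlinarith

end Hypotheses

/-! ### The grid error is dominated by the H¹ error. -/

section Error

variable {T : ℝ} {p n : ℕ} {u : ℝ → HSob 1}

/-- The supremum and the ℓ₂ norm each cost a factor 2 in the Sobolev embedding, whence the 4. -/
theorem schemeError_le (hp : 0 < p) {V : ℕ → HSob 1} {X : ℝ}
    (h : ∀ i ≤ n, ‖u (i * (T / n)) - V i‖ ^ 2 ≤ X) :
    schemeError T p n u (fun i k => evH (k * (1 / p)) (V i)) ≤ ENNReal.ofReal (4 * X) := by
  have hX : 0 ≤ X := (sq_nonneg _).trans (h 0 (Nat.zero_le n))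
  have hp0 : (0 : ℝ) < 1 / p := by positivity
  have hp1 : (1 : ℝ) / p ≤ 1 := by
    rw [div_le_one (by positivity)]
    exact_mod_cast hp
  have e : ∀ (i : Fin (n + 1)) (k : ℤ),
      |(u ((i : ℕ) * (T / n))).val (k * (1 / p)) - evH (k * (1 / p)) (V i)| ^ 2
        = (u ((i : ℕ) * (T / n)) - V i).val (k * (1 / p)) ^ 2 := fun i k => by
    rw [sq_abs, ← evH_apply, ← evH_apply, map_sub]
  have hX' : ∀ i : Fin (n + 1), 2 * ‖u ((i : ℕ) * (T / n)) - V i‖ ^ 2 ≤ 2 * X := fun i =>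
    mul_le_mul_of_nonneg_left (h i (by omega)) (by norm_num)
  rw [schemeError, show 4 * X = 2 * X + 2 * X by ring,
    ENNReal.ofReal_add (by positivity) (by positivity)]
  refine add_le_add (iSup_le fun i => iSup_le fun k => ?_) (iSup_le fun i => ?_)
  · rw [e]
    exact ENNReal.ofReal_le_ofReal ((HSob.sq_val_le _ _).trans (hX' i))
  · rw [← ENNReal.tsum_mul_left, ENNReal.tsum_eq_iSup_sum]
    refine iSup_le fun s => ?_
    simp only [e, ← ENNReal.ofReal_mul hp0.le]
    rw [← ENNReal.ofReal_sum_of_nonneg fun k _ => by positivity]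
    exact ENNReal.ofReal_le_ofReal ((HSob.sum_sq_val_le _ hp0 hp1 s).trans (hX' i))

end Error

/-! ### The constants of the theorem. -/

section Constants

/-- The constant in the bound of the solution by the data. -/
def dataConst (m : ℕ) (K T : ℝ) : ℝ := Real.exp (2 * dissipConst m K * T) ^ 2 * (2 * (1 + T))

/-- The constant in the bound of the time increments of the solution in `H³`. -/
def incrConst (m : ℕ) (K T μ₀ μ₂ : ℝ) : ℝ :=
  12 * (contConst 2 K μ₀ μ₂ * dataConst m K T + 1 + dataConst m K T)
    + 32 * (contConst 3 K μ₀ μ₂ ^ 2 * dataConst m K T + 1)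

/-- The constant in the rate of convergence of the scheme. -/
def rateConst (m : ℕ) (K C T μ₀ μ₂ : ℝ) : ℝ :=
  16 * Real.exp (2 * dissipConst 1 K * T) ^ 2 * T ^ 2 *
    (contConst 1 K μ₀ μ₂ ^ 2 * incrConst m K T μ₀ μ₂ + 144 * C * dataConst m K T
      + gridConst 1 K μ₀ μ₂ ^ 2 * dataConst m K T + 1)

variable {T K C : ℝ} {m : ℕ}

theorem dataConst_nonneg (hT : 0 ≤ T) : 0 ≤ dataConst m K T := by
  unfold dataConst
  positivity

theorem nonneg_incrConst (hT : 0 ≤ T) (hK : 0 ≤ K) (ν : Measure ℝ) :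
    0 ≤ incrConst m K T (levyMu0 ν) (levyMu2 ν) := by
  have := contConst_nonneg 2 hK ν
  have := dataConst_nonneg (m := m) (K := K) hT
  unfold incrConst
  positivity

/-- The four contributions to the error are squared separately; σ stands for the rate of the time
increments and ρ for τ^γ. -/
theorem sq_error_le {ν : Measure ℝ} (hT : 0 ≤ T) (hK : 0 ≤ K) (hC : 0 ≤ C) {B η w h σ ρ M : ℝ}
    (hM : 0 ≤ M) (hσ : 0 ≤ σ) (hρ : 0 ≤ C * ρ)
    (hB : B ^ 2 ≤ dataConst m K T * M)
    (hη : η ^ 2 ≤ incrConst m K T (levyMu0 ν) (levyMu2 ν) * (σ * M)) (hw : w ^ 2 = C * ρ)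
    (hρσ : ρ ≤ σ) :
    (Real.exp (2 * dissipConst 1 K * T) * (2 * T * (contConst 1 K (levyMu0 ν) (levyMu2 ν) * η
      + 12 * w * B + gridConst 1 K (levyMu0 ν) (levyMu2 ν) * (h * B) + w))) ^ 2
      ≤ rateConst m K C T (levyMu0 ν) (levyMu2 ν) * ((h ^ 2 + σ) * M + C * ρ) := by
  set c₁ := contConst 1 K (levyMu0 ν) (levyMu2 ν)
  set g₁ := gridConst 1 K (levyMu0 ν) (levyMu2 ν)
  set κ := incrConst m K T (levyMu0 ν) (levyMu2 ν)
  set β := dataConst m K T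
  set G := Real.exp (2 * dissipConst 1 K * T)
  have hβ0 : 0 ≤ β := dataConst_nonneg hT
  have hκ0 : 0 ≤ κ := nonneg_incrConst hT hK ν
  have h4 : ∀ w x y z : ℝ, (w + x + y + z) ^ 2 ≤ 4 * (w ^ 2 + x ^ 2 + y ^ 2 + z ^ 2) :=
    fun w x y z => by
      nlinarith [sq_nonneg (w - x), sq_nonneg (w - y), sq_nonneg (w - z), sq_nonneg (x - y),
        sq_nonneg (x - z), sq_nonneg (y - z)]
  have t1 : (c₁ * η) ^ 2 ≤ c₁ ^ 2 * κ * ((h ^ 2 + σ) * M + C * ρ) := by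
    rw [mul_pow, mul_assoc]
    refine mul_le_mul_of_nonneg_left (hη.trans (mul_le_mul_of_nonneg_left ?_ hκ0)) (sq_nonneg _)
    nlinarith [mul_nonneg (sq_nonneg h) hM]
  -- The Hölder modulus of the coefficients multiplies the size of the solution, so this product is
  -- charged to σM by ρ ≤ σ. The modulus of f stands alone and produces the separate term Cρ.
  have t2 : (12 * w * B) ^ 2 ≤ 144 * C * β * ((h ^ 2 + σ) * M + C * ρ) := by
    have e1 : w ^ 2 * B ^ 2 ≤ (C * σ) * (β * M) := by
      rw [hw]
      exact mul_le_mul (mul_le_mul_of_nonneg_left hρσ hC) hB (sq_nonneg _) (by positivity)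
    have e2 : 0 ≤ C * β * (h ^ 2 * M + C * ρ) := by positivity
    nlinarith
  have t3 : (g₁ * (h * B)) ^ 2 ≤ g₁ ^ 2 * β * ((h ^ 2 + σ) * M + C * ρ) := by
    rw [mul_pow, mul_pow, mul_assoc]
    refine mul_le_mul_of_nonneg_left ?_ (sq_nonneg _)
    have e1 := mul_le_mul_of_nonneg_left hB (sq_nonneg h)
    have e2 : 0 ≤ β * (σ * M + C * ρ) := by positivity
    nlinarith
  have t4 : w ^ 2 ≤ (h ^ 2 + σ) * M + C * ρ := by
    rw [hw]
    exact le_add_of_nonneg_left (by positivity)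
  calc (G * (2 * T * (c₁ * η + 12 * w * B + g₁ * (h * B) + w))) ^ 2
      = 4 * G ^ 2 * T ^ 2 * (c₁ * η + 12 * w * B + g₁ * (h * B) + w) ^ 2 := by ring
    _ ≤ 4 * G ^ 2 * T ^ 2 * (4 * ((c₁ ^ 2 * κ + 144 * C * β + g₁ ^ 2 * β + 1)
        * ((h ^ 2 + σ) * M + C * ρ))) := by
      refine mul_le_mul_of_nonneg_left ((h4 _ _ _ _).trans ?_) (by positivity)
      linarith
    _ = _ := by
      rw [rateConst]
      ring

end Constants

/-! ### Time increments and the rate of convergence. -/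

section Convergence

variable {T K C γ R : ℝ} {m p n : ℕ} {a b c : ℝ → ℝ → ℝ} {ψ : HSob m} {f : ℝ → HSob m}
  {u : ℝ → HSob 1} {ν : Measure ℝ} {U : ℝ → HSob m} {B M : ℝ}

/-- The two rates originate here. For m = 4 only H² increments are Lipschitz in time, and
interpolation with the bound in H⁴ leaves a square of order τ; for m ≥ 5 the H³ increments are
Lipschitz, and the square is of order τ². -/
theorem sq_norm_incr_le (hν : IsLevyMeasure ν) (h : TimeCoef T K C γ m a b c) (hm : 4 ≤ m)
    (hγ : 0 < γ) (hf : TimeForcing T C γ R f) (hu : IsPIDESolution T ν a b c ψ f u)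
    (hU : ∀ t ∈ Icc 0 T, truncH (by omega) (U t) = u t) (hB : ∀ t ∈ Icc 0 T, ‖U t‖ ≤ B)
    (hBM : B ^ 2 ≤ dataConst m K T * M) (hR : 0 ≤ R) (hRM : R ^ 2 ≤ M) {s t τ : ℝ}
    (hs : s ∈ Icc 0 T) (ht : t ∈ Icc 0 T) (hst : s ≤ t) (hτ : t - s ≤ τ) :
    ‖truncH (show 3 ≤ m by omega) (U t - U s)‖ ^ 2
        ≤ incrConst m K T (levyMu0 ν) (levyMu2 ν) * (τ * M) ∧
      (5 ≤ m → ‖truncH (show 3 ≤ m by omega) (U t - U s)‖ ^ 2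
        ≤ incrConst m K T (levyMu0 ν) (levyMu2 ν) * (τ ^ 2 * M)) := by
  have hK := (h.coef_b t ht).nonneg
  have hT : 0 ≤ T := ht.1.trans ht.2
  have hτ0 : 0 ≤ τ := (sub_nonneg.2 hst).trans hτ
  have hB0 : 0 ≤ B := (norm_nonneg _).trans (hB t ht)
  have hM : 0 ≤ M := (sq_nonneg R).trans hRM
  have hβ0 : 0 ≤ dataConst m K T := dataConst_nonneg hT
  have hc2 := contConst_nonneg 2 hK ν
  have hc3 := contConst_nonneg 3 hK ν
  set c₂ := contConst 2 K (levyMu0 ν) (levyMu2 ν) with hc₂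
  set c₃ := contConst 3 K (levyMu0 ν) (levyMu2 ν) with hc₃
  set β := dataConst m K T with hβ
  have hκ : incrConst m K T (levyMu0 ν) (levyMu2 ν)
    = 12 * (c₂ * β + 1 + β) + 32 * (c₃ ^ 2 * β + 1) := rfl
  rw [hκ]
  constructor
  · have h2 := norm_truncH_sub_le hν h hγ hf hu (k := 2) (by norm_num) (by omega) hU hB hs ht hst
    have h3 := norm_truncH_three_sq_le hm (U t - U s)
    have h4 : ‖U t - U s‖ ≤ 2 * B := (norm_sub_le _ _).trans (by linarith [hB t ht, hB s hs])
    have h5 : ‖truncH (show 2 ≤ m by omega) (U t - U s)‖ ≤ 3 * (τ * (c₂ * B + R)) := by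
      refine h2.trans (le_trans (le_of_eq (by norm_num [hc₂])) (mul_le_mul_of_nonneg_left
        (mul_le_mul_of_nonneg_right hτ (by positivity)) (by norm_num : (0 : ℝ) ≤ 3)))
    refine h3.trans ((mul_le_mul h5 (mul_le_mul_of_nonneg_left h4 zero_le_two) (by positivity)
      (by positivity)).trans ?_)
    have e1 : c₂ * B ^ 2 + R * B ≤ (c₂ * β + 1 + β) * M := by
      nlinarith [mul_le_mul_of_nonneg_left hBM hc2, sq_nonneg (R - B), mul_nonneg hβ0 hM]
    have e2 := mul_le_mul_of_nonneg_left e1 hτ0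
    have e3 : 0 ≤ 32 * (c₃ ^ 2 * β + 1) * (τ * M) := by positivity
    calc 3 * (τ * (c₂ * B + R)) * (2 * (2 * B)) = 12 * (τ * (c₂ * B ^ 2 + R * B)) := by ring
      _ ≤ 12 * (τ * ((c₂ * β + 1 + β) * M)) := mul_le_mul_of_nonneg_left e2 (by norm_num)
      _ ≤ _ := by linarith
  · intro hm5
    have h3 := norm_truncH_sub_le hν h hγ hf hu (k := 3) (by norm_num) (by omega) hU hB hs ht hst
    have h5 : ‖truncH (show 3 ≤ m by omega) (U t - U s)‖ ≤ 4 * (τ * (c₃ * B + R)) := by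
      refine h3.trans (le_trans (le_of_eq (by norm_num [hc₃])) (mul_le_mul_of_nonneg_left
        (mul_le_mul_of_nonneg_right hτ (by positivity)) (by norm_num : (0 : ℝ) ≤ 4)))
    refine (pow_le_pow_left₀ (norm_nonneg _) h5 2).trans ?_
    have e1 : (c₃ * B + R) ^ 2 ≤ 2 * (c₃ ^ 2 * β + 1) * M := by
      nlinarith [mul_le_mul_of_nonneg_left hBM (sq_nonneg c₃), sq_nonneg (c₃ * B - R)]
    have e2 := mul_le_mul_of_nonneg_left e1 (sq_nonneg τ)
    have e3 : 0 ≤ 12 * (c₂ * β + 1 + β) * (τ ^ 2 * M) := by positivity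
    calc (4 * (τ * (c₃ * B + R))) ^ 2 = 16 * (τ ^ 2 * (c₃ * B + R) ^ 2) := by ring
      _ ≤ 16 * (τ ^ 2 * (2 * (c₃ ^ 2 * β + 1) * M)) := mul_le_mul_of_nonneg_left e2 (by norm_num)
      _ ≤ _ := by linarith

theorem exists_scheme (hν : IsLevyMeasure ν) (h : TimeCoef T K C γ m a b c) (hm : 1 ≤ m)
    (hT : 0 ≤ T) (hp : 0 < p) (hτ : T / n * dissipConst 1 K < 1) :
    ∃ V : ℕ → HSob 1, V 0 = truncH hm ψ ∧ ∀ i < n, V (i + 1) = V i + (T / n) •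
      (schemeOp 1 ν p (a ((i + 1 : ℕ) * (T / n))) (b ((i + 1 : ℕ) * (T / n)))
        (c ((i + 1 : ℕ) * (T / n))) (V (i + 1)) + truncH hm (f ((i + 1 : ℕ) * (T / n)))) := by
  refine exists_implicit_scheme (A := fun i : ℕ => schemeOp 1 ν p (a (i * (T / n)))
    (b (i * (T / n))) (c (i * (T / n)))) (fun i hi v => ?_) (by positivity) hτ
    (fun i : ℕ => truncH hm (f (i * (T / n)))) (truncH hm ψ)
  have ht := node_mem_Icc hT (Nat.succ_le_of_lt hi)
  exact inner_schemeOp_le le_rfl hν hp ((h.coef_a _ ht).mono (max_le_max_right 2 hm))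
    (h.nonneg _ ht) ((h.coef_b _ ht).mono hm) ((h.coef_c _ ht).mono hm) v

/-- The rate of convergence, given the regularity of the solution in time. -/
theorem schemeError_le_rate (hν : IsLevyMeasure ν) (h : TimeCoef T K C γ m a b c) (hm : 4 ≤ m)
    (hγ : 0 < γ) (hC : 0 ≤ C) (hf : TimeForcing T C γ R f) (hu : IsPIDESolution T ν a b c ψ f u)
    (hU : ∀ t ∈ Icc 0 T, truncH (by omega) (U t) = u t) (hB : ∀ t ∈ Icc 0 T, ‖U t‖ ≤ B)
    (hBM : B ^ 2 ≤ dataConst m K T * M) (hM : 0 ≤ M) (hT : 0 < T) (hp : 0 < p) (hn : 0 < n)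
    (hτ : T / n * dissipConst 1 K ≤ 1 / 2) {σ : ℝ} (hσ : (T / n) ^ γ ≤ σ)
    (hincr : ∀ s ∈ Icc 0 T, ∀ t ∈ Icc 0 T, s ≤ t → t - s ≤ T / n →
      ‖truncH (show 3 ≤ m by omega) (U t - U s)‖ ^ 2
        ≤ incrConst m K T (levyMu0 ν) (levyMu2 ν) * (σ * M)) {V : ℕ → HSob 1}
    (hV0 : V 0 = truncH (by omega) ψ)
    (hV : ∀ i < n, V (i + 1) = V i + (T / n) • (schemeOp 1 ν p (a ((i + 1 : ℕ) * (T / n)))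
      (b ((i + 1 : ℕ) * (T / n))) (c ((i + 1 : ℕ) * (T / n))) (V (i + 1))
        + truncH (by omega) (f ((i + 1 : ℕ) * (T / n))))) :
    schemeError T p n u (fun i k => evH (k * (1 / p)) (V i))
      ≤ ENNReal.ofReal (4 * rateConst m K C T (levyMu0 ν) (levyMu2 ν) *
        (((1 / p : ℝ) ^ 2 + σ) * M + C * (T / n) ^ γ)) := by
  have hT0 : (0 : ℝ) ∈ Icc 0 T := left_mem_Icc.2 hT.le
  have hX := (sq_nonneg _).trans (hincr 0 hT0 0 hT0 le_rfl (by rw [sub_self]; positivity))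
  have hρ : 0 ≤ (T / n) ^ γ := by positivity
  have hV' := norm_sub_scheme_le hν h hm hγ hC hf hu hU hB hT hp hn hτ
    (fun s hs t ht hst hd => Real.le_sqrt_of_sq_le (hincr s hs t ht hst hd)) hV0 hV
  rw [mul_assoc 4]
  refine schemeError_le hp fun i hi => (pow_le_pow_left₀ (norm_nonneg _) (hV' i hi) 2).trans ?_
  exact sq_error_le hT.le (h.coef_b 0 hT0).nonneg hC hM (hρ.trans hσ) (by positivity) hBM
    (Real.sq_sqrt hX).le (Real.sq_sqrt (by positivity)) hσ

end Convergence

end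

/-! ### Assembly of the theorem. -/

theorem mainTheorem3 (T K C μ₀ μ₂ : ℝ) (m : ℕ) (hT : 0 < T) (hm : 4 ≤ m) :
    ∃ N₀ N : ℝ,
      ∀ (ν : MeasureTheory.Measure ℝ) (a b c : ℝ → ℝ → ℝ) (ψ : HSob m) (f : ℝ → HSob m)
        (γ K' : ℝ) (l : ℕ),
        IsLevyMeasure ν → levyMu0 ν = μ₀ → levyMu2 ν = μ₂ →
        CoeffBound T K (max m 2) a → CoeffBound T K m b → CoeffBound T K m c →
        ForcingL2 T f →
        (∀ t ∈ Set.Icc (0 : ℝ) T, ∀ x, 0 ≤ a t x) →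
        0 < γ → 1 ≤ l → TimeHolder T C γ l a b c f →
        (∀ t ∈ Set.Icc (0 : ℝ) T, SobolevSqLE (m - 2) (f t).toL2 K') →
        ∀ p n : ℕ, 0 < p → 0 < n → N₀ < n →
          (∃! v : Fin (n + 1) → ℤ → ℝ, IsSchemeSolution T ν a b c ψ f p n v) ∧
          ∀ (u : ℝ → HSob 1) (v : Fin (n + 1) → ℤ → ℝ),
            IsPIDESolution T ν a b c ψ f u → IsSchemeSolution T ν a b c ψ f p n v →
            schemeError T p n u v ≤ ENNReal.ofReal
              (N * (((1 / p : ℝ) ^ 2 + (T / n) ^ (min 1 γ)) * (K' + dataSq T ψ f)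
                + C * (T / n) ^ γ)) ∧
            (5 ≤ m → schemeError T p n u v ≤ ENNReal.ofReal
              (N * (((1 / p : ℝ) ^ 2 + (T / n) ^ (min 2 γ)) * (K' + dataSq T ψ f)
                + C * (T / n) ^ γ))) := by
  -- Taking n > T makes τ ≤ 1, so that smaller exponents give larger powers of τ; the second bound
  -- makes τ times the dissipativity constant at most 1/2, as stability requires.
  refine ⟨max T (2 * T * dissipConst 1 K), 4 * rateConst m K C T μ₀ μ₂, ?_⟩
  intro ν a b c ψ f γ K' l hν hμ₀ hμ₂ ha hb hc hf h0 hγ hl hH hK' p n hp hn hN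
  subst hμ₀ hμ₂
  have hm1 : 1 ≤ m := by omega
  have hn' : (0 : ℝ) < n := by exact_mod_cast hn
  have hT0 : (0 : ℝ) ∈ Icc 0 T := left_mem_Icc.2 hT.le
  have hC := hH.const_nonneg hT
  have hco := hH.timeCoef hl hm1 ha hb hc h0
  have hfo := hH.timeForcing hl hT.le hf hK'
  have hτ1 : T / n ≤ 1 := by
    rw [div_le_one hn']
    exact ((le_max_left _ _).trans_lt hN).le
  have hτ0 : 0 < T / n := by positivity
  have hτD : T / n * dissipConst 1 K ≤ 1 / 2 := by
    rw [div_mul_eq_mul_div, div_le_iff₀ hn']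
    linarith [(le_max_right T (2 * T * dissipConst 1 K)).trans_lt hN]
  obtain ⟨V, hV0, hV⟩ := exists_scheme (ψ := ψ) (f := f) hν hco hm1 hT.le hp
    (hτD.trans_lt (by norm_num : (1 / 2 : ℝ) < 1))
  have hVs := isSchemeSolution_evH hν hco hm1 hT.le hp hV0 hV
  have huniq : ∀ v, IsSchemeSolution T ν a b c ψ f p n v →
      v = fun (i : Fin (n + 1)) (k : ℤ) => evH (k * (1 / p)) (V i) := fun v hv =>
    hv.eq hν hco hm1 hT.le hp (hτD.trans_lt (by norm_num)) hVs
  refine ⟨⟨_, hVs, huniq⟩, fun u v hu hv => ?_⟩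
  rw [huniq v hv]
  obtain ⟨g, -, hg⟩ := hK' 0 hT0
  have hK0 : 0 ≤ K' := (sq_nonneg _).trans hg
  have hdata : 0 ≤ dataSq T ψ f := add_nonneg (sq_nonneg _)
    (intervalIntegral.integral_nonneg hT.le fun t _ => sq_nonneg _)
  -- The H^m representatives are chosen for each time separately; no regularity of this choice in
  -- time is needed, because it is used only through scalar products and pointwise bounds.
  choose! U hU hB using fun t ht => exists_regular (t := t) hν hco hm hγ hC hfo hu ht
  have hBM : regBound K ψ f T ^ 2 ≤ dataConst m K T * (K' + dataSq T ψ f) :=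
    (sq_regBound_le hT hf).trans (mul_le_mul_of_nonneg_left (le_add_of_nonneg_left hK0)
      (dataConst_nonneg hT.le))
  have hincr := fun s hs t ht hst hd => sq_norm_incr_le (s := s) (t := t) (τ := T / n) hν hco hm hγ
    hfo hu hU hB hBM (Real.sqrt_nonneg K')
    ((Real.sq_sqrt hK0).trans_le (le_add_of_nonneg_right hdata)) hs ht hst hd
  have hκ := nonneg_incrConst (m := m) hT.le (hco.coef_b 0 hT0).nonneg ν
  have hM := add_nonneg hK0 hdata
  -- As τ ≤ 1, the power with exponent min(q, γ) dominates both the Hölder rate and the rate of the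
  -- increments, q = 1 or q = 2.
  have hmin : ∀ q : ℝ, (T / n) ^ γ ≤ (T / n) ^ min q γ ∧ (T / n) ^ q ≤ (T / n) ^ min q γ := fun q =>
    ⟨Real.rpow_le_rpow_of_exponent_ge hτ0 hτ1 (min_le_right _ _),
      Real.rpow_le_rpow_of_exponent_ge hτ0 hτ1 (min_le_left _ _)⟩
  refine ⟨?_, fun hm5 => ?_⟩
  · refine schemeError_le_rate hν hco hm hγ hC hfo hu hU hB hBM hM hT hp hn hτD (hmin 1).1
      (fun s hs t ht hst hd => (hincr s hs t ht hst hd).1.trans ?_) hV0 hV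
    have := (hmin 1).2
    rw [Real.rpow_one] at this
    exact mul_le_mul_of_nonneg_left (mul_le_mul_of_nonneg_right this hM) hκ
  · refine schemeError_le_rate hν hco hm hγ hC hfo hu hU hB hBM hM hT hp hn hτD (hmin 2).1
      (fun s hs t ht hst hd => ((hincr s hs t ht hst hd).2 hm5).trans ?_) hV0 hV
    have := (hmin 2).2
    rw [Real.rpow_two] at this
    exact mul_le_mul_of_nonneg_left (mul_le_mul_of_nonneg_right this hM) hκ
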